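/- Let $k$ be a field of characteristic $0$ and $\Gamma$ a group. Let $\mathfrak g$ be a finite-dimensional Lie algebra over $k$ equipped with a $\Gamma$ Lie bialgebra structure: a Lie bialgebra cobracket $\delta:\mathfrak g\to\wedge^2(\mathfrak g)\subset\mathfrak g^{\otimes 2}$, an action $\theta:\Gamma\to\operatorname{Aut}(\mathfrak g,[-,-])$ and a map $f:\Gamma\to\wedge^2(\mathfrak g)$, such that for all $\gamma,\gamma'\in\Gamma$ and $x\in\mathfrak g$: (a) $\wedge^2(\theta_\gamma)\circ\delta\circ\theta_\gamma^{-1}(x)=\delta(x)+[f_\gamma,x\otimes1+1\otimes x]$; (b) $f_{\gamma\gamma'}=f_\gamma+\wedge^2(\theta_\gamma)(f_{\gamma'})$; (c) $(\delta\otimes\operatorname{id})(f_\gamma)+[f_\gamma^{1,3},f_\gamma^{2,3}]+\text{cyclic permutations}=0$. For $\gamma\in\Gamma$ put $\delta_\gamma=\wedge^2(\theta_\gamma)\circ\delta\circ\theta_\gamma^{-1}$, and let $\mathfrak g^*_\gamma$ be $\mathfrak g^*$ with the Lie bracket $\delta_\gamma^t$. Let $\mathcal O_{G^*_\gamma}=U(\mathfrak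 g^*_\gamma)^*$ be the Poisson algebra of functions on the formal Poisson-Lie group $G^*_\gamma$ dual to $(\mathfrak g,\delta_\gamma)$: its product is dual to the coproduct of $U(\mathfrak g^*_\gamma)$, and its bracket $\{-,-\}_\gamma$ is dual to the co-Poisson structure of $U(\mathfrak g^*_\gamma)$ that extends the transpose $\mathfrak g^*\to\wedge^2(\mathfrak g^*)$ of the Lie bracket of $\mathfrak g$. Let $\Delta_\gamma:\mathcal O_{G^*_\gamma}\to\mathcal O_{G^*_\gamma}^{\hat\otimes2}$ be the coproduct dual to the product of $U(\mathfrak g^*_\gamma)$, and $\mathfrak m_\gamma\subset\mathcal O_{G^*_\gamma}$ the maximal ideal; $\mathfrak m_\gamma/\mathfrak m_\gamma^2=\mathfrak g$ by taking differentials at the origin. Let $\star_\gamma$ be the Baker-Campbell-Hausdorff product for the Poisson bracket of $\mathcal O_{G^*_\gamma}^{\hat\otimes n}$. Let $\gamma,\gamma'\in\Gamma$. Call $\tilde f\in\mathfrak m_\gamma^{\hat\otimes2}$ a twist lifting $\wedge^2(\theta_\gamma)(f_{\gamma'})$ if $$(\tilde f\otimes1)\star_\gamma(\Delta_\gamma\otimes\operatorname{id})(\tilde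 f)=(1\otimes\tilde f)\star_\gamma(\operatorname{id}\otimes\Delta_\gamma)(\tilde f)$$ and the image $r\in\mathfrak g^{\otimes2}$ of $\tilde f$ satisfies $r-r^{2,1}=\wedge^2(\theta_\gamma)(f_{\gamma'})$. For such $\tilde f$ and $a\in\mathcal O_{G^*_\gamma}$ let $${}^{\tilde f}\Delta_\gamma(a)=\tilde f\star_\gamma\Delta_\gamma(a)\star_\gamma(-\tilde f)=\sum_{n\ge0}\frac1{n!}\,\{\tilde f,-\}_\gamma^{\,n}(\Delta_\gamma(a)).$$ Then a twist lifting $\wedge^2(\theta_\gamma)(f_{\gamma'})$ exists, and for every such twist $\tilde f$ the defining series of ${}^{\tilde f}\Delta_\gamma(a)$ converges for all $a$, and there is an isomorphism of Poisson algebras $j=j_{\gamma,\gamma\gamma'}:\mathcal O_{G^*_\gamma}\to\mathcal O_{G^*_{\gamma\gamma'}}$ that induces the identity of $\mathfrak g=\mathfrak m_\gamma/\mathfrak m_\gamma^2\to\mathfrak m_{\gamma\gamma'}/\mathfrak m_{\gamma\gamma'}^2=\mathfrak g$, extends to a continuous linear map $j^{\otimes2}:\mathcal O_{G^*_\gamma}^{\hat\otimes2}\to\mathcal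 O_{G^*_{\gamma\gamma'}}^{\hat\otimes2}$, $a\otimes b\mapsto j(a)\otimes j(b)$, and satisfies $$\Delta_{\gamma\gamma'}=j^{\otimes2}\circ{}^{\tilde f}\Delta_\gamma\circ j^{-1}.$$ -/

import Mathlib

open scoped TensorProduct

noncomputable section

/-! ## Lie bialgebras and `Γ` Lie bialgebras -/

section LieBialgebras

variable (k g : Type*) [Field k] [LieRing g] [LieAlgebra k g]

/-- The cyclic permutation `a ⊗ b ⊗ c ↦ b ⊗ c ⊗ a` of `V ⊗ V ⊗ V`. -/
def cyclicPerm (V : Type*) [AddCommGroup V] [Module k V] :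
    (V ⊗[k] V) ⊗[k] V →ₗ[k] (V ⊗[k] V) ⊗[k] V :=
  (TensorProduct.comm k V (V ⊗[k] V)).toLinearMap ∘ₗ (TensorProduct.assoc k V V V).toLinearMap

/-- The sum `t + (cyclic permutations of t)`. -/
def cyclicSum {V : Type*} [AddCommGroup V] [Module k V] (t : (V ⊗[k] V) ⊗[k] V) :
    (V ⊗[k] V) ⊗[k] V :=
  t + cyclicPerm k V t + cyclicPerm k V (cyclicPerm k V t)

/-- A Lie bialgebra structure on the Lie algebra `g`: a Lie cobracket `δ : g → ∧²(g)` (where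
`∧²(g)` is the space of antisymmetric elements of `g ⊗ g`) that is a `1`-cocycle. -/
structure LieBialgebra where
  cobracket : g →ₗ[k] g ⊗[k] g
  antisymm : ∀ x, TensorProduct.comm k g g (cobracket x) = -cobracket x
  coJacobi : ∀ x, cyclicSum k (TensorProduct.map cobracket LinearMap.id (cobracket x)) = 0
  cocycle : ∀ x y, cobracket ⁅x, y⁆ = ⁅x, cobracket y⁆ - ⁅y, cobracket x⁆

/-- `[s^{1,3}, t^{2,3}]`, i.e. `(a ⊗ b, a' ⊗ b') ↦ a ⊗ a' ⊗ [b, b']`. -/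
def bracket1323 (s t : g ⊗[k] g) : (g ⊗[k] g) ⊗[k] g :=
  TensorProduct.map LinearMap.id (LieModule.toModuleHom k g g : g ⊗[k] g →ₗ[k] g)
    (TensorProduct.tensorTensorTensorComm k g g g g (s ⊗ₜ[k] t))

/-- A `Γ` Lie bialgebra with underlying Lie algebra `g`. In `twist_cobracket`, `⁅x, f γ⁆` is
`[x ⊗ 1 + 1 ⊗ x, f γ]`, so that `- ⁅x, f γ⁆ = [f γ, x ⊗ 1 + 1 ⊗ x]`. -/
structure GammaLieBialgebra (Γ : Type*) [Group Γ] extends LieBialgebra k g where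
  θ : Γ → (g ≃ₗ⁅k⁆ g)
  θ_mul : ∀ γ γ' x, θ (γ * γ') x = θ γ (θ γ' x)
  f : Γ → g ⊗[k] g
  f_antisymm : ∀ γ, TensorProduct.comm k g g (f γ) = -f γ
  twist_cobracket : ∀ γ x,
    TensorProduct.map (θ γ : g →ₗ[k] g) (θ γ : g →ₗ[k] g) (cobracket ((θ γ).symm x)) =
      cobracket x - ⁅x, f γ⁆
  f_mul : ∀ γ γ',
    f (γ * γ') = f γ + TensorProduct.map (θ γ : g →ₗ[k] g) (θ γ : g →ₗ[k] g) (f γ')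
  f_twist : ∀ γ,
    cyclicSum k (TensorProduct.map cobracket LinearMap.id (f γ) +
      bracket1323 k g (f γ) (f γ)) = 0

variable {k g}

theorem map_lie_tensor (e : g ≃ₗ⁅k⁆ g) (x : g) (t : g ⊗[k] g) :
    TensorProduct.map (e : g →ₗ[k] g) (e : g →ₗ[k] g) ⁅x, t⁆ =
      ⁅e x, TensorProduct.map (e : g →ₗ[k] g) (e : g →ₗ[k] g) t⁆ := by
  induction t with
  | zero => simp
  | add a b ha hb => simp only [lie_add, map_add, ha, hb]
  | tmul a b => simp [TensorProduct.LieModule.lie_tmul_right, LieEquiv.map_lie]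

theorem cyclicPerm_map (e : g →ₗ[k] g) (t : (g ⊗[k] g) ⊗[k] g) :
    cyclicPerm k g (TensorProduct.map (TensorProduct.map e e) e t) =
      TensorProduct.map (TensorProduct.map e e) e (cyclicPerm k g t) := by
  have : cyclicPerm k g ∘ₗ TensorProduct.map (TensorProduct.map e e) e =
      TensorProduct.map (TensorProduct.map e e) e ∘ₗ cyclicPerm k g := by
    ext a b c
    simp [cyclicPerm]
  exact LinearMap.congr_fun this t

/-- The Lie bialgebra structure `∧²(e) ∘ δ ∘ e⁻¹` on `g`, for `e` an automorphism of the
Lie algebra `g`. -/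
def LieBialgebra.transport (B : LieBialgebra k g) (e : g ≃ₗ⁅k⁆ g) : LieBialgebra k g where
  cobracket := TensorProduct.map (e : g →ₗ[k] g) (e : g →ₗ[k] g) ∘ₗ B.cobracket ∘ₗ
    (e.symm : g →ₗ[k] g)
  antisymm x := by
    have := B.antisymm (e.symm x)
    simp only [LinearMap.comp_apply]
    rw [← TensorProduct.map_comm]
    simpa using congrArg (TensorProduct.map (e : g →ₗ[k] g) (e : g →ₗ[k] g)) this
  coJacobi x := by
    have h := B.coJacobi (e.symm x)
    have key : ∀ t : g ⊗[k] g,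
        TensorProduct.map (TensorProduct.map (e : g →ₗ[k] g) (e : g →ₗ[k] g) ∘ₗ B.cobracket ∘ₗ
          (e.symm : g →ₗ[k] g)) LinearMap.id
          (TensorProduct.map (e : g →ₗ[k] g) (e : g →ₗ[k] g) t) =
        TensorProduct.map (TensorProduct.map (e : g →ₗ[k] g) (e : g →ₗ[k] g)) (e : g →ₗ[k] g)
          (TensorProduct.map B.cobracket LinearMap.id t) := by
      intro t
      induction t with
      | zero => simp
      | add a b ha hb => simp only [map_add, ha, hb]
      | tmul a b => simp
    simp only [LinearMap.comp_apply]
    rw [key]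
    simp only [cyclicSum, cyclicPerm_map, ← map_add]
    simp only [cyclicSum] at h
    simpa using congrArg
      (TensorProduct.map (TensorProduct.map (e : g →ₗ[k] g) (e : g →ₗ[k] g)) (e : g →ₗ[k] g)) h
  cocycle x y := by
    have h := B.cocycle (e.symm x) (e.symm y)
    have h2 := congrArg (TensorProduct.map (e : g →ₗ[k] g) (e : g →ₗ[k] g)) h
    rw [map_sub, map_lie_tensor, map_lie_tensor] at h2
    simpa [LieEquiv.map_lie] using h2

/-- The Lie bialgebra `(g, [-,-], δ_γ)`, `δ_γ = ∧²(θ_γ) ∘ δ ∘ θ_γ⁻¹ = δ + [f_γ, -]`. -/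
def GammaLieBialgebra.lieBialgebra {Γ : Type*} [Group Γ] (B : GammaLieBialgebra k g Γ) (γ : Γ) :
    LieBialgebra k g :=
  B.toLieBialgebra.transport (B.θ γ)

/-! ## The dual Lie algebra -/

/-- The dual space `g*`, carrying the Lie bracket dual to the cobracket of `B`. -/
def LieBialgebra.DualLie (_B : LieBialgebra k g) : Type _ := Module.Dual k g

namespace LieBialgebra

variable (B : LieBialgebra k g)

instance : AddCommGroup B.DualLie := inferInstanceAs (AddCommGroup (Module.Dual k g))
instance : Module k B.DualLie := inferInstanceAs (Module k (Module.Dual k g))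

/-- The identification of `g*`, as a vector space, with the space of linear forms on `g`. -/
def toDual : B.DualLie ≃ₗ[k] Module.Dual k g := LinearEquiv.refl k (Module.Dual k g)

/-- The pairing of `ξ ⊗ η` with an element of `g ⊗ g`. -/
def pair (ξ η : B.DualLie) : g ⊗[k] g →ₗ[k] k :=
  TensorProduct.dualDistrib k g g (B.toDual ξ ⊗ₜ[k] B.toDual η)

theorem pair_tmul (ξ η : B.DualLie) (x y : g) :
    B.pair ξ η (x ⊗ₜ[k] y) = B.toDual ξ x * B.toDual η y := by
  simp [pair]

/-- The Lie bracket of `g*`: `⟨[ξ, η], x⟩ = ⟨ξ ⊗ η, δ x⟩`. -/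
instance : Bracket B.DualLie B.DualLie where
  bracket ξ η := B.toDual.symm (B.pair ξ η ∘ₗ B.cobracket)

theorem toDual_lie (ξ η : B.DualLie) (x : g) :
    B.toDual ⁅ξ, η⁆ x = B.pair ξ η (B.cobracket x) := rfl

theorem pair_comm (ξ η : B.DualLie) (t : g ⊗[k] g) :
    B.pair ξ η (TensorProduct.comm k g g t) = B.pair η ξ t := by
  induction t with
  | zero => simp
  | add a b ha hb => simp only [map_add, ha, hb]
  | tmul a b => simp [pair_tmul, mul_comm]

theorem dual_skew (ξ η : B.DualLie) : ⁅ξ, η⁆ = -⁅η, ξ⁆ := by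
  apply B.toDual.injective
  ext x
  rw [map_neg, LinearMap.neg_apply, toDual_lie, toDual_lie, ← pair_comm, B.antisymm, map_neg]

/-- The pairing of `ξ ⊗ η ⊗ ζ` with an element of `g ⊗ g ⊗ g`. -/
def pair₃ (ξ η ζ : B.DualLie) : (g ⊗[k] g) ⊗[k] g →ₗ[k] k :=
  TensorProduct.dualDistrib k (g ⊗[k] g) g (B.pair ξ η ⊗ₜ[k] B.toDual ζ)

theorem pair₃_cobracket (ξ η ζ : B.DualLie) (t : g ⊗[k] g) :
    B.pair₃ ξ η ζ (TensorProduct.map B.cobracket LinearMap.id t) = B.pair ⁅ξ, η⁆ ζ t := by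
  induction t with
  | zero => simp
  | add a b ha hb => simp only [map_add, ha, hb]
  | tmul a b => simp [pair_tmul, pair₃, toDual_lie]

theorem pair₃_cyclicPerm (ξ η ζ : B.DualLie) (t : (g ⊗[k] g) ⊗[k] g) :
    B.pair₃ ξ η ζ (cyclicPerm k g t) = B.pair₃ ζ ξ η t := by
  have : B.pair₃ ξ η ζ ∘ₗ cyclicPerm k g = B.pair₃ ζ ξ η := by
    ext a b c
    simp [cyclicPerm, pair₃, pair_tmul]
    ring
  exact LinearMap.congr_fun this t

theorem dual_jacobi (ξ η ζ : B.DualLie) : ⁅⁅ξ, η⁆, ζ⁆ + ⁅⁅ζ, ξ⁆, η⁆ + ⁅⁅η, ζ⁆, ξ⁆ = 0 := by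
  apply B.toDual.injective
  ext x
  have h := congrArg (B.pair₃ ξ η ζ) (B.coJacobi x)
  simpa only [cyclicSum, map_add, pair₃_cyclicPerm, pair₃_cobracket, map_zero, toDual_lie,
    LinearMap.add_apply, LinearMap.zero_apply] using h

theorem dual_add_lie (ξ η ζ : B.DualLie) : ⁅ξ + η, ζ⁆ = ⁅ξ, ζ⁆ + ⁅η, ζ⁆ := by
  apply B.toDual.injective
  ext x
  simp [toDual_lie, pair, TensorProduct.add_tmul]

theorem dual_lie_add (ξ η ζ : B.DualLie) : ⁅ξ, η + ζ⁆ = ⁅ξ, η⁆ + ⁅ξ, ζ⁆ := by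
  apply B.toDual.injective
  ext x
  simp [toDual_lie, pair, TensorProduct.tmul_add]

theorem dual_lie_smul (c : k) (ξ η : B.DualLie) : ⁅ξ, c • η⁆ = c • ⁅ξ, η⁆ := by
  apply B.toDual.injective
  ext x
  simp [toDual_lie, pair]

theorem dual_lie_neg (ξ η : B.DualLie) : ⁅ξ, -η⁆ = -⁅ξ, η⁆ := by
  simpa using B.dual_lie_smul (-1) ξ η

variable [CharZero k]

instance : LieRing B.DualLie where
  add_lie := B.dual_add_lie
  lie_add := B.dual_lie_add
  lie_self ξ := by
    have h := B.dual_skew ξ ξ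
    have h2 : (2 : k) • ⁅ξ, ξ⁆ = 0 := by rw [two_smul]; nth_rewrite 1 [h]; simp
    simpa using h2
  leibniz_lie ξ η ζ := by
    have h := B.dual_jacobi ξ η ζ
    rw [B.dual_skew ⁅ζ, ξ⁆ η, B.dual_skew ζ ξ, B.dual_lie_neg, neg_neg,
      B.dual_skew ⁅η, ζ⁆ ξ] at h
    rw [← sub_eq_zero, ← neg_eq_zero, ← h]
    abel

instance : LieAlgebra k B.DualLie where
  lie_smul := B.dual_lie_smul

end LieBialgebra
end LieBialgebras

/-! ## The universal enveloping algebra as a co-Poisson Hopf algebra -/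

section Enveloping

attribute [local instance 100] LieRing.ofAssociativeRing

namespace UniversalEnvelopingAlgebra

variable (k L : Type*) [Field k] [LieRing L] [LieAlgebra k L]

/-- The coproduct of `U(L)`: the algebra morphism with `Δ(x) = x ⊗ 1 + 1 ⊗ x` for `x ∈ L`. -/
def comulHom : UniversalEnvelopingAlgebra k L →ₐ[k]
    UniversalEnvelopingAlgebra k L ⊗[k] UniversalEnvelopingAlgebra k L :=
  lift k
    { toLinearMap :=
        (TensorProduct.mk k _ _).flip 1 ∘ₗ (ι k : L →ₗ⁅k⁆ UniversalEnvelopingAlgebra k L) +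
          TensorProduct.mk k _ _ 1 ∘ₗ (ι k : L →ₗ⁅k⁆ UniversalEnvelopingAlgebra k L)
      map_lie' := by
        intro x y
        simp [LieRing.of_associative_ring_bracket, add_mul, mul_add,
          TensorProduct.tmul_sub, -ι_apply]
        abel }

/-- The counit of `U(L)`: the algebra morphism with `ε(x) = 0` for `x ∈ L`. -/
def counitHom : UniversalEnvelopingAlgebra k L →ₐ[k] k := lift k 0

theorem comulHom_ι (x : L) : comulHom k L (ι k x) = ι k x ⊗ₜ[k] 1 + 1 ⊗ₜ[k] ι k x := by
  rw [comulHom, lift_ι_apply]; rfl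

theorem counitHom_ι (x : L) : counitHom k L (ι k x) = 0 := by
  rw [counitHom, lift_ι_apply]; rfl

theorem algHom_ext_ι {A : Type*} [Ring A] [Algebra k A] {f₁ f₂ : UniversalEnvelopingAlgebra k L →ₐ[k] A}
    (h : ∀ x, f₁ (ι k x) = f₂ (ι k x)) : f₁ = f₂ :=
  hom_ext k (LieHom.ext h)

instance : Bialgebra k (UniversalEnvelopingAlgebra k L) :=
  Bialgebra.ofAlgHom (comulHom k L) (counitHom k L)
    (by
      apply algHom_ext_ι
      intro x
      simp [comulHom_ι, -ι_apply, TensorProduct.add_tmul, TensorProduct.tmul_add,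
        Algebra.TensorProduct.one_def]
      abel)
    (by
      apply algHom_ext_ι
      intro x
      simp [comulHom_ι, counitHom_ι, -ι_apply])
    (by
      apply algHom_ext_ι
      intro x
      simp [comulHom_ι, counitHom_ι, -ι_apply])

end UniversalEnvelopingAlgebra

namespace LieBialgebra

variable {k g : Type*} [Field k] [CharZero k] [LieRing g] [LieAlgebra k g] [Module.Finite k g]
variable (B : LieBialgebra k g)

/-- The universal enveloping algebra `U(g*)` of the dual Lie algebra. -/
abbrev U : Type _ := UniversalEnvelopingAlgebra k B.DualLie

/-- The Lie cobracket of `g*`, i.e. the transpose `g* → g* ⊗ g*` of the Lie bracket of `g`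
(as `g` is finite dimensional, `g* ⊗ g*` is the dual of `g ⊗ g`). -/
def dualCobracket : B.DualLie →ₗ[k] B.DualLie ⊗[k] B.DualLie :=
  (TensorProduct.map (B.toDual.symm : Module.Dual k g →ₗ[k] B.DualLie)
      (B.toDual.symm : Module.Dual k g →ₗ[k] B.DualLie)) ∘ₗ
    (TensorProduct.dualDistribEquiv k g g).symm.toLinearMap ∘ₗ
      Module.Dual.transpose (R := k) (LieModule.toModuleHom k g g : g ⊗[k] g →ₗ[k] g) ∘ₗ
        B.toDual.toLinearMap

/-- The pairing of an element of `g* ⊗ g*` with `x ⊗ y`. -/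
def coPair (x y : g) : B.DualLie ⊗[k] B.DualLie →ₗ[k] k :=
  (LinearMap.applyₗ (x ⊗ₜ[k] y) ∘ₗ TensorProduct.dualDistrib k g g) ∘ₗ
    TensorProduct.map B.toDual.toLinearMap B.toDual.toLinearMap

theorem coPair_tmul (x y : g) (ξ η : B.DualLie) :
    B.coPair x y (ξ ⊗ₜ[k] η) = B.toDual ξ x * B.toDual η y := by
  simp [coPair]

theorem coPair_dualCobracket (x y : g) (ξ : B.DualLie) :
    B.coPair x y (B.dualCobracket ξ) = B.toDual ξ ⁅x, y⁆ := by
  have h : ∀ t : Module.Dual k g ⊗[k] Module.Dual k g,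
      TensorProduct.map B.toDual.toLinearMap B.toDual.toLinearMap
        (TensorProduct.map (B.toDual.symm : Module.Dual k g →ₗ[k] B.DualLie)
          (B.toDual.symm : Module.Dual k g →ₗ[k] B.DualLie) t) = t := by
    intro t
    induction t with
    | zero => simp
    | add a b ha hb => simp only [map_add, ha, hb]
    | tmul a b => simp
  have h2 : ∀ t : Module.Dual k (g ⊗[k] g), TensorProduct.dualDistrib k g g
      ((TensorProduct.dualDistribEquiv k g g).symm t) = t := fun t =>
    (TensorProduct.dualDistribEquiv k g g).apply_symm_apply t
  simp only [coPair, dualCobracket, LinearMap.comp_apply, LinearEquiv.coe_coe]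
  rw [h, h2]
  simp [Module.Dual.transpose_apply]

theorem coPair_ext {s t : B.DualLie ⊗[k] B.DualLie}
    (h : ∀ x y, B.coPair x y s = B.coPair x y t) : s = t := by
  have h1 : Function.Injective
      (TensorProduct.map B.toDual.toLinearMap B.toDual.toLinearMap) :=
    (TensorProduct.congr B.toDual B.toDual).injective
  apply h1
  apply (TensorProduct.dualDistribEquiv k g g).injective
  apply TensorProduct.ext'
  exact h

theorem coPair_lie (x y : g) (ζ : B.DualLie) (t : B.DualLie ⊗[k] B.DualLie) (p q : Module.Dual k g)
    (hp : ∀ b, p b = B.coPair b y t) (hq : ∀ b, q b = B.coPair x b t) :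
    B.coPair x y ⁅ζ, t⁆ = B.pair ζ (B.toDual.symm p) (B.cobracket x) +
      B.pair ζ (B.toDual.symm q) (B.cobracket y) := by
  have h : ∀ (p : Module.Dual k g) (s : g ⊗[k] g), B.pair ζ (B.toDual.symm p) s =
      p (TensorProduct.lid k g (TensorProduct.map (B.toDual ζ) LinearMap.id s)) := by
    intro p s
    induction s with
    | zero => simp
    | add a b ha hb => simp only [map_add, ha, hb]
    | tmul a b => simp [pair_tmul]
  rw [h, h, hp, hq]
  induction t generalizing p q with
  | zero => simp
  | add a b ha hb =>
    have e : ∀ c : B.DualLie ⊗[k] B.DualLie,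
        (∃ p : Module.Dual k g, ∀ b, p b = B.coPair b y c) ∧
        (∃ q : Module.Dual k g, ∀ b, q b = B.coPair x b c) := fun c =>
      ⟨⟨{ toFun := fun b => B.coPair b y c
          map_add' := by intro a b; simp [coPair, TensorProduct.add_tmul]
          map_smul' := by intro a b; simp [coPair, ← TensorProduct.smul_tmul'] }, fun _ => rfl⟩,
       ⟨{ toFun := fun b => B.coPair x b c
          map_add' := by intro a b; simp [coPair, TensorProduct.tmul_add]
          map_smul' := by intro a b; simp [coPair] }, fun _ => rfl⟩⟩
    obtain ⟨⟨pa, hpa⟩, ⟨qa, hqa⟩⟩ := e a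
    obtain ⟨⟨pb, hpb⟩, ⟨qb, hqb⟩⟩ := e b
    rw [lie_add, map_add, map_add, map_add, ha pa qa hpa hqa, hb pb qb hpb hqb]
    ring
  | tmul a b =>
    simp only [TensorProduct.LieModule.lie_tmul_right, map_add, coPair_tmul, toDual_lie]
    rw [← B.toDual.symm_apply_apply a, ← B.toDual.symm_apply_apply b, h, h]
    simp [mul_comm]

/-- The cobracket of `g*` is a cocycle. -/
theorem dualCobracket_lie (ξ η : B.DualLie) :
    B.dualCobracket ⁅ξ, η⁆ = ⁅ξ, B.dualCobracket η⁆ - ⁅η, B.dualCobracket ξ⁆ := by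
  apply B.coPair_ext
  intro x y
  have ad : ∀ (ζ : B.DualLie) (z : g), ∃ p : Module.Dual k g, ∀ b, p b = B.toDual ζ ⁅z, b⁆ :=
    fun ζ z => ⟨B.toDual ζ ∘ₗ (LieModule.toEnd k g g z), fun b => by simp⟩
  obtain ⟨p, hp⟩ := ad η y
  obtain ⟨q, hq⟩ := ad η x
  obtain ⟨p', hp'⟩ := ad ξ y
  obtain ⟨q', hq'⟩ := ad ξ x
  have key : ∀ (z : g) (u u' : Module.Dual k g) (_ : ∀ b, u b = B.toDual η ⁅z, b⁆)
      (_ : ∀ b, u' b = B.toDual ξ ⁅z, b⁆) (s : g ⊗[k] g), B.pair ξ η ⁅z, s⁆ =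
      B.pair ξ (B.toDual.symm u) s + B.pair η (B.toDual.symm u') (TensorProduct.comm k g g s) := by
    intro z u u' hu hu' s
    induction s with
    | zero => simp
    | add a b ha hb => simp only [map_add, lie_add, ha, hb]; ring
    | tmul a b =>
      simp [TensorProduct.LieModule.lie_tmul_right, pair_tmul, hu, hu']
      ring
  rw [map_sub, B.coPair_lie x y ξ (B.dualCobracket η) (-p) q, B.coPair_lie x y η
    (B.dualCobracket ξ) (-p') q', coPair_dualCobracket, toDual_lie, B.cocycle, map_sub,
    key x q q' hq hq', key y p p' hp hp', B.antisymm, B.antisymm]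
  · have n : ∀ (ζ : B.DualLie) (u : Module.Dual k g) (s : g ⊗[k] g),
        B.pair ζ (B.toDual.symm (-u)) s = -B.pair ζ (B.toDual.symm u) s := by
      intro ζ u s
      induction s with
      | zero => simp
      | add a b ha hb => simp only [map_add, ha, hb]; ring
      | tmul a b => simp [pair_tmul]
    rw [n, n, map_neg, map_neg]
    ring
  · intro b; rw [coPair_dualCobracket, LinearMap.neg_apply, hp', ← lie_skew, map_neg, neg_neg]
  · intro b; rw [coPair_dualCobracket, hq']
  · intro b; rw [coPair_dualCobracket, LinearMap.neg_apply, hp, ← lie_skew, map_neg, neg_neg]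
  · intro b; rw [coPair_dualCobracket, hq]

/-- The inclusion `g* ⊗ g* → U(g*) ⊗ U(g*)`. -/
def ι₂ : B.DualLie ⊗[k] B.DualLie →ₗ[k] B.U ⊗[k] B.U :=
  TensorProduct.map (UniversalEnvelopingAlgebra.ι k : B.DualLie →ₗ⁅k⁆ B.U)
    (UniversalEnvelopingAlgebra.ι k : B.DualLie →ₗ⁅k⁆ B.U)

theorem ι₂_lie (ξ : B.DualLie) (t : B.DualLie ⊗[k] B.DualLie) :
    B.ι₂ ⁅ξ, t⁆ = ⁅UniversalEnvelopingAlgebra.comulHom k B.DualLie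
      (UniversalEnvelopingAlgebra.ι k ξ), B.ι₂ t⁆ := by
  induction t with
  | zero => simp
  | add a b ha hb => simp only [map_add, lie_add, ha, hb]
  | tmul a b =>
    simp [ι₂, UniversalEnvelopingAlgebra.comulHom_ι, -UniversalEnvelopingAlgebra.ι_apply,
      TensorProduct.LieModule.lie_tmul_right, LieRing.of_associative_ring_bracket, add_mul, mul_add,
      TensorProduct.sub_tmul, TensorProduct.tmul_sub]
    abel

/-- The algebra morphism `u ↦ Δ(u) + ε δ_U(u)` from `U(g*)` to `(U(g*) ⊗ U(g*))[ε]`, `ε² = 0`,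
where `δ_U` is the co-Poisson structure of `U(g*)`, i.e. the linear map with
`δ_U(u v) = δ_U(u) Δ(v) + Δ(u) δ_U(v)` that extends the Lie cobracket of `g*`. -/
def comulCoPoisson : B.U →ₐ[k] DualNumber (B.U ⊗[k] B.U) :=
  UniversalEnvelopingAlgebra.lift k
    { toFun := fun ξ =>
        TrivSqZeroExt.inl (UniversalEnvelopingAlgebra.comulHom k B.DualLie
          (UniversalEnvelopingAlgebra.ι k ξ)) + TrivSqZeroExt.inr (B.ι₂ (B.dualCobracket ξ))
      map_add' := by intro ξ η; ext <;> simp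
      map_smul' := by intro c ξ; ext <;> simp
      map_lie' := by
        intro ξ η
        ext
        · simp [LieRing.of_associative_ring_bracket, -UniversalEnvelopingAlgebra.ι_apply]
        · rw [dualCobracket_lie, map_sub, ι₂_lie, ι₂_lie]
          simp [LieRing.of_associative_ring_bracket, -UniversalEnvelopingAlgebra.ι_apply]
          abel }

/-- The co-Poisson structure `δ_U : U(g*) → U(g*) ⊗ U(g*)`. -/
def coPoisson : B.U →ₗ[k] B.U ⊗[k] B.U :=
  TrivSqZeroExt.sndHom (R := B.U ⊗[k] B.U) (M := B.U ⊗[k] B.U) ∘ₗ B.comulCoPoisson.toLinearMap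

end LieBialgebra

end Enveloping

/-! ## Algebras of formal functions -/

section FormalFunctions

variable {k : Type*} [Field k]

/-- The linear dual of a coalgebra `C`, with the convolution product. For `C = U(a)^{⊗ n}` this is
the algebra of formal functions on the `n`-th power of the formal group with Lie algebra `a`. -/
abbrev FormalFun (k C : Type*) [Field k] [AddCommGroup C] [Module k C] : Type _ :=
  WithConv (C →ₗ[k] k)

variable {C D : Type*} [AddCommGroup C] [Module k C] [AddCommGroup D] [Module k D]

namespace FormalFun

/-- The transpose of a linear map. -/
def pullback (T : D →ₗ[k] C) : FormalFun k C →ₗ[k] FormalFun k D where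
  toFun a := WithConv.toConv (a.ofConv ∘ₗ T)
  map_add' _ _ := rfl
  map_smul' _ _ := rfl

/-- The function `a ⊗ b`, `(a ⊗ b)(c ⊗ d) = a(c) b(d)`. -/
def tmul (a : FormalFun k C) (b : FormalFun k D) : FormalFun k (C ⊗[k] D) :=
  WithConv.toConv (LinearMap.mul' k k ∘ₗ TensorProduct.map a.ofConv b.ofConv)

/-- The bracket `{a, b} = (a ⊗ b) ∘ δ` dual to a co-Poisson structure `δ`. -/
def bracket (δ : C →ₗ[k] C ⊗[k] C) (a b : FormalFun k C) : FormalFun k C :=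
  pullback δ (tmul a b)

/-- Convergence of the series `∑ t n` to `s`. The topology is that of simple convergence, with `k`
discrete; on formal functions on a finite dimensional formal group it is the topology of powers of
the maximal ideal. -/
def HasFormalSum (t : ℕ → FormalFun k C) (s : FormalFun k C) : Prop :=
  ∀ c : C, ∃ N, ∀ n ≥ N, (∑ i ∈ Finset.range n, t i).ofConv c = s.ofConv c

/-- Continuity of a linear map, for the topologies of simple convergence (with `k` discrete): for
each `d`, the linear form `a ↦ (T a)(d)` is continuous, i.e. it is the evaluation at some `c`. -/
def IsContinuous (T : FormalFun k C →ₗ[k] FormalFun k D) : Prop :=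
  ∀ d : D, ∃ c : C, ∀ a, (T a).ofConv d = a.ofConv c

/-- `j₂` is the completed tensor square of `j`: the continuous linear map with
`j₂(a ⊗ b) = j(a) ⊗ j(b)`. -/
def IsCompletedTensorSquare (j : FormalFun k C →ₗ[k] FormalFun k D)
    (j₂ : FormalFun k (C ⊗[k] C) →ₗ[k] FormalFun k (D ⊗[k] D)) : Prop :=
  IsContinuous j₂ ∧ ∀ a b, j₂ (tmul a b) = tmul (j a) (j b)

end FormalFun

/-- The co-Poisson structure of the tensor product of two co-Poisson coalgebras; it is dual to
`{a ⊗ b, a' ⊗ b'} = {a, a'} ⊗ b b' + a a' ⊗ {b, b'}`. -/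
def coPoissonTensor [Coalgebra k C] [Coalgebra k D] (δC : C →ₗ[k] C ⊗[k] C)
    (δD : D →ₗ[k] D ⊗[k] D) : C ⊗[k] D →ₗ[k] (C ⊗[k] D) ⊗[k] (C ⊗[k] D) :=
  (TensorProduct.tensorTensorTensorComm k C C D D).toLinearMap ∘ₗ
    (TensorProduct.map δC Coalgebra.comul + TensorProduct.map Coalgebra.comul δD)

/-- `[x₁, [x₂, … [x_{n-1}, x_n]…]]`. -/
def nestedBracket {V : Type*} [Zero V] (br : V → V → V) : List V → V
  | [] => 0
  | [x] => x
  | x :: y :: l => br x (nestedBracket br (y :: l))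

/-- The homogeneous component of total degree `n` of the Baker-Campbell-Hausdorff series
`log(exp x exp y)`, in Dynkin's form
`∑_{m ≥ 1} (-1)^{m-1}/m ∑ [x^{r₁} y^{s₁} ⋯ x^{r_m} y^{s_m}] / (n ∏ᵢ rᵢ! sᵢ!)`, the inner sum
being over `(r₁, s₁), …, (r_m, s_m)` with `rᵢ + sᵢ > 0` and `∑ᵢ (rᵢ + sᵢ) = n`. -/
def bchTerm (k : Type*) {V : Type*} [Field k] [AddCommGroup V] [Module k V] (br : V → V → V)
    (x y : V) (n : ℕ) : V :=
  ∑ m ∈ Finset.Icc 1 n,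
    ∑ p : Fin m → Fin (n + 1) × Fin (n + 1) with
        (∀ i, 0 < ((p i).1 : ℕ) + (p i).2) ∧ ∑ i, (((p i).1 : ℕ) + (p i).2) = n,
      ((-1) ^ (m - 1) / (m * n * ∏ i, (Nat.factorial (p i).1 * Nat.factorial (p i).2 : k)) : k) •
        nestedBracket br
          (List.ofFn fun i => List.replicate (p i).1 x ++ List.replicate (p i).2 y).flatten

namespace LieBialgebra

variable [CharZero k] {g : Type*} [LieRing g] [LieAlgebra k g] [Module.Finite k g]
  (B : LieBialgebra k g)

/-- The algebra `O_{G*} = U(g*)^*` of functions on the formal group `G*` with Lie algebra `g*`. -/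
abbrev O : Type _ := FormalFun k B.U

/-- The algebra of functions on the formal group `(G*)²`. -/
abbrev O₂ : Type _ := FormalFun k (B.U ⊗[k] B.U)

/-- The algebra of functions on the formal group `(G*)³`. -/
abbrev O₃ : Type _ := FormalFun k ((B.U ⊗[k] B.U) ⊗[k] B.U)

/-- The co-Poisson structure of `U(g*)^{⊗ 2}`. -/
def coPoisson₂ : B.U ⊗[k] B.U →ₗ[k] (B.U ⊗[k] B.U) ⊗[k] (B.U ⊗[k] B.U) :=
  coPoissonTensor B.coPoisson B.coPoisson

/-- The co-Poisson structure of `U(g*)^{⊗ 3}`. -/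
def coPoisson₃ : (B.U ⊗[k] B.U) ⊗[k] B.U →ₗ[k]
    ((B.U ⊗[k] B.U) ⊗[k] B.U) ⊗[k] ((B.U ⊗[k] B.U) ⊗[k] B.U) :=
  coPoissonTensor B.coPoisson₂ B.coPoisson

/-- The Poisson bracket of `O_{G*}`. -/
def poisson (a b : B.O) : B.O := FormalFun.bracket B.coPoisson a b

/-- The Poisson bracket of `O_{(G*)²}`. -/
def poisson₂ (a b : B.O₂) : B.O₂ := FormalFun.bracket B.coPoisson₂ a b

/-- The Poisson bracket of `O_{(G*)³}`. -/
def poisson₃ (a b : B.O₃) : B.O₃ := FormalFun.bracket B.coPoisson₃ a b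

/-- The coproduct `Δ : O_{G*} → O_{(G*)²}`, `Δ(a)(u ⊗ v) = a(u v)`. -/
def comul : B.O →ₗ[k] B.O₂ := FormalFun.pullback (LinearMap.mul' k B.U)

/-- `Δ ⊗ id : O_{(G*)²} → O_{(G*)³}`. -/
def comulLeft : B.O₂ →ₗ[k] B.O₃ :=
  FormalFun.pullback (TensorProduct.map (LinearMap.mul' k B.U) LinearMap.id)

/-- `id ⊗ Δ : O_{(G*)²} → O_{(G*)³}`. -/
def comulRight : B.O₂ →ₗ[k] B.O₃ :=
  FormalFun.pullback (TensorProduct.map LinearMap.id (LinearMap.mul' k B.U) ∘ₗ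
    (TensorProduct.assoc k B.U B.U B.U).toLinearMap)

/-- `F ↦ F ⊗ 1`. -/
def tensorOne (F : B.O₂) : B.O₃ := FormalFun.tmul F (1 : B.O)

/-- `F ↦ 1 ⊗ F`. -/
def oneTensor (F : B.O₂) : B.O₃ :=
  FormalFun.pullback (TensorProduct.assoc k B.U B.U B.U).toLinearMap
    (FormalFun.tmul (1 : B.O) F)

/-- `a` lies in the maximal ideal `m` of `O_{G*}` (it vanishes at the origin of `G*`), and its class
in `m / m² = (g*)^* = g` (its differential at the origin) is `x`. -/
def HasCotangentClass (a : B.O) (x : g) : Prop :=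
  a.ofConv 1 = 0 ∧
    ∀ ξ : B.DualLie, a.ofConv (UniversalEnvelopingAlgebra.ι k ξ) = B.toDual ξ x

/-- The series of the Baker-Campbell-Hausdorff product `a ⋆ b` in `O_{(G*)³}` converges to `c`. -/
def IsStar₃ (a b c : B.O₃) : Prop :=
  FormalFun.HasFormalSum (bchTerm k B.poisson₃ a b) c

/-- `F` belongs to `m ⊗̂ m`, where `m` is the maximal ideal of `O_{G*}`. -/
def IsInMaxIdealSq (F : B.O₂) : Prop :=
  ∀ u : B.U, F.ofConv (u ⊗ₜ[k] 1) = 0 ∧ F.ofConv (1 ⊗ₜ[k] u) = 0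

/-- `F ∈ m ⊗̂ m` is a twist for `Δ`:
`(F ⊗ 1) ⋆ (Δ ⊗ id)(F) = (1 ⊗ F) ⋆ (id ⊗ Δ)(F)`. -/
def IsTwist (F : B.O₂) : Prop :=
  B.IsInMaxIdealSq F ∧
    ∃ c : B.O₃, B.IsStar₃ (B.tensorOne F) (B.comulLeft F) c ∧
      B.IsStar₃ (B.oneTensor F) (B.comulRight F) c

/-- The antisymmetrization `r - r^{2,1}` of the image `r` of `F` under
`m ⊗̂ m → (m / m²) ⊗ (m / m²) = g ⊗ g` is equal to `t`. -/
def HasAltClass (F : B.O₂) (t : g ⊗[k] g) : Prop :=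
  ∀ ξ η : B.DualLie,
    F.ofConv (UniversalEnvelopingAlgebra.ι k ξ ⊗ₜ[k] UniversalEnvelopingAlgebra.ι k η) -
      F.ofConv (UniversalEnvelopingAlgebra.ι k η ⊗ₜ[k] UniversalEnvelopingAlgebra.ι k ξ) =
    B.pair ξ η t

/-- `b` is the value at `a` of the twisted coproduct
`F ⋆ Δ(a) ⋆ (-F) = ∑ₙ (1/n!) {F, {F, … {F, Δ(a)}…}}`. -/
def IsTwistedComul (F : B.O₂) (a : B.O) (b : B.O₂) : Prop :=
  FormalFun.HasFormalSum
    (fun n => ((Nat.factorial n : k)⁻¹) • (B.poisson₂ F)^[n] (B.comul a)) b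

end LieBialgebra

/-- `F` is a lift of `∧²(θ_γ)(f_{γ'})` to a twist for `Δ_γ`. -/
def GammaLieBialgebra.IsTwistLift [CharZero k] {g Γ : Type*} [LieRing g] [LieAlgebra k g]
    [Module.Finite k g] [Group Γ] (B : GammaLieBialgebra k g Γ) (γ γ' : Γ)
    (F : (B.lieBialgebra γ).O₂) : Prop :=
  (B.lieBialgebra γ).IsTwist F ∧
    (B.lieBialgebra γ).HasAltClass F
      (TensorProduct.map (B.θ γ : g →ₗ[k] g) (B.θ γ : g →ₗ[k] g) (B.f γ'))

end FormalFunctions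

end

/-!
Everything is done on the side of the enveloping algebras `U(g*)`, `U(g*) ⊗ U(g*)`, …, viewed as
co-Poisson bialgebras generated by primitive elements (`CoPoissonFrame`). Functions are linear forms
on them; `I p` is the space of functions vanishing on products of fewer than `p` generators, that is
to order `p` at the origin. The bracket satisfies `{I p, I q} ⊆ I (p + q - 1)`, so `I 2` is a Lie
algebra with nilpotent quotients `I 2 / I p`, in which the Baker-Campbell-Hausdorff product is a
group law (`lieBch_assoc`, deduced from the formula `exp_mul_exp` in associative algebras).

Put `t = ∧²(θ_γ)(f_γ')`. The identities satisfied by `f`, transported by `θ_γ`, say that `t` is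
antisymmetric, that it solves the twist equation of `(g, δ_γ)`, and that
`δ_γγ' (x) = δ_γ (x) + [t, x ⊗ 1 + 1 ⊗ x]` (`lieBialgebra_mul_cobracket`). The statement is then one
about a single Lie bialgebra and a solution `t` of its twist equation.

*Existence of a twist* (`exists_isTwist`). One starts from the function with leading term `t / 2` and
solves the equation order by order. If `F` is a twist modulo `I p`, the defect of the equation modulo
`I (p + 1)` is central in the group of jets, and comparing the two ways round the pentagon shows that
it is a cocycle (`obstruction_pentagon`) of the complex computing the Hochschild cohomology of the
coalgebra `S(g*)`, once the Poincaré-Birkhoff-Witt theorem identifies it with the associated graded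
of `U(g*)`. A 3-cocycle is a coboundary as soon as its total antisymmetrization vanishes
(`MonomialCohomology.exists_eq_d`), and then `F` can be corrected (`exists_twist_lift`). The
antisymmetrization only sees the component of degree `(1, 1, 1)`: it is zero for `p > 3`, and for
`p = 3` it is the left hand side of the twist equation for `t` (`alt_obstruction`).

*The isomorphism.* Let `F` be a twist. The transpose of `{F, -}` is a locally nilpotent coderivation
of `U(g*) ⊗ U(g*)`, whose exponential `flow F` is an automorphism of co-Poisson coalgebras. The
coproduct twisted by `F` is therefore dual to the product `twistMul F`, the product of `U(g*)`
precomposed with `flow F`. Flows turn Baker-Campbell-Hausdorff products into compositions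
(`flow_mul`), so the twist equation gives the associativity of this product (`twistMul_assoc`). On
`g*` its commutator is the bracket dual to the twisted cobracket (`toDual_twist_commutator`). With
`g'*` the dual Lie algebra for that cobracket, the universal property of `U(g'*)` thus makes it act on
`U(g*)` by twisted left multiplications, and `toU : U(g'*) → U(g*)`, `u ↦ u · 1`, carries the product
to the twisted product. It is a morphism of co-Poisson coalgebras, and it is bijective since it is
the identity up to terms of lower order in the Poincaré-Birkhoff-Witt bases (`toU_injective`,
`toU_surjective`). Its transpose `funEquiv` is the isomorphism `j`.
-/

noncomputable section

set_option linter.unusedSectionVars false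

/-! ### Power series in a nilpotent element -/

section NilpotentCalculus

open Finset PowerSeries

variable {k A : Type*} [Field k] [Ring A] [Algebra k A]

/-- The value `∑ fᵢ aⁱ` of a formal power series `f` at a nilpotent element `a`. -/
def nilEval (a : A) (f : PowerSeries k) : A :=
  ∑ i ∈ range (nilpotencyClass a), coeff i f • a ^ i

theorem nilEval_eq_sum {a : A} {N : ℕ} (h : a ^ N = 0) (f : PowerSeries k) :
    nilEval a f = ∑ i ∈ range N, coeff i f • a ^ i := by
  have hle : nilpotencyClass a ≤ N := csInf_le' h
  rw [nilEval, ← sum_range_add_sum_Ico _ hle, sum_eq_zero (s := Ico _ _), add_zero]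
  intro i hi
  rw [pow_eq_zero_of_le (mem_Ico.1 hi).1 (pow_nilpotencyClass ⟨N, h⟩), smul_zero]

theorem nilEval_coe {a : A} (ha : IsNilpotent a) (p : Polynomial k) :
    nilEval a (p : PowerSeries k) = Polynomial.aeval a p := by
  obtain ⟨N, hN⟩ := ha
  rw [Polynomial.aeval_eq_sum_range' (n := max N (p.natDegree + 1)) (by omega),
    nilEval_eq_sum (pow_eq_zero_of_le (le_max_left N (p.natDegree + 1)) hN)]
  simp

theorem nilEval_trunc {a : A} {N : ℕ} (h : a ^ N = 0) (f : PowerSeries k) :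
    nilEval a f = Polynomial.aeval a (trunc N f) := by
  rw [← nilEval_coe ⟨N, h⟩, nilEval_eq_sum h, nilEval_eq_sum h]
  refine sum_congr rfl fun i hi => ?_
  rw [Polynomial.coeff_coe, coeff_trunc, if_pos (mem_range.1 hi)]

theorem nilEval_add {a : A} (f g : PowerSeries k) :
    nilEval a (f + g) = nilEval a f + nilEval a g := by
  simp [nilEval, add_smul, sum_add_distrib]

theorem nilEval_mul {a : A} (ha : IsNilpotent a) (f g : PowerSeries k) :
    nilEval a (f * g) = nilEval a f * nilEval a g := by
  obtain ⟨N, h⟩ := ha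
  rw [nilEval_trunc h f, nilEval_trunc h g, ← map_mul, ← nilEval_coe ⟨N, h⟩,
    nilEval_trunc h (f * g), nilEval_trunc h, Polynomial.coe_mul, trunc_trunc_mul_trunc]

theorem nilEval_X {a : A} (ha : IsNilpotent a) : nilEval a (X : PowerSeries k) = a := by
  simpa using nilEval_coe (k := k) ha Polynomial.X

theorem nilEval_one {a : A} (ha : IsNilpotent a) : nilEval a (1 : PowerSeries k) = 1 := by
  simpa using nilEval_coe (k := k) ha 1

/-- `f ↦ ∑ fᵢ aⁱ` as an algebra morphism. -/
def nilEvalHom {a : A} (ha : IsNilpotent a) : PowerSeries k →ₐ[k] A :=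
  AlgHom.ofLinearMap
    { toFun := nilEval a
      map_add' := nilEval_add
      map_smul' := fun c f => by simp [nilEval, smul_sum, mul_smul] }
    (nilEval_one ha) (nilEval_mul ha)

theorem nilEvalHom_apply {a : A} (ha : IsNilpotent a) (f : PowerSeries k) :
    nilEvalHom ha f = nilEval a f := rfl

theorem nilEval_pow {a : A} {N : ℕ} (h : a ^ N = 0) {g : PowerSeries k}
    (hg : constantCoeff g = 0) : nilEval a g ^ N = 0 := by
  obtain ⟨r, rfl⟩ := X_dvd_iff.2 hg
  have ha : IsNilpotent a := ⟨N, h⟩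
  rw [← nilEvalHom_apply ha, ← map_pow, mul_pow, map_mul, map_pow, nilEvalHom_apply,
    nilEval_X ha, h, zero_mul]

theorem nilEval_subst {a : A} (ha : IsNilpotent a) {g : PowerSeries k}
    (hg : constantCoeff g = 0) (f : PowerSeries k) :
    nilEval a (f.subst g) = nilEval (nilEval a g) f := by
  have ha' := ha
  obtain ⟨N, h⟩ := ha'
  have hs : HasSubst g := HasSubst.of_constantCoeff_zero' hg
  have hb : nilEval a g ^ N = 0 := nilEval_pow h hg
  have key : nilEval a (((X : PowerSeries k) ^ N).subst g) = 0 := by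
    rw [subst_pow hs, subst_X hs, ← nilEvalHom_apply ha, map_pow, nilEvalHom_apply, hb]
  rw [nilEval_trunc hb]
  conv_lhs => rw [eq_shift_mul_X_pow_add_trunc N f]
  rw [subst_add hs, subst_mul hs, nilEval_add, nilEval_mul ha, key, mul_zero, zero_add,
    subst_coe hs, ← nilEvalHom_apply ha, ← nilEvalHom_apply ha, Polynomial.aeval_algHom_apply]

variable [CharZero k]

theorem log_subst_exp_sub_one : (log k).subst (exp k - 1) = (X : PowerSeries k) := by
  have hs : HasSubst (exp k - 1) := HasSubst.exp_sub_one
  apply derivative.ext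
  · rw [derivative_subst hs, deriv_log, map_sub, derivative_exp, derivative_one, sub_zero,
      derivative_X]
    have h1 : (mk fun n => algebraMap ℚ k ((-1 : ℚ) ^ n)) * (1 + X : PowerSeries k) = 1 := by
      ext n
      cases n with
      | zero => simp [mul_add]
      | succ n => simp [mul_add, coeff_succ_mul_X, pow_succ, coeff_one]
    have h2 := congrArg (PowerSeries.subst (exp k - 1)) h1
    have h3 : (1 : PowerSeries k).subst (exp k - 1) = (1 : PowerSeries k) := by
      rw [← coe_substAlgHom hs, map_one]
    rw [subst_mul hs, subst_add hs, subst_X hs, h3, add_sub_cancel] at h2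
    exact h2
  · rw [constantCoeff_X]
    exact constantCoeff_subst_eq_zero (by
      change constantCoeff (exp k - 1) = 0
      simp [constantCoeff_exp]) _ constantCoeff_log

theorem exp_subst_log : (exp k).subst (log k) = 1 + (X : PowerSeries k) := by
  have hs : HasSubst (exp k - 1) := HasSubst.exp_sub_one
  have hE : constantCoeff (exp k - 1) = 0 := by simp [constantCoeff_exp]
  have : Invertible (coeff 1 (exp k - 1)) := by
    have : coeff 1 (exp k - 1) = 1 := by simp [coeff_exp, coeff_one]
    rw [this]; exact invertibleOne
  have hL : log k = substInv (exp k - 1) := by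
    have h := congrArg (PowerSeries.subst (substInv (exp k - 1))) (log_subst_exp_sub_one (k := k))
    rw [subst_comp_subst_apply hs (HasSubst.substInv _), subst_substInv_right _ hE, X_subst,
      subst_X (HasSubst.substInv _)] at h
    exact h
  have h2 := subst_substInv_right (exp k - 1) hE
  rw [← hL, subst_sub HasSubst.log, sub_eq_iff_eq_add] at h2
  rw [h2, add_comm, ← coe_substAlgHom HasSubst.log, map_one]

/-- The exponential of a nilpotent element of an algebra over a field of characteristic `0`. -/
def nilExp (k : Type*) [Field k] [CharZero k] {A : Type*} [Ring A] [Algebra k A] (a : A) : A :=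
  nilEval a (exp k)

/-- `log (1 + a)` for a nilpotent element `a`. -/
def nilLog (k : Type*) [Field k] [CharZero k] {A : Type*} [Ring A] [Algebra k A] (a : A) : A :=
  nilEval a (log k)

theorem nilExp_eq_sum {a : A} {N : ℕ} (h : a ^ N = 0) :
    nilExp k a = ∑ i ∈ range N, ((i.factorial : k)⁻¹) • a ^ i := by
  rw [nilExp, nilEval_eq_sum h]
  simp [coeff_exp]

theorem nilLog_eq_sum {a : A} {N : ℕ} (h : a ^ N = 0) :
    nilLog k a = ∑ m ∈ Ico 1 N, ((-1) ^ (m - 1) / m : k) • a ^ m := by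
  rw [nilLog, nilEval_eq_sum h]
  rcases Nat.eq_zero_or_pos N with rfl | hN
  · simp
  rw [range_eq_Ico, sum_eq_sum_Ico_succ_bot hN]
  simp only [coeff_log, if_true, zero_smul, zero_add]
  refine sum_congr rfl fun m hm => ?_
  obtain ⟨hm, -⟩ := mem_Ico.1 hm
  rw [if_neg (by omega)]
  obtain ⟨m, rfl⟩ : ∃ n, m = n + 1 := ⟨m - 1, by omega⟩
  simp [pow_succ]

theorem nilLog_nilExp {a : A} (ha : IsNilpotent a) : nilLog k (nilExp k a - 1) = a := by
  have h := nilEval_subst ha (g := exp k - 1) (by simp [constantCoeff_exp]) (log k)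
  rw [log_subst_exp_sub_one, nilEval_X ha] at h
  rw [← nilEvalHom_apply ha (exp k - 1), map_sub, map_one] at h
  exact h.symm

theorem isNilpotent_nilLog {a : A} (ha : IsNilpotent a) : IsNilpotent (nilLog k a) := by
  obtain ⟨N, h⟩ := ha
  exact ⟨N, nilEval_pow h constantCoeff_log⟩

theorem nilExp_nilLog {a : A} (ha : IsNilpotent a) : nilExp k (nilLog k a) = 1 + a := by
  have h := nilEval_subst ha (g := log k) constantCoeff_log (exp k)
  rw [exp_subst_log, nilEval_add, nilEval_X ha, nilEval_one ha] at h
  exact h.symm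

theorem nilExp_injOn {a b : A} (ha : IsNilpotent a) (hb : IsNilpotent b)
    (h : nilExp k a = nilExp k b) : a = b := by
  rw [← nilLog_nilExp (k := k) ha, h, nilLog_nilExp hb]

theorem nilExp_add {a b : A} (hab : Commute a b) (ha : IsNilpotent a) (hb : IsNilpotent b) :
    nilExp k (a + b) = nilExp k a * nilExp k b := by
  let _ : Module ℚ A := Module.compHom A (algebraMap ℚ k)
  have conv : ∀ c : A, IsNilpotent c → nilExp k c = IsNilpotent.exp c := by
    rintro c ⟨N, h⟩
    rw [nilExp_eq_sum h, IsNilpotent.exp_eq_sum h]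
    refine sum_congr rfl fun i _ => ?_
    change _ = (algebraMap ℚ k (i.factorial : ℚ)⁻¹) • c ^ i
    simp
  rw [conv _ (hab.isNilpotent_add ha hb), conv _ ha, conv _ hb,
    IsNilpotent.exp_add_of_commute hab ha hb]

theorem nilExp_zero : nilExp k (0 : A) = 1 := by
  rw [nilExp_eq_sum (N := 1) (by simp)]; simp

theorem nilExp_mul_neg {a : A} (ha : IsNilpotent a) : nilExp k a * nilExp k (-a) = 1 := by
  rw [← nilExp_add (Commute.neg_right rfl) ha ha.neg, add_neg_cancel, nilExp_zero]

theorem map_nilExp {B : Type*} [Ring B] [Algebra k B] (f : A →ₐ[k] B) {a : A}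
    (ha : IsNilpotent a) : f (nilExp k a) = nilExp k (f a) := by
  obtain ⟨N, h⟩ := ha
  rw [nilExp_eq_sum h, nilExp_eq_sum (N := N) (by rw [← map_pow, h, map_zero])]
  simp

theorem map_nilLog {B : Type*} [Ring B] [Algebra k B] (f : A →ₐ[k] B) {a : A}
    (ha : IsNilpotent a) : f (nilLog k a) = nilLog k (f a) := by
  obtain ⟨N, h⟩ := ha
  rw [nilLog_eq_sum h, nilLog_eq_sum (N := N) (by rw [← map_pow, h, map_zero])]
  simp

end NilpotentCalculus

/-! ### The Baker-Campbell-Hausdorff-Dynkin formula -/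

section BCH

open Finset

/-- The word `x^{r₁} y^{s₁} ⋯ x^{r_m} y^{s_m}`. -/
def blockWord {V : Type*} (x y : V) {m N : ℕ} (p : Fin m → Fin N × Fin N) : List V :=
  (List.ofFn fun i => List.replicate (p i).1 x ++ List.replicate (p i).2 y).flatten

/-- The exponents of the words of total length `n` with `m` nonempty blocks. -/
def blockExponents (m N n : ℕ) : Finset (Fin m → Fin N × Fin N) :=
  {p | (∀ i, 0 < ((p i).1 : ℕ) + (p i).2) ∧ ∑ i, (((p i).1 : ℕ) + (p i).2) = n}

/-- The component of degree `n` of `log (exp x exp y)`, where `W` says how to evaluate a word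
in `x` and `y`. -/
def dynkinSum (k : Type*) {V V' : Type*} [Field k] [AddCommGroup V'] [Module k V']
    (W : List V → V') (x y : V) (N n : ℕ) : V' :=
  ∑ m ∈ Icc 1 n, ∑ p ∈ blockExponents m N n,
    ((-1) ^ (m - 1) / m * (∏ i, (Nat.factorial (p i).1 * Nat.factorial (p i).2 : k))⁻¹ : k) •
      W (blockWord x y p)

theorem length_blockWord {V : Type*} (x y : V) {m N : ℕ} (p : Fin m → Fin N × Fin N) :
    (blockWord x y p).length = ∑ i, (((p i).1 : ℕ) + (p i).2) := by
  simp [blockWord, List.length_flatten, List.map_ofFn, Function.comp_def, List.sum_ofFn]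

theorem mem_blockWord {V : Type*} {x y : V} {m N : ℕ} {p : Fin m → Fin N × Fin N} {a : V}
    (h : a ∈ blockWord x y p) : a = x ∨ a = y := by
  simp only [blockWord, List.mem_flatten, List.mem_ofFn] at h
  obtain ⟨l, ⟨i, rfl⟩, h⟩ := h
  rcases List.mem_append.1 h with h | h
  · exact Or.inl (List.eq_of_mem_replicate h)
  · exact Or.inr (List.eq_of_mem_replicate h)

theorem map_blockWord {V V' : Type*} (f : V → V') (x y : V) {m N : ℕ}
    (p : Fin m → Fin N × Fin N) : (blockWord x y p).map f = blockWord (f x) (f y) p := by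
  simp [blockWord, List.map_flatten, List.map_ofFn, Function.comp_def]

variable {k : Type*} [Field k]

theorem dynkinSum_congr {V V' : Type*} [AddCommGroup V'] [Module k V'] {W W' : List V → V'}
    {x y : V} {N n : ℕ} (h : ∀ l : List V, (∀ a ∈ l, a = x ∨ a = y) → l.length = n →
      W l = W' l) : dynkinSum k W x y N n = dynkinSum k W' x y N n := by
  refine sum_congr rfl fun m _ => sum_congr rfl fun p hp => ?_
  rw [h _ (fun a => mem_blockWord) (by
    rw [length_blockWord]; exact (mem_filter.1 hp).2.2)]

theorem map_dynkinSum {V V' V'' : Type*} [AddCommGroup V'] [Module k V'] [AddCommGroup V'']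
    [Module k V''] (f : V' →ₗ[k] V'') (W : List V → V') (x y : V) (N n : ℕ) :
    f (dynkinSum k W x y N n) = dynkinSum k (fun l => f (W l)) x y N n := by
  simp [dynkinSum]

theorem smul_dynkinSum {V V' : Type*} [AddCommGroup V'] [Module k V']
    (c : k) (W : List V → V') (x y : V) (N n : ℕ) :
    c • (dynkinSum k W x y N n) = dynkinSum k (fun l => c • (W l)) x y N n :=
  map_dynkinSum (LinearMap.lsmul k V' c) W x y N n

theorem dynkinSum_zero {V V' : Type*} [AddCommGroup V'] [Module k V'] (x y : V) (N n : ℕ) :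
    dynkinSum k (fun _ => (0 : V')) x y N n = 0 := by
  simp [dynkinSum]

theorem dynkinSum_map {V U V' : Type*} [AddCommGroup V'] [Module k V'] (f : U → V)
    (W : List V → V') (x y : U) (N n : ℕ) :
    dynkinSum k W (f x) (f y) N n = dynkinSum k (fun l => W (l.map f)) x y N n := by
  simp [dynkinSum, map_blockWord]

theorem dynkinSum_eq_of_lt {V V' : Type*} [AddCommGroup V'] [Module k V'] (W : List V → V')
    (x y : V) {N n : ℕ} (h : n < N) :
    dynkinSum k W x y N n = dynkinSum k W x y (n + 1) n := by
  refine sum_congr rfl fun m _ => ?_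
  symm
  refine sum_bij (fun p _ i => (Fin.castLE h (p i).1, Fin.castLE h (p i).2)) ?_ ?_ ?_ ?_
  · intro p hp
    simpa [blockExponents] using hp
  · intro p _ q _ hpq
    funext i
    have := congrFun hpq i
    simp only [Prod.mk.injEq, Fin.castLE_inj] at this
    exact Prod.ext this.1 this.2
  · intro p hp
    obtain ⟨h1, h2⟩ := (mem_filter.1 hp).2
    have hle : ∀ i, ((p i).1 : ℕ) + (p i).2 ≤ n := fun i => by
      rw [← h2]
      exact single_le_sum (f := fun i => ((p i).1 : ℕ) + (p i).2) (fun _ _ => Nat.zero_le _)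
        (mem_univ i)
    refine ⟨fun i => (⟨(p i).1, by have := hle i; omega⟩, ⟨(p i).2, by have := hle i; omega⟩),
      ?_, ?_⟩
    · exact mem_filter.2 ⟨mem_univ _, h1, h2⟩
    · funext i
      simp
  · intro p hp
    simp [blockWord]

theorem bchTerm_eq_dynkinSum {V : Type*} [AddCommGroup V] [Module k V] (br : V → V → V)
    (x y : V) {N n : ℕ} (h : n < N) :
    bchTerm k br x y n = (n : k)⁻¹ • dynkinSum k (nestedBracket br) x y N n := by
  rw [dynkinSum_eq_of_lt _ _ _ h]
  simp only [bchTerm, dynkinSum, smul_sum, smul_smul, blockExponents, blockWord]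
  refine sum_congr rfl fun m _ => sum_congr rfl fun p _ => ?_
  congr 1
  rw [div_eq_mul_inv, div_eq_mul_inv, mul_inv, mul_inv]
  ring

theorem map_nestedBracket {V V' : Type*} [Zero V] [Zero V'] (f : V → V') (hf : f 0 = 0)
    (br : V → V → V) (br' : V' → V' → V') (h : ∀ a b, f (br a b) = br' (f a) (f b)) :
    ∀ l : List V, f (nestedBracket br l) = nestedBracket br' (l.map f)
  | [] => hf
  | [_] => rfl
  | x :: y :: l => by
    have := map_nestedBracket f hf br br' h (y :: l)
    simp only [nestedBracket, h, List.map_cons] at this ⊢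
    rw [this]

/-- Linear maps that respect brackets respect the terms of the Baker-Campbell-Hausdorff series. -/
theorem map_bchTerm {V V' : Type*} [AddCommGroup V] [Module k V] [AddCommGroup V'] [Module k V']
    (f : V →ₗ[k] V') (br : V → V → V) (br' : V' → V' → V')
    (h : ∀ a b, f (br a b) = br' (f a) (f b)) (x y : V) (n : ℕ) :
    f (bchTerm k br x y n) = bchTerm k br' (f x) (f y) n := by
  rw [bchTerm_eq_dynkinSum _ _ _ n.lt_succ_self, bchTerm_eq_dynkinSum _ _ _ n.lt_succ_self,
    map_smul, map_dynkinSum, dynkinSum_map]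
  simp only [map_nestedBracket f (map_zero f) br br' h]

theorem bchTerm_eq_zero_of_nested {V : Type*} [AddCommGroup V] [Module k V] {br : V → V → V}
    {x y : V} {n : ℕ} (h : ∀ l : List V, l.length = n → nestedBracket br l = 0) :
    bchTerm k br x y n = 0 := by
  rw [bchTerm_eq_dynkinSum _ _ _ n.lt_succ_self, dynkinSum_congr (W' := fun _ => 0)
    (fun l _ hl => h l hl), dynkinSum_zero, smul_zero]

/-- The term of degree `n` belongs to any subspace that contains the nested brackets of length
`n`. -/
theorem bchTerm_mem {V : Type*} [AddCommGroup V] [Module k V] {br : V → V → V}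
    {x y : V} {n : ℕ} (S : Submodule k V) (h : ∀ l : List V, (∀ a ∈ l, a = x ∨ a = y) →
      l.length = n → nestedBracket br l ∈ S) : bchTerm k br x y n ∈ S := by
  rw [bchTerm_eq_dynkinSum _ _ _ n.lt_succ_self]
  refine S.smul_mem _ (S.sum_mem fun m _ => S.sum_mem fun p hp => S.smul_mem _ ?_)
  exact h _ (fun a => mem_blockWord) (by
    rw [length_blockWord]; exact (mem_filter.1 hp).2.2)

variable {A : Type*} [Ring A] [Algebra k A]

theorem sum_pow_eq_sum_ofFn {ι : Type*} [Fintype ι] [DecidableEq ι] (s : Finset ι) (f : ι → A)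
    (m : ℕ) : (∑ i ∈ s, f i) ^ m =
      ∑ p : Fin m → ι with ∀ i, p i ∈ s, (List.ofFn fun i => f (p i)).prod := by
  have gen : ∀ g : ι → A, (∑ i, g i) ^ m = ∑ p : Fin m → ι, (List.ofFn fun i => g (p i)).prod := by
    intro g
    induction m with
    | zero => simp
    | succ m ih =>
      rw [pow_succ', ih, sum_mul_sum, ← sum_product',
        ← (Fin.consEquiv fun _ : Fin (m + 1) => ι).sum_comp]
      simp only [Fin.consEquiv_apply, List.ofFn_succ, Fin.cons_zero, Fin.cons_succ, List.prod_cons]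
      rfl
  have h1 : ∑ i ∈ s, f i = ∑ i, if i ∈ s then f i else 0 := by simp
  rw [h1, gen, sum_filter]
  refine sum_congr rfl fun p _ => ?_
  split_ifs with hp
  · congr 2
    funext i
    rw [if_pos (hp i)]
  · push Not at hp
    obtain ⟨i, hi⟩ := hp
    refine List.prod_eq_zero ?_
    rw [List.mem_ofFn]
    exact ⟨i, if_neg hi⟩

theorem prod_ofFn_smul {m : ℕ} (c : Fin m → k) (w : Fin m → A) :
    (List.ofFn fun i => c i • w i).prod = (∏ i, c i) • (List.ofFn w).prod := by
  induction m with
  | zero => simp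
  | succ m ih =>
    rw [List.ofFn_succ, List.prod_cons, ih, Fin.prod_univ_succ, List.ofFn_succ, List.prod_cons,
      smul_mul_smul_comm]

theorem prod_blockWord (x y : A) {m N : ℕ} (p : Fin m → Fin N × Fin N) :
    (blockWord x y p).prod = (List.ofFn fun i => x ^ ((p i).1 : ℕ) * y ^ ((p i).2 : ℕ)).prod := by
  simp [blockWord, List.prod_flatten, List.map_ofFn, Function.comp_def]

/-- All products of at least `N` factors equal to `x` or `y` vanish. -/
def NilWords (N : ℕ) (x y : A) : Prop :=
  ∀ l : List A, (∀ a ∈ l, a = x ∨ a = y) → N ≤ l.length → l.prod = 0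

theorem NilWords.mono {N M : ℕ} {x y : A} (h : NilWords N x y) (hM : N ≤ M) : NilWords M x y :=
  fun l hl hlen => h l hl (hM.trans hlen)

theorem NilWords.pow_left {N : ℕ} {x y : A} (h : NilWords N x y) : x ^ N = 0 := by
  simpa using h (List.replicate N x) (fun a ha => Or.inl (List.eq_of_mem_replicate ha)) (by simp)

theorem NilWords.pow_right {N : ℕ} {x y : A} (h : NilWords N x y) : y ^ N = 0 := by
  simpa using h (List.replicate N y) (fun a ha => Or.inr (List.eq_of_mem_replicate ha)) (by simp)

variable [CharZero k]

theorem exp_mul_exp_sub_one_pow {N : ℕ} {x y : A} (h : NilWords N x y) (m : ℕ) :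
    (nilExp k x * nilExp k y - 1) ^ m =
      ∑ p : Fin m → Fin N × Fin N with ∀ i, 0 < ((p i).1 : ℕ) + (p i).2,
        ((∏ i, (Nat.factorial (p i).1 * Nat.factorial (p i).2 : k))⁻¹ : k) •
          (blockWord x y p).prod := by
  rcases Nat.eq_zero_or_pos N with rfl | hN
  · have : Subsingleton A := subsingleton_of_zero_eq_one (by simpa using (h [] (by simp) (by simp)).symm)
    exact Subsingleton.elim _ _
  have h1 : nilExp k x * nilExp k y - 1 =
      ∑ q : Fin N × Fin N with 0 < (q.1 : ℕ) + q.2,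
        ((Nat.factorial q.1 * Nat.factorial q.2 : k)⁻¹) • (x ^ (q.1 : ℕ) * y ^ (q.2 : ℕ)) := by
    rw [nilExp_eq_sum h.pow_left, nilExp_eq_sum h.pow_right, sum_range, sum_range, sum_mul_sum,
      ← sum_product', sub_eq_iff_eq_add, ← sum_filter_add_sum_filter_not _
        (fun q : Fin N × Fin N => 0 < (q.1 : ℕ) + q.2)]
    congr 1
    · refine sum_congr rfl fun q _ => ?_
      rw [smul_mul_smul_comm, mul_inv]
    · rw [sum_eq_single (⟨0, hN⟩, ⟨0, hN⟩)]
      · simp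
      · rintro ⟨a, b⟩ hb hne
        simp only [mem_filter, not_lt, Nat.le_zero, Nat.add_eq_zero_iff] at hb
        exact absurd (Prod.ext (Fin.ext hb.2.1) (Fin.ext hb.2.2)) hne
      · simp
  rw [h1, sum_pow_eq_sum_ofFn]
  refine sum_congr (by simp) fun p _ => ?_
  rw [prod_ofFn_smul, prod_blockWord, prod_inv_distrib]

theorem exp_mul_exp_sub_one_nilpotent {N : ℕ} {x y : A} (h : NilWords N x y) :
    (nilExp k x * nilExp k y - 1) ^ N = 0 := by
  rw [exp_mul_exp_sub_one_pow h]
  refine sum_eq_zero fun p hp => ?_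
  rw [h _ (fun a => mem_blockWord), smul_zero]
  rw [length_blockWord]
  calc N = ∑ _i : Fin N, 1 := by simp
    _ ≤ _ := sum_le_sum fun i _ => (mem_filter.1 hp).2 i

theorem log_exp_mul_exp {N : ℕ} {x y : A} (h : NilWords N x y) :
    nilLog k (nilExp k x * nilExp k y - 1) = ∑ n ∈ Ico 1 N, dynkinSum k List.prod x y N n := by
  rw [nilLog_eq_sum (exp_mul_exp_sub_one_nilpotent h)]
  have hpos : ∀ {m n : ℕ} {p : Fin m → Fin N × Fin N}, p ∈ blockExponents m N n → m ≤ n := by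
    intro m n p hp
    obtain ⟨h1, h2⟩ := (mem_filter.1 hp).2
    calc m = ∑ _i : Fin m, 1 := by simp
      _ ≤ _ := sum_le_sum fun i _ => h1 i
      _ = n := h2
  have h1 : ∀ n ∈ Ico 1 N, dynkinSum k List.prod x y N n =
      ∑ m ∈ Ico 1 N, ∑ p ∈ blockExponents m N n,
        ((-1) ^ (m - 1) / m * (∏ i, (Nat.factorial (p i).1 * Nat.factorial (p i).2 : k))⁻¹ : k) •
          (blockWord x y p).prod := by
    intro n hn
    refine sum_subset ?_ ?_
    · intro m hm
      simp only [mem_Icc, mem_Ico] at *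
      omega
    · intro m hm hm'
      refine sum_eq_zero fun p hp => ?_
      have := hpos hp
      simp only [mem_Icc, mem_Ico] at *
      omega
  rw [sum_congr rfl h1, sum_comm]
  refine sum_congr rfl fun m hm => ?_
  rw [exp_mul_exp_sub_one_pow h, smul_sum]
  simp only [smul_smul]
  set T : (Fin m → Fin N × Fin N) → A := fun p =>
    ((-1) ^ (m - 1) / m * (∏ i, (Nat.factorial (p i).1 * Nat.factorial (p i).2 : k))⁻¹ : k) •
          (blockWord x y p).prod with hT
  change ∑ p with _, T p = ∑ n ∈ Ico 1 N, ∑ p ∈ blockExponents m N n, T p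
  rw [← sum_filter_add_sum_filter_not _
    (fun p : Fin m → Fin N × Fin N => ∑ i, (((p i).1 : ℕ) + (p i).2) < N),
    sum_eq_zero (s := filter (fun p => ¬ _) _), add_zero]
  · rw [← sum_fiberwise_of_maps_to (t := Ico 1 N)
      (g := fun p : Fin m → Fin N × Fin N => ∑ i, (((p i).1 : ℕ) + (p i).2))]
    · refine sum_congr rfl fun n hn => sum_congr ?_ fun _ _ => rfl
      ext p
      simp only [blockExponents, mem_filter, mem_univ, true_and, mem_Ico] at *
      constructor
      · rintro ⟨⟨h1, -⟩, h3⟩; exact ⟨h1, h3⟩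
      · rintro ⟨h1, h3⟩; exact ⟨⟨h1, by omega⟩, h3⟩
    · intro p hp
      simp only [mem_filter, mem_univ, true_and, mem_Ico] at *
      refine ⟨?_, hp.2⟩
      refine hm.1.trans (hpos (n := ∑ i, (((p i).1 : ℕ) + (p i).2)) (p := p) ?_)
      exact mem_filter.2 ⟨mem_univ _, hp.1, rfl⟩
  · intro p hp
    simp only [mem_filter, not_lt] at hp
    simp only [hT]
    rw [h _ (fun a => mem_blockWord) (by rw [length_blockWord]; exact hp.2), smul_zero]

end BCH

/-! ### The Baker-Campbell-Hausdorff formula in nilpotent associative algebras -/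

section BCHTheorem

open Finset

variable {k : Type*} [Field k] [CharZero k] {A : Type*} [Ring A] [Algebra k A]

/-- The endomorphism `b ↦ a b - b a`. -/
def commutatorEnd (k : Type*) [Field k] {A : Type*} [Ring A] [Algebra k A] (a : A) :
    Module.End k A :=
  LinearMap.mulLeft k a - LinearMap.mulRight k a

theorem commutatorEnd_apply (a b : A) : commutatorEnd k a b = a * b - b * a := rfl

theorem nilExp_mulLeft {a : A} (ha : IsNilpotent a) :
    nilExp k (LinearMap.mulLeft k a) = LinearMap.mulLeft k (nilExp k a) :=
  (map_nilExp (Algebra.lmul k A) ha).symm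

theorem nilExp_mulRight {a : A} (ha : IsNilpotent a) :
    nilExp k (LinearMap.mulRight k a) = LinearMap.mulRight k (nilExp k a) := by
  obtain ⟨N, h⟩ := ha
  rw [nilExp_eq_sum h, nilExp_eq_sum (N := N) (by rw [LinearMap.pow_mulRight, h]; simp)]
  ext b
  simp [LinearMap.pow_mulRight, mul_sum]

theorem isNilpotent_mulLeft {a : A} (ha : IsNilpotent a) : IsNilpotent (LinearMap.mulLeft k a) := by
  obtain ⟨N, h⟩ := ha
  exact ⟨N, by rw [LinearMap.pow_mulLeft, h]; simp⟩

theorem isNilpotent_mulRight {a : A} (ha : IsNilpotent a) :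
    IsNilpotent (LinearMap.mulRight k a) := by
  obtain ⟨N, h⟩ := ha
  exact ⟨N, by rw [LinearMap.pow_mulRight, h]; simp⟩

theorem commutatorEnd_eq (a : A) :
    commutatorEnd k a = LinearMap.mulLeft k a + LinearMap.mulRight k (-a) := by
  ext b; simp [commutatorEnd, sub_eq_add_neg]

theorem isNilpotent_commutatorEnd {a : A} (ha : IsNilpotent a) :
    IsNilpotent (commutatorEnd k a) := by
  rw [commutatorEnd_eq]
  exact (LinearMap.commute_mulLeft_right (R := k) a (-a)).isNilpotent_add (isNilpotent_mulLeft ha)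
    (isNilpotent_mulRight ha.neg)

theorem nilExp_commutatorEnd {a : A} (ha : IsNilpotent a) (b : A) :
    nilExp k (commutatorEnd k a) b = nilExp k a * b * nilExp k (-a) := by
  rw [commutatorEnd_eq, nilExp_add (LinearMap.commute_mulLeft_right (R := k) a (-a))
    (isNilpotent_mulLeft ha) (isNilpotent_mulRight ha.neg), nilExp_mulLeft ha,
    nilExp_mulRight ha.neg]
  simp [mul_assoc]

theorem NilWords.commutatorEnd {N : ℕ} {x y : A} (h : NilWords N x y) :
    NilWords (2 * N) (commutatorEnd k x) (commutatorEnd k y) := by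
  have key : ∀ l : List (Module.End k A),
      (∀ a ∈ l, a = _root_.commutatorEnd k x ∨ a = _root_.commutatorEnd k y) → ∀ b : A,
      l.prod b ∈ Submodule.span k {c | ∃ u v : List A, (∀ a ∈ u, a = x ∨ a = y) ∧
        (∀ a ∈ v, a = x ∨ a = y) ∧ u.length + v.length = l.length ∧ c = u.prod * b * v.prod} := by
    intro l
    induction l with
    | nil =>
      intro _ b
      exact Submodule.subset_span ⟨[], [], by simp, by simp, by simp, by simp⟩
    | cons a l ih =>
      intro hl b
      obtain ⟨z, hz, rfl⟩ : ∃ z, (z = x ∨ z = y) ∧ a = _root_.commutatorEnd k z := by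
        rcases hl a (by simp) with h | h
        · exact ⟨x, Or.inl rfl, h⟩
        · exact ⟨y, Or.inr rfl, h⟩
      rw [List.prod_cons, Module.End.mul_apply]
      have hb := ih (fun a ha => hl a (by simp [ha])) b
      refine Submodule.span_induction (p := fun c _ => _root_.commutatorEnd k z c ∈ _) ?_ ?_ ?_ ?_ hb
      · rintro c ⟨u, v, hu, hv, hlen, rfl⟩
        refine Submodule.sub_mem _ (Submodule.subset_span ⟨z :: u, v, ?_, hv, ?_, ?_⟩)
          (Submodule.subset_span ⟨u, v ++ [z], hu, ?_, ?_, ?_⟩)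
        · simpa using ⟨hz, hu⟩
        · simp; omega
        · simp [mul_assoc]
        · intro a ha
          rcases List.mem_append.1 ha with ha | ha
          · exact hv a ha
          · rw [List.mem_singleton.1 ha]; exact hz
        · simp; omega
        · simp [mul_assoc]
      · simp
      · intro c d _ _ hc hd
        rw [map_add]; exact Submodule.add_mem _ hc hd
      · intro c d _ hd
        rw [map_smul]; exact Submodule.smul_mem _ _ hd
  intro l hl hlen
  ext b
  refine (Submodule.mem_bot k).1 (Submodule.span_le.2 ?_ (key l hl b))
  rintro c ⟨u, v, hu, hv, hl, rfl⟩
  rcases le_or_gt N u.length with h1 | h1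
  · simp [h u hu h1]
  · simp [h v hv (by omega)]

theorem eq_zero_of_sum_eigenvectors {V : Type*} [AddCommGroup V] [Module k V]
    (f : V →ₗ[k] V) (s : Finset ℕ) (q : ℕ → V) (hq : ∀ n ∈ s, f (q n) = (n : k) • q n)
    (h : ∑ n ∈ s, q n = 0) : ∀ n ∈ s, q n = 0 := by
  induction s using Finset.induction_on generalizing q with
  | empty => simp
  | insert a s ha ih =>
    have hs : ∀ n ∈ s, q n = 0 := by
      intro n hn
      have h1 := ih (fun n => ((n : k) - a) • q n) (by
        intro n hn
        rw [map_smul, hq n (mem_insert_of_mem hn), smul_comm]) (by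
        have h2 := congrArg f h
        rw [map_sum, map_zero, sum_congr rfl hq, sum_insert ha] at h2
        rw [sum_insert ha] at h
        simp only [sub_smul, sum_sub_distrib, ← smul_sum]
        rw [eq_neg_of_add_eq_zero_right h2, eq_neg_of_add_eq_zero_right h]
        simp) n hn
      refine (smul_eq_zero.1 h1).resolve_left ?_
      intro h0
      rw [sub_eq_zero, Nat.cast_inj] at h0
      exact ha (h0 ▸ hn)
    intro n hn
    rcases mem_insert.1 hn with rfl | hn
    · rw [sum_insert ha, sum_eq_zero hs, add_zero] at h
      exact h
    · exact hs n hn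

/-- The Baker-Campbell-Hausdorff-Dynkin formula when the degree of words in `x` and `y` is measured
by the commutator with an element `e`. Both `log (exp (ad x) exp (ad y))` and
`ad (log (exp x exp y))` are the same derivation; its value at `e` is a sum of nested brackets. -/
theorem exp_mul_exp_of_grading {N : ℕ} {x y e : A} (h : NilWords N x y)
    (hx : x * e - e * x = x) (hy : y * e - e * y = y) :
    nilLog k (nilExp k x * nilExp k y - 1) =
      ∑ n ∈ Ico 1 N, bchTerm k (fun a b => a * b - b * a) x y n := by
  set M := 2 * N with hM
  have hNM : N ≤ M := by omega
  have hnx : IsNilpotent x := ⟨N, h.pow_left⟩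
  have hny : IsNilpotent y := ⟨N, h.pow_right⟩
  set br : A → A → A := fun a b => a * b - b * a with hbr
  set g := nilExp k x * nilExp k y with hg
  set Z := nilLog k (g - 1) with hZ
  have hν : IsNilpotent (g - 1) := ⟨N, exp_mul_exp_sub_one_nilpotent h⟩
  have hZn : IsNilpotent Z := isNilpotent_nilLog hν
  have hexpZ : nilExp k Z = g := by rw [hZ, nilExp_nilLog hν]; abel
  have hexpZ' : nilExp k (-Z) = nilExp k (-y) * nilExp k (-x) := by
    refine (left_inv_eq_right_inv (a := g) ?_ ?_).symm
    · have h1 : nilExp k (-x) * nilExp k x = 1 := by simpa using nilExp_mul_neg (k := k) hnx.neg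
      have h2 : nilExp k (-y) * nilExp k y = 1 := by simpa using nilExp_mul_neg (k := k) hny.neg
      rw [hg, mul_assoc, ← mul_assoc (nilExp k (-x)), h1, one_mul, h2]
    · rw [← hexpZ, nilExp_mul_neg hZn]
  have hT : nilExp k (commutatorEnd k x) * nilExp k (commutatorEnd k y) =
      nilExp k (commutatorEnd k Z) := by
    ext b
    rw [Module.End.mul_apply, nilExp_commutatorEnd hny, nilExp_commutatorEnd hnx,
      nilExp_commutatorEnd hZn, hexpZ, hexpZ', hg]
    simp only [mul_assoc]
  have hlog : commutatorEnd k Z =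
      ∑ n ∈ Ico 1 M, dynkinSum k List.prod (commutatorEnd k x) (commutatorEnd k y) M n := by
    rw [← log_exp_mul_exp h.commutatorEnd, hT, nilLog_nilExp (isNilpotent_commutatorEnd hZn)]
  have hZsum : Z = ∑ n ∈ Ico 1 M, dynkinSum k List.prod x y M n := log_exp_mul_exp (h.mono hNM)
  -- Since `[a, e] = a` for the last letter `a`, a word in the commutator endomorphisms maps `e` to
  -- the nested bracket of the same letters.
  have hword : ∀ l : List A, (∀ a ∈ l, a = x ∨ a = y) → l ≠ [] →
      (l.map (commutatorEnd k)).prod e = nestedBracket br l := by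
    intro l
    induction l with
    | nil => simp
    | cons a l ih =>
      intro hl _
      have ha : a * e - e * a = a := by
        rcases hl a (by simp) with rfl | rfl
        · exact hx
        · exact hy
      cases l with
      | nil => simpa [nestedBracket, commutatorEnd_apply] using ha
      | cons b l =>
        have h1 := ih (fun a ha => hl a (by simp at ha ⊢; tauto)) (by simp)
        rw [List.map_cons, List.prod_cons, Module.End.mul_apply, h1]
        rfl
  -- The derivation `f = [-, e]` multiplies words and nested brackets by their length.
  set f : A →ₗ[k] A := -commutatorEnd k e with hf
  have hfa : ∀ a, f a = a * e - e * a := fun a => by simp [hf, commutatorEnd_apply]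
  have hfmul : ∀ a b, f (a * b) = f a * b + a * f b := fun a b => by
    simp only [hfa]; noncomm_ring
  have hfprod : ∀ l : List A, (∀ a ∈ l, a = x ∨ a = y) →
      f l.prod = (l.length : k) • l.prod := by
    intro l
    induction l with
    | nil => simp [hfa]
    | cons a l ih =>
      intro hl
      have ha : f a = a := by
        rw [hfa]
        rcases hl a (by simp) with rfl | rfl
        · exact hx
        · exact hy
      rw [List.prod_cons, hfmul, ih (fun a ha => hl a (by simp [ha])), ha]
      simp [add_smul, add_comm]
  have hfnested : ∀ l : List A, (∀ a ∈ l, a = x ∨ a = y) →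
      f (nestedBracket br l) = (l.length : k) • nestedBracket br l := by
    intro l
    induction l with
    | nil => simp [nestedBracket]
    | cons a l ih =>
      intro hl
      have ha : f a = a := by
        rw [hfa]
        rcases hl a (by simp) with rfl | rfl
        · exact hx
        · exact hy
      cases l with
      | nil => simpa [nestedBracket] using ha
      | cons b l =>
        have h1 := ih (fun a ha => hl a (by simp at ha ⊢; tauto))
        simp only [nestedBracket, hbr] at h1 ⊢
        rw [map_sub, hfmul, hfmul, h1, ha]
        simp only [List.length_cons, Nat.cast_add, Nat.cast_one, add_smul, one_smul, mul_add,
          add_mul, mul_smul_comm, smul_mul_assoc]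
        module
  -- The equality `[Z, e] = ∑ n • bchTerm n` is split into its components in degree `n`, which are
  -- eigenvectors of `f` with distinct eigenvalues.
  set Q : ℕ → A := fun n => (n : k) •
    (dynkinSum k List.prod x y M n - bchTerm k br x y n) with hQ
  have hZe : f Z = ∑ n ∈ Ico 1 M, (n : k) • bchTerm k br x y n := by
    have h1 := LinearMap.congr_fun hlog e
    have h2 : commutatorEnd k Z e = f Z := by rw [hfa]; rfl
    rw [← h2, h1, LinearMap.sum_apply]
    refine sum_congr rfl fun n hn => ?_
    obtain ⟨hn1, hn2⟩ := mem_Ico.1 hn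
    rw [bchTerm_eq_dynkinSum br x y hn2, smul_smul, mul_inv_cancel₀ (by
      rw [Nat.cast_ne_zero]; omega), one_smul, dynkinSum_map]
    let eval_e : Module.End k A →ₗ[k] A := LinearMap.applyₗ e
    have h3 := map_dynkinSum (k := k) eval_e (fun l : List A => (l.map (commutatorEnd k)).prod)
      x y M n
    have h4 : dynkinSum k (fun l : List A => eval_e ((l.map (commutatorEnd k)).prod)) x y M n =
        dynkinSum k (nestedBracket br) x y M n :=
      dynkinSum_congr (k := k) fun l hl hlen => hword l hl (by rintro rfl; simp at hlen; omega)
    exact h3.trans h4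
  have hfZ : ∀ n, f (dynkinSum k List.prod x y M n) = (n : k) • dynkinSum k List.prod x y M n := by
    intro n
    rw [map_dynkinSum, smul_dynkinSum]
    refine dynkinSum_congr fun l hl hlen => ?_
    rw [hfprod l hl, hlen]
  have hfb : ∀ n, f (bchTerm k br x y n) = (n : k) • bchTerm k br x y n := by
    intro n
    have h4 : dynkinSum k (fun l : List A => f (nestedBracket br l)) x y (n + 1) n =
        dynkinSum k (fun l : List A => (n : k) • nestedBracket br l) x y (n + 1) n :=
      dynkinSum_congr (k := k) fun l hl hlen => by rw [hfnested l hl, hlen]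
    rw [bchTerm_eq_dynkinSum br x y n.lt_succ_self, map_smul, map_dynkinSum, h4,
      ← smul_dynkinSum, smul_comm]
  have hQ0 : ∀ n ∈ Ico 1 M, Q n = 0 := by
    refine eq_zero_of_sum_eigenvectors f _ Q (fun n _ => ?_) ?_
    · simp only [hQ]
      rw [map_smul, map_sub, hfZ, hfb, ← smul_sub]
    · simp only [hQ, smul_sub, sum_sub_distrib]
      rw [← hZe, hZsum, map_sum, sum_congr rfl fun n _ => hfZ n, sub_self]
  have hterm : ∀ n ∈ Ico 1 M, dynkinSum k List.prod x y M n = bchTerm k br x y n := by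
    intro n hn
    have h1 := (smul_eq_zero.1 (hQ0 n hn)).resolve_left (by
      have := (mem_Ico.1 hn).1
      exact Nat.cast_ne_zero.2 (by omega))
    exact sub_eq_zero.1 h1
  rw [hZsum, sum_congr rfl hterm]
  symm
  refine sum_subset (Ico_subset_Ico le_rfl hNM) fun n hn hn' => ?_
  rw [← hterm n hn, dynkinSum_congr (W' := fun _ => 0) (fun l hl hlen => h l hl ?_), dynkinSum_zero]
  simp only [mem_Ico] at hn hn'
  omega

/-- The monomial `a X`. -/
def mulX (a : A) : Polynomial A := Polynomial.C a * Polynomial.X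

theorem prod_map_mulX (l : List A) :
    (l.map mulX).prod = Polynomial.C l.prod * Polynomial.X ^ l.length := by
  induction l with
  | nil => simp
  | cons a l ih =>
    rw [List.map_cons, List.prod_cons, ih, List.prod_cons, Polynomial.C_mul, List.length_cons,
      pow_succ', mulX, mul_assoc, ← mul_assoc Polynomial.X, Polynomial.X_mul_C]
    simp only [mul_assoc]

theorem NilWords.map {B : Type*} [Ring B] {N : ℕ} {x y : A} (f : A → B)
    (hf : ∀ l : List A, (∀ a ∈ l, a = x ∨ a = y) → N ≤ l.length → (l.map f).prod = 0) :
    NilWords N (f x) (f y) := by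
  intro l hl hlen
  have hl' : ∃ l' : List A, (∀ a ∈ l', a = x ∨ a = y) ∧ l = l'.map f := by
    clear hlen
    induction l with
    | nil => exact ⟨[], by simp, rfl⟩
    | cons a l ih =>
      obtain ⟨l', h1, rfl⟩ := ih (fun a ha => hl a (by simp [ha]))
      rcases hl a (by simp) with rfl | rfl
      · exact ⟨x :: l', by simpa using h1, rfl⟩
      · exact ⟨y :: l', by simpa using h1, rfl⟩
  obtain ⟨l', h1, rfl⟩ := hl'
  exact hf l' h1 (by simpa using hlen)

theorem map_sum_bchTerm {B : Type*} [Ring B] [Algebra k B] (φ : A →ₐ[k] B) (x y : A)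
    (s : Finset ℕ) : φ (∑ n ∈ s, bchTerm k (fun a b => a * b - b * a) x y n) =
      ∑ n ∈ s, bchTerm k (fun a b => a * b - b * a) (φ x) (φ y) n := by
  rw [map_sum]
  exact sum_congr rfl fun n _ => map_bchTerm φ.toLinearMap _ _ (fun a b => by simp) x y n

/-- The Baker-Campbell-Hausdorff-Dynkin formula for elements of an associative algebra that
generate a nilpotent algebra. -/
theorem log_exp_mul_exp_eq_sum_bchTerm {N : ℕ} {x y : A} (h : NilWords N x y) :
    nilLog k (nilExp k x * nilExp k y - 1) =
      ∑ n ∈ Ico 1 N, bchTerm k (fun a b => a * b - b * a) x y n := by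
  rcases Nat.eq_zero_or_pos N with rfl | hN
  · have : Subsingleton A := subsingleton_of_zero_eq_one (by simpa using (h [] (by simp) (by simp)).symm)
    exact Subsingleton.elim _ _
  -- `x` and `y` are lifted to `x X`, `y X` in `A[X]`, on which `A[X]` and `-X d/dX` act.
  let lam : Polynomial A →ₐ[k] Module.End k (Polynomial A) := Algebra.lmul k (Polynomial A)
  have hlam : Function.Injective lam := fun p q hpq => by
    simpa [lam] using LinearMap.congr_fun hpq 1
  let ev : Polynomial A →ₐ[k] A :=
    { Polynomial.eval₂RingHom' (RingHom.id A) 1 (fun a => Commute.one_right a) with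
      commutes' := fun c => by
        change Polynomial.eval₂ _ _ (algebraMap k (Polynomial A) c) = _
        rw [Polynomial.algebraMap_apply, Polynomial.eval₂_C]
        rfl }
  have hev : ∀ a, ev (mulX a) = a := fun a => by
    change Polynomial.eval₂ _ _ (Polynomial.C a * Polynomial.X) = _
    rw [Polynomial.eval₂_mul_X, Polynomial.eval₂_C, mul_one, RingHom.id_apply]
  have hnil : NilWords N (mulX x) (mulX y) := NilWords.map mulX fun l hl hlen => by
    rw [prod_map_mulX, h l hl hlen, Polynomial.C_0, zero_mul]
  have hnil2 : NilWords N (lam (mulX x)) (lam (mulX y)) := NilWords.map lam fun l hl hlen => by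
    rw [← map_list_prod, hnil l hl hlen, map_zero]
  let der : Module.End k (Polynomial A) := (Polynomial.derivative (R := A)).restrictScalars k
  let e : Module.End k (Polynomial A) := -(LinearMap.mulLeft k Polynomial.X * der)
  have he : ∀ a, lam (mulX a) * e - e * lam (mulX a) = lam (mulX a) := by
    intro a
    apply LinearMap.ext
    intro p
    change Polynomial.C a * Polynomial.X * -(Polynomial.X * Polynomial.derivative p) -
      -(Polynomial.X * Polynomial.derivative (Polynomial.C a * Polynomial.X * p)) =
        Polynomial.C a * Polynomial.X * p
    have hc : ∀ q : Polynomial A, Polynomial.X * (Polynomial.C a * q) =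
        Polynomial.C a * (Polynomial.X * q) := fun q => by
      rw [← mul_assoc, Polynomial.X_mul_C, mul_assoc]
    simp only [Polynomial.derivative_mul, Polynomial.derivative_C, Polynomial.derivative_X,
      zero_mul, zero_add, one_mul, mul_add, mul_neg, mul_assoc, hc]
    abel
  have h1 := exp_mul_exp_of_grading (k := k) hnil2 (he x) (he y)
  have hν : IsNilpotent (nilExp k (mulX x) * nilExp k (mulX y) - 1) :=
    ⟨N, exp_mul_exp_sub_one_nilpotent hnil⟩
  rw [← map_sum_bchTerm, ← map_nilExp lam ⟨N, hnil.pow_left⟩, ← map_nilExp lam ⟨N, hnil.pow_right⟩,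
    ← map_mul, ← map_one lam, ← map_sub, ← map_nilLog lam hν] at h1
  have h2 := congrArg ev (hlam h1)
  rw [map_nilLog ev hν, map_sub, map_one, map_mul, map_nilExp ev ⟨N, hnil.pow_left⟩,
    map_nilExp ev ⟨N, hnil.pow_right⟩, map_sum_bchTerm, hev, hev] at h2
  exact h2

/-- The Baker-Campbell-Hausdorff formula for two elements of an associative algebra all of whose
long products vanish. The reduction to `exp_mul_exp_of_grading` replaces `x` and `y` by the
monomials `x X` and `y X`, whose degree is measured by the derivation `X d/dX`. -/
theorem exp_mul_exp {N : ℕ} {x y : A} (h : NilWords N x y) :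
    nilExp k x * nilExp k y =
      nilExp k (∑ n ∈ Ico 1 N, bchTerm k (fun a b => a * b - b * a) x y n) := by
  rw [← log_exp_mul_exp_eq_sum_bchTerm h, nilExp_nilLog ⟨N, exp_mul_exp_sub_one_nilpotent h⟩]
  abel

end BCHTheorem

/-! ### The group of a nilpotent Lie algebra -/

section NilpotentLieGroup

open Finset

theorem nestedBracket_mem_lowerCentralSeries (R : Type*) {L : Type*} [CommRing R] [LieRing L]
    [LieAlgebra R L] : ∀ (n : ℕ) (l : List L), l.length = n + 1 →
      nestedBracket (fun a b => ⁅a, b⁆) l ∈ LieModule.lowerCentralSeries R L L n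
  | 0, l, _ => by simp
  | n + 1, [], h => by simp at h
  | n + 1, [_], h => by simp at h
  | n + 1, x :: y :: l, h => by
    rw [LieModule.lowerCentralSeries_succ]
    exact LieSubmodule.lie_mem_lie (LieSubmodule.mem_top x)
      (nestedBracket_mem_lowerCentralSeries R n (y :: l) (by simpa using h))

theorem exists_nestedBracket_eq_zero (L : Type*) [LieRing L] [LieRing.IsNilpotent L] :
    ∃ c, ∀ l : List L, c ≤ l.length → nestedBracket (fun a b => ⁅a, b⁆) l = 0 := by
  obtain ⟨c, hc⟩ := LieModule.IsNilpotent.nilpotent ℤ L L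
  refine ⟨c + 1, fun l hl => ?_⟩
  have h1 := nestedBracket_mem_lowerCentralSeries ℤ (l.length - 1) l (by omega)
  have h2 := LieModule.antitone_lowerCentralSeries ℤ L L (show c ≤ l.length - 1 by omega) h1
  rw [hc] at h2
  simpa using h2

variable (k : Type*) [Field k] {L : Type*} [LieRing L] [LieAlgebra k L]

/-- The Baker-Campbell-Hausdorff product of two elements of a nilpotent Lie algebra (whenever the
series has infinitely many nonzero terms, the sum takes the junk value `0`). -/
def lieBch (x y : L) : L := ∑ᶠ n, bchTerm k (fun a b : L => ⁅a, b⁆) x y n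

variable {k}

theorem bchTerm_zero {V : Type*} [AddCommGroup V] [Module k V] (br : V → V → V) (x y : V) :
    bchTerm k br x y 0 = 0 := by simp [bchTerm]

theorem lieBch_eq_sum {c : ℕ}
    (hc : ∀ l : List L, c ≤ l.length → nestedBracket (fun a b => ⁅a, b⁆) l = 0) (x y : L) :
    lieBch k x y = ∑ n ∈ Ico 1 c, bchTerm k (fun a b : L => ⁅a, b⁆) x y n := by
  refine finsum_eq_sum_of_support_subset _ fun n hn => ?_
  simp only [coe_Ico, Set.mem_Ico]
  by_contra h
  refine hn ?_
  rcases Nat.eq_zero_or_pos n with rfl | h0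
  · exact bchTerm_zero _ _ _
  · exact bchTerm_eq_zero_of_nested fun l hl => hc l (by omega)

theorem map_lieBch [LieRing.IsNilpotent L] {L' : Type*} [LieRing L'] [LieAlgebra k L']
    (f : L →ₗ⁅k⁆ L') (x y : L) : f (lieBch k x y) = lieBch k (f x) (f y) := by
  obtain ⟨c, hc⟩ := exists_nestedBracket_eq_zero L
  have hfin : (Function.support fun n => bchTerm k (fun a b : L => ⁅a, b⁆) x y n).Finite := by
    refine (finite_toSet (range c)).subset fun n hn => ?_
    simp only [coe_range, Set.mem_Iio]
    by_contra h
    exact hn (bchTerm_eq_zero_of_nested fun l hl => hc l (by omega))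
  rw [lieBch, lieBch]
  have := (f : L →ₗ[k] L').toAddMonoidHom.map_finsum hfin
  refine this.trans (finsum_congr fun n => ?_)
  exact map_bchTerm (f : L →ₗ[k] L') _ _ (fun a b => LieHom.map_lie f a b) x y n

theorem nilExp_lieBch [CharZero k] [LieRing.IsNilpotent L] {A : Type*} [Ring A] [Algebra k A]
    (ρ : L →ₗ[k] A) (hρ : ∀ x y, ρ ⁅x, y⁆ = ρ x * ρ y - ρ y * ρ x) {x y : L} {N : ℕ}
    (h : NilWords N (ρ x) (ρ y)) :
    nilExp k (ρ x) * nilExp k (ρ y) = nilExp k (ρ (lieBch k x y)) := by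
  obtain ⟨c, hc⟩ := exists_nestedBracket_eq_zero L
  rw [exp_mul_exp (h.mono (le_max_left N c)), lieBch_eq_sum (c := max N c)
    (fun l hl => hc l ((le_max_right _ _).trans hl)), map_sum]
  simp only [map_bchTerm ρ (fun a b : L => ⁅a, b⁆) (fun a b => a * b - b * a) hρ]


section Polynomial

open Polynomial

variable (k L) in
/-- The Lie algebra `k[X] ⊗ L` of polynomials with coefficients in `L`. -/
def PolyLie : Type _ := k[X] ⊗[k] L

namespace PolyLie

instance : LieRing (PolyLie k L) := inferInstanceAs (LieRing (k[X] ⊗[k] L))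
instance : LieAlgebra k (PolyLie k L) := inferInstanceAs (LieAlgebra k (k[X] ⊗[k] L))
instance [LieRing.IsNilpotent L] : LieRing.IsNilpotent (PolyLie k L) :=
  LieModule.instIsNilpotentTensor k k[X] L L

/-- The polynomial `p x`, for a scalar polynomial `p` and `x ∈ L`. -/
def mk (p : k[X]) (x : L) : PolyLie k L := p ⊗ₜ[k] x

theorem lie_mk (p q : k[X]) (x y : L) : ⁅mk p x, mk q y⁆ = mk (p * q) ⁅x, y⁆ := rfl

theorem induction {P : PolyLie k L → Prop} (hmk : ∀ p x, P (mk p x))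
    (hadd : ∀ u v, P u → P v → P (u + v)) (u : PolyLie k L) : P u := by
  refine TensorProduct.induction_on (motive := P) u ?_ hmk hadd
  have h := hmk 0 0
  rwa [show mk (0 : k[X]) (0 : L) = 0 from TensorProduct.zero_tmul _ _] at h

/-- The endomorphism of `k[X] ⊗ L` defined by a linear endomorphism of `k[X]`. -/
def map (f : k[X] →ₗ[k] k[X]) : PolyLie k L →ₗ[k] PolyLie k L := LinearMap.rTensor L f

theorem map_mk (f : k[X] →ₗ[k] k[X]) (p : k[X]) (x : L) : map f (mk p x) = mk (f p) x := rfl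

variable (L) in
/-- Evaluation of polynomials at `a`. -/
def eval (a : k) : PolyLie k L →ₗ⁅k⁆ L :=
  { (TensorProduct.lid k L ∘ₗ LinearMap.rTensor L (aeval a : k[X] →ₐ[k] k).toLinearMap :
      k[X] ⊗[k] L →ₗ[k] L) with
    map_lie' := by
      intro u v
      let f : PolyLie k L →ₗ[k] L :=
        TensorProduct.lid k L ∘ₗ LinearMap.rTensor L (aeval a : k[X] →ₐ[k] k).toLinearMap
      have hf : ∀ p x, f (mk p x) = p.eval a • x := fun p x => by
        change TensorProduct.lid k L (LinearMap.rTensor L _ (p ⊗ₜ x)) = _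
        simp
      change f ⁅u, v⁆ = ⁅f u, f v⁆
      induction u using induction with
      | hadd u u' hu hu' => simp only [add_lie, map_add, hu, hu']
      | hmk p x =>
        induction v using induction with
        | hadd v v' hv hv' => simp only [lie_add, map_add, hv, hv']
        | hmk q y => simp [lie_mk, hf, mul_smul, smul_comm (Polynomial.eval a p)] }

theorem eval_mk (a : k) (p : k[X]) (x : L) : eval L a (mk p x) = p.eval a • x := by
  change TensorProduct.lid k L (LinearMap.rTensor L _ (p ⊗ₜ x)) = _
  simp

variable (k L) in
/-- The derivation `X d/dX` of the Lie algebra of polynomials with coefficients in `L`. -/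
def euler : PolyLie k L →ₗ[k] PolyLie k L :=
  map (LinearMap.mulLeft k X ∘ₗ Polynomial.derivative)

theorem mk_add_left (p q : k[X]) (x : L) : mk (p + q) x = mk p x + mk q x :=
  TensorProduct.add_tmul _ _ _

theorem euler_lie (u v : PolyLie k L) : euler k L ⁅u, v⁆ = ⁅euler k L u, v⁆ + ⁅u, euler k L v⁆ := by
  induction u using induction with
  | hadd u u' hu hu' => simp only [add_lie, map_add, hu, hu']; abel
  | hmk p x =>
    induction v using induction with
    | hadd v v' hv hv' => simp only [lie_add, map_add, hv, hv']; abel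
    | hmk q y =>
      simp only [euler, map_mk, lie_mk, ← mk_add_left]
      congr 1
      simp
      ring

theorem eq_zero_of_euler [CharZero k] {u : PolyLie k L} (h : euler k L u = 0)
    (h0 : eval L (0 : k) u = 0) : u = 0 := by
  -- `I` divides the coefficient of `X ^ n` by `n`, so that `I ∘ X d/dX` kills the constants only.
  let I : k[X] →ₗ[k] k[X] := Polynomial.lsum fun n => (n : k)⁻¹ • monomial n
  have hI : ∀ p : k[X], p = I (X * derivative p) + C (p.eval 0) := by
    intro p
    induction p using Polynomial.induction_on' with
    | add p q hp hq =>
      rw [derivative_add, mul_add, map_add, eval_add, map_add, add_add_add_comm, ← hp, ← hq]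
    | monomial n a =>
      rcases n with _ | n
      · simp
      · have hn : ((n : k) + 1) ≠ 0 := by exact_mod_cast n.succ_ne_zero
        rw [derivative_monomial, X_mul_monomial]
        simp only [I, Polynomial.lsum_apply]
        rw [Polynomial.sum_monomial_index _ _ (by simp)]
        simp only [LinearMap.smul_apply, Polynomial.smul_monomial]
        simp [hn, mul_comm a]
  have key : ∀ u : PolyLie k L, u = map I (euler k L u) + mk 1 (eval L (0 : k) u) := by
    intro u
    induction u using induction with
    | hadd u v hu hv =>
      have hm : ∀ x y : L, mk (1 : k[X]) (x + y) = mk 1 x + mk 1 y :=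
        fun x y => TensorProduct.tmul_add _ _ _
      rw [map_add, map_add, map_add, hm, add_add_add_comm, ← hu, ← hv]
    | hmk p x =>
      have hm : mk (1 : k[X]) (p.eval 0 • x) = mk (C (p.eval 0)) x := by
        rw [mk, ← TensorProduct.smul_tmul, smul_eq_C_mul, mul_one]; rfl
      rw [eval_mk, hm, euler, map_mk, map_mk, ← mk_add_left]
      exact congrArg (fun p => mk p x) (hI p)
  rw [key u, h, h0, map_zero, zero_add]
  exact TensorProduct.tmul_zero _ _

variable (k L) in
/-- The representation `u ↦ ((c, m) ↦ (0, [u, m] + c E(u)))`, for `E = X d/dX`; it is faithful on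
polynomials without constant term, even if `L` has a nontrivial center. -/
def affineRep : PolyLie k L →ₗ[k] Module.End k (k × PolyLie k L) :=
  LinearMap.mk₂ k (fun u v => (0, ⁅u, v.2⁆ + v.1 • euler k L u))
    (fun u u' v => by simp; abel) (fun c u v => by simp [smul_comm c])
    (fun u v v' => by simp [add_smul]; abel) (fun c u v => by simp [mul_smul])

theorem affineRep_apply (u : PolyLie k L) (v) :
    affineRep k L u v = (0, ⁅u, v.2⁆ + v.1 • euler k L u) := rfl

theorem affineRep_lie (u v : PolyLie k L) : affineRep k L ⁅u, v⁆ =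
    affineRep k L u * affineRep k L v - affineRep k L v * affineRep k L u := by
  refine LinearMap.ext fun w => ?_
  simp only [affineRep_apply, Module.End.mul_apply, LinearMap.sub_apply, euler_lie, Prod.mk_sub_mk,
    lie_add, lie_smul, zero_smul, add_zero, sub_zero, smul_add, lie_lie]
  rw [← lie_skew (euler k L u) v]
  congr 1
  rw [smul_neg]
  abel

theorem affineRep_prod (n : ℕ) (l : List (PolyLie k L)) (hl : l.length = n + 1) (v) :
    ∃ z ∈ LieModule.lowerCentralSeries k (PolyLie k L) (PolyLie k L) n,
      (l.map (affineRep k L)).prod v = (0, z) := by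
  induction n generalizing l with
  | zero =>
    obtain ⟨u, rfl⟩ := List.length_eq_one_iff.1 hl
    exact ⟨⁅u, v.2⁆ + v.1 • euler k L u, by simp, by simp [affineRep_apply]⟩
  | succ n ih =>
    obtain _ | ⟨u, l⟩ := l
    · simp at hl
    obtain ⟨z, hz, hz'⟩ := ih l (by simpa using hl)
    refine ⟨⁅u, z⁆, ?_, ?_⟩
    · rw [LieModule.lowerCentralSeries_succ]
      exact LieSubmodule.lie_mem_lie (LieSubmodule.mem_top u) hz
    · rw [List.map_cons, List.prod_cons, Module.End.mul_apply, hz']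
      simp [affineRep_apply]

theorem exists_nilWords_affineRep [LieRing.IsNilpotent L] : ∃ N, ∀ u v : PolyLie k L,
    NilWords N (affineRep k L u) (affineRep k L v) := by
  obtain ⟨c, hc⟩ := LieModule.IsNilpotent.nilpotent k (PolyLie k L) (PolyLie k L)
  refine ⟨c + 1, fun u v l hl hlen => ?_⟩
  have hmap : ∃ l' : List (PolyLie k L), l'.map (affineRep k L) = l := by
    clear hlen
    induction l with
    | nil => exact ⟨[], rfl⟩
    | cons a l ih =>
      obtain ⟨l', hl'⟩ := ih fun b hb => hl b (by simp [hb])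
      rcases hl a (by simp) with rfl | rfl
      · exact ⟨u :: l', by simp [hl']⟩
      · exact ⟨v :: l', by simp [hl']⟩
  obtain ⟨l', rfl⟩ := hmap
  rw [List.length_map] at hlen
  refine LinearMap.ext fun w => ?_
  obtain ⟨z, hz, hz'⟩ := affineRep_prod (l'.length - 1) l' (by omega) w
  have h2 := LieModule.antitone_lowerCentralSeries k (PolyLie k L) (PolyLie k L)
    (show c ≤ l'.length - 1 by omega) hz
  rw [hc] at h2
  rw [hz', (LieSubmodule.mem_bot z).1 h2]
  rfl

theorem affineRep_inj [CharZero k] [LieRing.IsNilpotent L] {u v : PolyLie k L}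
    (hu : PolyLie.eval L (0 : k) u = 0) (hv : PolyLie.eval L (0 : k) v = 0)
    (h : nilExp k (affineRep k L u) = nilExp k (affineRep k L v)) : u = v := by
  obtain ⟨N, hN⟩ := exists_nilWords_affineRep (k := k) (L := L)
  have h1 := nilExp_injOn ⟨N, (hN u v).pow_left⟩ ⟨N, (hN u v).pow_right⟩ h
  have h2 := congrArg Prod.snd (LinearMap.congr_fun h1 (1, 0))
  simp only [affineRep_apply, lie_zero, one_smul, zero_add] at h2
  exact sub_eq_zero.1 (eq_zero_of_euler (by rw [map_sub, h2, sub_self]) (by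
    rw [map_sub, hu, hv, sub_self]))

end PolyLie
end Polynomial

theorem nestedBracket_replicate_zero (L : Type*) [LieRing L] (l : List L) (hl : ∀ a ∈ l, a = 0) :
    nestedBracket (fun a b => ⁅a, b⁆) l = 0 := by
  match l with
  | [] => rfl
  | [x] => exact hl x (by simp)
  | x :: y :: l =>
    rw [nestedBracket, hl x (by simp), zero_lie]

theorem lieBch_zero_zero : lieBch k (0 : L) 0 = 0 := by
  rw [lieBch, ← finsum_zero (α := ℕ)]
  refine finsum_congr fun n => ?_
  have := bchTerm_mem (k := k) (br := fun a b : L => ⁅a, b⁆) (x := 0) (y := 0) (n := n) ⊥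
    fun l hl _ => (Submodule.mem_bot k).2 (nestedBracket_replicate_zero L l (by simpa using hl))
  simpa using this

section Group

open Polynomial

universe u v

variable {k : Type u} [Field k] {L : Type v} [LieRing L] [LieAlgebra k L]
variable [CharZero k] [LieRing.IsNilpotent L]

/-- The Baker-Campbell-Hausdorff product is computed in polynomials without constant term, where it
is the product of exponentials in a faithful representation. -/
theorem exists_exp_model : ∃ (P : Type (max u v)) (_ : Ring P) (e : PolyLie k L → P),
    (∀ u v, PolyLie.eval L (0 : k) u = 0 → PolyLie.eval L (0 : k) v = 0 → e u = e v → u = v) ∧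
    e 0 = 1 ∧ (∀ u, e u * e (-u) = 1) ∧ ∀ u v, e (lieBch k u v) = e u * e v := by
  obtain ⟨N, hN⟩ := PolyLie.exists_nilWords_affineRep (k := k) (L := L)
  refine ⟨_, inferInstance, fun u => nilExp k (PolyLie.affineRep k L u),
    fun u v hu hv h => PolyLie.affineRep_inj hu hv h, by simp only [map_zero, nilExp_zero], fun u => ?_, fun u v => ?_⟩
  · change nilExp k _ * nilExp k _ = 1
    rw [map_neg, nilExp_mul_neg ⟨N, (hN u u).pow_left⟩]
  · exact (nilExp_lieBch _ PolyLie.affineRep_lie (hN u v)).symm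

theorem eval_zero_lieBch {u v : PolyLie k L} (hu : PolyLie.eval L (0 : k) u = 0)
    (hv : PolyLie.eval L (0 : k) v = 0) : PolyLie.eval L (0 : k) (lieBch k u v) = 0 := by
  rw [map_lieBch, hu, hv, lieBch_zero_zero]

theorem eval_one_X (x : L) : PolyLie.eval L (1 : k) (PolyLie.mk X x) = x := by simp [PolyLie.eval_mk]

theorem eval_zero_X (x : L) : PolyLie.eval L (0 : k) (PolyLie.mk X x) = 0 := by simp [PolyLie.eval_mk]

theorem lieBch_assoc (x y z : L) :
    lieBch k (lieBch k x y) z = lieBch k x (lieBch k y z) := by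
  obtain ⟨P, _, e, hinj, _, _, hmul⟩ := exists_exp_model (k := k) (L := L)
  have h0 := eval_zero_X (k := k) (L := L)
  have h := hinj (lieBch k (lieBch k (PolyLie.mk X x) (PolyLie.mk X y)) (PolyLie.mk X z))
    (lieBch k (PolyLie.mk X x) (lieBch k (PolyLie.mk X y) (PolyLie.mk X z)))
    (eval_zero_lieBch (eval_zero_lieBch (h0 x) (h0 y)) (h0 z))
    (eval_zero_lieBch (h0 x) (eval_zero_lieBch (h0 y) (h0 z)))
    (by simp only [hmul, mul_assoc])
  simpa only [map_lieBch, eval_one_X] using congrArg (PolyLie.eval L (1 : k)) h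

theorem zero_lieBch (x : L) : lieBch k 0 x = x := by
  obtain ⟨P, _, e, hinj, h1, _, hmul⟩ := exists_exp_model (k := k) (L := L)
  have h0 := eval_zero_X (k := k) (L := L)
  have h := hinj (lieBch k 0 (PolyLie.mk X x)) (PolyLie.mk X x)
    (eval_zero_lieBch (map_zero _) (h0 x)) (h0 x) (by rw [hmul, h1, one_mul])
  simpa only [map_lieBch, eval_one_X, map_zero] using congrArg (PolyLie.eval L (1 : k)) h

theorem lieBch_zero (x : L) : lieBch k x 0 = x := by
  obtain ⟨P, _, e, hinj, h1, _, hmul⟩ := exists_exp_model (k := k) (L := L)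
  have h0 := eval_zero_X (k := k) (L := L)
  have h := hinj (lieBch k (PolyLie.mk X x) 0) (PolyLie.mk X x)
    (eval_zero_lieBch (h0 x) (map_zero _)) (h0 x) (by rw [hmul, h1, mul_one])
  simpa only [map_lieBch, eval_one_X, map_zero] using congrArg (PolyLie.eval L (1 : k)) h

theorem neg_lieBch (x : L) : lieBch k (-x) x = 0 := by
  obtain ⟨P, _, e, hinj, h1, h2, hmul⟩ := exists_exp_model (k := k) (L := L)
  have h0 : PolyLie.eval L (0 : k) (-(PolyLie.mk X x)) = 0 := by rw [map_neg, eval_zero_X, neg_zero]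
  have h := hinj (lieBch k (-(PolyLie.mk X x)) (PolyLie.mk X x)) 0
    (eval_zero_lieBch h0 (eval_zero_X x)) (map_zero _) (by
      rw [hmul, h1, ← h2 (-(PolyLie.mk X x)), neg_neg])
  simpa only [map_lieBch, eval_one_X, map_neg, map_zero] using congrArg (PolyLie.eval L (1 : k)) h

end Group

/-- The group attached to a nilpotent Lie algebra `L`: the set `L`, with the
Baker-Campbell-Hausdorff product. -/
@[ext] structure ExpGroup (k L : Type*) where
  /-- The element of the group with logarithm `log`. -/
  exp ::
  /-- The logarithm of an element of the group. -/
  log : L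

namespace ExpGroup

variable [CharZero k] [LieRing.IsNilpotent L]

instance : Mul (ExpGroup k L) := ⟨fun a b => exp (lieBch k a.log b.log)⟩
instance : One (ExpGroup k L) := ⟨exp 0⟩
instance : Inv (ExpGroup k L) := ⟨fun a => exp (-a.log)⟩

theorem log_mul (a b : ExpGroup k L) : (a * b).log = lieBch k a.log b.log := rfl
theorem log_inv (a : ExpGroup k L) : (a⁻¹).log = -a.log := rfl

instance : Group (ExpGroup k L) where
  mul_assoc a b c := ExpGroup.ext (lieBch_assoc a.log b.log c.log)
  one_mul a := ExpGroup.ext (zero_lieBch a.log)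
  mul_one a := ExpGroup.ext (lieBch_zero a.log)
  inv_mul_cancel a := ExpGroup.ext (neg_lieBch a.log)

/-- The group morphism induced by a Lie algebra morphism. -/
def map {L' : Type*} [LieRing L'] [LieAlgebra k L'] [LieRing.IsNilpotent L'] (f : L →ₗ⁅k⁆ L') :
    ExpGroup k L →* ExpGroup k L' where
  toFun a := exp (f a.log)
  map_one' := ExpGroup.ext (map_zero f)
  map_mul' a b := ExpGroup.ext (map_lieBch f a.log b.log)

end ExpGroup

theorem bchTerm_one {V : Type*} [AddCommGroup V] [Module k V] (br : V → V → V) (x y : V) :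
    bchTerm k br x y 1 = x + y := by
  have h : (univ.filter fun p : Fin 1 → Fin 2 × Fin 2 =>
      (∀ i, 0 < ((p i).1 : ℕ) + (p i).2) ∧ ∑ i, (((p i).1 : ℕ) + (p i).2) = 1) =
      {fun _ => (1, 0), fun _ => (0, 1)} := by decide
  rw [bchTerm, Icc_self, sum_singleton]
  erw [h]
  rw [sum_pair (by decide)]
  simp [nestedBracket]

theorem lieBch_eq_add [CharZero k] {x y : L} [LieRing.IsNilpotent L] (h : ⁅x, y⁆ = 0) :
    lieBch k x y = x + y := by
  have hw : ∀ l : List L, (∀ a ∈ l, a = x ∨ a = y) → 2 ≤ l.length →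
      nestedBracket (fun a b => ⁅a, b⁆) l = 0 := by
    intro l
    induction l with
    | nil => simp
    | cons a l ih =>
      intro hl hlen
      obtain _ | ⟨b, l⟩ := l
      · simp at hlen
      rw [nestedBracket]
      obtain _ | ⟨c, l⟩ := l
      · have h' : ⁅y, x⁆ = 0 := by rw [← lie_skew, h, neg_zero]
        rcases hl a (by simp) with rfl | rfl <;> rcases hl b (by simp) with rfl | rfl <;>
          simp [nestedBracket, h, h']
      · rw [ih (fun d hd => hl d (List.mem_cons_of_mem a hd)) (by simp), lie_zero]
  rw [lieBch, finsum_eq_single _ 1, bchTerm_one]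
  intro n hn
  rcases Nat.eq_zero_or_pos n with rfl | h0
  · exact bchTerm_zero _ _ _
  · have := bchTerm_mem (k := k) (br := fun a b : L => ⁅a, b⁆) (x := x) (y := y) (n := n) ⊥
      fun l hl hlen => (Submodule.mem_bot k).2 (hw l hl (by omega))
    simpa using this

end NilpotentLieGroup

/-! ### Co-Poisson bialgebras generated by primitive elements -/

namespace FormalFun

variable {k : Type*} [Field k] {C D E : Type*} [AddCommGroup C] [Module k C] [AddCommGroup D]
  [Module k D] [AddCommGroup E] [Module k E]

theorem ext_ofConv {f g : FormalFun k C} (h : ∀ c, f.ofConv c = g.ofConv c) : f = g :=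
  WithConv.ofConv_injective (LinearMap.ext h)

theorem ofConv_add_apply (f g : FormalFun k C) (c : C) :
    (f + g).ofConv c = f.ofConv c + g.ofConv c := rfl

theorem ofConv_sub_apply (f g : FormalFun k C) (c : C) :
    (f - g).ofConv c = f.ofConv c - g.ofConv c := rfl

theorem ofConv_zero_apply (c : C) : (0 : FormalFun k C).ofConv c = 0 := rfl

theorem ofConv_smul_apply (a : k) (f : FormalFun k C) (c : C) :
    (a • f).ofConv c = a * f.ofConv c := rfl

variable (k) in
/-- Evaluation at `c`, as a linear form. -/
def evalAt (c : C) : FormalFun k C →ₗ[k] k where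
  toFun f := f.ofConv c
  map_add' _ _ := rfl
  map_smul' _ _ := rfl

theorem ofConv_sum_apply {ι : Type*} (s : Finset ι) (f : ι → FormalFun k C) (c : C) :
    (∑ i ∈ s, f i).ofConv c = ∑ i ∈ s, (f i).ofConv c :=
  map_sum (evalAt k c) f s

theorem pullback_apply (T : D →ₗ[k] C) (f : FormalFun k C) (d : D) :
    (pullback T f).ofConv d = f.ofConv (T d) := rfl

theorem tmul_tmul (f : FormalFun k C) (g : FormalFun k D) (c : C) (d : D) :
    (tmul f g).ofConv (c ⊗ₜ d) = f.ofConv c * g.ofConv d := by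
  simp [tmul]

theorem tmul_pullback {C' D' : Type*} [AddCommGroup C'] [Module k C'] [AddCommGroup D']
    [Module k D'] (S : C' →ₗ[k] C) (T : D' →ₗ[k] D) (f : FormalFun k C) (g : FormalFun k D) :
    tmul (pullback S f) (pullback T g) = pullback (TensorProduct.map S T) (tmul f g) := by
  refine ext_ofConv fun t => ?_
  induction t with
  | zero => simp
  | add s t hs ht => rw [map_add, map_add, hs, ht]
  | tmul c d => simp [tmul_tmul, pullback_apply]

/-- `f ⊗ g` as a bilinear function of `f` and `g`. -/
def tmulₗ : FormalFun k C →ₗ[k] FormalFun k D →ₗ[k] FormalFun k (C ⊗[k] D) :=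
  LinearMap.mk₂ k tmul
    (fun f f' g => ext_ofConv fun t => by
      induction t with
      | zero => simp
      | add s t hs ht => rw [map_add, map_add, hs, ht]
      | tmul c d => simp [tmul_tmul, add_mul])
    (fun a f g => ext_ofConv fun t => by
      induction t with
      | zero => simp
      | add s t hs ht => rw [map_add, map_add, hs, ht]
      | tmul c d => simp [tmul_tmul, mul_assoc])
    (fun f g g' => ext_ofConv fun t => by
      induction t with
      | zero => simp
      | add s t hs ht => rw [map_add, map_add, hs, ht]
      | tmul c d => simp [tmul_tmul, mul_add])
    (fun a f g => ext_ofConv fun t => by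
      induction t with
      | zero => simp
      | add s t hs ht => rw [map_add, map_add, hs, ht]
      | tmul c d => simp [tmul_tmul, mul_left_comm])

/-- The bracket dual to `δ`, as a bilinear map. -/
def bracketₗ (δ : C →ₗ[k] C ⊗[k] C) : FormalFun k C →ₗ[k] FormalFun k C →ₗ[k] FormalFun k C :=
  tmulₗ.compr₂ (pullback δ)

theorem mul_eq_pullback [Coalgebra k C] (f g : FormalFun k C) :
    f * g = pullback (Coalgebra.comul (R := k)) (tmul f g) := rfl

theorem one_apply [Coalgebra k C] (c : C) :
    (1 : FormalFun k C).ofConv c = Coalgebra.counit (R := k) c := rfl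

/-- Functions of the form `f ⊗ g` separate the points of `C ⊗ D`. -/
theorem eq_of_tmul_eq {s t : C ⊗[k] D}
    (h : ∀ (f : FormalFun k C) (g : FormalFun k D), (tmul f g).ofConv s = (tmul f g).ofConv t) :
    s = t := by
  let b := Module.Basis.ofVectorSpace k C
  let b' := Module.Basis.ofVectorSpace k D
  refine (b.tensorProduct b').repr.injective (Finsupp.ext fun ⟨i, i'⟩ => ?_)
  have key : ∀ s : C ⊗[k] D, (b.tensorProduct b').repr s (i, i') =
      (tmul (WithConv.toConv (b.coord i)) (WithConv.toConv (b'.coord i'))).ofConv s := by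
    intro s
    induction s with
    | zero => simp
    | add s t hs ht => rw [map_add, map_add, Finsupp.add_apply, hs, ht]
    | tmul c d => simp [tmul_tmul, Module.Basis.tensorProduct_repr_tmul_apply, mul_comm]
  rw [key, key, h]

end FormalFun

open FormalFun

/-- A co-Poisson structure `δ` on a bialgebra `H` generated by primitive elements `x i`, with
structure constants `c`: `δ` is the co-derivation along the coproduct with
`δ (x i) = ∑ c i j l • x j ⊗ x l`. The universal enveloping algebra of a Lie bialgebra is
an example, and so are its tensor powers. -/
structure CoPoissonFrame (k H ι : Type*) [Field k] [Ring H] [Bialgebra k H] [Fintype ι] where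
  x : ι → H
  comul_x : ∀ i, Coalgebra.comul (R := k) (x i) = x i ⊗ₜ[k] 1 + 1 ⊗ₜ[k] x i
  counit_x : ∀ i, Coalgebra.counit (R := k) (x i) = 0
  span_words : Submodule.span k (Set.range fun l : List ι => (l.map x).prod) = ⊤
  δ : H →ₗ[k] H ⊗[k] H
  c : ι → ι → ι → k
  c_antisymm : ∀ i j l, c i l j = -c i j l
  c_jacobi : ∀ i a b e, ∑ j, (c i j e * c j a b + c i j a * c j b e + c i j b * c j e a) = 0
  δ_one : δ 1 = 0
  δ_mul : ∀ u i, δ (u * x i) =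
    δ u * Coalgebra.comul (x i) + Coalgebra.comul u * ∑ j, ∑ l, c i j l • x j ⊗ₜ[k] x l

namespace CoPoissonFrame

variable {k H ι : Type*} [Field k] [Ring H] [Bialgebra k H] [Fintype ι]
  (F : CoPoissonFrame k H ι)

/-- The product `x i₁ ⋯ x iₙ` of generators. -/
def word (l : List ι) : H := (l.map F.x).prod

/-- The invariant vector field `f ↦ (u ↦ f (u x i))`. -/
def X (i : ι) : FormalFun k H →ₗ[k] FormalFun k H := pullback (LinearMap.mulRight k (F.x i))

/-- The Poisson bracket of functions. -/
def br : FormalFun k H →ₗ[k] FormalFun k H →ₗ[k] FormalFun k H := bracketₗ F.δ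

theorem X_apply (i : ι) (f : FormalFun k H) (u : H) : (F.X i f).ofConv u = f.ofConv (u * F.x i) :=
  rfl

theorem word_append (l l' : List ι) : F.word (l ++ l') = F.word l * F.word l' := by
  simp [word]

theorem word_nil : F.word [] = 1 := rfl

theorem word_singleton (i : ι) : F.word [i] = F.x i := by simp [word]

theorem word_cons (i : ι) (l : List ι) : F.word (i :: l) = F.x i * F.word l := by simp [word]

theorem ext_words {f g : FormalFun k H} (h : ∀ l, f.ofConv (F.word l) = g.ofConv (F.word l)) :
    f = g := by
  refine WithConv.ofConv_injective (LinearMap.ext_on F.span_words ?_)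
  rintro _ ⟨l, rfl⟩
  exact h l

theorem eq_zero_of_span (S : Set (FormalFun k H)) (h1 : ∀ f ∈ S, f.ofConv 1 = 0)
    (hX : ∀ f ∈ S, ∀ i, F.X i f ∈ Submodule.span k S) : ∀ f ∈ S, f = 0 := by
  have h1' : ∀ f ∈ Submodule.span k S, f.ofConv 1 = 0 := fun f hf =>
    Submodule.span_induction (p := fun f _ => f.ofConv 1 = 0) h1 rfl
      (fun f g _ _ hf hg => by rw [ofConv_add_apply, hf, hg, add_zero])
      (fun a f _ hf => by rw [ofConv_smul_apply, hf, mul_zero]) hf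
  have hX' : ∀ f ∈ Submodule.span k S, ∀ i, F.X i f ∈ Submodule.span k S := fun f hf i =>
    Submodule.span_induction (p := fun f _ => F.X i f ∈ Submodule.span k S) (fun f hf => hX f hf i)
      (by rw [map_zero]; exact zero_mem _)
      (fun f g _ _ hf hg => by rw [map_add]; exact add_mem hf hg)
      (fun a f _ hf => by rw [map_smul]; exact Submodule.smul_mem _ a hf) hf
  have key : ∀ l : List ι, ∀ f ∈ Submodule.span k S, f.ofConv (F.word l) = 0 := by
    intro l
    induction l using List.reverseRecOn with
    | nil => exact h1'
    | append_singleton l i ih =>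
      intro f hf
      rw [word_append, word_singleton, ← X_apply]
      exact ih _ (hX' f hf i)
  intro f hf
  exact F.ext_words fun l => key l f (Submodule.subset_span hf)

theorem tmul_mul (f g : FormalFun k H) (t : H ⊗[k] H) (a b : H) :
    (tmul f g).ofConv (t * a ⊗ₜ b) = (tmul (pullback (LinearMap.mulRight k a) f)
      (pullback (LinearMap.mulRight k b) g)).ofConv t := by
  induction t with
  | zero => simp
  | add s t hs ht => rw [add_mul, map_add, map_add, hs, ht]
  | tmul c d => simp [tmul_tmul, pullback_apply]

theorem pullback_mulRight_one (f : FormalFun k H) :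
    pullback (LinearMap.mulRight k (1 : H)) f = f :=
  ext_ofConv fun u => by rw [pullback_apply]; simp

theorem tmul_mul_comul (f g : FormalFun k H) (t : H ⊗[k] H) (i : ι) :
    (tmul f g).ofConv (t * Coalgebra.comul (F.x i)) =
      (tmul (F.X i f) g).ofConv t + (tmul f (F.X i g)).ofConv t := by
  rw [F.comul_x, mul_add, map_add, tmul_mul, tmul_mul, pullback_mulRight_one,
    pullback_mulRight_one]
  rfl

theorem X_mul (i : ι) (f g : FormalFun k H) : F.X i (f * g) = F.X i f * g + f * F.X i g := by
  refine ext_ofConv fun u => ?_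
  rw [X_apply, mul_eq_pullback, pullback_apply, Bialgebra.comul_mul, tmul_mul_comul]
  rfl

theorem X_br (i : ι) (f g : FormalFun k H) : F.X i (F.br f g) =
    F.br (F.X i f) g + F.br f (F.X i g) + ∑ j, ∑ l, F.c i j l • (F.X j f * F.X l g) := by
  refine ext_ofConv fun u => ?_
  have h : (F.X i (F.br f g)).ofConv u = (tmul f g).ofConv (F.δ (u * F.x i)) := rfl
  rw [h, F.δ_mul, map_add, tmul_mul_comul, Finset.mul_sum, map_sum, ofConv_add_apply,
    ofConv_sum_apply]
  congr 1
  refine Finset.sum_congr rfl fun j _ => ?_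
  rw [Finset.mul_sum, map_sum, ofConv_sum_apply]
  refine Finset.sum_congr rfl fun l _ => ?_
  rw [mul_smul_comm, map_smul, tmul_mul]
  rfl

theorem mul_apply_one (f g : FormalFun k H) : (f * g).ofConv 1 = f.ofConv 1 * g.ofConv 1 := by
  rw [mul_eq_pullback, pullback_apply, Bialgebra.comul_one, Algebra.TensorProduct.one_def,
    tmul_tmul]

theorem br_apply_one (f g : FormalFun k H) : (F.br f g).ofConv 1 = 0 := by
  change (tmul f g).ofConv (F.δ 1) = 0
  rw [F.δ_one, map_zero]

variable [Coalgebra.IsCocomm k H]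

theorem br_skew (f g : FormalFun k H) : F.br f g = -F.br g f := by
  rw [← add_eq_zero_iff_eq_neg]
  refine F.eq_zero_of_span {h | ∃ f g, h = F.br f g + F.br g f} ?_ ?_ _ ⟨f, g, rfl⟩
  · rintro _ ⟨f, g, rfl⟩
    rw [ofConv_add_apply, br_apply_one, br_apply_one, add_zero]
  · rintro _ ⟨f, g, rfl⟩ i
    have hsum : (∑ j, ∑ l, F.c i j l • (F.X j f * F.X l g)) =
        -∑ j, ∑ l, F.c i j l • (F.X j g * F.X l f) := by
      rw [Finset.sum_comm, ← Finset.sum_neg_distrib]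
      refine Finset.sum_congr rfl fun j _ => ?_
      rw [← Finset.sum_neg_distrib]
      refine Finset.sum_congr rfl fun l _ => ?_
      rw [F.c_antisymm i j l, neg_smul, mul_comm]
    rw [map_add, X_br, X_br, hsum]
    have : F.br (F.X i f) g + F.br f (F.X i g) + -(∑ j, ∑ l, F.c i j l • (F.X j g * F.X l f)) +
        (F.br (F.X i g) f + F.br g (F.X i f) + ∑ j, ∑ l, F.c i j l • (F.X j g * F.X l f)) =
        (F.br (F.X i f) g + F.br g (F.X i f)) + (F.br f (F.X i g) + F.br (F.X i g) f) := by ring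
    rw [this]
    exact add_mem (Submodule.subset_span ⟨_, _, rfl⟩) (Submodule.subset_span ⟨_, _, rfl⟩)

theorem br_mul (f g h : FormalFun k H) : F.br f (g * h) = F.br f g * h + g * F.br f h := by
  rw [← sub_eq_zero]
  refine F.eq_zero_of_span {e | ∃ f g h, e = F.br f (g * h) - (F.br f g * h + g * F.br f h)}
    ?_ ?_ _ ⟨f, g, h, rfl⟩
  · rintro _ ⟨f, g, h, rfl⟩
    rw [ofConv_sub_apply, ofConv_add_apply, mul_apply_one, mul_apply_one, br_apply_one,
      br_apply_one, br_apply_one]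
    simp
  · rintro _ ⟨f, g, h, rfl⟩ i
    have hsum : (∑ j, ∑ l, F.c i j l • (F.X j f * F.X l (g * h))) =
        (∑ j, ∑ l, F.c i j l • (F.X j f * F.X l g)) * h +
          g * ∑ j, ∑ l, F.c i j l • (F.X j f * F.X l h) := by
      simp only [Finset.sum_mul, Finset.mul_sum, ← Finset.sum_add_distrib]
      refine Finset.sum_congr rfl fun j _ => Finset.sum_congr rfl fun l _ => ?_
      rw [X_mul, smul_mul_assoc, mul_smul_comm, ← smul_add]
      congr 1
      ring
    have : F.X i (F.br f (g * h) - (F.br f g * h + g * F.br f h)) =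
        (F.br (F.X i f) (g * h) - (F.br (F.X i f) g * h + g * F.br (F.X i f) h)) +
        (F.br f (F.X i g * h) - (F.br f (F.X i g) * h + F.X i g * F.br f h)) +
        (F.br f (g * F.X i h) - (F.br f g * F.X i h + g * F.br f (F.X i h))) := by
      rw [map_sub, map_add, X_br, X_mul, X_mul, X_mul, X_br, X_br, hsum, map_add]
      ring
    rw [this]
    exact add_mem (add_mem (Submodule.subset_span ⟨_, _, _, rfl⟩)
      (Submodule.subset_span ⟨_, _, _, rfl⟩)) (Submodule.subset_span ⟨_, _, _, rfl⟩)


theorem br_mul_left (f g h : FormalFun k H) : F.br (f * g) h = f * F.br g h + F.br f h * g := by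
  rw [br_skew, br_mul, F.br_skew h f, F.br_skew h g]
  ring

theorem sum_structureConstants (i : ι) (u v w : ι → FormalFun k H) :
    ∑ j, ∑ l, F.c i j l • ((∑ a, ∑ b, F.c j a b • (u a * v b)) * w l) =
      ∑ a, ∑ b, ∑ l, (∑ j, F.c i j l * F.c j a b) • (u a * v b * w l) := by
  simp only [Finset.sum_mul, Finset.smul_sum, smul_mul_assoc, smul_smul, Finset.sum_smul]
  rw [Finset.sum_comm]
  refine (Finset.sum_congr rfl fun l _ => Finset.sum_comm).trans ?_
  rw [Finset.sum_comm]
  refine Finset.sum_congr rfl fun a _ => ?_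
  refine (Finset.sum_congr rfl fun l _ => Finset.sum_comm).trans ?_
  rw [Finset.sum_comm]

theorem sum_jacobi (i : ι) (u v w : ι → FormalFun k H) :
    (∑ j, ∑ l, F.c i j l • ((∑ a, ∑ b, F.c j a b • (u a * v b)) * w l)) +
      (∑ j, ∑ l, F.c i j l • ((∑ a, ∑ b, F.c j a b • (v a * w b)) * u l)) +
      (∑ j, ∑ l, F.c i j l • ((∑ a, ∑ b, F.c j a b • (w a * u b)) * v l)) = 0 := by
  rw [sum_structureConstants, sum_structureConstants, sum_structureConstants]
  have h2 : (∑ b, ∑ e, ∑ a, (∑ j, F.c i j a * F.c j b e) • (v b * w e * u a)) =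
      ∑ a, ∑ b, ∑ e, (∑ j, F.c i j a * F.c j b e) • (u a * v b * w e) := by
    refine (Finset.sum_congr rfl fun b _ => Finset.sum_comm).trans ?_
    rw [Finset.sum_comm]
    refine Finset.sum_congr rfl fun a _ => Finset.sum_congr rfl fun b _ =>
      Finset.sum_congr rfl fun e _ => ?_
    congr 1
    ring
  have h3 : (∑ e, ∑ a, ∑ b, (∑ j, F.c i j b * F.c j e a) • (w e * u a * v b)) =
      ∑ a, ∑ b, ∑ e, (∑ j, F.c i j b * F.c j e a) • (u a * v b * w e) := by
    rw [Finset.sum_comm]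
    refine Finset.sum_congr rfl fun a _ => ?_
    rw [Finset.sum_comm]
    refine Finset.sum_congr rfl fun b _ => Finset.sum_congr rfl fun e _ => ?_
    congr 1
    ring
  rw [h2, h3]
  simp only [← Finset.sum_add_distrib, ← add_smul]
  refine Finset.sum_eq_zero fun a _ => Finset.sum_eq_zero fun b _ =>
    Finset.sum_eq_zero fun e _ => ?_
  rw [F.c_jacobi, zero_smul]

theorem br_jacobi (f g h : FormalFun k H) :
    F.br (F.br f g) h + F.br (F.br g h) f + F.br (F.br h f) g = 0 := by
  refine F.eq_zero_of_span {e | ∃ f g h, e =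
    F.br (F.br f g) h + F.br (F.br g h) f + F.br (F.br h f) g} ?_ ?_ _ ⟨f, g, h, rfl⟩
  · rintro _ ⟨f, g, h, rfl⟩
    simp only [ofConv_add_apply, br_apply_one, add_zero]
  · rintro _ ⟨f, g, h, rfl⟩ i
    set A : FormalFun k H → FormalFun k H → FormalFun k H → FormalFun k H := fun f g h =>
      ∑ j, ∑ l, F.c i j l • (F.br (F.X j f) g * F.X l h) with hA
    set T : FormalFun k H → FormalFun k H → FormalFun k H → FormalFun k H := fun f g h =>
      ∑ j, ∑ l, F.c i j l • ((∑ a, ∑ b, F.c j a b • (F.X a f * F.X b g)) * F.X l h) with hT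
    have h1 : ∀ f g h, F.br (∑ j, ∑ l, F.c i j l • (F.X j f * F.X l g)) h =
        A f h g - A g h f := by
      intro f g h
      have e : A g h f = -∑ j, ∑ l, F.c i j l • (F.X j f * F.br (F.X l g) h) := by
        rw [hA, Finset.sum_comm, ← Finset.sum_neg_distrib]
        refine Finset.sum_congr rfl fun j _ => ?_
        rw [← Finset.sum_neg_distrib]
        refine Finset.sum_congr rfl fun l _ => ?_
        rw [F.c_antisymm i j l, neg_smul, neg_neg, mul_comm]
      rw [e, sub_neg_eq_add, hA, ← Finset.sum_add_distrib, map_sum, LinearMap.sum_apply]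
      refine Finset.sum_congr rfl fun j _ => ?_
      rw [← Finset.sum_add_distrib, map_sum, LinearMap.sum_apply]
      refine Finset.sum_congr rfl fun l _ => ?_
      rw [map_smul, LinearMap.smul_apply, br_mul_left, ← smul_add, add_comm]
    have h2 : ∀ f g h, (∑ j, ∑ l, F.c i j l • (F.X j (F.br f g) * F.X l h)) =
        A f g h - A g f h + T f g h := by
      intro f g h
      simp only [hA, hT, ← Finset.sum_sub_distrib, ← Finset.sum_add_distrib]
      refine Finset.sum_congr rfl fun j _ => Finset.sum_congr rfl fun l _ => ?_
      rw [X_br, F.br_skew f (F.X j g), ← smul_sub, ← smul_add]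
      congr 1
      ring
    have h3 : ∀ f g h, F.X i (F.br (F.br f g) h) = F.br (F.br (F.X i f) g) h +
        F.br (F.br f (F.X i g)) h + F.br (F.br f g) (F.X i h) + (A f h g - A g h f) +
        (A f g h - A g f h + T f g h) := by
      intro f g h
      rw [X_br, X_br, h2, map_add, map_add, LinearMap.add_apply, LinearMap.add_apply, h1]
      abel
    have h4 : T f g h + T g h f + T h f g = 0 := F.sum_jacobi i _ _ _
    have h5 : F.X i (F.br (F.br f g) h + F.br (F.br g h) f + F.br (F.br h f) g) =
        (F.br (F.br (F.X i f) g) h + F.br (F.br g h) (F.X i f) + F.br (F.br h (F.X i f)) g) +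
        (F.br (F.br f (F.X i g)) h + F.br (F.br (F.X i g) h) f + F.br (F.br h f) (F.X i g)) +
        (F.br (F.br f g) (F.X i h) + F.br (F.br g (F.X i h)) f + F.br (F.br (F.X i h) f) g) := by
      rw [map_add, map_add, h3, h3, h3]
      linear_combination h4
    rw [h5]
    exact add_mem (add_mem (Submodule.subset_span ⟨_, _, _, rfl⟩)
      (Submodule.subset_span ⟨_, _, _, rfl⟩)) (Submodule.subset_span ⟨_, _, _, rfl⟩)

/-! ### The filtration by the order of vanishing at the origin -/

/-- The functions that vanish to order `p` at the origin: those that vanish on words of length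
`< p`. -/
def I (p : ℕ) : Submodule k (FormalFun k H) where
  carrier := {f | ∀ l : List ι, l.length < p → f.ofConv (F.word l) = 0}
  add_mem' hf hg l hl := by rw [ofConv_add_apply, hf l hl, hg l hl, add_zero]
  zero_mem' l _ := rfl
  smul_mem' a f hf l hl := by rw [ofConv_smul_apply, hf l hl, mul_zero]

theorem mem_I_zero (f : FormalFun k H) : f ∈ F.I 0 := fun l hl => by omega

theorem I_anti {p q : ℕ} (h : p ≤ q) : F.I q ≤ F.I p := fun _ hf l hl => hf l (by omega)

theorem mem_I_succ {p : ℕ} {f : FormalFun k H} :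
    f ∈ F.I (p + 1) ↔ f.ofConv 1 = 0 ∧ ∀ i, F.X i f ∈ F.I p := by
  constructor
  · refine fun h => ⟨h [] (by simp), fun i l hl => ?_⟩
    rw [X_apply, ← F.word_singleton i, ← word_append]
    exact h _ (by simp; omega)
  · rintro ⟨h1, h2⟩ l hl
    induction l using List.reverseRecOn with
    | nil => exact h1
    | append_singleton l i _ =>
      rw [word_append, word_singleton]
      exact h2 i l (by simp at hl; omega)

theorem X_mem_I {p : ℕ} {f : FormalFun k H} (hf : f ∈ F.I p) (i : ι) : F.X i f ∈ F.I (p - 1) := by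
  rcases p with _ | p
  · exact F.mem_I_zero _
  · exact (F.mem_I_succ.1 hf).2 i

theorem mul_mem_I {r : ℕ} : ∀ {p q : ℕ} {f g : FormalFun k H}, f ∈ F.I p → g ∈ F.I q →
    r ≤ p + q → f * g ∈ F.I r := by
  induction r with
  | zero => exact fun _ _ _ => F.mem_I_zero _
  | succ r ih =>
    intro p q f g hf hg h
    refine F.mem_I_succ.2 ⟨?_, fun i => ?_⟩
    · rw [mul_apply_one]
      rcases p with _ | p
      · rw [show g.ofConv 1 = 0 from hg [] (by simp; omega), mul_zero]
      · rw [show f.ofConv 1 = 0 from hf [] (by simp), zero_mul]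
    · rw [X_mul]
      exact add_mem (ih (F.X_mem_I hf i) hg (by omega)) (ih hf (F.X_mem_I hg i) (by omega))

theorem br_mem_I {r : ℕ} : ∀ {p q : ℕ} {f g : FormalFun k H}, f ∈ F.I p → g ∈ F.I q →
    r + 1 ≤ p + q → F.br f g ∈ F.I r := by
  induction r with
  | zero => exact fun _ _ _ => F.mem_I_zero _
  | succ r ih =>
    intro p q f g hf hg h
    refine F.mem_I_succ.2 ⟨F.br_apply_one f g, fun i => ?_⟩
    rw [X_br]
    refine add_mem (add_mem (ih (F.X_mem_I hf i) hg (by omega)) (ih hf (F.X_mem_I hg i)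
      (by omega))) ?_
    exact sum_mem fun j _ => sum_mem fun l _ => Submodule.smul_mem _ _
      (F.mul_mem_I (F.X_mem_I hf j) (F.X_mem_I hg l) (by omega))

/-! ### The Lie algebra of functions vanishing to order two, and its nilpotent quotients -/

/-- The functions vanishing to order two at the origin; they form a Lie algebra for the Poisson
bracket, which is pronilpotent since `{I ^ 2, I ^ p} ⊆ I ^ (p + 1)`. -/
def LieFun : Type _ := F.I 2

namespace LieFun

instance : AddCommGroup F.LieFun := inferInstanceAs (AddCommGroup (F.I 2))
instance : Module k F.LieFun := inferInstanceAs (Module k (F.I 2))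

variable {F}

/-- The underlying function. -/
def val : F.LieFun →ₗ[k] FormalFun k H := (F.I 2).subtype

theorem val_injective : Function.Injective (val : F.LieFun → FormalFun k H) :=
  Subtype.val_injective

theorem val_mem (f : F.LieFun) : val f ∈ F.I 2 := Subtype.property (p := (· ∈ F.I 2)) f

/-- A function vanishing to order two, as an element of the Lie algebra. -/
def mk (f : FormalFun k H) (hf : f ∈ F.I 2) : F.LieFun := (⟨f, hf⟩ : F.I 2)

theorem val_mk (f : FormalFun k H) (hf : f ∈ F.I 2) : val (mk f hf) = f := rfl

instance : Bracket F.LieFun F.LieFun :=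
  ⟨fun f g => mk (F.br (val f) (val g)) (F.br_mem_I (val_mem f) (val_mem g) (by omega))⟩

theorem val_lie (f g : F.LieFun) : val ⁅f, g⁆ = F.br (val f) (val g) := rfl

variable [CharZero k]

instance : LieRing F.LieFun where
  add_lie f g h := val_injective (by simp [val_lie])
  lie_add f g h := val_injective (by simp [val_lie])
  lie_self f := val_injective (by
    have h := F.br_skew (val f) (val f)
    have h2 : (2 : k) • F.br (val f) (val f) = 0 := by
      rw [two_smul]; nth_rewrite 1 [h]; exact neg_add_cancel _
    rw [val_lie, map_zero]
    exact (smul_eq_zero.1 h2).resolve_left two_ne_zero)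
  leibniz_lie f g h := val_injective (by
    have e := F.br_jacobi (val f) (val g) (val h)
    simp only [val_lie, map_add]
    rw [F.br_skew (val f) (F.br (val g) (val h)), F.br_skew (val g) (F.br (val f) (val h)),
      F.br_skew (val f) (val h), map_neg, LinearMap.neg_apply]
    linear_combination -e)

instance : LieAlgebra k F.LieFun where
  lie_smul a f g := val_injective (by simp [val_lie])

end LieFun

variable [CharZero k]

/-- The ideal of functions vanishing to order `p`. -/
def J (p : ℕ) : LieIdeal k F.LieFun :=
  { (F.I p).comap LieFun.val with
    lie_mem := by
      intro f g hg
      exact F.I_anti (Nat.le_succ p) (F.br_mem_I (LieFun.val_mem f) hg (by omega)) }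

theorem lowerCentralSeries_le_J (n : ℕ) :
    LieModule.lowerCentralSeries k F.LieFun F.LieFun n ≤ F.J n := by
  induction n with
  | zero => exact fun f _ => F.mem_I_zero _
  | succ n ih =>
    rw [LieModule.lowerCentralSeries_succ, LieSubmodule.lie_le_iff]
    exact fun f _ g hg => F.br_mem_I (LieFun.val_mem f) (ih hg) (by omega)

/-- The nilpotent Lie algebra of jets of order `p` of functions vanishing to order two. -/
abbrev Jet (p : ℕ) : Type _ := F.LieFun ⧸ F.J p

instance (p : ℕ) : LieRing.IsNilpotent (F.Jet p) := by
  have h : LieModule.IsNilpotent F.LieFun (F.Jet p) :=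
    (LieModule.isNilpotent_quotient_iff k F.LieFun F.LieFun (F.J p)).2
      ⟨p, F.lowerCentralSeries_le_J p⟩
  obtain ⟨n, hn⟩ := LieModule.IsNilpotent.nilpotent k F.LieFun (F.Jet p)
  refine LieModule.IsNilpotent.mk (R := k) (L := F.Jet p) (M := F.Jet p) (k := n) ?_
  rw [← LieSubmodule.toSubmodule_inj, ← coe_lowerCentralSeries_ideal_quot_eq, hn]
  rfl

end CoPoissonFrame

open FormalFun

section TensorFrame

variable {k : Type*} [Field k]

/-- The exchange `(a ⊗ b) ⊗ (c ⊗ d) ↦ (a ⊗ c) ⊗ (b ⊗ d)`, as an algebra isomorphism. -/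
def tensorComm₄ (k A B C D : Type*) [Field k] [Ring A] [Algebra k A] [Ring B] [Algebra k B]
    [Ring C] [Algebra k C] [Ring D] [Algebra k D] :
    (A ⊗[k] B) ⊗[k] (C ⊗[k] D) ≃ₐ[k] (A ⊗[k] C) ⊗[k] (B ⊗[k] D) :=
  Algebra.TensorProduct.tensorTensorTensorComm k k k k A B C D

theorem tensorComm₄_tmul {A B C D : Type*} [Ring A] [Algebra k A] [Ring B] [Algebra k B]
    [Ring C] [Algebra k C] [Ring D] [Algebra k D] (a : A) (b : B) (c : C) (d : D) :
    tensorComm₄ k A B C D ((a ⊗ₜ b) ⊗ₜ (c ⊗ₜ d)) = (a ⊗ₜ c) ⊗ₜ (b ⊗ₜ d) := rfl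

theorem comul_tmul_eq {A B : Type*} [Ring A] [Bialgebra k A] [Ring B] [Bialgebra k B] (a : A)
    (b : B) : Coalgebra.comul (R := k) (a ⊗ₜ[k] b) =
      tensorComm₄ k A A B B (Coalgebra.comul (R := k) a ⊗ₜ Coalgebra.comul (R := k) b) := rfl

theorem coPoissonTensor_tmul {A B : Type*} [Ring A] [Bialgebra k A] [Ring B] [Bialgebra k B]
    (δ : A →ₗ[k] A ⊗[k] A) (δ' : B →ₗ[k] B ⊗[k] B) (a : A) (b : B) :
    coPoissonTensor δ δ' (a ⊗ₜ b) = tensorComm₄ k A A B B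
      (δ a ⊗ₜ Coalgebra.comul (R := k) b + Coalgebra.comul (R := k) a ⊗ₜ δ' b) := rfl

namespace CoPoissonFrame

variable {H ι K κ : Type*} [Ring H] [Bialgebra k H] [Fintype ι] [Ring K] [Bialgebra k K]
  [Fintype κ]

/-- The generators of a tensor product. -/
def tensorGen (F : CoPoissonFrame k H ι) (G : CoPoissonFrame k K κ) : ι ⊕ κ → H ⊗[k] K :=
  Sum.elim (fun i => F.x i ⊗ₜ 1) (fun j => 1 ⊗ₜ G.x j)

/-- The structure constants of a tensor product. -/
def tensorConst (F : CoPoissonFrame k H ι) (G : CoPoissonFrame k K κ) : ι ⊕ κ → ι ⊕ κ → ι ⊕ κ → k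
  | .inl i, .inl j, .inl l => F.c i j l
  | .inr i, .inr j, .inr l => G.c i j l
  | _, _, _ => 0

theorem prod_map_tensorGen (F : CoPoissonFrame k H ι) (G : CoPoissonFrame k K κ) (l : List ι)
    (l' : List κ) : ((l.map Sum.inl ++ l'.map Sum.inr).map (tensorGen F G)).prod =
      F.word l ⊗ₜ G.word l' := by
  have h1 : ∀ l : List ι, ((l.map Sum.inl).map (tensorGen F G)).prod = F.word l ⊗ₜ 1 := by
    intro l
    induction l with
    | nil => rfl
    | cons i l ih =>
      rw [List.map_cons, List.map_cons, List.prod_cons, ih, word_cons]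
      simp [tensorGen]
  have h2 : ∀ l : List κ, ((l.map Sum.inr).map (tensorGen F G)).prod = 1 ⊗ₜ G.word l := by
    intro l
    induction l with
    | nil => rfl
    | cons i l ih =>
      rw [List.map_cons, List.map_cons, List.prod_cons, ih, word_cons]
      simp [tensorGen]
  rw [List.map_append, List.prod_append, h1, h2]
  simp

/-- The tensor product of two co-Poisson bialgebras. -/
def tensor (F : CoPoissonFrame k H ι) (G : CoPoissonFrame k K κ) :
    CoPoissonFrame k (H ⊗[k] K) (ι ⊕ κ) where
  x := tensorGen F G
  comul_x := by
    rintro (i | j)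
    · simp only [tensorGen, Sum.elim_inl]
      rw [comul_tmul_eq, F.comul_x, Bialgebra.comul_one, Algebra.TensorProduct.one_def,
        TensorProduct.add_tmul, map_add]
      rfl
    · simp only [tensorGen, Sum.elim_inr]
      rw [comul_tmul_eq, G.comul_x, Bialgebra.comul_one, Algebra.TensorProduct.one_def,
        TensorProduct.tmul_add, map_add]
      rfl
  counit_x := by
    rintro (i | j)
    · simp [tensorGen, F.counit_x]
    · simp [tensorGen, G.counit_x]
  span_words := by
    rw [eq_top_iff]
    intro t _
    have key : ∀ a ∈ Submodule.span k (Set.range F.word), ∀ b ∈ Submodule.span k (Set.range G.word),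
        a ⊗ₜ[k] b ∈ Submodule.span k
          (Set.range fun l : List (ι ⊕ κ) => (l.map (tensorGen F G)).prod) := by
      intro a ha b hb
      induction ha using Submodule.span_induction with
      | zero => simp
      | add a a' _ _ ha ha' => rw [TensorProduct.add_tmul]; exact add_mem ha ha'
      | smul c a _ ha => rw [← TensorProduct.smul_tmul']; exact Submodule.smul_mem _ _ ha
      | mem a ha =>
        obtain ⟨l, rfl⟩ := ha
        induction hb using Submodule.span_induction with
        | zero => simp
        | add a a' _ _ ha ha' => rw [TensorProduct.tmul_add]; exact add_mem ha ha'
        | smul c a _ ha => rw [TensorProduct.tmul_smul]; exact Submodule.smul_mem _ _ ha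
        | mem b hb =>
          obtain ⟨l', rfl⟩ := hb
          exact Submodule.subset_span ⟨_, prod_map_tensorGen F G l l'⟩
    induction t with
    | zero => simp
    | add s t hs ht => exact add_mem (hs trivial) (ht trivial)
    | tmul a b =>
      exact key a (by rw [show Set.range F.word = _ from rfl]; rw [show
        Submodule.span k (Set.range F.word) = ⊤ from F.span_words]; trivial) b (by
        rw [show Submodule.span k (Set.range G.word) = ⊤ from G.span_words]; trivial)
  δ := coPoissonTensor F.δ G.δ
  c := tensorConst F G
  c_antisymm := by
    rintro (i | i) (j | j) (l | l) <;> simp [tensorConst]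
    · exact F.c_antisymm i j l
    · exact G.c_antisymm i j l
  c_jacobi := by
    rintro (i | i) (a | a) (b | b) (e | e) <;> simp [tensorConst, F.c_jacobi, G.c_jacobi]
  δ_one := by
    rw [Algebra.TensorProduct.one_def, coPoissonTensor_tmul, F.δ_one, G.δ_one]
    simp
  δ_mul := by
    intro u i
    induction u with
    | zero => simp
    | add s t hs ht => simp only [add_mul, map_add, hs, ht]; abel
    | tmul a b =>
      rcases i with i | i
      · have e : ∑ j, ∑ l, tensorConst F G (.inl i) j l • tensorGen F G j ⊗ₜ[k] tensorGen F G l =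
            tensorComm₄ k H H K K ((∑ j, ∑ l, F.c i j l • F.x j ⊗ₜ[k] F.x l) ⊗ₜ (1 ⊗ₜ 1)) := by
          simp [tensorConst, tensorGen, TensorProduct.sum_tmul, map_sum, tensorComm₄_tmul,
            ← TensorProduct.smul_tmul']
        rw [e]
        simp only [tensorGen, Sum.elim_inl, Algebra.TensorProduct.tmul_mul_tmul, mul_one]
        rw [coPoissonTensor_tmul, coPoissonTensor_tmul, comul_tmul_eq, comul_tmul_eq,
          ← map_mul, ← map_mul, ← map_add, F.δ_mul, Bialgebra.comul_mul, Bialgebra.comul_one,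
          Algebra.TensorProduct.one_def]
        congr 1
        simp only [add_mul, Algebra.TensorProduct.tmul_mul_tmul, TensorProduct.add_tmul,
          ← Algebra.TensorProduct.one_def, mul_one]
        abel
      · have e : ∑ j, ∑ l, tensorConst F G (.inr i) j l • tensorGen F G j ⊗ₜ[k] tensorGen F G l =
            tensorComm₄ k H H K K ((1 ⊗ₜ 1) ⊗ₜ (∑ j, ∑ l, G.c i j l • G.x j ⊗ₜ[k] G.x l)) := by
          simp [tensorConst, tensorGen, TensorProduct.tmul_sum, map_sum, tensorComm₄_tmul]
        rw [e]
        simp only [tensorGen, Sum.elim_inr, Algebra.TensorProduct.tmul_mul_tmul, mul_one]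
        rw [coPoissonTensor_tmul, coPoissonTensor_tmul, comul_tmul_eq, comul_tmul_eq,
          ← map_mul, ← map_mul, ← map_add, G.δ_mul, Bialgebra.comul_mul, Bialgebra.comul_one,
          Algebra.TensorProduct.one_def]
        congr 1
        simp only [add_mul, Algebra.TensorProduct.tmul_mul_tmul, TensorProduct.tmul_add,
          ← Algebra.TensorProduct.one_def, mul_one]
        abel

theorem tensor_word (F : CoPoissonFrame k H ι) (G : CoPoissonFrame k K κ) (l : List ι)
    (l' : List κ) : (F.tensor G).word (l.map Sum.inl ++ l'.map Sum.inr) =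
      F.word l ⊗ₜ G.word l' :=
  prod_map_tensorGen F G l l'

/-- A word in the generators of a tensor product is a tensor product of words. -/
theorem exists_tensor_word (F : CoPoissonFrame k H ι) (G : CoPoissonFrame k K κ)
    (l : List (ι ⊕ κ)) : ∃ l₁ l₂, l₁.length + l₂.length = l.length ∧
      (F.tensor G).word l = F.word l₁ ⊗ₜ G.word l₂ := by
  induction l with
  | nil => exact ⟨[], [], rfl, rfl⟩
  | cons i l ih =>
    obtain ⟨l₁, l₂, h, h'⟩ := ih
    rcases i with i | j
    · refine ⟨i :: l₁, l₂, by simp [← h]; omega, ?_⟩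
      rw [word_cons, h', word_cons]
      simp [tensor, tensorGen]
    · refine ⟨l₁, j :: l₂, by simp [← h]; omega, ?_⟩
      rw [word_cons, h', word_cons]
      simp [tensor, tensorGen]

end CoPoissonFrame

end TensorFrame

/-! ### The co-Poisson structure of the universal enveloping algebra -/

section EnvelopingGenerators

attribute [local instance 100] LieRing.ofAssociativeRing

variable {k L : Type*} [Field k] [LieRing L] [LieAlgebra k L]

namespace UniversalEnvelopingAlgebra

theorem adjoin_range_ι : Algebra.adjoin k (Set.range (ι k : L → UniversalEnvelopingAlgebra k L)) =
    ⊤ := by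
  let S := Algebra.adjoin k (Set.range (ι k : L → UniversalEnvelopingAlgebra k L))
  let f : L →ₗ⁅k⁆ S :=
    { toFun := fun x => ⟨ι k x, Algebra.subset_adjoin ⟨x, rfl⟩⟩
      map_add' := fun x y => Subtype.ext (map_add _ x y)
      map_smul' := fun c x => Subtype.ext (map_smul _ c x)
      map_lie' := fun {x y} => Subtype.ext (LieHom.map_lie _ x y) }
  have h : S.val.comp (lift k f) = AlgHom.id k _ := by
    refine algHom_ext_ι k L fun x => ?_
    rw [AlgHom.comp_apply, lift_ι_apply]
    rfl
  rw [eq_top_iff]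
  intro u _
  have := AlgHom.congr_fun h u
  rw [AlgHom.comp_apply, AlgHom.id_apply] at this
  rw [← this]
  exact (lift k f u).2

theorem ι_lie (x y : L) : (ι k ⁅x, y⁆ : UniversalEnvelopingAlgebra k L) =
    ι k x * ι k y - ι k y * ι k x := by
  rw [LieHom.map_lie, LieRing.of_associative_ring_bracket]

theorem span_words_eq_top {n : Type*} (b : Module.Basis n k L) :
    Submodule.span k (Set.range fun l : List n =>
      (l.map fun i => (ι k (b i) : UniversalEnvelopingAlgebra k L)).prod) = ⊤ := by
  set S := Submodule.span k (Set.range fun l : List n =>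
      (l.map fun i => (ι k (b i) : UniversalEnvelopingAlgebra k L)).prod) with hS
  have hmul : ∀ x : L, ∀ u ∈ S, ι k x * u ∈ S := by
    intro x u hu
    induction hu using Submodule.span_induction with
    | zero => simp
    | add u v _ _ hu hv => rw [mul_add]; exact add_mem hu hv
    | smul c u _ hu => rw [mul_smul_comm]; exact S.smul_mem c hu
    | mem u hu =>
      obtain ⟨l, rfl⟩ := hu
      have hx : x ∈ Submodule.span k (Set.range b) := by rw [b.span_eq]; trivial
      induction hx using Submodule.span_induction with
      | zero => simp
      | add u v _ _ hu hv => rw [map_add, add_mul]; exact add_mem hu hv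
      | smul c u _ hu => rw [map_smul, smul_mul_assoc]; exact S.smul_mem c hu
      | mem u hu =>
        obtain ⟨i, rfl⟩ := hu
        exact Submodule.subset_span ⟨i :: l, by simp⟩
  rw [eq_top_iff]
  intro u _
  have hu : u ∈ Algebra.adjoin k (Set.range (ι k : L → UniversalEnvelopingAlgebra k L)) := by
    rw [adjoin_range_ι]; trivial
  have key : ∀ v ∈ S, u * v ∈ S := by
    clear * - hu hmul
    induction hu using Algebra.adjoin_induction with
    | mem u hu => obtain ⟨x, rfl⟩ := hu; exact hmul x
    | algebraMap c =>
      intro v hv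
      rw [← Algebra.smul_def]; exact S.smul_mem c hv
    | add u v _ _ hu hv => rintro w hw; rw [add_mul]; exact add_mem (hu w hw) (hv w hw)
    | mul u v _ _ hu hv => intro w hw; rw [mul_assoc]; exact hu _ (hv w hw)
  simpa using key 1 (Submodule.subset_span ⟨[], rfl⟩)

theorem comul_ι (x : L) : Coalgebra.comul (R := k) (ι k x : UniversalEnvelopingAlgebra k L) =
    ι k x ⊗ₜ 1 + 1 ⊗ₜ ι k x := comulHom_ι k L x

instance : Coalgebra.IsCocomm k (UniversalEnvelopingAlgebra k L) where
  comm_comp_comul := by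
    have h : ((Algebra.TensorProduct.comm k (UniversalEnvelopingAlgebra k L)
        (UniversalEnvelopingAlgebra k L)).toAlgHom.comp (comulHom k L)) = comulHom k L := by
      refine algHom_ext_ι k L fun x => ?_
      rw [AlgHom.comp_apply, comulHom_ι, map_add, add_comm]
      rfl
    exact LinearMap.ext fun u => AlgHom.congr_fun h u

end UniversalEnvelopingAlgebra

end EnvelopingGenerators

namespace LieBialgebra

variable {k g : Type*} [Field k] [CharZero k] [LieRing g] [LieAlgebra k g] [Module.Finite k g]
variable (B : LieBialgebra k g)

/-- A basis of `g*`. -/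
def dualBasis : Module.Basis (Fin (Module.finrank k g)) k B.DualLie :=
  (Module.finBasis k g).dualBasis.map B.toDual.symm

theorem toDual_dualBasis (i : Fin (Module.finrank k g)) :
    B.toDual (B.dualBasis i) = (Module.finBasis k g).coord i := by
  rw [dualBasis, Module.Basis.map_apply, LinearEquiv.apply_symm_apply,
    Module.Basis.coe_dualBasis]

theorem dualCobracket_dualBasis (i : Fin (Module.finrank k g)) :
    B.dualCobracket (B.dualBasis i) = ∑ j, ∑ l, (Module.finBasis k g).coord i
      ⁅Module.finBasis k g j, Module.finBasis k g l⁆ • B.dualBasis j ⊗ₜ[k] B.dualBasis l := by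
  apply B.coPair_ext
  intro x y
  rw [coPair_dualCobracket, toDual_dualBasis]
  simp only [map_sum, map_smul, coPair_tmul, toDual_dualBasis]
  conv_lhs => rw [← (Module.finBasis k g).sum_repr x, ← (Module.finBasis k g).sum_repr y]
  simp only [sum_lie, lie_sum, smul_lie, lie_smul, map_sum, map_smul,
    smul_eq_mul, Finset.mul_sum]
  rw [Finset.sum_comm]
  refine Finset.sum_congr rfl fun j _ => Finset.sum_congr rfl fun l _ => ?_
  simp only [Module.Basis.coord_apply]
  ring

theorem fst_comulCoPoisson (u : B.U) : (B.comulCoPoisson u).fst = Coalgebra.comul (R := k) u := by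
  have h : (TrivSqZeroExt.fstHom k (B.U ⊗[k] B.U) (B.U ⊗[k] B.U)).comp B.comulCoPoisson =
      UniversalEnvelopingAlgebra.comulHom k B.DualLie := by
    refine UniversalEnvelopingAlgebra.algHom_ext_ι k _ fun ξ => ?_
    rw [AlgHom.comp_apply, comulCoPoisson, UniversalEnvelopingAlgebra.lift_ι_apply]
    simp [-UniversalEnvelopingAlgebra.ι_apply]
  exact AlgHom.congr_fun h u

theorem coPoisson_ι (ξ : B.DualLie) :
    B.coPoisson (UniversalEnvelopingAlgebra.ι k ξ) = B.ι₂ (B.dualCobracket ξ) := by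
  change (B.comulCoPoisson _).snd = _
  rw [comulCoPoisson, UniversalEnvelopingAlgebra.lift_ι_apply]
  simp [-UniversalEnvelopingAlgebra.ι_apply]

theorem coPoisson_mul (u v : B.U) : B.coPoisson (u * v) =
    B.coPoisson u * Coalgebra.comul (R := k) v + Coalgebra.comul (R := k) u * B.coPoisson v := by
  change (B.comulCoPoisson _).snd = (B.comulCoPoisson _).snd * _ + _ * (B.comulCoPoisson _).snd
  rw [map_mul, TrivSqZeroExt.snd_mul, fst_comulCoPoisson, fst_comulCoPoisson]
  simp [add_comm]

theorem coPoisson_one : B.coPoisson 1 = 0 := by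
  change (B.comulCoPoisson 1).snd = 0
  rw [map_one, TrivSqZeroExt.snd_one]

/-- The co-Poisson bialgebra `U(g*)`, with the generators given by a basis of `g*`. -/
def frame : CoPoissonFrame k B.U (Fin (Module.finrank k g)) where
  x i := UniversalEnvelopingAlgebra.ι k (B.dualBasis i)
  comul_x i := UniversalEnvelopingAlgebra.comulHom_ι k _ _
  counit_x i := UniversalEnvelopingAlgebra.counitHom_ι k _ _
  span_words := UniversalEnvelopingAlgebra.span_words_eq_top B.dualBasis
  δ := B.coPoisson
  c i j l := (Module.finBasis k g).coord i ⁅Module.finBasis k g j, Module.finBasis k g l⁆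
  c_antisymm i j l := by rw [← lie_skew, map_neg]
  c_jacobi i a b e := by
    set β := Module.finBasis k g
    have h : ∀ a b e, ∑ j, β.coord i ⁅β j, β e⁆ * β.coord j ⁅β a, β b⁆ =
        β.coord i ⁅⁅β a, β b⁆, β e⁆ := by
      intro a b e
      conv_rhs => rw [← β.sum_repr ⁅β a, β b⁆]
      simp only [sum_lie, smul_lie, map_sum, map_smul, smul_eq_mul]
      refine Finset.sum_congr rfl fun j _ => ?_
      simp only [Module.Basis.coord_apply]
      ring
    have hj := lie_jacobi (β a) (β b) (β e)
    have hs : ⁅⁅β a, β b⁆, β e⁆ + ⁅⁅β b, β e⁆, β a⁆ + ⁅⁅β e, β a⁆, β b⁆ = 0 := by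
      rw [← lie_skew ⁅β a, β b⁆ (β e), ← lie_skew ⁅β b, β e⁆ (β a), ← lie_skew ⁅β e, β a⁆ (β b),
        ← neg_add, ← neg_add, neg_eq_zero, ← hj]
      abel
    rw [Finset.sum_add_distrib, Finset.sum_add_distrib, h, h, h, ← map_add, ← map_add, hs, map_zero]
  δ_one := B.coPoisson_one
  δ_mul u i := by
    rw [coPoisson_mul, coPoisson_ι, dualCobracket_dualBasis]
    simp [ι₂, -UniversalEnvelopingAlgebra.ι_apply]

end LieBialgebra

open FormalFun

/-! ### Morphisms of co-Poisson bialgebras -/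

namespace CoPoissonFrame

variable {k : Type*} [Field k] {H ι K κ M μ : Type*} [Ring H] [Bialgebra k H] [Fintype ι]
  [Ring K] [Bialgebra k K] [Fintype κ] [Ring M] [Bialgebra k M] [Fintype μ]

section Filtration

variable (F : CoPoissonFrame k H ι)

/-- The span of the words of length at most `n`. -/
def filt (n : ℕ) : Submodule k H := Submodule.span k (F.word '' {l | l.length ≤ n})

theorem word_mem_filt {l : List ι} {n : ℕ} (h : l.length ≤ n) : F.word l ∈ F.filt n :=
  Submodule.subset_span ⟨l, h, rfl⟩

theorem filt_mono {m n : ℕ} (h : m ≤ n) : F.filt m ≤ F.filt n :=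
  Submodule.span_mono (Set.image_mono fun _ hl => le_trans hl h)

theorem mul_mem_filt {m n p : ℕ} {u v : H} (hu : u ∈ F.filt m) (hv : v ∈ F.filt n)
    (h : m + n ≤ p) : u * v ∈ F.filt p := by
  induction hu using Submodule.span_induction with
  | zero => simp
  | add u u' _ _ hu hu' => rw [add_mul]; exact add_mem hu hu'
  | smul c u _ hu => rw [smul_mul_assoc]; exact Submodule.smul_mem _ c hu
  | mem u hu =>
    obtain ⟨l, hl, rfl⟩ := hu
    induction hv using Submodule.span_induction with
    | zero => simp
    | add u u' _ _ hu hu' => rw [mul_add]; exact add_mem hu hu'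
    | smul c u _ hu => rw [mul_smul_comm]; exact Submodule.smul_mem _ c hu
    | mem v hv =>
      obtain ⟨l', hl', rfl⟩ := hv
      rw [← word_append]
      simp only [Set.mem_ofPred_eq] at hl hl'
      exact F.word_mem_filt (by rw [List.length_append]; omega)

theorem one_mem_filt (n : ℕ) : (1 : H) ∈ F.filt n := F.word_mem_filt (l := []) (by simp)

theorem exists_mem_filt (u : H) : ∃ n, u ∈ F.filt n := by
  have hu : u ∈ Submodule.span k (Set.range F.word) := by
    rw [show Submodule.span k (Set.range F.word) = ⊤ from F.span_words]; trivial
  induction hu using Submodule.span_induction with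
  | zero => exact ⟨0, zero_mem _⟩
  | add u v _ _ hu hv =>
    obtain ⟨m, hm⟩ := hu
    obtain ⟨n, hn⟩ := hv
    exact ⟨m + n, add_mem (F.filt_mono (by omega) hm) (F.filt_mono (by omega) hn)⟩
  | smul c u _ hu => obtain ⟨m, hm⟩ := hu; exact ⟨m, Submodule.smul_mem _ c hm⟩
  | mem u hu => obtain ⟨l, rfl⟩ := hu; exact ⟨l.length, F.word_mem_filt le_rfl⟩

theorem tmul_mem_filt (G : CoPoissonFrame k K κ) {m n p : ℕ} {u : H} {v : K} (hu : u ∈ F.filt m)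
    (hv : v ∈ G.filt n) (h : m + n ≤ p) : u ⊗ₜ[k] v ∈ (F.tensor G).filt p := by
  induction hu using Submodule.span_induction with
  | zero => simp
  | add u u' _ _ hu hu' => rw [TensorProduct.add_tmul]; exact add_mem hu hu'
  | smul c u _ hu => rw [← TensorProduct.smul_tmul']; exact Submodule.smul_mem _ c hu
  | mem u hu =>
    obtain ⟨l, hl, rfl⟩ := hu
    induction hv using Submodule.span_induction with
    | zero => simp
    | add u u' _ _ hu hu' => rw [TensorProduct.tmul_add]; exact add_mem hu hu'
    | smul c u _ hu => rw [TensorProduct.tmul_smul]; exact Submodule.smul_mem _ c hu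
    | mem v hv =>
      obtain ⟨l', hl', rfl⟩ := hv
      rw [← tensor_word]
      simp only [Set.mem_ofPred_eq] at hl hl'
      exact word_mem_filt _ (by simp; omega)

theorem I_apply_filt [Coalgebra.IsCocomm k H] {p n : ℕ} {f : FormalFun k H} (hf : f ∈ F.I p)
    {u : H} (hu : u ∈ F.filt n) (h : n < p) : f.ofConv u = 0 := by
  induction hu using Submodule.span_induction with
  | zero => simp
  | add u u' _ _ hu hu' => rw [map_add, hu, hu', add_zero]
  | smul c u _ hu => rw [map_smul, hu, smul_zero]
  | mem u hu =>
    obtain ⟨l, hl, rfl⟩ := hu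
    simp only [Set.mem_ofPred_eq] at hl
    exact hf l (by omega)

/-- The equality `{1, 1} = 0`. -/
theorem counit_counit_δ [Coalgebra.IsCocomm k H] (f : FormalFun k H) : F.br f 1 = 0 := by
  have h := F.br_mul f 1 1
  rw [mul_one, mul_one, one_mul] at h
  exact left_eq_add.1 h

end Filtration

theorem map_map_tensorComm₄ {A B A' B' : Type*} [Ring A] [Algebra k A] [Ring B] [Algebra k B]
    [Ring A'] [Algebra k A'] [Ring B'] [Algebra k B'] (φ : A →ₗ[k] A') (ψ : B →ₗ[k] B')
    (s : A ⊗[k] A) (t : B ⊗[k] B) :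
    TensorProduct.map (TensorProduct.map φ ψ) (TensorProduct.map φ ψ)
      (tensorComm₄ k A A B B (s ⊗ₜ t)) =
    tensorComm₄ k A' A' B' B' (TensorProduct.map φ φ s ⊗ₜ TensorProduct.map ψ ψ t) := by
  induction s with
  | zero => simp
  | add s s' hs hs' => simp only [TensorProduct.add_tmul, map_add, hs, hs']
  | tmul a a' =>
    induction t with
    | zero => simp
    | add t t' ht ht' => simp only [TensorProduct.tmul_add, map_add, ht, ht']
    | tmul b b' => simp [tensorComm₄_tmul]

theorem map_assoc_tensorComm₄ {A B C : Type*} [Ring A] [Algebra k A] [Ring B] [Algebra k B]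
    [Ring C] [Algebra k C] (s : A ⊗[k] A) (t : B ⊗[k] B) (r : C ⊗[k] C) :
    TensorProduct.map (TensorProduct.assoc k A B C).toLinearMap
        (TensorProduct.assoc k A B C).toLinearMap
      (tensorComm₄ k (A ⊗[k] B) (A ⊗[k] B) C C (tensorComm₄ k A A B B (s ⊗ₜ t) ⊗ₜ r)) =
    tensorComm₄ k A A (B ⊗[k] C) (B ⊗[k] C) (s ⊗ₜ tensorComm₄ k B B C C (t ⊗ₜ r)) := by
  induction s with
  | zero => simp
  | add s s' hs hs' => simp only [TensorProduct.add_tmul, map_add, hs, hs']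
  | tmul a a' =>
    induction t with
    | zero => simp
    | add t t' ht ht' => simp only [TensorProduct.tmul_add, TensorProduct.add_tmul, map_add, ht, ht']
    | tmul b b' =>
      induction r with
      | zero => simp
      | add t t' ht ht' => simp only [TensorProduct.tmul_add, map_add, ht, ht']
      | tmul c c' => simp [tensorComm₄_tmul]

/-- A morphism of coalgebras compatible with the co-Poisson structures and with the filtrations by
the length of words. -/
structure Hom (F : CoPoissonFrame k H ι) (G : CoPoissonFrame k K κ) where
  map : H →ₗ[k] K
  counit_map : ∀ u, Coalgebra.counit (R := k) (map u) = Coalgebra.counit (R := k) u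
  comul_map : ∀ u, Coalgebra.comul (R := k) (map u) =
    TensorProduct.map map map (Coalgebra.comul (R := k) u)
  δ_map : ∀ u, G.δ (map u) = TensorProduct.map map map (F.δ u)
  map_word : ∀ l, map (F.word l) ∈ G.filt l.length

namespace Hom

variable {F : CoPoissonFrame k H ι} {G : CoPoissonFrame k K κ} {L : CoPoissonFrame k M μ}

theorem map_mem_filt (φ : Hom F G) {n : ℕ} {u : H} (hu : u ∈ F.filt n) : φ.map u ∈ G.filt n := by
  induction hu using Submodule.span_induction with
  | zero => simp
  | add u u' _ _ hu hu' => rw [map_add]; exact add_mem hu hu'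
  | smul c u _ hu => rw [map_smul]; exact Submodule.smul_mem _ c hu
  | mem u hu =>
    obtain ⟨l, hl, rfl⟩ := hu
    exact G.filt_mono hl (φ.map_word l)

variable (F) in
/-- The identity. -/
def id : Hom F F where
  map := LinearMap.id
  counit_map _ := rfl
  comul_map u := by rw [TensorProduct.map_id]; rfl
  δ_map u := by rw [TensorProduct.map_id]; rfl
  map_word l := F.word_mem_filt le_rfl

/-- The composition of two morphisms. -/
def comp (ψ : Hom G L) (φ : Hom F G) : Hom F L where
  map := ψ.map ∘ₗ φ.map
  counit_map u := by rw [LinearMap.comp_apply, ψ.counit_map, φ.counit_map]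
  comul_map u := by
    rw [LinearMap.comp_apply, ψ.comul_map, φ.comul_map, TensorProduct.map_comp]; rfl
  δ_map u := by rw [LinearMap.comp_apply, ψ.δ_map, φ.δ_map, TensorProduct.map_comp]; rfl
  map_word l := ψ.map_mem_filt (φ.map_word l)

/-- The tensor product of two morphisms. -/
def tensor {H' ι' K' κ' : Type*} [Ring H'] [Bialgebra k H'] [Fintype ι'] [Ring K'] [Bialgebra k K']
    [Fintype κ'] {F' : CoPoissonFrame k H' ι'} {G' : CoPoissonFrame k K' κ'} (φ : Hom F G)
    (ψ : Hom F' G') : Hom (F.tensor F') (G.tensor G') where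
  map := TensorProduct.map φ.map ψ.map
  counit_map u := by
    induction u with
    | zero => simp
    | add u v hu hv => simp only [map_add, hu, hv]
    | tmul a b => simp [φ.counit_map, ψ.counit_map]
  comul_map u := by
    induction u with
    | zero => simp
    | add u v hu hv => simp only [map_add, hu, hv]
    | tmul a b =>
      rw [comul_tmul_eq, map_map_tensorComm₄, TensorProduct.map_tmul,
        comul_tmul_eq, φ.comul_map, ψ.comul_map]
  δ_map u := by
    induction u with
    | zero => simp
    | add u v hu hv => simp only [map_add, hu, hv]
    | tmul a b =>
      change coPoissonTensor G.δ G'.δ _ =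
        TensorProduct.map _ _ (coPoissonTensor F.δ F'.δ (a ⊗ₜ b))
      rw [coPoissonTensor_tmul, map_add, map_add, map_map_tensorComm₄,
        map_map_tensorComm₄, TensorProduct.map_tmul,
        coPoissonTensor_tmul, φ.comul_map, ψ.comul_map, φ.δ_map, ψ.δ_map, map_add]
  map_word l := by
    obtain ⟨l₁, l₂, h, h'⟩ := exists_tensor_word F F' l
    rw [h', TensorProduct.map_tmul]
    exact tmul_mem_filt _ _ (φ.map_word l₁) (ψ.map_word l₂) h.le

variable (F G L) in
/-- The associativity isomorphism. -/
def assoc : Hom ((F.tensor G).tensor L) (F.tensor (G.tensor L)) where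
  map := (TensorProduct.assoc k H K M).toLinearMap
  counit_map u := by
    induction u with
    | zero => simp
    | add u v hu hv => simp only [map_add, hu, hv]
    | tmul u c =>
      induction u with
      | zero => simp
      | add u v hu hv => simp only [map_add, TensorProduct.add_tmul, hu, hv]
      | tmul a b => simp; ring
  comul_map u := by
    induction u with
    | zero => simp
    | add u v hu hv => simp only [map_add, hu, hv]
    | tmul u c =>
      induction u with
      | zero => simp
      | add u v hu hv => simp only [map_add, TensorProduct.add_tmul, hu, hv]
      | tmul a b =>
        rw [comul_tmul_eq, comul_tmul_eq, map_assoc_tensorComm₄]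
        rfl
  δ_map u := by
    induction u with
    | zero => simp
    | add u v hu hv => simp only [map_add, hu, hv]
    | tmul u c =>
      induction u with
      | zero => simp
      | add u v hu hv => simp only [map_add, TensorProduct.add_tmul, hu, hv]
      | tmul a b =>
        change coPoissonTensor F.δ (coPoissonTensor G.δ L.δ) (a ⊗ₜ (b ⊗ₜ c)) = TensorProduct.map _ _
          (coPoissonTensor (coPoissonTensor F.δ G.δ) L.δ ((a ⊗ₜ b) ⊗ₜ c))
        rw [coPoissonTensor_tmul, coPoissonTensor_tmul, coPoissonTensor_tmul, coPoissonTensor_tmul,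
          comul_tmul_eq, comul_tmul_eq]
        simp only [map_add, TensorProduct.add_tmul, TensorProduct.tmul_add,
          map_assoc_tensorComm₄]
        abel
  map_word l := by
    obtain ⟨l', l₃, h, e⟩ := exists_tensor_word (F.tensor G) L l
    obtain ⟨l₁, l₂, h', e'⟩ := exists_tensor_word F G l'
    rw [e, e']
    change F.word l₁ ⊗ₜ (G.word l₂ ⊗ₜ L.word l₃) ∈ _
    exact tmul_mem_filt _ _ (F.word_mem_filt le_rfl)
      (tmul_mem_filt _ _ (G.word_mem_filt le_rfl) (L.word_mem_filt le_rfl) le_rfl) (by omega)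

theorem counit_word (l : List ι) : l ≠ [] → Coalgebra.counit (R := k) (F.word l) = 0 := by
  intro hl
  obtain ⟨i, l, rfl⟩ := List.exists_cons_of_ne_nil hl
  rw [word_cons, Bialgebra.counit_mul, F.counit_x, zero_mul]

/-- The map `ε ⊗ ε`. -/
theorem tmul_one_one (t : H ⊗[k] H) : (tmul (1 : FormalFun k H) (1 : FormalFun k H)).ofConv t =
    Coalgebra.counit (R := k) t := by
  induction t with
  | zero => simp
  | add s t hs ht => rw [map_add, map_add, hs, ht]
  | tmul a b => rw [tmul_tmul, one_apply, one_apply]; simp [mul_comm]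

theorem counit_comul' (u : H) : Coalgebra.counit (R := k) (Coalgebra.comul (R := k) u) =
    Coalgebra.counit (R := k) u := by
  rw [← tmul_one_one, ← pullback_apply, ← mul_eq_pullback, one_mul, one_apply]

theorem counit_δ [Coalgebra.IsCocomm k H] (u : H) : Coalgebra.counit (R := k) (F.δ u) = 0 := by
  rw [← tmul_one_one]
  exact LinearMap.congr_fun (congrArg WithConv.ofConv (F.counit_counit_δ 1)) u


theorem map_counitRight (s : H ⊗[k] H) (t : K ⊗[k] K) :
    TensorProduct.map (TensorProduct.rid k H ∘ₗ TensorProduct.map LinearMap.id Coalgebra.counit)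
      (TensorProduct.rid k H ∘ₗ TensorProduct.map LinearMap.id Coalgebra.counit)
      (tensorComm₄ k H H K K (s ⊗ₜ t)) = Coalgebra.counit (R := k) t • s := by
  induction s with
  | zero => simp
  | add s s' hs hs' => simp only [TensorProduct.add_tmul, map_add, hs, hs', smul_add]
  | tmul a a' =>
    induction t with
    | zero => simp
    | add t t' ht ht' => simp only [TensorProduct.tmul_add, map_add, ht, ht', add_smul]
    | tmul b b' =>
      simp [tensorComm₄_tmul, ← TensorProduct.smul_tmul', TensorProduct.tmul_smul, mul_smul]

theorem map_counitLeft (s : H ⊗[k] H) (t : K ⊗[k] K) :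
    TensorProduct.map (TensorProduct.lid k K ∘ₗ TensorProduct.map Coalgebra.counit LinearMap.id)
      (TensorProduct.lid k K ∘ₗ TensorProduct.map Coalgebra.counit LinearMap.id)
      (tensorComm₄ k H H K K (s ⊗ₜ t)) = Coalgebra.counit (R := k) s • t := by
  induction s with
  | zero => simp
  | add s s' hs hs' => simp only [TensorProduct.add_tmul, map_add, hs, hs', add_smul]
  | tmul a a' =>
    induction t with
    | zero => simp
    | add t t' ht ht' => simp only [TensorProduct.tmul_add, map_add, ht, ht', smul_add]
    | tmul b b' =>
      simp [tensorComm₄_tmul, ← TensorProduct.smul_tmul', TensorProduct.tmul_smul, mul_smul]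

variable (F G) in
/-- The contraction `id ⊗ ε`. -/
def counitRight [Coalgebra.IsCocomm k K] : Hom (F.tensor G) F where
  map := TensorProduct.rid k H ∘ₗ TensorProduct.map LinearMap.id Coalgebra.counit
  counit_map u := by
    induction u with
    | zero => simp
    | add u v hu hv => simp only [map_add, hu, hv]
    | tmul a b => simp
  comul_map u := by
    induction u with
    | zero => simp
    | add u v hu hv => simp only [map_add, hu, hv]
    | tmul a b =>
      rw [comul_tmul_eq, map_counitRight, counit_comul']
      simp
  δ_map u := by
    induction u with
    | zero => simp
    | add u v hu hv => simp only [map_add, hu, hv]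
    | tmul a b =>
      change _ = TensorProduct.map _ _ (coPoissonTensor F.δ G.δ (a ⊗ₜ b))
      rw [coPoissonTensor_tmul, map_add, map_add, map_counitRight, map_counitRight, counit_comul',
        counit_δ]
      simp
  map_word l := by
    obtain ⟨l₁, l₂, h, h'⟩ := exists_tensor_word F G l
    rw [h']
    simp only [LinearMap.comp_apply, TensorProduct.map_tmul, LinearMap.id_apply,
      LinearEquiv.coe_coe, TensorProduct.rid_tmul]
    exact Submodule.smul_mem _ _ (F.word_mem_filt (by omega))

variable (F G) in
/-- The contraction `ε ⊗ id`. -/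
def counitLeft [Coalgebra.IsCocomm k H] : Hom (F.tensor G) G where
  map := TensorProduct.lid k K ∘ₗ TensorProduct.map Coalgebra.counit LinearMap.id
  counit_map u := by
    induction u with
    | zero => simp
    | add u v hu hv => simp only [map_add, hu, hv]
    | tmul a b => simp [mul_comm]
  comul_map u := by
    induction u with
    | zero => simp
    | add u v hu hv => simp only [map_add, hu, hv]
    | tmul a b =>
      rw [comul_tmul_eq, map_counitLeft, counit_comul']
      simp
  δ_map u := by
    induction u with
    | zero => simp
    | add u v hu hv => simp only [map_add, hu, hv]
    | tmul a b =>
      change _ = TensorProduct.map _ _ (coPoissonTensor F.δ G.δ (a ⊗ₜ b))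
      rw [coPoissonTensor_tmul, map_add, map_add, map_counitLeft, map_counitLeft, counit_comul',
        counit_δ]
      simp
  map_word l := by
    obtain ⟨l₁, l₂, h, h'⟩ := exists_tensor_word F G l
    rw [h']
    simp only [LinearMap.comp_apply, TensorProduct.map_tmul, LinearMap.id_apply,
      LinearEquiv.coe_coe, TensorProduct.lid_tmul]
    exact Submodule.smul_mem _ _ (G.word_mem_filt (by omega))

variable (F G) in
/-- The insertion `u ↦ u ⊗ 1`. -/
def unitRight : Hom F (F.tensor G) where
  map := (TensorProduct.mk k H K).flip 1
  counit_map u := by simp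
  comul_map u := by
    have h : ∀ s : H ⊗[k] H, TensorProduct.map ((TensorProduct.mk k H K).flip 1)
        ((TensorProduct.mk k H K).flip 1) s = tensorComm₄ k H H K K (s ⊗ₜ (1 ⊗ₜ 1)) := by
      intro s
      induction s with
      | zero => simp
      | add s s' hs hs' => simp only [TensorProduct.add_tmul, map_add, hs, hs']
      | tmul a a' => rfl
    rw [h, LinearMap.flip_apply, TensorProduct.mk_apply, comul_tmul_eq, Bialgebra.comul_one]
    rfl
  δ_map u := by
    have h : ∀ s : H ⊗[k] H, TensorProduct.map ((TensorProduct.mk k H K).flip 1)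
        ((TensorProduct.mk k H K).flip 1) s = tensorComm₄ k H H K K (s ⊗ₜ (1 ⊗ₜ 1)) := by
      intro s
      induction s with
      | zero => simp
      | add s s' hs hs' => simp only [TensorProduct.add_tmul, map_add, hs, hs']
      | tmul a a' => rfl
    change coPoissonTensor F.δ G.δ (u ⊗ₜ 1) = _
    rw [h, coPoissonTensor_tmul, G.δ_one, Bialgebra.comul_one, TensorProduct.tmul_zero, add_zero]
    rfl
  map_word l := tmul_mem_filt _ _ (F.word_mem_filt le_rfl) (G.one_mem_filt 0) le_rfl

variable (F G) in
/-- The insertion `u ↦ 1 ⊗ u`. -/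
def unitLeft : Hom G (F.tensor G) where
  map := TensorProduct.mk k H K 1
  counit_map u := by simp
  comul_map u := by
    have h : ∀ s : K ⊗[k] K, TensorProduct.map (TensorProduct.mk k H K 1)
        (TensorProduct.mk k H K 1) s = tensorComm₄ k H H K K ((1 ⊗ₜ 1) ⊗ₜ s) := by
      intro s
      induction s with
      | zero => simp
      | add s s' hs hs' => simp only [TensorProduct.tmul_add, map_add, hs, hs']
      | tmul a a' => rfl
    rw [h, TensorProduct.mk_apply, comul_tmul_eq, Bialgebra.comul_one]
    rfl
  δ_map u := by
    have h : ∀ s : K ⊗[k] K, TensorProduct.map (TensorProduct.mk k H K 1)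
        (TensorProduct.mk k H K 1) s = tensorComm₄ k H H K K ((1 ⊗ₜ 1) ⊗ₜ s) := by
      intro s
      induction s with
      | zero => simp
      | add s s' hs hs' => simp only [TensorProduct.tmul_add, map_add, hs, hs']
      | tmul a a' => rfl
    change coPoissonTensor F.δ G.δ (1 ⊗ₜ u) = _
    rw [h, coPoissonTensor_tmul, F.δ_one, Bialgebra.comul_one, TensorProduct.zero_tmul, zero_add]
    rfl
  map_word l := tmul_mem_filt _ _ (F.one_mem_filt 0) (G.word_mem_filt le_rfl) (by omega)

theorem map_mul' (s t : H ⊗[k] H) : TensorProduct.map (LinearMap.mul' k H) (LinearMap.mul' k H)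
    (tensorComm₄ k H H H H (s ⊗ₜ t)) = s * t := by
  induction s with
  | zero => simp
  | add s s' hs hs' => simp only [TensorProduct.add_tmul, map_add, hs, hs', add_mul]
  | tmul a a' =>
    induction t with
    | zero => simp
    | add t t' ht ht' => simp only [TensorProduct.tmul_add, map_add, ht, ht', mul_add]
    | tmul b b' => simp [tensorComm₄_tmul]

/-! ### The action of morphisms on functions -/

/-- The pullback of functions along a morphism. -/
def pull (φ : Hom F G) : FormalFun k K →ₗ[k] FormalFun k H := pullback φ.map

theorem pull_apply (φ : Hom F G) (f : FormalFun k K) (u : H) :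
    (φ.pull f).ofConv u = f.ofConv (φ.map u) := rfl

theorem pull_br (φ : Hom F G) (f g : FormalFun k K) :
    φ.pull (G.br f g) = F.br (φ.pull f) (φ.pull g) := by
  refine ext_ofConv fun u => ?_
  change (tmul f g).ofConv (G.δ (φ.map u)) = (tmul (pullback _ f) (pullback _ g)).ofConv (F.δ u)
  rw [tmul_pullback, φ.δ_map]
  rfl

theorem pull_mul (φ : Hom F G) (f g : FormalFun k K) :
    φ.pull (f * g) = φ.pull f * φ.pull g := by
  refine ext_ofConv fun u => ?_
  change (tmul f g).ofConv (Coalgebra.comul (φ.map u)) =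
    (tmul (pullback _ f) (pullback _ g)).ofConv (Coalgebra.comul u)
  rw [tmul_pullback, φ.comul_map]
  rfl

section

variable [Coalgebra.IsCocomm k H] [Coalgebra.IsCocomm k K] [Coalgebra.IsCocomm k M]

theorem pull_mem_I (φ : Hom F G) {p : ℕ} {f : FormalFun k K} (hf : f ∈ G.I p) :
    φ.pull f ∈ F.I p :=
  fun l hl => G.I_apply_filt hf (φ.map_word l) hl

/-- The morphism of Lie algebras of functions induced by a morphism. -/
def lie [CharZero k] (φ : Hom F G) : G.LieFun →ₗ⁅k⁆ F.LieFun where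
  toFun f := LieFun.mk (φ.pull (LieFun.val f)) (φ.pull_mem_I (LieFun.val_mem f))
  map_add' f g := LieFun.val_injective (by simp [LieFun.val_mk])
  map_smul' c f := LieFun.val_injective (by simp [LieFun.val_mk])
  map_lie' {f g} := LieFun.val_injective (φ.pull_br _ _)

variable [CharZero k]

theorem val_lie (φ : Hom F G) (f : G.LieFun) : LieFun.val (φ.lie f) = φ.pull (LieFun.val f) := rfl

/-- The morphism of jets induced by a morphism. -/
def jet (φ : Hom F G) (p : ℕ) : G.Jet p →ₗ⁅k⁆ F.Jet p :=
  { Submodule.mapQ (G.J p).toSubmodule (F.J p).toSubmodule (φ.lie : G.LieFun →ₗ[k] F.LieFun)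
      (fun _ hf => φ.pull_mem_I hf) with
    map_lie' := by
      rintro ⟨f⟩ ⟨g⟩
      exact congrArg LieSubmodule.Quotient.mk (LieHom.map_lie φ.lie f g) }

end

end Hom

section Group

variable [CharZero k] [Coalgebra.IsCocomm k H] (F : CoPoissonFrame k H ι)

/-- The jet of order `p` of a function. -/
def jetMk (p : ℕ) : F.LieFun →ₗ[k] F.Jet p := (F.J p).toSubmodule.mkQ

theorem jetMk_lie (p : ℕ) (f g : F.LieFun) : F.jetMk p ⁅f, g⁆ = ⁅F.jetMk p f, F.jetMk p g⁆ := rfl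

theorem jetMk_surjective (p : ℕ) : Function.Surjective (F.jetMk p) :=
  Submodule.Quotient.mk_surjective _

theorem jetMk_eq_zero {p : ℕ} {f : F.LieFun} : F.jetMk p f = 0 ↔ LieFun.val f ∈ F.I p :=
  Submodule.Quotient.mk_eq_zero (F.J p).toSubmodule

/-- The class of a function in the group attached to the nilpotent Lie algebra of jets. -/
def gp (p : ℕ) (f : F.LieFun) : ExpGroup k (F.Jet p) := ExpGroup.exp (F.jetMk p f)

theorem gp_eq_iff {p : ℕ} {f g : F.LieFun} :
    F.gp p f = F.gp p g ↔ LieFun.val f - LieFun.val g ∈ F.I p := by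
  rw [ExpGroup.ext_iff, ← map_sub, ← jetMk_eq_zero, map_sub, sub_eq_zero]
  rfl

theorem gp_surjective {p : ℕ} (a : ExpGroup k (F.Jet p)) : ∃ f, F.gp p f = a := by
  obtain ⟨f, hf⟩ := F.jetMk_surjective p a.log
  exact ⟨f, ExpGroup.ext hf⟩

theorem lie_jetMk_eq_zero {p : ℕ} {f : F.LieFun} (hf : LieFun.val f ∈ F.I (p - 1))
    (z : F.Jet p) : ⁅F.jetMk p f, z⁆ = 0 := by
  obtain ⟨g, rfl⟩ := F.jetMk_surjective p z
  rw [← jetMk_lie, jetMk_eq_zero]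
  exact F.br_mem_I hf (LieFun.val_mem g) (by omega)

/-- Functions vanishing to order `p - 1` are central modulo functions vanishing to order `p`. -/
theorem gp_add {p : ℕ} {f g : F.LieFun} (hf : LieFun.val f ∈ F.I (p - 1)) :
    F.gp p (f + g) = F.gp p f * F.gp p g := by
  refine ExpGroup.ext ?_
  rw [ExpGroup.log_mul, lieBch_eq_add]
  · rfl
  · exact F.lie_jetMk_eq_zero hf _

theorem gp_central {p : ℕ} {f : F.LieFun} (hf : LieFun.val f ∈ F.I (p - 1))
    (a : ExpGroup k (F.Jet p)) : F.gp p f * a = a * F.gp p f := by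
  obtain ⟨g, rfl⟩ := F.gp_surjective a
  refine ExpGroup.ext ?_
  have h : ∀ z : F.Jet p, ⁅(F.gp p f).log, z⁆ = 0 := F.lie_jetMk_eq_zero hf
  rw [ExpGroup.log_mul, lieBch_eq_add (h _)]
  have h2 : ExpGroup.log (F.gp p g * F.gp p f) = (F.gp p g).log + (F.gp p f).log := by
    have := congrArg ExpGroup.log (mul_inv_rev (F.gp p f)⁻¹ (F.gp p g)⁻¹)
    rw [inv_inv, inv_inv] at this
    rw [← this, ExpGroup.log_inv, ExpGroup.log_mul, lieBch_eq_add (by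
      rw [ExpGroup.log_inv, neg_lie, h, neg_zero]), ExpGroup.log_inv, ExpGroup.log_inv]
    abel
  rw [h2, add_comm]

theorem gp_zero (p : ℕ) : F.gp p 0 = 1 := rfl

theorem nestedBracket_mem_I : ∀ l : List (FormalFun k H), (∀ f ∈ l, f ∈ F.I 2) →
    nestedBracket (fun f g => F.br f g) l ∈ F.I (l.length + 1)
  | [], _ => zero_mem _
  | [f], h => h f (by simp)
  | f :: g :: l, h => by
    have := nestedBracket_mem_I (g :: l) (fun f hf => h f (by simp at hf ⊢; tauto))
    exact F.br_mem_I (h f (by simp)) this (by simp; omega)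

theorem bchTerm_mem_I {f g : FormalFun k H} (hf : f ∈ F.I 2) (hg : g ∈ F.I 2) (n : ℕ) :
    bchTerm k (fun f g => F.br f g) f g n ∈ F.I (n + 1) := by
  refine bchTerm_mem _ fun l hl hlen => ?_
  rw [← hlen]
  refine F.nestedBracket_mem_I l fun a ha => ?_
  rcases hl a ha with rfl | rfl
  exacts [hf, hg]

theorem gp_mul_eq_iff {p N : ℕ} {f g h : F.LieFun} (hN : p ≤ N + 1) :
    F.gp p f * F.gp p g = F.gp p h ↔
      (∑ n ∈ Finset.range N, bchTerm k (fun f g => F.br f g) (LieFun.val f) (LieFun.val g) n) -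
        LieFun.val h ∈ F.I p := by
  obtain ⟨c, hc⟩ := exists_nestedBracket_eq_zero (F.Jet p)
  set M := max c N
  let S : F.LieFun := ∑ n ∈ Finset.Ico 1 M, bchTerm k (fun f g : F.LieFun => ⁅f, g⁆) f g n
  have h1 : F.gp p f * F.gp p g = F.gp p S := by
    refine ExpGroup.ext ?_
    rw [ExpGroup.log_mul, lieBch_eq_sum (c := M) fun l hl => hc l ((le_max_left c N).trans hl)]
    have : (F.gp p S).log = F.jetMk p S := rfl
    rw [this, map_sum]
    refine Finset.sum_congr rfl fun n _ => ?_
    exact (map_bchTerm (F.jetMk p) _ _ (F.jetMk_lie p) f g n).symm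
  have h2 : LieFun.val S = ∑ n ∈ Finset.range M,
      bchTerm k (fun f g => F.br f g) (LieFun.val f) (LieFun.val g) n := by
    rw [map_sum, Finset.range_eq_Ico]
    have : ∀ n, LieFun.val (bchTerm k (fun f g : F.LieFun => ⁅f, g⁆) f g n) =
        bchTerm k (fun f g => F.br f g) (LieFun.val f) (LieFun.val g) n :=
      map_bchTerm LieFun.val _ _ (fun a b => LieFun.val_lie a b) f g
    simp only [this]
    refine Finset.sum_subset (Finset.Ico_subset_Ico (by omega) le_rfl) fun n hn hn' => ?_
    have : n = 0 := by simp at hn hn'; omega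
    rw [this, bchTerm_zero]
  have h3 : (∑ n ∈ Finset.range M,
        bchTerm k (fun f g => F.br f g) (LieFun.val f) (LieFun.val g) n) -
      (∑ n ∈ Finset.range N,
        bchTerm k (fun f g => F.br f g) (LieFun.val f) (LieFun.val g) n) ∈ F.I p := by
    rw [← Finset.sum_range_add_sum_Ico _ (le_max_right c N), add_sub_cancel_left]
    exact sum_mem fun n hn => F.I_anti (by simp at hn; omega)
      (F.bchTerm_mem_I (LieFun.val_mem f) (LieFun.val_mem g) n)
  rw [h1, gp_eq_iff, h2]
  constructor
  · intro h; have := sub_mem h h3; simpa using this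
  · intro h; have := add_mem h h3; simpa using this

variable {F} [Coalgebra.IsCocomm k K] {G : CoPoissonFrame k K κ}

/-- The morphism of groups induced by a morphism. -/
def Hom.grp (φ : Hom F G) (p : ℕ) : ExpGroup k (G.Jet p) →* ExpGroup k (F.Jet p) :=
  ExpGroup.map (φ.jet p)

theorem Hom.grp_gp (φ : Hom F G) (p : ℕ) (f : G.LieFun) :
    φ.grp p (G.gp p f) = F.gp p (φ.lie f) := rfl

end Group
end CoPoissonFrame

/-- The multiplication of `U(g*)`. -/
def LieBialgebra.mulHom {k g : Type*} [Field k] [CharZero k] [LieRing g] [LieAlgebra k g]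
    [Module.Finite k g] (B : LieBialgebra k g) :
    CoPoissonFrame.Hom (B.frame.tensor B.frame) B.frame where
  map := LinearMap.mul' k B.U
  counit_map u := by
    induction u with
    | zero => simp
    | add u v hu hv => simp only [map_add, hu, hv]
    | tmul a b => simp [mul_comm]
  comul_map u := by
    induction u with
    | zero => simp
    | add u v hu hv => simp only [map_add, hu, hv]
    | tmul a b =>
      rw [comul_tmul_eq, CoPoissonFrame.Hom.map_mul', LinearMap.mul'_apply, Bialgebra.comul_mul]
  δ_map u := by
    induction u with
    | zero => simp
    | add u v hu hv => simp only [map_add, hu, hv]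
    | tmul a b =>
      change _ = TensorProduct.map _ _ (coPoissonTensor B.coPoisson B.coPoisson (a ⊗ₜ b))
      rw [coPoissonTensor_tmul, map_add, map_add, CoPoissonFrame.Hom.map_mul',
        CoPoissonFrame.Hom.map_mul', LinearMap.mul'_apply]
      exact B.coPoisson_mul a b
  map_word l := by
    obtain ⟨l₁, l₂, h, h'⟩ := CoPoissonFrame.exists_tensor_word B.frame B.frame l
    rw [h', LinearMap.mul'_apply]
    exact B.frame.mul_mem_filt (B.frame.word_mem_filt le_rfl) (B.frame.word_mem_filt le_rfl) h.le

/-! ### The Poincaré-Birkhoff-Witt theorem -/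

namespace PBW

variable {k : Type*} [Field k] {ι : Type*} [LinearOrder ι]

/-- The vector `z_P` of the free vector space on monomials. -/
abbrev z (k : Type*) [Field k] {ι : Type*} (P : Multiset ι) : Multiset ι →₀ k := Finsupp.single P 1

theorem exists_min (P : Multiset ι) (hP : P ≠ 0) : ∃ j Q, P = j ::ₘ Q ∧ ∀ l ∈ Q, j ≤ l := by
  obtain ⟨a, ha⟩ := Multiset.exists_mem_of_ne_zero hP
  obtain ⟨j, hj, hmin⟩ := P.toFinset.exists_min_image id ⟨a, Multiset.mem_toFinset.2 ha⟩
  obtain ⟨Q, hQ⟩ := Multiset.exists_cons_of_mem (Multiset.mem_toFinset.1 hj)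
  exact ⟨j, Q, hQ, fun l hl => hmin l (Multiset.mem_toFinset.2 (by
    rw [hQ]; exact Multiset.mem_cons_of_mem hl))⟩

theorem min_unique {j j' : ι} {Q Q' : Multiset ι} (h : j ::ₘ Q = j' ::ₘ Q') (hQ : ∀ l ∈ Q, j ≤ l)
    (hQ' : ∀ l ∈ Q', j' ≤ l) : j = j' ∧ Q = Q' := by
  have e : j = j' := by
    refine le_antisymm ?_ ?_
    · have : j' ∈ j ::ₘ Q := by rw [h]; exact Multiset.mem_cons_self _ _
      rcases Multiset.mem_cons.1 this with e | e
      · exact e.ge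
      · exact hQ _ e
    · have : j ∈ j' ::ₘ Q' := by rw [← h]; exact Multiset.mem_cons_self _ _
      rcases Multiset.mem_cons.1 this with e | e
      · exact e.ge
      · exact hQ' _ e
  subst e
  exact ⟨rfl, (Multiset.cons_inj_right j).1 h⟩

variable [Fintype ι]

/-- The action of a basis vector `x i` on the monomial `z_P`: it is `z_{i + P}` if `i ≤ P`, and
otherwise it is computed by means of `x i x j = x j x i + [x i, x j]`, for `j` the smallest element
of `P`. The condition on the cardinality of `R` always holds. -/
def actAux (c : ι → ι → ι → k) (P : Multiset ι) (i : ι) : Multiset ι →₀ k :=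
  open Classical in
  if h : ∃ j Q, P = j ::ₘ Q ∧ (∀ l ∈ Q, j ≤ l) ∧ j < i then
    z k (i ::ₘ P) + (actAux c h.choose_spec.choose i - z k (i ::ₘ h.choose_spec.choose)).sum
      (fun R a => if Multiset.card R < Multiset.card P then a • actAux c R h.choose else 0) +
      ∑ m, c i h.choose m • actAux c h.choose_spec.choose m
  else z k (i ::ₘ P)
termination_by Multiset.card P
decreasing_by
  · have h2 := congrArg Multiset.card h.choose_spec.choose_spec.1
    rw [Multiset.card_cons] at h2; omega
  · assumption
  · have h2 := congrArg Multiset.card h.choose_spec.choose_spec.1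
    rw [Multiset.card_cons] at h2; omega

/-- The operator of the basis vector `x i`. -/
def act (c : ι → ι → ι → k) (i : ι) : (Multiset ι →₀ k) →ₗ[k] (Multiset ι →₀ k) :=
  Finsupp.lsum k fun P => LinearMap.toSpanSingleton k _ (actAux c P i)

theorem act_z (c : ι → ι → ι → k) (i : ι) (P : Multiset ι) : act c i (z k P) = actAux c P i := by
  simp [act]

/-- The span of the monomials of degree at most `n`. -/
def deg (k ι : Type*) [Field k] (n : ℕ) : Submodule k (Multiset ι →₀ k) :=
  Finsupp.supported k k {P | Multiset.card P ≤ n}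

theorem z_mem_deg {P : Multiset ι} {n : ℕ} (h : Multiset.card P ≤ n) : z k P ∈ deg k ι n :=
  Finsupp.single_mem_supported k _ h

theorem deg_mono {m n : ℕ} (h : m ≤ n) : deg k ι m ≤ deg k ι n :=
  Finsupp.supported_mono fun _ hP => le_trans hP h

theorem deg_induction {n : ℕ} {p : (Multiset ι →₀ k) → Prop} (hz : ∀ P, Multiset.card P ≤ n →
    p (z k P)) (h0 : p 0) (hadd : ∀ v w, p v → p w → p (v + w)) (hsmul : ∀ (a : k) v, p v → p (a • v))
    {v : Multiset ι →₀ k} (hv : v ∈ deg k ι n) : p v := by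
  rw [deg, Finsupp.supported_eq_span_single] at hv
  induction hv using Submodule.span_induction with
  | zero => exact h0
  | add v w _ _ hv hw => exact hadd v w hv hw
  | smul a v _ hv => exact hsmul a v hv
  | mem v hv => obtain ⟨P, hP, rfl⟩ := hv; exact hz P hP

theorem act_of_le (c : ι → ι → ι → k) {i : ι} {P : Multiset ι} (h : ∀ j ∈ P, i ≤ j) :
    act c i (z k P) = z k (i ::ₘ P) := by
  rw [act_z, actAux, dif_neg]
  rintro ⟨j, Q, rfl, -, hj⟩
  exact absurd (h j (Multiset.mem_cons_self j Q)) (not_le.2 hj)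

theorem act_aux_of_lt (c : ι → ι → ι → k) {i j : ι} {Q : Multiset ι} (hQ : ∀ l ∈ Q, j ≤ l)
    (hj : j < i) : act c i (z k (j ::ₘ Q)) = z k (i ::ₘ j ::ₘ Q) +
      (act c i (z k Q) - z k (i ::ₘ Q)).sum (fun R a =>
        if Multiset.card R < Multiset.card Q + 1 then a • act c j (z k R) else 0) +
      ∑ m, c i j m • act c m (z k Q) := by
  have h : ∃ j' Q', j ::ₘ Q = j' ::ₘ Q' ∧ (∀ l ∈ Q', j' ≤ l) ∧ j' < i := ⟨j, Q, rfl, hQ, hj⟩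
  obtain ⟨e, e2⟩ := min_unique h.choose_spec.choose_spec.1 hQ h.choose_spec.choose_spec.2.1
  rw [act_z, actAux, dif_pos h]
  simp only [act_z, Multiset.card_cons]
  generalize h.choose_spec.choose = Q' at e2 ⊢
  rw [← e2, ← e]

theorem act_z_sub_mem (c : ι → ι → ι → k) (n : ℕ) : ∀ (P : Multiset ι), Multiset.card P = n →
    ∀ i, act c i (z k P) - z k (i ::ₘ P) ∈ deg k ι n := by
  induction n using Nat.strong_induction_on with
  | _ n ih =>
    intro P hP i
    have hdeg : ∀ R : Multiset ι, Multiset.card R < n → ∀ j, act c j (z k R) ∈ deg k ι n := by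
      intro R hR j
      have := add_mem (deg_mono hR.le (ih _ hR R rfl j))
        (z_mem_deg (k := k) (P := j ::ₘ R) (n := n) (by rw [Multiset.card_cons]; omega))
      rwa [sub_add_cancel] at this
    by_cases h : ∀ j ∈ P, i ≤ j
    · rw [act_of_le c h, sub_self]; exact zero_mem _
    · obtain ⟨j, Q, rfl, hQ⟩ := exists_min P (by rintro rfl; simp at h)
      have hj : j < i := by
        by_contra hj
        exact h fun l hl => (not_lt.1 hj).trans (by
          rcases Multiset.mem_cons.1 hl with rfl | hl
          · exact le_rfl
          · exact hQ l hl)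
      rw [Multiset.card_cons] at hP
      rw [act_aux_of_lt c hQ hj, add_assoc, add_sub_cancel_left]
      refine add_mem ?_ (sum_mem fun m _ => Submodule.smul_mem _ _ (hdeg Q (by omega) m))
      refine sum_mem fun R _ => ?_
      dsimp only
      split_ifs with hR
      · exact Submodule.smul_mem _ _ (hdeg R (by omega) j)
      · exact zero_mem _

theorem act_of_lt (c : ι → ι → ι → k) {i j : ι} {Q : Multiset ι} (hQ : ∀ l ∈ Q, j ≤ l)
    (hj : j < i) : act c i (z k (j ::ₘ Q)) = act c j (act c i (z k Q)) +
      ∑ m, c i j m • act c m (z k Q) := by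
  rw [act_aux_of_lt c hQ hj]
  congr 1
  have h1 : (act c i (z k Q) - z k (i ::ₘ Q)).sum (fun R a =>
      if Multiset.card R < Multiset.card Q + 1 then a • act c j (z k R) else 0) =
      act c j (act c i (z k Q) - z k (i ::ₘ Q)) := by
    conv_rhs => rw [act, Finsupp.lsum_apply]
    refine Finsupp.sum_congr fun R hR => ?_
    have : Multiset.card R ≤ Multiset.card Q :=
      (Finsupp.mem_supported k _).1 (act_z_sub_mem c _ Q rfl i) hR
    rw [if_pos (by omega), act_z]
    simp [act_z]
  rw [h1, map_sub, act_of_le c (i := j) (P := i ::ₘ Q), Multiset.cons_swap]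
  · abel
  · intro l hl
    rcases Multiset.mem_cons.1 hl with rfl | hl
    · exact hj.le
    · exact hQ l hl

section Lie

variable {L : Type*} [LieRing L] [LieAlgebra k L] (b : Module.Basis ι k L)

/-- The action of the Lie algebra `L`, with basis `b`, on the space of monomials. -/
def lieAct : L →ₗ[k] Module.End k (Multiset ι →₀ k) :=
  b.constr k fun i => act (fun i j m => b.repr ⁅b i, b j⁆ m) i

theorem lieAct_basis (i : ι) : lieAct b (b i) = act (fun i j m => b.repr ⁅b i, b j⁆ m) i :=
  b.constr_basis k _ i

theorem lieAct_of_le {i : ι} {P : Multiset ι} (h : ∀ j ∈ P, i ≤ j) :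
    lieAct b (b i) (z k P) = z k (i ::ₘ P) := by
  rw [lieAct_basis, act_of_le _ h]

theorem lieAct_of_lt {i j : ι} {Q : Multiset ι} (hQ : ∀ l ∈ Q, j ≤ l) (hj : j < i) :
    lieAct b (b i) (z k (j ::ₘ Q)) = lieAct b (b j) (lieAct b (b i) (z k Q)) +
      lieAct b ⁅b i, b j⁆ (z k Q) := by
  rw [lieAct_basis, act_of_lt _ hQ hj, lieAct_basis]
  congr 1
  conv_rhs => rw [← b.sum_repr ⁅b i, b j⁆]
  rw [map_sum, LinearMap.sum_apply]
  exact Finset.sum_congr rfl fun m _ => by rw [map_smul, LinearMap.smul_apply, lieAct_basis]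

theorem lieAct_sub_mem (P : Multiset ι) (i : ι) :
    lieAct b (b i) (z k P) - z k (i ::ₘ P) ∈ deg k ι (Multiset.card P) := by
  rw [lieAct_basis]
  exact act_z_sub_mem _ _ P rfl i

/-- The commutation relation at the vector `v`. -/
def Commutes (x y : L) (v : Multiset ι →₀ k) : Prop :=
  lieAct b x (lieAct b y v) - lieAct b y (lieAct b x v) = lieAct b ⁅x, y⁆ v

variable {b}

theorem Commutes.swap {x y : L} {v : Multiset ι →₀ k} (h : Commutes b x y v) : Commutes b y x v := by
  rw [Commutes, ← lie_skew, map_neg, LinearMap.neg_apply, ← show _ = _ from h]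
  abel

theorem Commutes.add {x y : L} {v w : Multiset ι →₀ k} (h : Commutes b x y v)
    (h' : Commutes b x y w) : Commutes b x y (v + w) := by
  simp only [Commutes, map_add] at h h' ⊢
  rw [← h, ← h']
  abel

theorem Commutes.smul {x y : L} {v : Multiset ι →₀ k} (h : Commutes b x y v) (a : k) :
    Commutes b x y (a • v) := by
  simp only [Commutes, map_smul] at h ⊢
  rw [← h, smul_sub]

theorem commutes_of_basis {v : Multiset ι →₀ k} (h : ∀ i j, Commutes b (b i) (b j) v) (x y : L) :
    Commutes b x y v := by
  have hx : x ∈ Submodule.span k (Set.range b) := by rw [b.span_eq]; trivial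
  have hy : y ∈ Submodule.span k (Set.range b) := by rw [b.span_eq]; trivial
  induction hx using Submodule.span_induction with
  | zero => simp [Commutes]
  | add x x' _ _ hx hx' =>
    simp only [Commutes, map_add, LinearMap.add_apply, add_lie] at hx hx' ⊢
    rw [← hx, ← hx']; abel
  | smul a x _ hx =>
    simp only [Commutes, map_smul, LinearMap.smul_apply, smul_lie] at hx ⊢
    rw [← hx, smul_sub]
  | mem x hx =>
    obtain ⟨i, rfl⟩ := hx
    induction hy using Submodule.span_induction with
    | zero => simp [Commutes]
    | add x x' _ _ hx hx' =>
      simp only [Commutes, map_add, LinearMap.add_apply, lie_add] at hx hx' ⊢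
      rw [← hx, ← hx']; abel
    | smul a x _ hx =>
      simp only [Commutes, map_smul, LinearMap.smul_apply, lie_smul] at hx ⊢
      rw [← hx, smul_sub]
    | mem y hy => obtain ⟨j, rfl⟩ := hy; exact h i j

theorem commutes_of_le {i j : ι} {P : Multiset ι} (hP : ∀ l ∈ P, j ≤ l) (hj : j < i) :
    Commutes b (b i) (b j) (z k P) := by
  rw [Commutes, lieAct_of_le b hP, lieAct_of_lt b hP hj, add_sub_cancel_left]

theorem commutes_z (n : ℕ) : ∀ P : Multiset ι, Multiset.card P = n →
    ∀ x y, Commutes b x y (z k P) := by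
  induction n using Nat.strong_induction_on with
  | _ n ih =>
    intro P hP
    have hlow : ∀ {m : ℕ}, m < n → ∀ v ∈ deg k ι m, ∀ x y, Commutes b x y v := by
      intro m hm v hv x y
      exact deg_induction (fun Q hQ => ih _ (by omega) Q rfl x y) (by simp [Commutes])
        (fun v w => Commutes.add) (fun a v h => h.smul a) hv
    -- It is enough to treat the case `j < i`.
    suffices h : ∀ i j, j < i → Commutes b (b i) (b j) (z k P) by
      refine commutes_of_basis fun i j => ?_
      rcases lt_trichotomy i j with hij | rfl | hij
      · exact (h j i hij).swap
      · simp [Commutes]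
      · exact h i j hij
    intro i j hij
    by_cases hj : ∀ l ∈ P, j ≤ l
    · exact commutes_of_le hj hij
    obtain ⟨m, Q, rfl, hQ⟩ := exists_min P (by rintro rfl; simp at hj)
    have hmj : m < j := by
      by_contra hmj
      exact hj fun l hl => (not_lt.1 hmj).trans (by
        rcases Multiset.mem_cons.1 hl with rfl | hl
        · exact le_rfl
        · exact hQ l hl)
    rw [Multiset.card_cons] at hP
    have hQc : ∀ x y, Commutes b x y (z k Q) := ih _ (by omega) Q rfl
    -- `x a` and `x m` commute up to the bracket on `x a' z_Q`, whose leading term is `z_{a' + Q}`.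
    have key : ∀ a a' : ι, m < a → m < a' →
        Commutes b (b a) (b m) (lieAct b (b a') (z k Q)) := by
      intro a a' ha ha'
      have := (hlow (by omega) _ (lieAct_sub_mem b Q a') (b a) (b m)).add
        (commutes_of_le (b := b) (P := a' ::ₘ Q) (i := a) (j := m) (fun l hl => by
          rcases Multiset.mem_cons.1 hl with rfl | hl
          · exact ha'.le
          · exact hQ l hl) ha)
      rwa [sub_add_cancel] at this
    have h1 := key i j (hmj.trans hij) hmj
    have h2 := key j i hmj (hmj.trans hij)
    have h3 := hQc (b i) (b j)
    have h4 := hQc ⁅b i, b m⁆ (b j)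
    have h5 := hQc (b i) ⁅b j, b m⁆
    have h6 := hQc ⁅b i, b j⁆ (b m)
    have h7 := hQc (b j) (b m)
    have h8 := hQc (b i) (b m)
    have hz : z k (m ::ₘ Q) = lieAct b (b m) (z k Q) := (lieAct_of_le b hQ).symm
    have hJ : (⁅⁅b i, b j⁆, b m⁆ : L) = ⁅⁅b i, b m⁆, b j⁆ + ⁅b i, ⁅b j, b m⁆⁆ := by
      rw [leibniz_lie (b i) (b j) (b m), ← lie_skew ⁅b i, b m⁆ (b j)]
      abel
    simp only [Commutes] at h1 h2 h3 h4 h5 h6 h7 h8 ⊢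
    rw [hJ, map_add, LinearMap.add_apply, ← h4, ← h5] at h6
    rw [sub_eq_iff_eq_add] at h7 h8
    rw [hz, h7, h8, map_add, map_add]
    rw [sub_eq_iff_eq_add] at h1 h2 h6
    rw [h1, h2, h6, ← h3, map_sub]
    abel

theorem commutes (x y : L) (v : Multiset ι →₀ k) : Commutes b x y v := by
  induction v using Finsupp.induction_linear with
  | zero => simp [Commutes]
  | add v w hv hw => exact hv.add hw
  | single P a =>
    have := (commutes_z (b := b) _ P rfl x y).smul a
    rwa [Finsupp.smul_single, smul_eq_mul, mul_one] at this

end Lie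

end PBW

section PBWBasis

attribute [local instance 100] LieRing.ofAssociativeRing

variable {k : Type*} [Field k] {ι : Type*} [LinearOrder ι] [Fintype ι] {L : Type*} [LieRing L]
  [LieAlgebra k L] (b : Module.Basis ι k L)

/-- The sorted monomial of `U(L)` attached to a multiset of indices of basis vectors of `L`. -/
def pbwMonomial (P : Multiset ι) : UniversalEnvelopingAlgebra k L :=
  ((P.sort (· ≤ ·)).map fun i => (UniversalEnvelopingAlgebra.ι k (b i) :
    UniversalEnvelopingAlgebra k L)).prod

/-- The representation of `U(L)` on the space of monomials. -/
def pbwRep : UniversalEnvelopingAlgebra k L →ₐ[k] Module.End k (Multiset ι →₀ k) :=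
  UniversalEnvelopingAlgebra.lift k
    { PBW.lieAct b with
      map_lie' := fun {x y} => by
        refine LinearMap.ext fun v => ?_
        rw [LieRing.of_associative_ring_bracket]
        exact Eq.symm (show _ = _ from PBW.commutes x y v) }

theorem pbwRep_ι (x : L) : pbwRep b (UniversalEnvelopingAlgebra.ι k x) = PBW.lieAct b x := by
  rw [pbwRep, UniversalEnvelopingAlgebra.lift_ι_apply]
  rfl

theorem pbwRep_pbwMonomial (P : Multiset ι) : pbwRep b (pbwMonomial b P) (PBW.z k 0) = PBW.z k P := by
  have key : ∀ l : List ι, l.Pairwise (· ≤ ·) → pbwRep b ((l.map fun i =>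
      (UniversalEnvelopingAlgebra.ι k (b i) : UniversalEnvelopingAlgebra k L)).prod) (PBW.z k 0) =
      PBW.z k (l : Multiset ι) := by
    intro l hl
    induction l with
    | nil => simp
    | cons i l ih =>
      rw [List.map_cons, List.prod_cons, map_mul, Module.End.mul_apply,
        ih (List.Pairwise.of_cons hl), pbwRep_ι, PBW.lieAct_of_le b]
      · rfl
      · intro j hj
        exact List.rel_of_pairwise_cons hl (by simpa using hj)
  rw [pbwMonomial, key _ (by exact Multiset.pairwise_sort P _), Multiset.sort_eq]

end PBWBasis

theorem linearIndependent_pbwMonomial {k : Type*} [Field k] {ι : Type*} [LinearOrder ι] [Fintype ι]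
    {L : Type*} [LieRing L] [LieAlgebra k L] (b : Module.Basis ι k L) : LinearIndependent k (pbwMonomial b) := by
  let e : UniversalEnvelopingAlgebra k L →ₗ[k] (Multiset ι →₀ k) :=
    LinearMap.applyₗ (PBW.z k 0) ∘ₗ (pbwRep b).toLinearMap
  refine LinearIndependent.of_comp e ?_
  have : (e ∘ pbwMonomial b) = fun P => Finsupp.single P (1 : k) := funext (pbwRep_pbwMonomial b)
  rw [this]
  exact Finsupp.linearIndependent_single_one k _

open FormalFun

/-! ### Bases adapted to the filtration by the length of words -/

namespace CoPoissonFrame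

variable {k : Type*} [Field k] {H ι K κ : Type*} [Ring H] [Bialgebra k H] [Fintype ι]
  [Ring K] [Bialgebra k K] [Fintype κ]

/-- The vectors `m a`, with `a` of degree at most `n`, span the words of length at most `n`. -/
def SpansFilt (F : CoPoissonFrame k H ι) {A : Type*} (m : A → H) (d : A → ℕ) : Prop :=
  (∀ a, m a ∈ F.filt (d a)) ∧ ∀ l, F.word l ∈ Submodule.span k (m '' {a | d a ≤ l.length})

theorem SpansFilt.tensor {F : CoPoissonFrame k H ι} {G : CoPoissonFrame k K κ} {A A' : Type*}
    {m : A → H} {d : A → ℕ} {m' : A' → K} {d' : A' → ℕ} (h : F.SpansFilt m d)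
    (h' : G.SpansFilt m' d') : (F.tensor G).SpansFilt (fun a : A × A' => m a.1 ⊗ₜ[k] m' a.2)
      (fun a => d a.1 + d' a.2) := by
  refine ⟨fun a => tmul_mem_filt F G (h.1 _) (h'.1 _) le_rfl, fun l => ?_⟩
  obtain ⟨l₁, l₂, hl, e⟩ := exists_tensor_word F G l
  rw [e, ← hl]
  have h1 := h.2 l₁
  have h2 := h'.2 l₂
  generalize F.word l₁ = u at h1
  generalize G.word l₂ = v at h2
  induction h1 using Submodule.span_induction with
  | zero => simp
  | add a a' _ _ ha ha' => rw [TensorProduct.add_tmul]; exact add_mem ha ha'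
  | smul c a _ ha => rw [← TensorProduct.smul_tmul']; exact Submodule.smul_mem _ _ ha
  | mem u hu =>
    obtain ⟨a, ha, rfl⟩ := hu
    induction h2 using Submodule.span_induction with
    | zero => simp
    | add a a' _ _ ha ha' => rw [TensorProduct.tmul_add]; exact add_mem ha ha'
    | smul c a _ ha => rw [TensorProduct.tmul_smul]; exact Submodule.smul_mem _ _ ha
    | mem v hv =>
      obtain ⟨a', ha', rfl⟩ := hv
      exact Submodule.subset_span ⟨(a, a'), Nat.add_le_add (show d a ≤ _ from ha) (show d' a' ≤ _ from ha'), rfl⟩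

theorem SpansFilt.mem_I_iff {F : CoPoissonFrame k H ι} [Coalgebra.IsCocomm k H] {A : Type*}
    {m : A → H} {d : A → ℕ} (h : F.SpansFilt m d) {p : ℕ} {f : FormalFun k H} :
    f ∈ F.I p ↔ ∀ a, d a < p → f.ofConv (m a) = 0 := by
  refine ⟨fun hf a ha => F.I_apply_filt hf (h.1 a) ha, fun hf l hl => ?_⟩
  have h1 := h.2 l
  generalize F.word l = u at h1
  induction h1 using Submodule.span_induction with
  | zero => simp
  | add u u' _ _ hu hu' => rw [map_add, hu, hu', add_zero]
  | smul c u _ hu => rw [map_smul, hu, smul_zero]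
  | mem u hu => obtain ⟨a, ha, rfl⟩ := hu; exact hf a (lt_of_le_of_lt ha hl)

/-- Words that differ by the order of their letters agree up to shorter words. -/
theorem word_sub_word_mem_filt {F : CoPoissonFrame k H ι}
    (hF : ∀ i j, F.x i * F.x j - F.x j * F.x i ∈ F.filt 1) {l l' : List ι} (h : l.Perm l') :
    ∀ n, l.length = n + 1 → F.word l - F.word l' ∈ F.filt n := by
  have hx : ∀ i, F.x i ∈ F.filt 1 := fun i => by
    rw [← word_singleton]; exact F.word_mem_filt (by simp)
  induction h with
  | nil => simp
  | @cons i l l' h ih =>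
    intro n hn
    rw [word_cons, word_cons, ← mul_sub]
    rcases n with _ | n
    · have : l = [] := by simpa using hn
      subst this
      rw [List.nil_perm.1 h]
      simp
    · exact F.mul_mem_filt (hx i) (ih n (by simpa using hn)) (by omega)
  | swap i j l =>
    intro n hn
    rw [word_cons, word_cons, word_cons, word_cons, ← mul_assoc, ← mul_assoc, ← sub_mul]
    exact F.mul_mem_filt (hF j i) (F.word_mem_filt le_rfl) (by simp at hn; omega)
  | trans h h' ih ih' =>
    intro n hn
    have := add_mem (ih n hn) (ih' n (by rw [← h.length_eq, hn]))
    simpa using this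

end CoPoissonFrame

namespace LieBialgebra

variable {k g : Type*} [Field k] [CharZero k] [LieRing g] [LieAlgebra k g] [Module.Finite k g]
variable (B : LieBialgebra k g)

/-- The indices of the basis vectors of `g*`. -/
abbrev Idx (_B : LieBialgebra k g) : Type := Fin (Module.finrank k g)

/-- The Poincaré-Birkhoff-Witt basis of `U(g*)`. -/
def pbw (P : Multiset B.Idx) : B.U := pbwMonomial B.dualBasis P

theorem pbw_eq_word (P : Multiset B.Idx) : B.pbw P = B.frame.word (P.sort (· ≤ ·)) := rfl

theorem pbw_zero : B.pbw 0 = 1 := by simp [pbw_eq_word, CoPoissonFrame.word_nil]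

theorem pbw_singleton (i : B.Idx) : B.pbw {i} = B.frame.x i := by
  simp [pbw_eq_word, CoPoissonFrame.word_singleton]

theorem x_eq_ι (i : B.Idx) : B.frame.x i = UniversalEnvelopingAlgebra.ι k (B.dualBasis i) := rfl

theorem ι_mem_filt (ξ : B.DualLie) : (UniversalEnvelopingAlgebra.ι k ξ : B.U) ∈ B.frame.filt 1 := by
  rw [← B.dualBasis.sum_repr ξ, map_sum]
  refine sum_mem fun i _ => ?_
  rw [map_smul, ← x_eq_ι, ← CoPoissonFrame.word_singleton]
  exact Submodule.smul_mem _ _ (B.frame.word_mem_filt (by simp))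

theorem x_commutator_mem (i j : B.Idx) :
    B.frame.x i * B.frame.x j - B.frame.x j * B.frame.x i ∈ B.frame.filt 1 := by
  rw [x_eq_ι, x_eq_ι, ← UniversalEnvelopingAlgebra.ι_lie]
  exact B.ι_mem_filt _

theorem word_sub_pbw_mem (l : List B.Idx) {n : ℕ} (h : l.length = n + 1) :
    B.frame.word l - B.pbw (l : Multiset B.Idx) ∈ B.frame.filt n := by
  rw [pbw_eq_word]
  refine CoPoissonFrame.word_sub_word_mem_filt B.x_commutator_mem ?_ n h
  rw [← Multiset.coe_eq_coe, Multiset.sort_eq]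

theorem pbw_mem_filt (P : Multiset B.Idx) : B.pbw P ∈ B.frame.filt (Multiset.card P) := by
  rw [pbw_eq_word]
  exact B.frame.word_mem_filt (by rw [Multiset.length_sort])

theorem spansFilt_pbw : B.frame.SpansFilt B.pbw Multiset.card := by
  refine ⟨B.pbw_mem_filt, fun l => ?_⟩
  induction hn : l.length using Nat.strong_induction_on generalizing l with
  | _ n ih =>
    rcases n with _ | n
    · have : l = [] := by simpa using hn
      subst this
      exact Submodule.subset_span ⟨0, by simp, by rw [pbw_zero]; rfl⟩
    · have h1 := B.word_sub_pbw_mem l hn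
      have h2 : B.frame.filt n ≤ Submodule.span k (B.pbw '' {P | Multiset.card P ≤ n + 1}) := by
        refine Submodule.span_le.2 ?_
        rintro _ ⟨l', hl', rfl⟩
        refine Submodule.span_mono (Set.image_mono fun P hP => ?_)
          (ih l'.length (Nat.lt_succ_of_le hl') l' rfl)
        exact le_trans (le_trans hP hl') (Nat.le_succ n)
      have h3 : B.pbw (l : Multiset B.Idx) ∈
          Submodule.span k (B.pbw '' {P | Multiset.card P ≤ n + 1}) :=
        Submodule.subset_span ⟨l, by simp [hn], rfl⟩
      have := add_mem (h2 h1) h3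
      rwa [sub_add_cancel] at this

/-- Up to terms of lower degree, the basis vectors multiply as commuting monomials. -/
theorem pbw_mul_sub_mem (P Q : Multiset B.Idx) {n : ℕ}
    (h : Multiset.card P + Multiset.card Q = n + 1) :
    B.pbw P * B.pbw Q - B.pbw (P + Q) ∈ B.frame.filt n := by
  have h1 := B.word_sub_pbw_mem (P.sort (· ≤ ·) ++ Q.sort (· ≤ ·)) (n := n) (by
    rw [List.length_append, Multiset.length_sort, Multiset.length_sort, h])
  rw [CoPoissonFrame.word_append] at h1
  have h2 : ((P.sort (· ≤ ·) ++ Q.sort (· ≤ ·) : List B.Idx) : Multiset B.Idx) = P + Q := by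
    rw [← Multiset.coe_add, Multiset.sort_eq, Multiset.sort_eq]
  rw [h2] at h1
  exact h1

theorem counit_pbw {P : Multiset B.Idx} (hP : P ≠ 0) :
    Coalgebra.counit (R := k) (B.pbw P) = 0 := by
  rw [pbw_eq_word]
  refine CoPoissonFrame.Hom.counit_word _ fun h => hP ?_
  rw [← Multiset.sort_eq P (· ≤ ·), h]
  rfl

/-- The Poincaré-Birkhoff-Witt basis of `U(g*)`, as a basis. -/
def pbwBasis : Module.Basis (Multiset B.Idx) k B.U :=
  Module.Basis.mk (v := B.pbw) (linearIndependent_pbwMonomial B.dualBasis) (by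
    intro u _
    have hu : u ∈ Submodule.span k (Set.range B.frame.word) := by
      rw [show Submodule.span k (Set.range B.frame.word) = ⊤ from B.frame.span_words]; trivial
    refine Submodule.span_le.2 ?_ hu
    rintro _ ⟨l, rfl⟩
    exact Submodule.span_mono (Set.image_subset_range _ _) (B.spansFilt_pbw.2 l))

theorem pbwBasis_apply (P : Multiset B.Idx) : B.pbwBasis P = B.pbw P := by
  exact Module.Basis.mk_apply _ _ P

/-- The co-Poisson bialgebra `U(g*) ⊗ U(g*)`. -/
abbrev frame₂ : CoPoissonFrame k (B.U ⊗[k] B.U) (B.Idx ⊕ B.Idx) := B.frame.tensor B.frame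

/-- The co-Poisson bialgebra `U(g*) ⊗ U(g*) ⊗ U(g*)`. -/
abbrev frame₃ : CoPoissonFrame k ((B.U ⊗[k] B.U) ⊗[k] B.U) ((B.Idx ⊕ B.Idx) ⊕ B.Idx) :=
  B.frame₂.tensor B.frame

theorem spansFilt_pbw₂ : B.frame₂.SpansFilt (fun a : Multiset B.Idx × Multiset B.Idx =>
    B.pbw a.1 ⊗ₜ[k] B.pbw a.2) (fun a => Multiset.card a.1 + Multiset.card a.2) :=
  B.spansFilt_pbw.tensor B.spansFilt_pbw

theorem spansFilt_pbw₃ : B.frame₃.SpansFilt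
    (fun a : (Multiset B.Idx × Multiset B.Idx) × Multiset B.Idx =>
      (B.pbw a.1.1 ⊗ₜ[k] B.pbw a.1.2) ⊗ₜ[k] B.pbw a.2)
    (fun a => Multiset.card a.1.1 + Multiset.card a.1.2 + Multiset.card a.2) :=
  B.spansFilt_pbw₂.tensor B.spansFilt_pbw

/-- The function on the square of the formal group with prescribed values on the
Poincaré-Birkhoff-Witt basis. -/
def ofCoeffs (β : Multiset B.Idx → Multiset B.Idx → k) : B.O₂ :=
  WithConv.toConv ((B.pbwBasis.tensorProduct B.pbwBasis).constr k fun a => β a.1 a.2)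

theorem ofCoeffs_apply (β : Multiset B.Idx → Multiset B.Idx → k) (P Q : Multiset B.Idx) :
    (B.ofCoeffs β).ofConv (B.pbw P ⊗ₜ B.pbw Q) = β P Q := by
  have := (B.pbwBasis.tensorProduct B.pbwBasis).constr_basis k
    (fun a => β a.1 a.2) (P, Q)
  rwa [Module.Basis.tensorProduct_apply, pbwBasis_apply, pbwBasis_apply] at this

end LieBialgebra

/-! ### A cohomology computation for the coalgebra of polynomials -/

namespace MonomialCohomology

variable {k : Type*} [Field k] {ι : Type*} [LinearOrder ι]

theorem exists_max (P : Multiset ι) (hP : P ≠ 0) : ∃ m Q, P = Q + {m} ∧ ∀ l ∈ Q, l ≤ m := by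
  obtain ⟨m, Q, h, h'⟩ := PBW.exists_min (ι := ιᵒᵈ) P hP
  exact ⟨m, Q, h.trans (add_comm {m} Q), h'⟩

/-- Functions of monomials may be defined by singling out the largest variable. -/
theorem exists_fun_of_max (f : ι → Multiset ι → k) :
    ∃ G : Multiset ι → k, ∀ m Q, (∀ l ∈ Q, l ≤ m) → G (Q + {m}) = f m Q := by
  classical
  refine ⟨fun P => if h : ∃ m Q, P = Q + {m} ∧ ∀ l ∈ Q, l ≤ m then
    f h.choose h.choose_spec.choose else 0, fun m Q hQ => ?_⟩
  have h : ∃ m' Q', Q + {m} = Q' + {m'} ∧ ∀ l ∈ Q', l ≤ m' := ⟨m, Q, rfl, hQ⟩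
  have h1 := h.choose_spec.choose_spec.1
  obtain ⟨e, e2⟩ := PBW.min_unique (ι := ιᵒᵈ) (j := m) (j' := h.choose) (Q := Q)
    (Q' := h.choose_spec.choose) ((add_comm {m} Q).trans (h1.trans (add_comm _ _))) hQ h.choose_spec.choose_spec.2
  dsimp only
  rw [dif_pos h]
  exact congrArg₂ f e.symm e2.symm

/-- The coboundary of a `2`-cochain. -/
def d (β : Multiset ι → Multiset ι → k) (p q r : Multiset ι) : k := β p (q + r) - β (p + q) r

/-- The cocycle condition for `3`-cochains. -/
def IsCocycle (α : Multiset ι → Multiset ι → Multiset ι → k) : Prop :=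
  ∀ p q r s, p ≠ 0 → q ≠ 0 → r ≠ 0 → s ≠ 0 → α p (q + r) s = α (p + q) r s + α p q (r + s)

theorem isCocycle_d (β : Multiset ι → Multiset ι → k) : IsCocycle (d β) := by
  intro p q r s _ _ _ _
  simp only [d, add_assoc]
  ring

/-- A cocycle that vanishes on `p ⊗ q ⊗ x i` whenever all the variables of `q` are at most `x i`,
and whose total antisymmetrization vanishes, is a coboundary. -/
theorem exists_eq_d_of_normalized {α : Multiset ι → Multiset ι → Multiset ι → k}
    (hα : IsCocycle α) (hn : ∀ p q i, p ≠ 0 → q ≠ 0 → (∀ l ∈ q, l ≤ i) → α p q {i} = 0)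
    (halt : ∀ i j l, α {i} {j} {l} + α {j} {l} {i} + α {l} {i} {j} =
      α {j} {i} {l} + α {i} {l} {j} + α {l} {j} {i}) :
    ∃ γ : Multiset ι → Multiset ι → k, ∀ p q r, p ≠ 0 → q ≠ 0 → r ≠ 0 → α p q r = d γ p q r := by
  classical
  -- `b i j u` is the antisymmetrization of `α` in two last variables; by the cocycle condition it
  -- only depends on the product `u` of the first ones, which is `hA`.
  set b : ι → ι → Multiset ι → k := fun i j u => α u {i} {j} - α u {j} {i} with hb
  have hanti : ∀ i j u, b i j u = -b j i u := fun i j u => by simp only [hb]; ring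
  have hsum : ∀ p q r i, p ≠ 0 → q ≠ 0 → r ≠ 0 → α p q (r + {i}) =
      α p (q + r) {i} - α (p + q) r {i} := fun p q r i hp hq hr => by
    rw [hα p q r {i} hp hq hr (by simp)]; ring
  have hA : ∀ p q i j, p ≠ 0 → α p (q + {i}) {j} - α p (q + {j}) {i} = b i j (p + q) := by
    intro p q i j hp
    by_cases hq : q = 0
    · subst hq; simp [hb]
    · have h1 := hsum p q {i} j hp hq (by simp)
      have h2 := hsum p q {j} i hp hq (by simp)
      rw [add_comm ({j} : Multiset ι) {i}, h1] at h2
      simp only [hb]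
      linear_combination h2
  have hcyc : ∀ p i j l, b i j (p + {l}) + b j l (p + {i}) + b l i (p + {j}) = 0 := by
    intro p i j l
    by_cases hp : p = 0
    · subst hp
      have := halt i j l
      simp only [hb, zero_add]
      linear_combination this
    · have h1 := hA p {l} i j hp
      have h2 := hA p {i} j l hp
      have h3 := hA p {j} l i hp
      rw [add_comm ({l} : Multiset ι) {j}] at h1
      rw [add_comm ({i} : Multiset ι) {l}] at h2
      rw [add_comm ({j} : Multiset ι) {i}] at h3
      linear_combination -h1 - h2 - h3
  -- `b` is closed, hence of the form `b i j u = c i (u + {j}) - c j (u + {i})`; a primitive `c` is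
  -- found by contraction along the largest variable.
  choose c hc using fun j : ι => exists_fun_of_max (k := k) fun m Q =>
    if Q = 0 ∨ m ≤ j then 0 else b j m Q
  have hbc' : ∀ i j u, u ≠ 0 → i < j → b i j u = c i (u + {j}) - c j (u + {i}) := by
    intro i j u hu hij
    obtain ⟨m, v, rfl, hv⟩ := exists_max u hu
    by_cases hm : m ≤ j
    · have hle : ∀ l ∈ v + {m}, l ≤ j := by
        intro l hl
        rcases Multiset.mem_add.1 hl with h | h
        · exact (hv l h).trans hm
        · rw [Multiset.mem_singleton.1 h]; exact hm
      have h1 : c i (v + {m} + {j}) = b i j (v + {m}) := by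
        rw [hc i j _ hle, if_neg (by simp [hij])]
      obtain ⟨m', v', e, hv'⟩ := exists_max (v + {m} + {i}) (by simp)
      have hm' : m' ≤ j := by
        have : m' ∈ v + {m} + {i} := by rw [e]; simp
        rcases Multiset.mem_add.1 this with h | h
        · exact hle _ h
        · rw [Multiset.mem_singleton.1 h]; exact hij.le
      rw [h1, e, hc j m' v' hv', if_pos (Or.inr hm'), sub_zero]
    · have hle : ∀ l, l < m → ∀ x ∈ v + {l}, x ≤ m := by
        intro l hl x hx
        rcases Multiset.mem_add.1 hx with h | h
        · exact hv x h
        · rw [Multiset.mem_singleton.1 h]; exact hl.le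
      push Not at hm
      rw [add_right_comm v {m} {j}, add_right_comm v {m} {i}, hc i m _ (hle j hm),
        hc j m _ (hle i (hij.trans hm)), if_neg (by simp [hij.trans hm]), if_neg (by simp [hm])]
      have := hcyc v i j m
      rw [hanti m i] at this
      linear_combination this
  have hbc : ∀ i j u, u ≠ 0 → b i j u = c i (u + {j}) - c j (u + {i}) := by
    intro i j u hu
    rcases lt_trichotomy i j with h | rfl | h
    · exact hbc' i j u hu h
    · simp [hb]
    · rw [hanti, hbc' j i u hu h]; ring
  -- The primitive `γ` of `α` is prescribed on `p ⊗ (Q + {m})`, with `m` the largest variable, by the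
  -- normalization of `α` and the requirement `γ p {i} = c i p`.
  choose γ hγ using fun p : Multiset ι => exists_fun_of_max (k := k) fun m Q => c m (p + Q)
  have hγi : ∀ p i, γ p {i} = c i p := fun p i => by
    have := hγ p i 0 (by simp)
    rwa [zero_add, add_zero] at this
  have key : ∀ p q i, p ≠ 0 → q ≠ 0 → α p q {i} = γ p (q + {i}) - c i (p + q) := by
    intro p q i hp hq
    by_cases hi : ∀ l ∈ q, l ≤ i
    · rw [hn p q i hp hq hi, hγ p i q hi, sub_self]
    · obtain ⟨m, v, rfl, hv⟩ := exists_max q hq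
      have him : i < m := by
        by_contra him
        exact hi fun l hl => by
          rcases Multiset.mem_add.1 hl with h | h
          · exact (hv l h).trans (not_lt.1 him)
          · rw [Multiset.mem_singleton.1 h]; exact not_lt.1 him
      have hle : ∀ l ∈ v + {i}, l ≤ m := by
        intro l hl
        rcases Multiset.mem_add.1 hl with h | h
        · exact hv l h
        · rw [Multiset.mem_singleton.1 h]; exact him.le
      have h1 := hA p v m i hp
      rw [hn p (v + {i}) m hp (by simp) hle, hbc m i (p + v) (fun h => hp (by simp at h; exact h.1))]
        at h1
      rw [add_right_comm v {m} {i}, hγ p m _ hle, ← add_assoc, ← add_assoc]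
      linear_combination h1
  refine ⟨γ, fun p q r hp hq hr => ?_⟩
  obtain ⟨i, s, rfl, -⟩ := exists_max r hr
  by_cases hs : s = 0
  · subst hs
    rw [zero_add, key p q i hp hq, d, hγi]
  · rw [hsum p q s i hp hq hs, key p (q + s) i hp (fun h => hq (by simp at h; exact h.1)),
      key (p + q) s i (fun h => hp (by simp at h; exact h.1)) hs, d]
    simp only [add_assoc]
    ring

/-- A `3`-cocycle whose total antisymmetrization vanishes is a coboundary. -/
theorem exists_eq_d {α : Multiset ι → Multiset ι → Multiset ι → k}
    (hα : IsCocycle α)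
    (halt : ∀ i j l, α {i} {j} {l} + α {j} {l} {i} + α {l} {i} {j} =
      α {j} {i} {l} + α {i} {l} {j} + α {l} {j} {i}) :
    ∃ β : Multiset ι → Multiset ι → k, ∀ p q r, p ≠ 0 → q ≠ 0 → r ≠ 0 → α p q r = d β p q r := by
  classical
  choose β hβ using fun p : Multiset ι => exists_fun_of_max (k := k) fun m Q =>
    if Q = 0 then 0 else α p Q {m}
  have h0 : ∀ p i, β p {i} = 0 := fun p i => by
    have := hβ p i 0 (by simp)
    rwa [zero_add, if_pos rfl] at this
  obtain ⟨γ, hγ⟩ := exists_eq_d_of_normalized (α := fun p q r => α p q r - d β p q r)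
    (fun p q r s hp hq hr hs => by
      dsimp only
      rw [hα p q r s hp hq hr hs, isCocycle_d β p q r s hp hq hr hs]; ring)
    (fun p q i hp hq h => by rw [d, hβ p i q h, if_neg hq, h0]; ring)
    (fun i j l => by
      have := halt i j l
      simp only [d, h0]
      rw [add_comm ({l} : Multiset ι) {i}, add_comm ({l} : Multiset ι) {j},
        add_comm ({j} : Multiset ι) {i}]
      linear_combination this)
  refine ⟨fun p q => β p q + γ p q, fun p q r hp hq hr => ?_⟩
  have := hγ p q r hp hq hr
  simp only [d] at this ⊢
  linear_combination this

end MonomialCohomology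

open FormalFun

/-! ### Convergence for the filtration by the order of vanishing -/

namespace CoPoissonFrame

variable {k : Type*} [Field k] {H ι K κ : Type*} [Ring H] [Bialgebra k H] [Fintype ι]
  [Ring K] [Bialgebra k K] [Fintype κ] (F : CoPoissonFrame k H ι)

theorem exists_hasFormalSum [Coalgebra.IsCocomm k H] {t : ℕ → FormalFun k H}
    (ht : ∀ n, t n ∈ F.I n) : ∃ s, HasFormalSum t s := by
  have hfin : ∀ u, (Function.support fun n => (t n).ofConv u).Finite := by
    intro u
    obtain ⟨m, hm⟩ := F.exists_mem_filt u
    refine (Finset.finite_toSet (Finset.range (m + 1))).subset fun n hn => ?_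
    by_contra h
    exact hn (F.I_apply_filt (ht n) hm (by simpa using h))
  refine ⟨WithConv.toConv
    { toFun := fun u => ∑ᶠ n, (t n).ofConv u
      map_add' := fun u v => by
        simp only [map_add]
        exact finsum_add_distrib (hfin u) (hfin v)
      map_smul' := fun c u => by
        simp only [map_smul, smul_eq_mul, RingHom.id_apply]
        exact (mul_finsum _ _).symm }, fun u => ?_⟩
  obtain ⟨m, hm⟩ := F.exists_mem_filt u
  refine ⟨m + 1, fun n hn => ?_⟩
  rw [ofConv_sum_apply]
  refine (finsum_eq_sum_of_support_subset _ fun i hi => ?_).symm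
  by_contra h
  have h' : n ≤ i := by simpa using h
  exact hi (F.I_apply_filt (ht i) hm (by omega))

theorem hasFormalSum_iff [Coalgebra.IsCocomm k H] {t : ℕ → FormalFun k H}
    (ht : ∀ n, t n ∈ F.I n) {s : FormalFun k H} :
    HasFormalSum t s ↔ ∀ N, (∑ n ∈ Finset.range N, t n) - s ∈ F.I N := by
  have hst : ∀ {M N : ℕ}, N ≤ M →
      (∑ n ∈ Finset.range M, t n) - ∑ n ∈ Finset.range N, t n ∈ F.I N := by
    intro M N h
    rw [← Finset.sum_range_add_sum_Ico _ h, add_sub_cancel_left]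
    exact sum_mem fun n hn => F.I_anti (by simp at hn; omega) (ht n)
  constructor
  · intro h N l hl
    obtain ⟨M, hM⟩ := h (F.word l)
    have h1 := hM (max M N) (le_max_left _ _)
    have h2 := hst (le_max_right M N) l hl
    rw [ofConv_sub_apply] at h2 ⊢
    rw [h1] at h2
    rw [← neg_sub, h2, neg_zero]
  · intro h u
    obtain ⟨m, hm⟩ := F.exists_mem_filt u
    refine ⟨m + 1, fun n hn => ?_⟩
    have := F.I_apply_filt (h n) hm (by omega)
    rwa [ofConv_sub_apply, sub_eq_zero] at this

theorem gp_mul_comm_of_br [CharZero k] [Coalgebra.IsCocomm k H] {f g : FormalFun k H}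
    (h : F.br f g = 0) {p : ℕ} (f' g' : F.LieFun) (hf : LieFun.val f' = f) (hg : LieFun.val g' = g) :
    F.gp p f' * F.gp p g' = F.gp p g' * F.gp p f' := by
  have h1 : ⁅F.jetMk p f', F.jetMk p g'⁆ = 0 := by
    rw [← jetMk_lie, jetMk_eq_zero, LieFun.val_lie, hf, hg, h]
    exact zero_mem _
  have h2 : ⁅F.jetMk p g', F.jetMk p f'⁆ = 0 := by rw [← lie_skew, h1, neg_zero]
  refine ExpGroup.ext ?_
  rw [ExpGroup.log_mul, ExpGroup.log_mul]
  change lieBch k (F.jetMk p f') (F.jetMk p g') = lieBch k (F.jetMk p g') (F.jetMk p f')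
  rw [lieBch_eq_add h1, lieBch_eq_add h2, add_comm]

theorem bracket_tmul (G : CoPoissonFrame k K κ) (f f' : FormalFun k H) (g g' : FormalFun k K) :
    (F.tensor G).br (tmul f g) (tmul f' g') =
      tmul (F.br f f') (g * g') + tmul (f * f') (G.br g g') := by
  have key : ∀ (s : H ⊗[k] H) (t : K ⊗[k] K), (tmul (tmul f g) (tmul f' g')).ofConv
      (tensorComm₄ k H H K K (s ⊗ₜ t)) = (tmul f f').ofConv s * (tmul g g').ofConv t := by
    intro s t
    induction s with
    | zero => simp
    | add s s' hs hs' => simp only [TensorProduct.add_tmul, map_add, hs, hs', add_mul]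
    | tmul a a' =>
      induction t with
      | zero => simp
      | add t t' ht ht' => simp only [TensorProduct.tmul_add, map_add, ht, ht', mul_add]
      | tmul b b' => simp only [tensorComm₄_tmul, tmul_tmul]; ring
  refine ext_ofConv fun u => ?_
  induction u with
  | zero => simp
  | add u v hu hv => rw [map_add, map_add, hu, hv]
  | tmul a b =>
    change (tmul (tmul f g) (tmul f' g')).ofConv (coPoissonTensor F.δ G.δ (a ⊗ₜ b)) = _
    rw [coPoissonTensor_tmul, map_add, map_add, key, key, ofConv_add_apply, tmul_tmul, tmul_tmul]
    rfl

theorem br_tmul_one_one_tmul [Coalgebra.IsCocomm k H] [Coalgebra.IsCocomm k K]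
    (G : CoPoissonFrame k K κ) (f : FormalFun k H) (g : FormalFun k K) :
    (F.tensor G).br (tmul f 1) (tmul 1 g) = 0 := by
  have h : G.br 1 g = 0 := by rw [G.br_skew, counit_counit_δ, neg_zero]
  rw [bracket_tmul, counit_counit_δ, h]
  refine ext_ofConv fun u => ?_
  induction u with
  | zero => simp
  | add u v hu hv => rw [map_add, map_add, hu, hv]
  | tmul a b => simp [tmul_tmul]

theorem Hom.lie_lie_congr [CharZero k] [Coalgebra.IsCocomm k H] [Coalgebra.IsCocomm k K]
    {M μ M' μ' : Type*} [Ring M] [Bialgebra k M] [Fintype μ] [Coalgebra.IsCocomm k M]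
    [Ring M'] [Bialgebra k M'] [Fintype μ'] [Coalgebra.IsCocomm k M']
    {F : CoPoissonFrame k H ι} {G : CoPoissonFrame k K κ} {L : CoPoissonFrame k M μ}
    {L' : CoPoissonFrame k M' μ'} {φ : Hom F L} {ψ : Hom L G} {φ' : Hom F L'} {ψ' : Hom L' G}
    (h : ψ.map ∘ₗ φ.map = ψ'.map ∘ₗ φ'.map) (f : G.LieFun) :
    φ.lie (ψ.lie f) = φ'.lie (ψ'.lie f) :=
  LieFun.val_injective (ext_ofConv fun u => congrArg (LieFun.val f).ofConv (LinearMap.congr_fun h u))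

end CoPoissonFrame

/-! ### The faces of the cosimplicial group of functions -/

namespace LieBialgebra

variable {k g : Type*} [Field k] [CharZero k] [LieRing g] [LieAlgebra k g] [Module.Finite k g]
variable (B : LieBialgebra k g)

open CoPoissonFrame

/-- The co-Poisson bialgebra `U(g*)^{⊗ 4}`. -/
abbrev frame₄ : CoPoissonFrame k (((B.U ⊗[k] B.U) ⊗[k] B.U) ⊗[k] B.U)
    (((B.Idx ⊕ B.Idx) ⊕ B.Idx) ⊕ B.Idx) := B.frame₃.tensor B.frame

/-- `a ⊗ b ⊗ c ↦ ε(a) b ⊗ c`. -/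
def face₀ : Hom B.frame₃ B.frame₂ :=
  (Hom.counitLeft B.frame B.frame₂).comp (Hom.assoc B.frame B.frame B.frame)

/-- `a ⊗ b ⊗ c ↦ a b ⊗ c`. -/
def face₁ : Hom B.frame₃ B.frame₂ := B.mulHom.tensor (Hom.id B.frame)

/-- `a ⊗ b ⊗ c ↦ a ⊗ b c`. -/
def face₂ : Hom B.frame₃ B.frame₂ :=
  ((Hom.id B.frame).tensor B.mulHom).comp (Hom.assoc B.frame B.frame B.frame)

/-- `a ⊗ b ⊗ c ↦ a ⊗ b ε(c)`. -/
def face₃ : Hom B.frame₃ B.frame₂ := Hom.counitRight B.frame₂ B.frame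

theorem face₀_map (a b c : B.U) : B.face₀.map ((a ⊗ₜ b) ⊗ₜ c) =
    Coalgebra.counit (R := k) a • b ⊗ₜ c := by
  simp [face₀, Hom.comp, Hom.counitLeft, Hom.assoc]

theorem face₁_map (a b c : B.U) : B.face₁.map ((a ⊗ₜ b) ⊗ₜ c) = (a * b) ⊗ₜ c := by
  simp [face₁, Hom.tensor, Hom.id, mulHom]

theorem face₂_map (a b c : B.U) : B.face₂.map ((a ⊗ₜ b) ⊗ₜ c) = a ⊗ₜ (b * c) := by
  simp [face₂, Hom.comp, Hom.tensor, Hom.assoc, Hom.id, mulHom]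

theorem face₃_map (t : B.U ⊗[k] B.U) (c : B.U) : B.face₃.map (t ⊗ₜ c) =
    Coalgebra.counit (R := k) c • t := by
  simp [face₃, Hom.counitRight]

/-- `t ⊗ d ↦ face₀ t ⊗ d`. -/
def coface₀ : Hom B.frame₄ B.frame₃ := B.face₀.tensor (Hom.id B.frame)

/-- `t ⊗ d ↦ face₁ t ⊗ d`. -/
def coface₁ : Hom B.frame₄ B.frame₃ := B.face₁.tensor (Hom.id B.frame)

/-- `t ⊗ d ↦ face₂ t ⊗ d`. -/
def coface₂ : Hom B.frame₄ B.frame₃ := B.face₂.tensor (Hom.id B.frame)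

/-- `t ⊗ c ⊗ d ↦ t ⊗ c d`. -/
def coface₃ : Hom B.frame₄ B.frame₃ :=
  ((Hom.id B.frame₂).tensor B.mulHom).comp (Hom.assoc B.frame₂ B.frame B.frame)

/-- `t ⊗ d ↦ ε(d) t`. -/
def coface₄ : Hom B.frame₄ B.frame₃ := Hom.counitRight B.frame₃ B.frame

theorem coface₀_map (t : (B.U ⊗[k] B.U) ⊗[k] B.U) (d : B.U) :
    B.coface₀.map (t ⊗ₜ d) = B.face₀.map t ⊗ₜ d := by
  simp [coface₀, Hom.tensor, Hom.id]

theorem coface₁_map (t : (B.U ⊗[k] B.U) ⊗[k] B.U) (d : B.U) :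
    B.coface₁.map (t ⊗ₜ d) = B.face₁.map t ⊗ₜ d := by
  simp [coface₁, Hom.tensor, Hom.id]

theorem coface₂_map (t : (B.U ⊗[k] B.U) ⊗[k] B.U) (d : B.U) :
    B.coface₂.map (t ⊗ₜ d) = B.face₂.map t ⊗ₜ d := by
  simp [coface₂, Hom.tensor, Hom.id]

theorem coface₃_map (t : B.U ⊗[k] B.U) (c d : B.U) :
    B.coface₃.map ((t ⊗ₜ c) ⊗ₜ d) = t ⊗ₜ (c * d) := by
  simp [coface₃, Hom.comp, Hom.tensor, Hom.assoc, Hom.id, mulHom]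

theorem coface₄_map (t : (B.U ⊗[k] B.U) ⊗[k] B.U) (d : B.U) :
    B.coface₄.map (t ⊗ₜ d) = Coalgebra.counit (R := k) d • t := by
  simp [coface₄, Hom.counitRight]

theorem ext_tmul₃ {V : Type*} [AddCommGroup V] [Module k V]
    {f f' : (B.U ⊗[k] B.U) ⊗[k] B.U →ₗ[k] V}
    (h : ∀ a b c, f ((a ⊗ₜ b) ⊗ₜ c) = f' ((a ⊗ₜ b) ⊗ₜ c)) : f = f' :=
  TensorProduct.ext_threefold h

theorem ext_tmul₄ {V : Type*} [AddCommGroup V] [Module k V]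
    {f f' : ((B.U ⊗[k] B.U) ⊗[k] B.U) ⊗[k] B.U →ₗ[k] V}
    (h : ∀ a b c d, f (((a ⊗ₜ b) ⊗ₜ c) ⊗ₜ d) = f' (((a ⊗ₜ b) ⊗ₜ c) ⊗ₜ d)) : f = f' := by
  refine TensorProduct.ext' fun t d => ?_
  exact LinearMap.congr_fun (f := f ∘ₗ (TensorProduct.mk k _ _).flip d)
    (g := f' ∘ₗ (TensorProduct.mk k _ _).flip d) (B.ext_tmul₃ fun a b c => h a b c d) t

/-- The simplicial identities. -/
theorem face_comp_coface :
    B.face₀.map ∘ₗ B.coface₁.map = B.face₀.map ∘ₗ B.coface₀.map ∧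
    B.face₀.map ∘ₗ B.coface₂.map = B.face₁.map ∘ₗ B.coface₀.map ∧
    B.face₀.map ∘ₗ B.coface₃.map = B.face₂.map ∘ₗ B.coface₀.map ∧
    B.face₀.map ∘ₗ B.coface₄.map = B.face₃.map ∘ₗ B.coface₀.map ∧
    B.face₁.map ∘ₗ B.coface₂.map = B.face₁.map ∘ₗ B.coface₁.map ∧
    B.face₁.map ∘ₗ B.coface₃.map = B.face₂.map ∘ₗ B.coface₁.map ∧
    B.face₁.map ∘ₗ B.coface₄.map = B.face₃.map ∘ₗ B.coface₁.map ∧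
    B.face₂.map ∘ₗ B.coface₃.map = B.face₂.map ∘ₗ B.coface₂.map ∧
    B.face₂.map ∘ₗ B.coface₄.map = B.face₃.map ∘ₗ B.coface₂.map ∧
    B.face₃.map ∘ₗ B.coface₄.map = B.face₃.map ∘ₗ B.coface₃.map := by
  refine ⟨?_, ?_, ?_, ?_, ?_, ?_, ?_, ?_, ?_, ?_⟩ <;> refine B.ext_tmul₄ fun a b c d => ?_ <;>
  simp only [LinearMap.comp_apply, coface₀_map, coface₁_map, coface₂_map, coface₃_map, coface₄_map,
    face₀_map, face₁_map, face₂_map, face₃_map, map_smul, ← TensorProduct.smul_tmul', smul_smul,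
    Bialgebra.counit_mul, mul_assoc, mul_comm]

/-- The insertion `a ⊗ b ↦ 1 ⊗ a ⊗ b`. -/
def degen₁ : Hom B.frame₂ B.frame₃ :=
  (Hom.unitLeft B.frame B.frame).tensor (Hom.id B.frame)

/-- The insertion `a ⊗ b ↦ a ⊗ 1 ⊗ b`. -/
def degen₂ : Hom B.frame₂ B.frame₃ :=
  (Hom.unitRight B.frame B.frame).tensor (Hom.id B.frame)

/-- The insertion `a ⊗ b ↦ a ⊗ b ⊗ 1`. -/
def degen₃ : Hom B.frame₂ B.frame₃ := Hom.unitRight B.frame₂ B.frame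

theorem degen₁_map (a b : B.U) : B.degen₁.map (a ⊗ₜ b) = (1 ⊗ₜ a) ⊗ₜ b := by
  simp [degen₁, Hom.tensor, Hom.unitLeft, Hom.id]

theorem degen₂_map (a b : B.U) : B.degen₂.map (a ⊗ₜ b) = (a ⊗ₜ 1) ⊗ₜ b := by
  simp [degen₂, Hom.tensor, Hom.unitRight, Hom.id]

theorem degen₃_map (t : B.U ⊗[k] B.U) : B.degen₃.map t = t ⊗ₜ 1 := by
  simp [degen₃, Hom.unitRight]

theorem tensorOne_eq (F : B.O₂) : B.tensorOne F = B.face₃.pull F := by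
  refine ext_ofConv fun u => ?_
  induction u with
  | zero => simp
  | add u v hu hv => rw [map_add, map_add, hu, hv]
  | tmul t c =>
    rw [tensorOne, tmul_tmul, Hom.pull_apply, face₃_map, map_smul, one_apply, smul_eq_mul, mul_comm]

theorem oneTensor_eq (F : B.O₂) : B.oneTensor F = B.face₀.pull F := by
  refine WithConv.ofConv_injective (B.ext_tmul₃ fun a b c => ?_)
  change (tmul (1 : B.O) F).ofConv (a ⊗ₜ (b ⊗ₜ c)) = F.ofConv (B.face₀.map _)
  rw [tmul_tmul, face₀_map, map_smul, one_apply, smul_eq_mul]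

theorem comulLeft_eq (F : B.O₂) : B.comulLeft F = B.face₁.pull F := rfl

theorem comulRight_eq (F : B.O₂) : B.comulRight F = B.face₂.pull F := rfl

end LieBialgebra

open FormalFun

/-! ### Twists modulo functions vanishing to a given order -/

namespace LieBialgebra

variable {k g : Type*} [Field k] [CharZero k] [LieRing g] [LieAlgebra k g] [Module.Finite k g]
variable (B : LieBialgebra k g)

open CoPoissonFrame

variable {B} in
theorem IsInMaxIdealSq.mem_I {F : B.O₂} (hF : B.IsInMaxIdealSq F) : F ∈ B.frame₂.I 2 := by
  refine B.spansFilt_pbw₂.mem_I_iff.2 ?_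
  rintro ⟨P, Q⟩ h
  dsimp only at h ⊢
  have : P = 0 ∨ Q = 0 := by
    rw [← Multiset.card_eq_zero, ← Multiset.card_eq_zero]; omega
  rcases this with rfl | rfl
  · rw [pbw_zero]; exact (hF _).2
  · rw [pbw_zero]; exact (hF _).1

variable {B} in
theorem IsInMaxIdealSq.add {F G : B.O₂} (hF : B.IsInMaxIdealSq F) (hG : B.IsInMaxIdealSq G) :
    B.IsInMaxIdealSq (F + G) := fun u => by
  rw [ofConv_add_apply, ofConv_add_apply, (hF u).1, (hF u).2, (hG u).1, (hG u).2]; simp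

theorem isInMaxIdealSq_iff {F : B.O₂} : B.IsInMaxIdealSq F ↔
    ∀ P, F.ofConv (B.pbw P ⊗ₜ 1) = 0 ∧ F.ofConv (1 ⊗ₜ B.pbw P) = 0 := by
  refine ⟨fun h P => h _, fun h u => ?_⟩
  have hu : u ∈ Submodule.span k (Set.range B.pbwBasis) := by rw [B.pbwBasis.span_eq]; trivial
  induction hu using Submodule.span_induction with
  | zero => simp
  | add u v _ _ hu hv =>
    rw [TensorProduct.add_tmul, TensorProduct.tmul_add, map_add, map_add, hu.1, hv.1, hu.2, hv.2]
    simp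
  | smul c u _ hu =>
    rw [← TensorProduct.smul_tmul', TensorProduct.tmul_smul, map_smul, map_smul, hu.1, hu.2]
    simp
  | mem u hu =>
    obtain ⟨P, rfl⟩ := hu
    rw [pbwBasis_apply]
    exact h P

/-- The function on the square of the formal group with coefficients `β`, for `β` vanishing
whenever one argument is the trivial monomial. -/
theorem isInMaxIdealSq_ofCoeffs {β : Multiset B.Idx → Multiset B.Idx → k}
    (h : ∀ P, β P 0 = 0 ∧ β 0 P = 0) : B.IsInMaxIdealSq (B.ofCoeffs β) := by
  rw [isInMaxIdealSq_iff]
  intro P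
  rw [← pbw_zero, ofCoeffs_apply, ofCoeffs_apply]
  exact h P

/-- `F` satisfies the twist equation modulo functions vanishing to order `p`. -/
def IsTwistMod (p : ℕ) (F : B.frame₂.LieFun) : Prop :=
  B.frame₃.gp p (B.face₃.lie F) * B.frame₃.gp p (B.face₁.lie F) =
    B.frame₃.gp p (B.face₀.lie F) * B.frame₃.gp p (B.face₂.lie F)

/-- The sum of the terms of degree `< N` of the Baker-Campbell-Hausdorff series. -/
def bchSum (N : ℕ) (f g : B.O₃) : B.O₃ :=
  ∑ n ∈ Finset.range N, bchTerm k (fun f g => B.frame₃.br f g) f g n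

theorem bchSum_mem_I (N : ℕ) (f g : B.frame₃.LieFun) :
    B.bchSum N (LieFun.val f) (LieFun.val g) ∈ B.frame₃.I 2 := by
  refine sum_mem fun n _ => ?_
  rcases n with _ | n
  · rw [bchTerm_zero]; exact zero_mem _
  · exact B.frame₃.I_anti (by omega) (B.frame₃.bchTerm_mem_I (LieFun.val_mem f) (LieFun.val_mem g) _)

theorem gp_mul_eq_gp_bchSum {p N : ℕ} (hN : p ≤ N + 1) (f g : B.frame₃.LieFun) :
    B.frame₃.gp p f * B.frame₃.gp p g = B.frame₃.gp p (LieFun.mk _ (B.bchSum_mem_I N f g)) := by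
  rw [B.frame₃.gp_mul_eq_iff hN, LieFun.val_mk, bchSum, sub_self]
  exact zero_mem _

theorem isTwistMod_iff {p N : ℕ} (hN : p ≤ N + 1) (F : B.frame₂.LieFun) : B.IsTwistMod p F ↔
    B.bchSum N (B.face₃.pull (LieFun.val F)) (B.face₁.pull (LieFun.val F)) -
      B.bchSum N (B.face₀.pull (LieFun.val F)) (B.face₂.pull (LieFun.val F)) ∈ B.frame₃.I p := by
  rw [IsTwistMod, gp_mul_eq_gp_bchSum B hN, gp_mul_eq_gp_bchSum B hN, gp_eq_iff]
  rfl

theorem hasFormalSum_bchTerm_iff {f g : B.O₃} (hf : f ∈ B.frame₃.I 2) (hg : g ∈ B.frame₃.I 2)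
    {c : B.O₃} : B.IsStar₃ f g c ↔ ∀ N, B.bchSum N f g - c ∈ B.frame₃.I N :=
  B.frame₃.hasFormalSum_iff fun n => B.frame₃.I_anti (Nat.le_succ n) (B.frame₃.bchTerm_mem_I hf hg n)

/-- The twist equation holds if and only if it holds to every order. -/
theorem isTwist_iff {F : B.O₂} (hF : B.IsInMaxIdealSq F) :
    B.IsTwist F ↔ ∀ p, B.IsTwistMod p (LieFun.mk F hF.mem_I) := by
  have hm : ∀ φ : Hom B.frame₃ B.frame₂, φ.pull F ∈ B.frame₃.I 2 := fun φ => φ.pull_mem_I hF.mem_I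
  rw [IsTwist, tensorOne_eq, oneTensor_eq, comulLeft_eq, comulRight_eq]
  simp only [hasFormalSum_bchTerm_iff B (hm _) (hm _)]
  constructor
  · rintro ⟨-, c, h1, h2⟩ p
    rw [isTwistMod_iff B (Nat.le_succ p)]
    have := sub_mem (h1 p) (h2 p)
    rwa [sub_sub_sub_cancel_right] at this
  · intro h
    refine ⟨hF, ?_⟩
    obtain ⟨c, hc⟩ := B.frame₃.exists_hasFormalSum fun n => B.frame₃.I_anti (Nat.le_succ n)
      (B.frame₃.bchTerm_mem_I (hm B.face₃) (hm B.face₁) n)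
    have hc' := (hasFormalSum_bchTerm_iff B (hm B.face₃) (hm B.face₁)).1 hc
    refine ⟨c, hc', fun N => ?_⟩
    have := sub_mem (hc' N) ((isTwistMod_iff B (Nat.le_succ N) _).1 (h N))
    rw [LieFun.val_mk] at this
    convert this using 1
    abel

/-! ### The obstruction to lifting a twist to the next order -/

/-- The obstruction to extending a twist modulo functions vanishing to order `p` to the next
order. -/
def obstruction (p : ℕ) (F : B.frame₂.LieFun) : B.O₃ :=
  B.bchSum p (B.face₃.pull (LieFun.val F)) (B.face₁.pull (LieFun.val F)) -
    B.bchSum p (B.face₀.pull (LieFun.val F)) (B.face₂.pull (LieFun.val F))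

variable {B} {p : ℕ} {F : B.frame₂.LieFun}

theorem obstruction_mem_I_two (p : ℕ) (F : B.frame₂.LieFun) : B.obstruction p F ∈ B.frame₃.I 2 :=
  sub_mem (B.bchSum_mem_I p (B.face₃.lie F) (B.face₁.lie F))
    (B.bchSum_mem_I p (B.face₀.lie F) (B.face₂.lie F))

/-- The obstruction, as an element of the Lie algebra of functions. -/
def obstructionLie (p : ℕ) (F : B.frame₂.LieFun) : B.frame₃.LieFun :=
  LieFun.mk _ (obstruction_mem_I_two p F)

theorem val_obstructionLie (p : ℕ) (F : B.frame₂.LieFun) :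
    LieFun.val (obstructionLie p F) = B.obstruction p F := rfl

theorem obstruction_mem_I (h : B.IsTwistMod p F) : B.obstruction p F ∈ B.frame₃.I p :=
  (B.isTwistMod_iff (Nat.le_succ p) F).1 h

/-- The twist equation holds to the next order up to the obstruction. -/
theorem gp_obstruction (h : B.IsTwistMod p F) :
    B.frame₃.gp (p + 1) (B.face₃.lie F) * B.frame₃.gp (p + 1) (B.face₁.lie F) =
      B.frame₃.gp (p + 1) (obstructionLie p F) *
        (B.frame₃.gp (p + 1) (B.face₀.lie F) * B.frame₃.gp (p + 1) (B.face₂.lie F)) := by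
  rw [gp_mul_eq_gp_bchSum B le_rfl, gp_mul_eq_gp_bchSum B le_rfl, ← gp_add]
  · congr 1
    refine LieFun.val_injective ?_
    rw [map_add]
    exact (sub_add_cancel _ _).symm
  · exact obstruction_mem_I h

/-- The image of the defining identity of the obstruction under a coface map. -/
theorem grp_gp_obstruction {H ι : Type*} [Ring H] [Bialgebra k H] [Fintype ι]
    [Coalgebra.IsCocomm k H] {G : CoPoissonFrame k H ι} (φ : Hom G B.frame₃)
    (h : B.IsTwistMod p F) :
    G.gp (p + 1) (φ.lie (B.face₃.lie F)) * G.gp (p + 1) (φ.lie (B.face₁.lie F)) =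
      G.gp (p + 1) (φ.lie (obstructionLie p F)) *
        (G.gp (p + 1) (φ.lie (B.face₀.lie F)) * G.gp (p + 1) (φ.lie (B.face₂.lie F))) := by
  have := congrArg (φ.grp (p + 1)) (gp_obstruction h)
  simpa only [map_mul, Hom.grp_gp] using this

/-- The functions `F ⊗ 1 ⊗ 1` and `1 ⊗ 1 ⊗ F` commute. -/
theorem gp_coface_comm (q : ℕ) (F : B.frame₂.LieFun) :
    B.frame₄.gp q (B.coface₃.lie (B.face₃.lie F)) * B.frame₄.gp q (B.coface₀.lie (B.face₀.lie F)) =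
      B.frame₄.gp q (B.coface₀.lie (B.face₀.lie F)) *
        B.frame₄.gp q (B.coface₃.lie (B.face₃.lie F)) := by
  have ha : LieFun.val (B.coface₃.lie (B.face₃.lie F)) =
      (Hom.assoc B.frame₂ B.frame B.frame).pull (tmul (LieFun.val F) 1) := by
    refine WithConv.ofConv_injective (B.ext_tmul₄ fun a b c d => ?_)
    change (LieFun.val F).ofConv (B.face₃.map (B.coface₃.map _)) =
      (tmul (LieFun.val F) 1).ofConv ((a ⊗ₜ b) ⊗ₜ (c ⊗ₜ d))
    rw [coface₃_map, face₃_map, tmul_tmul, one_apply, map_smul, smul_eq_mul,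
      Bialgebra.counit_mul, TensorProduct.counit_tmul, smul_eq_mul]
    ring
  have hb : LieFun.val (B.coface₀.lie (B.face₀.lie F)) =
      (Hom.assoc B.frame₂ B.frame B.frame).pull (tmul 1 (LieFun.val F)) := by
    refine WithConv.ofConv_injective (B.ext_tmul₄ fun a b c d => ?_)
    change (LieFun.val F).ofConv (B.face₀.map (B.coface₀.map _)) =
      (tmul 1 (LieFun.val F)).ofConv ((a ⊗ₜ b) ⊗ₜ (c ⊗ₜ d))
    rw [coface₀_map, face₀_map, tmul_tmul, one_apply, ← TensorProduct.smul_tmul', map_smul,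
      face₀_map, map_smul, map_smul, smul_eq_mul,
      smul_eq_mul, TensorProduct.counit_tmul, smul_eq_mul]
    ring
  refine B.frame₄.gp_mul_comm_of_br ?_ _ _ ha hb
  rw [← Hom.pull_br, br_tmul_one_one_tmul, map_zero]

/-- The two ways round the pentagon in a group, with central corrections `aᵢ` on its faces. -/
theorem pentagon_of_central {A : Type*} [Group A]
    {F12 F34 F12'3 F123'4 F12'34 F1'23 F1'234 F23 F23'4 F2'34 a0 a1 a2 a3 a4 : A}
    (c1 : ∀ a, a1 * a = a * a1) (c2 : ∀ a, a2 * a = a * a2) (c3 : ∀ a, a3 * a = a * a3)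
    (hcomm : F12 * F34 = F34 * F12) (e0 : F23 * F23'4 = a0 * (F34 * F2'34))
    (e1 : F12'3 * F123'4 = a1 * (F34 * F12'34)) (e2 : F1'23 * F123'4 = a2 * (F23'4 * F1'234))
    (e3 : F12 * F12'34 = a3 * (F2'34 * F1'234)) (e4 : F12 * F12'3 = a4 * (F23 * F1'23)) :
    a4 * a2 * a0 = a1 * a3 := by
  have l : F12 * F12'3 * F123'4 = a4 * a2 * a0 * (F34 * (F2'34 * F1'234)) := by
    rw [e4, mul_assoc, mul_assoc, e2, ← mul_assoc F23 a2, ← c2, mul_assoc a2, ← mul_assoc F23, e0]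
    simp only [mul_assoc]
  have r : F12 * F12'3 * F123'4 = a1 * a3 * (F34 * (F2'34 * F1'234)) := by
    rw [mul_assoc, e1, ← mul_assoc F12, ← c1, mul_assoc a1, ← mul_assoc F12 F34, hcomm,
      mul_assoc F34, e3, ← mul_assoc F34, ← c3]
    simp only [mul_assoc]
  exact mul_right_cancel (l.symm.trans r)

theorem sub_mem_I_of_gp_mul_eq {H ι : Type*} [Ring H] [Bialgebra k H] [Fintype ι]
    [Coalgebra.IsCocomm k H] {G : CoPoissonFrame k H ι} {q : ℕ} {a b c d e : G.LieFun}
    (ha : LieFun.val a ∈ G.I (q - 1)) (hb : LieFun.val b ∈ G.I (q - 1))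
    (hd : LieFun.val d ∈ G.I (q - 1)) (h : G.gp q a * G.gp q b * G.gp q c = G.gp q d * G.gp q e) :
    LieFun.val a + LieFun.val b + LieFun.val c - (LieFun.val d + LieFun.val e) ∈ G.I q := by
  rw [← gp_add _ ha, ← gp_add _ (by rw [map_add]; exact add_mem ha hb), ← gp_add _ hd,
    gp_eq_iff] at h
  simpa only [map_add] using h

/-- The pentagon identity: the obstruction is a cocycle. -/
theorem obstruction_pentagon (h : B.IsTwistMod p F) :
    (B.coface₄.pull (B.obstruction p F) + B.coface₂.pull (B.obstruction p F) +
      B.coface₀.pull (B.obstruction p F)) - (B.coface₁.pull (B.obstruction p F) +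
      B.coface₃.pull (B.obstruction p F)) ∈ B.frame₄.I (p + 1) := by
  obtain ⟨s01, s02, s03, s04, s12, s13, s14, s23, s24, s34⟩ := B.face_comp_coface
  have e0 := grp_gp_obstruction B.coface₀ h
  have e1 := grp_gp_obstruction B.coface₁ h
  have e2 := grp_gp_obstruction B.coface₂ h
  have e3 := grp_gp_obstruction B.coface₃ h
  have e4 := grp_gp_obstruction B.coface₄ h
  rw [Hom.lie_lie_congr s01] at e1
  rw [Hom.lie_lie_congr s02, Hom.lie_lie_congr s12] at e2
  rw [Hom.lie_lie_congr s03, Hom.lie_lie_congr s13, Hom.lie_lie_congr s23] at e3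
  rw [Hom.lie_lie_congr s04, Hom.lie_lie_congr s14, Hom.lie_lie_congr s24,
    Hom.lie_lie_congr s34] at e4
  have hmem : ∀ φ : Hom B.frame₄ B.frame₃, LieFun.val (φ.lie (obstructionLie p F)) ∈
      B.frame₄.I (p + 1 - 1) := fun φ => φ.pull_mem_I (obstruction_mem_I h)
  have key := pentagon_of_central (B.frame₄.gp_central (hmem B.coface₁))
    (B.frame₄.gp_central (hmem B.coface₂)) (B.frame₄.gp_central (hmem B.coface₃))
    (gp_coface_comm (p + 1) F) e0 e1 e2 e3 e4
  have fin := sub_mem_I_of_gp_mul_eq (hmem _) (hmem _) (hmem _) key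
  simpa only [Hom.val_lie, val_obstructionLie] using fin

end LieBialgebra

open FormalFun

theorem CoPoissonFrame.I_apply_eq {k H ι : Type*} [Field k] [Ring H] [Bialgebra k H] [Fintype ι]
    [Coalgebra.IsCocomm k H] (F : CoPoissonFrame k H ι) {p n : ℕ} {f : FormalFun k H}
    (hf : f ∈ F.I p) {u v : H} (h : u - v ∈ F.filt n) (hn : n < p) : f.ofConv u = f.ofConv v := by
  rw [← sub_eq_zero, ← map_sub]
  exact F.I_apply_filt hf h hn

namespace LieBialgebra

variable {k g : Type*} [Field k] [CharZero k] [LieRing g] [LieAlgebra k g] [Module.Finite k g]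
variable {B : LieBialgebra k g}

open CoPoissonFrame

/-! ### Lifting a twist to the next order -/

/-- A function of `m ⊗̂ m`, as an element of the Lie algebra of functions. -/
def IsInMaxIdealSq.lieFun {F : B.O₂} (hF : B.IsInMaxIdealSq F) : B.frame₂.LieFun :=
  LieFun.mk F hF.mem_I

theorem IsInMaxIdealSq.val_lieFun {F : B.O₂} (hF : B.IsInMaxIdealSq F) :
    LieFun.val hF.lieFun = F := rfl

theorem IsInMaxIdealSq.lie_eq {F : B.O₂} (hF : B.IsInMaxIdealSq F) {φ : Hom B.frame₂ B.frame₃}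
    {ψ : Hom B.frame₃ B.frame₂} (h : ∀ a b, ψ.map (φ.map (a ⊗ₜ b)) = a ⊗ₜ b) :
    φ.lie (ψ.lie hF.lieFun) = hF.lieFun := by
  refine LieFun.val_injective (WithConv.ofConv_injective (TensorProduct.ext' fun a b => ?_))
  exact congrArg F.ofConv (h a b)

theorem IsInMaxIdealSq.lie_eq_zero {F : B.O₂} (hF : B.IsInMaxIdealSq F)
    {φ : Hom B.frame₂ B.frame₃} {ψ : Hom B.frame₃ B.frame₂}
    (h : ∀ a b, F.ofConv (ψ.map (φ.map (a ⊗ₜ b))) = 0) : φ.lie (ψ.lie hF.lieFun) = 0 := by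
  refine LieFun.val_injective (WithConv.ofConv_injective (TensorProduct.ext' fun a b => ?_))
  exact h a b

/-- The obstruction vanishes whenever one of its arguments is trivial. -/
theorem obstruction_apply_eq_zero {p : ℕ} {F : B.O₂} (hF : B.IsInMaxIdealSq F)
    (h : B.IsTwistMod p hF.lieFun) {P Q R : Multiset B.Idx}
    (hc : Multiset.card P + Multiset.card Q + Multiset.card R ≤ p) (h0 : P = 0 ∨ Q = 0 ∨ R = 0) :
    (B.obstruction p hF.lieFun).ofConv ((B.pbw P ⊗ₜ B.pbw Q) ⊗ₜ B.pbw R) = 0 := by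
  have hl : ∀ u : B.U, F.ofConv (1 ⊗ₜ u) = 0 := fun u => (hF u).2
  have hr : ∀ u : B.U, F.ofConv (u ⊗ₜ 1) = 0 := fun u => (hF u).1
  have key : ∀ φ : Hom B.frame₂ B.frame₃, B.frame₂.gp (p + 1) (φ.lie (obstructionLie p hF.lieFun)) =
      1 → φ.pull (B.obstruction p hF.lieFun) ∈ B.frame₂.I (p + 1) := by
    intro φ hφ
    rw [← gp_zero, gp_eq_iff, map_zero, sub_zero] at hφ
    exact hφ
  have hmem : ∀ P Q : Multiset B.Idx, B.pbw P ⊗ₜ B.pbw Q ∈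
      B.frame₂.filt (Multiset.card P + Multiset.card Q) := fun P Q => B.spansFilt_pbw₂.1 (P, Q)
  rcases h0 with rfl | rfl | rfl
  · have e := grp_gp_obstruction B.degen₁ h
    rw [hF.lie_eq_zero (φ := B.degen₁) (ψ := B.face₃) (fun a b => by
        rw [degen₁_map, face₃_map, map_smul, hl, smul_zero]),
      hF.lie_eq (φ := B.degen₁) (ψ := B.face₁) (fun a b => by
        rw [degen₁_map, face₁_map, one_mul]),
      hF.lie_eq (φ := B.degen₁) (ψ := B.face₀) (fun a b => by
        rw [degen₁_map, face₀_map, Bialgebra.counit_one, one_smul]),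
      hF.lie_eq_zero (φ := B.degen₁) (ψ := B.face₂) (fun a b => by
        rw [degen₁_map, face₂_map, hl]), gp_zero, one_mul, mul_one, right_eq_mul] at e
    have := B.frame₂.I_apply_filt (key _ e) (hmem Q R) (by simp at hc; omega)
    rwa [Hom.pull_apply, degen₁_map, ← pbw_zero] at this
  · have e := grp_gp_obstruction B.degen₂ h
    rw [hF.lie_eq_zero (φ := B.degen₂) (ψ := B.face₃) (fun a b => by
        rw [degen₂_map, face₃_map, map_smul, hr, smul_zero]),
      hF.lie_eq (φ := B.degen₂) (ψ := B.face₁) (fun a b => by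
        rw [degen₂_map, face₁_map, mul_one]),
      hF.lie_eq_zero (φ := B.degen₂) (ψ := B.face₀) (fun a b => by
        rw [degen₂_map, face₀_map, map_smul, hl, smul_zero]),
      hF.lie_eq (φ := B.degen₂) (ψ := B.face₂) (fun a b => by
        rw [degen₂_map, face₂_map, one_mul]), gp_zero, one_mul, right_eq_mul] at e
    have := B.frame₂.I_apply_filt (key _ e) (hmem P R) (by simp at hc; omega)
    rwa [Hom.pull_apply, degen₂_map, ← pbw_zero] at this
  · have e := grp_gp_obstruction B.degen₃ h
    rw [hF.lie_eq (φ := B.degen₃) (ψ := B.face₃) (fun a b => by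
        rw [degen₃_map, face₃_map, Bialgebra.counit_one, one_smul]),
      hF.lie_eq_zero (φ := B.degen₃) (ψ := B.face₁) (fun a b => by
        rw [degen₃_map, face₁_map, hr]),
      hF.lie_eq_zero (φ := B.degen₃) (ψ := B.face₀) (fun a b => by
        rw [degen₃_map, face₀_map, map_smul, hr, smul_zero]),
      hF.lie_eq (φ := B.degen₃) (ψ := B.face₂) (fun a b => by
        rw [degen₃_map, face₂_map, mul_one]), gp_zero, one_mul, mul_one, right_eq_mul] at e
    have := B.frame₂.I_apply_filt (key _ e) (hmem P Q) (by simp at hc; omega)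
    rwa [Hom.pull_apply, degen₃_map, ← pbw_zero] at this

/-- The values of the obstruction on the monomials of degree `p`. -/
def obstructionCoeff (p : ℕ) (F : B.frame₂.LieFun) (P Q R : Multiset B.Idx) : k :=
  if Multiset.card P + Multiset.card Q + Multiset.card R = p then
    (B.obstruction p F).ofConv ((B.pbw P ⊗ₜ B.pbw Q) ⊗ₜ B.pbw R) else 0

theorem apply_pbw_mul_left {p : ℕ} {f : B.O₃} (hf : f ∈ B.frame₃.I p) {P Q R S : Multiset B.Idx}
    (hP : P ≠ 0) (h : Multiset.card P + Multiset.card Q + Multiset.card R + Multiset.card S = p) :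
    f.ofConv (((B.pbw P * B.pbw Q) ⊗ₜ B.pbw R) ⊗ₜ B.pbw S) =
      f.ofConv ((B.pbw (P + Q) ⊗ₜ B.pbw R) ⊗ₜ B.pbw S) := by
  have hc := Multiset.card_pos.2 hP
  refine B.frame₃.I_apply_eq hf (n := p - 1) ?_ (by omega)
  rw [← TensorProduct.sub_tmul, ← TensorProduct.sub_tmul]
  exact tmul_mem_filt _ _ (tmul_mem_filt _ _ (B.pbw_mul_sub_mem P Q
    (n := Multiset.card P + Multiset.card Q - 1) (by omega)) (B.pbw_mem_filt R) le_rfl)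
    (B.pbw_mem_filt S) (by omega)

theorem apply_pbw_mul_middle {p : ℕ} {f : B.O₃} (hf : f ∈ B.frame₃.I p) {P Q R S : Multiset B.Idx}
    (hQ : Q ≠ 0) (h : Multiset.card P + Multiset.card Q + Multiset.card R + Multiset.card S = p) :
    f.ofConv ((B.pbw P ⊗ₜ (B.pbw Q * B.pbw R)) ⊗ₜ B.pbw S) =
      f.ofConv ((B.pbw P ⊗ₜ B.pbw (Q + R)) ⊗ₜ B.pbw S) := by
  have hc := Multiset.card_pos.2 hQ
  refine B.frame₃.I_apply_eq hf (n := p - 1) ?_ (by omega)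
  rw [← TensorProduct.sub_tmul, ← TensorProduct.tmul_sub]
  exact tmul_mem_filt _ _ (tmul_mem_filt _ _ (B.pbw_mem_filt P) (B.pbw_mul_sub_mem Q R
    (n := Multiset.card Q + Multiset.card R - 1) (by omega)) le_rfl)
    (B.pbw_mem_filt S) (by omega)

theorem apply_pbw_mul_right {p : ℕ} {f : B.O₃} (hf : f ∈ B.frame₃.I p) {P Q R S : Multiset B.Idx}
    (hR : R ≠ 0) (h : Multiset.card P + Multiset.card Q + Multiset.card R + Multiset.card S = p) :
    f.ofConv ((B.pbw P ⊗ₜ B.pbw Q) ⊗ₜ (B.pbw R * B.pbw S)) =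
      f.ofConv ((B.pbw P ⊗ₜ B.pbw Q) ⊗ₜ B.pbw (R + S)) := by
  have hc := Multiset.card_pos.2 hR
  refine B.frame₃.I_apply_eq hf (n := p - 1) ?_ (by omega)
  rw [← TensorProduct.tmul_sub]
  exact tmul_mem_filt _ _ (tmul_mem_filt _ _ (B.pbw_mem_filt P) (B.pbw_mem_filt Q) le_rfl)
    (B.pbw_mul_sub_mem R S (n := Multiset.card R + Multiset.card S - 1) (by omega)) (by omega)

theorem isCocycle_obstructionCoeff {p : ℕ} {F : B.frame₂.LieFun} (h : B.IsTwistMod p F) :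
    MonomialCohomology.IsCocycle (obstructionCoeff p F) := by
  intro P Q R S hP hQ hR hS
  have hα := obstruction_mem_I h
  by_cases hc : Multiset.card P + Multiset.card Q + Multiset.card R + Multiset.card S = p
  · have := B.frame₄.I_apply_filt (obstruction_pentagon h) (tmul_mem_filt B.frame₃ B.frame
      (B.spansFilt_pbw₃.1 ((P, Q), R)) (B.pbw_mem_filt S) le_rfl)
      (by dsimp only; omega)
    dsimp only at this
    rw [ofConv_sub_apply, ofConv_add_apply, ofConv_add_apply, ofConv_add_apply, Hom.pull_apply,
      Hom.pull_apply, Hom.pull_apply, Hom.pull_apply, Hom.pull_apply, coface₀_map, coface₁_map,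
      coface₂_map, coface₃_map, coface₄_map, face₀_map, face₁_map, face₂_map, B.counit_pbw hP,
      B.counit_pbw hS, zero_smul, zero_smul, TensorProduct.zero_tmul, map_zero,
      apply_pbw_mul_left hα hP hc, apply_pbw_mul_middle hα hQ hc,
      apply_pbw_mul_right hα hR hc] at this
    rw [obstructionCoeff, if_pos (by rw [Multiset.card_add]; omega), obstructionCoeff,
      if_pos (by rw [Multiset.card_add]; omega), obstructionCoeff,
      if_pos (by rw [Multiset.card_add]; omega)]
    linear_combination this
  · rw [obstructionCoeff, if_neg (by rw [Multiset.card_add]; omega), obstructionCoeff,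
      if_neg (by rw [Multiset.card_add]; omega), obstructionCoeff,
      if_neg (by rw [Multiset.card_add]; omega), add_zero]

theorem ofCoeffs_apply_mul_left {p : ℕ} {f : B.O₂} (hf : f ∈ B.frame₂.I p)
    {P Q R : Multiset B.Idx} (hP : P ≠ 0)
    (h : Multiset.card P + Multiset.card Q + Multiset.card R ≤ p) :
    f.ofConv ((B.pbw P * B.pbw Q) ⊗ₜ B.pbw R) = f.ofConv (B.pbw (P + Q) ⊗ₜ B.pbw R) := by
  have hc := Multiset.card_pos.2 hP
  refine B.frame₂.I_apply_eq hf (n := p - 1) ?_ (by omega)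
  rw [← TensorProduct.sub_tmul]
  exact tmul_mem_filt _ _ (B.pbw_mul_sub_mem P Q
    (n := Multiset.card P + Multiset.card Q - 1) (by omega)) (B.pbw_mem_filt R) (by omega)

theorem ofCoeffs_apply_mul_right {p : ℕ} {f : B.O₂} (hf : f ∈ B.frame₂.I p)
    {P Q R : Multiset B.Idx} (hQ : Q ≠ 0)
    (h : Multiset.card P + Multiset.card Q + Multiset.card R ≤ p) :
    f.ofConv (B.pbw P ⊗ₜ (B.pbw Q * B.pbw R)) = f.ofConv (B.pbw P ⊗ₜ B.pbw (Q + R)) := by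
  have hc := Multiset.card_pos.2 hQ
  refine B.frame₂.I_apply_eq hf (n := p - 1) ?_ (by omega)
  rw [← TensorProduct.tmul_sub]
  exact tmul_mem_filt _ _ (B.pbw_mem_filt P) (B.pbw_mul_sub_mem Q R
    (n := Multiset.card Q + Multiset.card R - 1) (by omega)) (by omega)

/-- In the group of jets, the corrections `bᵢ` and the obstruction `o` are central, so that an
additive relation between them absorbs the defect of the twist equation of the `fᵢ`. -/
theorem mul_mul_mul_eq_of_central {A : Type*} [Group A] {b0 b1 b2 b3 f0 f1 f2 f3 o : A}
    (c1 : ∀ a, b1 * a = a * b1) (c2 : ∀ a, b2 * a = a * b2) (h : f3 * f1 = o * (f0 * f2))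
    (hb : b3 * b1 * o = b0 * b2) : b3 * f3 * (b1 * f1) = b0 * f0 * (b2 * f2) := by
  rw [mul_assoc, ← mul_assoc f3, ← c1, mul_assoc, h, mul_assoc, ← mul_assoc f0, ← c2, mul_assoc,
    ← mul_assoc, ← mul_assoc, hb, mul_assoc]

theorem IsInMaxIdealSq.lieFun_add {F G : B.O₂} (hF : B.IsInMaxIdealSq F)
    (hG : B.IsInMaxIdealSq G) : (hF.add hG).lieFun = hF.lieFun + hG.lieFun := rfl

/-- A function `b` that bounds the obstruction corrects the twist to the next order. -/
theorem isTwistMod_add {p : ℕ} {F b : B.frame₂.LieFun} (h : B.IsTwistMod p F)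
    (hb : LieFun.val b ∈ B.frame₂.I p)
    (key : B.face₃.pull (LieFun.val b) + B.face₁.pull (LieFun.val b) + B.obstruction p F -
      (B.face₀.pull (LieFun.val b) + B.face₂.pull (LieFun.val b)) ∈ B.frame₃.I (p + 1)) :
    B.IsTwistMod (p + 1) (b + F) := by
  have hmem : ∀ φ : Hom B.frame₃ B.frame₂, LieFun.val (φ.lie b) ∈
      B.frame₃.I (p + 1 - 1) := fun φ => φ.pull_mem_I hb
  have key' : B.frame₃.gp (p + 1) (B.face₃.lie b + B.face₁.lie b + obstructionLie p F) =
      B.frame₃.gp (p + 1) (B.face₀.lie b + B.face₂.lie b) := by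
    rw [gp_eq_iff]
    simpa only [map_add, Hom.val_lie, val_obstructionLie] using key
  rw [B.frame₃.gp_add (by rw [map_add]; exact add_mem (hmem _) (hmem _)), B.frame₃.gp_add (hmem _),
    B.frame₃.gp_add (hmem _)] at key'
  have h1 := gp_obstruction h
  have c1 := B.frame₃.gp_central (hmem B.face₁)
  have c2 := B.frame₃.gp_central (hmem B.face₂)
  rw [IsTwistMod, map_add, map_add, map_add, map_add, B.frame₃.gp_add (hmem _),
    B.frame₃.gp_add (hmem _), B.frame₃.gp_add (hmem _), B.frame₃.gp_add (hmem _)]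
  exact mul_mul_mul_eq_of_central c1 c2 h1 key'

theorem bounds_obstruction {p : ℕ} {F b : B.O₂} (hF : B.IsInMaxIdealSq F)
    (h : B.IsTwistMod p hF.lieFun) (hbn : B.IsInMaxIdealSq b) (hbI : b ∈ B.frame₂.I p)
    (hb : ∀ P Q R, P ≠ 0 → Q ≠ 0 → R ≠ 0 →
      Multiset.card P + Multiset.card Q + Multiset.card R = p →
      obstructionCoeff p hF.lieFun P Q R =
        b.ofConv (B.pbw P ⊗ₜ B.pbw (Q + R)) - b.ofConv (B.pbw (P + Q) ⊗ₜ B.pbw R)) :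
    B.face₃.pull b + B.face₁.pull b + B.obstruction p hF.lieFun -
      (B.face₀.pull b + B.face₂.pull b) ∈ B.frame₃.I (p + 1) := by
  refine B.spansFilt_pbw₃.mem_I_iff.2 ?_
  rintro ⟨⟨P, Q⟩, R⟩ hc
  dsimp only at hc ⊢
  rw [ofConv_sub_apply, ofConv_add_apply, ofConv_add_apply,
    ofConv_add_apply, Hom.pull_apply, Hom.pull_apply, Hom.pull_apply, Hom.pull_apply, face₀_map,
    face₁_map, face₂_map, face₃_map, map_smul, map_smul]
  by_cases h0 : P = 0 ∨ Q = 0 ∨ R = 0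
  · rw [obstruction_apply_eq_zero hF h (by omega) h0]
    rcases h0 with rfl | rfl | rfl <;> simp [pbw_zero, (hbn _).1, (hbn _).2]
  · push Not at h0
    rw [B.counit_pbw h0.1, B.counit_pbw h0.2.2, zero_smul, zero_smul,
      ofCoeffs_apply_mul_left hbI h0.1 (by omega), ofCoeffs_apply_mul_right hbI h0.2.1 (by omega)]
    by_cases hc' : Multiset.card P + Multiset.card Q + Multiset.card R = p
    · have h1 := hb P Q R h0.1 h0.2.1 h0.2.2 hc'
      rw [obstructionCoeff, if_pos hc'] at h1
      rw [h1]
      ring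
    · have h2 := B.frame₃.I_apply_filt (obstruction_mem_I h) (B.spansFilt_pbw₃.1 ((P, Q), R))
        (by dsimp only; omega)
      have h3 := B.frame₂.I_apply_filt hbI (B.spansFilt_pbw₂.1 (P + Q, R))
        (by simp only [Multiset.card_add]; omega)
      have h4 := B.frame₂.I_apply_filt hbI (B.spansFilt_pbw₂.1 (P, Q + R))
        (by simp only [Multiset.card_add]; omega)
      dsimp only at h2 h3 h4
      rw [h2, h3, h4]
      simp

/-- A twist modulo functions vanishing to order `p` lifts to the next order if the total
antisymmetrization of its obstruction vanishes. -/
theorem exists_twist_lift {p : ℕ} {F : B.O₂} (hF : B.IsInMaxIdealSq F)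
    (h : B.IsTwistMod p hF.lieFun)
    (halt : ∀ i j l, obstructionCoeff p hF.lieFun {i} {j} {l} +
      obstructionCoeff p hF.lieFun {j} {l} {i} + obstructionCoeff p hF.lieFun {l} {i} {j} =
      obstructionCoeff p hF.lieFun {j} {i} {l} + obstructionCoeff p hF.lieFun {i} {l} {j} +
      obstructionCoeff p hF.lieFun {l} {j} {i}) :
    ∃ (G : B.O₂) (hG : B.IsInMaxIdealSq G), G - F ∈ B.frame₂.I p ∧
      B.IsTwistMod (p + 1) hG.lieFun := by
  classical
  obtain ⟨β, hβ⟩ := MonomialCohomology.exists_eq_d (isCocycle_obstructionCoeff h) halt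
  let β' : Multiset B.Idx → Multiset B.Idx → k := fun P Q =>
    if P ≠ 0 ∧ Q ≠ 0 ∧ Multiset.card P + Multiset.card Q = p then β P Q else 0
  have hbn : B.IsInMaxIdealSq (B.ofCoeffs β') := B.isInMaxIdealSq_ofCoeffs fun P => by simp [β']
  have hbI : B.ofCoeffs β' ∈ B.frame₂.I p := by
    refine B.spansFilt_pbw₂.mem_I_iff.2 ?_
    rintro ⟨P, Q⟩ hPQ
    dsimp only at hPQ ⊢
    rw [ofCoeffs_apply]
    exact if_neg (by omega)
  refine ⟨B.ofCoeffs β' + F, hbn.add hF, by rwa [add_sub_cancel_right], ?_⟩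
  rw [hbn.lieFun_add hF]
  refine isTwistMod_add (b := hbn.lieFun) h hbI ?_
  rw [hbn.val_lieFun]
  refine bounds_obstruction hF h hbn hbI fun P Q R hP hQ hR hc => ?_
  have hPQ : P + Q ≠ 0 := fun h => hP (by simp at h; exact h.1)
  have hQR : Q + R ≠ 0 := fun h => hQ (by simp at h; exact h.1)
  rw [hβ P Q R hP hQ hR, MonomialCohomology.d, ofCoeffs_apply, ofCoeffs_apply]
  simp only [β']
  rw [if_pos ⟨hP, hQR, by rw [Multiset.card_add]; omega⟩,
    if_pos ⟨hPQ, hR, by rw [Multiset.card_add]; omega⟩]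

end LieBialgebra

open FormalFun

/-! ### The obstruction in degree three -/

/-- The Poisson bracket of two functions vanishing to order two, to the lowest order. -/
theorem CoPoissonFrame.br_apply_three {k H ι : Type*} [Field k] [Ring H] [Bialgebra k H] [Fintype ι]
    [Coalgebra.IsCocomm k H] (F : CoPoissonFrame k H ι) {f g : FormalFun k H}
    (hf : f ∈ F.I 2) (hg : g ∈ F.I 2) (a b c : ι) :
    (F.br f g).ofConv (F.x a * F.x b * F.x c) =
      ∑ j, ∑ l, F.c a j l * (f.ofConv (F.x j * F.x b) * g.ofConv (F.x l * F.x c) +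
        f.ofConv (F.x j * F.x c) * g.ofConv (F.x l * F.x b)) +
      ∑ j, ∑ l, F.c b j l * (f.ofConv (F.x j * F.x c) * g.ofConv (F.x a * F.x l) +
        f.ofConv (F.x a * F.x j) * g.ofConv (F.x l * F.x c)) +
      ∑ j, ∑ l, F.c c j l * (f.ofConv (F.x a * F.x j) * g.ofConv (F.x b * F.x l) +
        f.ofConv (F.x b * F.x j) * g.ofConv (F.x a * F.x l)) := by
  have hf1 : ∀ i, f.ofConv (F.x i) = 0 := fun i => by
    rw [← word_singleton]; exact hf _ (by simp)
  have hg1 : ∀ i, g.ofConv (F.x i) = 0 := fun i => by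
    rw [← word_singleton]; exact hg _ (by simp)
  have h : (F.br f g).ofConv (F.x a * F.x b * F.x c) =
      (F.X a (F.X b (F.X c (F.br f g)))).ofConv 1 := by
    simp only [X_apply, one_mul]
  rw [h]
  simp only [X_br, X_mul, map_add, map_sum, map_smul, ofConv_add_apply, ofConv_sum_apply,
    ofConv_smul_apply, mul_apply_one, br_apply_one, X_apply, one_mul, hf1, hg1, mul_zero,
    zero_mul, add_zero, zero_add, Finset.sum_const_zero, ← Finset.sum_add_distrib]
  refine Finset.sum_congr rfl fun j _ => Finset.sum_congr rfl fun l _ => ?_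
  ring

theorem bchTerm_two_of_antisymm {k V : Type*} [Field k] [CharZero k] [AddCommGroup V] [Module k V]
    {br : V → V → V} (h : ∀ x y, br x y = -br y x) (x y : V) :
    bchTerm k br x y 2 = (2 : k)⁻¹ • br x y := by
  have h0 : ∀ x, br x x = 0 := fun x => by
    have h2 : (2 : k) • br x x = 0 := by rw [two_smul]; nth_rewrite 1 [h]; simp
    simpa using h2
  have h1 : (Finset.univ.filter fun p : Fin 1 → Fin 3 × Fin 3 =>
      (∀ i, 0 < ((p i).1 : ℕ) + (p i).2) ∧ ∑ i, (((p i).1 : ℕ) + (p i).2) = 2) =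
      {fun _ => (2, 0), fun _ => (1, 1), fun _ => (0, 2)} := by decide
  have h2 : (Finset.univ.filter fun p : Fin 2 → Fin 3 × Fin 3 =>
      (∀ i, 0 < ((p i).1 : ℕ) + (p i).2) ∧ ∑ i, (((p i).1 : ℕ) + (p i).2) = 2) =
      {![(1, 0), (1, 0)], ![(1, 0), (0, 1)], ![(0, 1), (1, 0)], ![(0, 1), (0, 1)]} := by decide
  rw [bchTerm, show Finset.Icc 1 2 = {1, 2} from rfl, Finset.sum_pair (by decide)]
  erw [h1, h2]
  repeat rw [Finset.sum_insert (by decide)]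
  rw [Finset.sum_singleton, Finset.sum_singleton]
  simp [nestedBracket, List.ofFn_succ, List.replicate_succ, h0]
  rw [h y x, smul_neg, add_neg_cancel]

theorem CoPoissonFrame.sum_range_three_bchTerm {k H ι : Type*} [Field k] [CharZero k] [Ring H]
    [Bialgebra k H] [Fintype ι] [Coalgebra.IsCocomm k H] (F : CoPoissonFrame k H ι)
    (f g : FormalFun k H) : ∑ n ∈ Finset.range 3, bchTerm k (fun f g => F.br f g) f g n =
      f + g + (2 : k)⁻¹ • F.br f g := by
  rw [Finset.sum_range_succ, Finset.sum_range_succ, Finset.sum_range_one, bchTerm_zero,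
    bchTerm_one, zero_add, bchTerm_two_of_antisymm F.br_skew]

namespace LieBialgebra

variable {k g : Type*} [Field k] [CharZero k] [LieRing g] [LieAlgebra k g] [Module.Finite k g]
variable {B : LieBialgebra k g}

open CoPoissonFrame

theorem bchSum_three (f h : B.O₃) :
    B.bchSum 3 f h = f + h + (2 : k)⁻¹ • B.frame₃.br f h :=
  B.frame₃.sum_range_three_bchTerm f h

theorem tensor_x_inl {H ι K κ : Type*} [Ring H] [Bialgebra k H] [Fintype ι]
    [Ring K] [Bialgebra k K] [Fintype κ] (F : CoPoissonFrame k H ι) (G : CoPoissonFrame k K κ)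
    (i : ι) : (F.tensor G).x (Sum.inl i) = F.x i ⊗ₜ 1 := rfl

theorem tensor_x_inr {H ι K κ : Type*} [Ring H] [Bialgebra k H] [Fintype ι]
    [Ring K] [Bialgebra k K] [Fintype κ] (F : CoPoissonFrame k H ι) (G : CoPoissonFrame k K κ)
    (i : κ) : (F.tensor G).x (Sum.inr i) = 1 ⊗ₜ G.x i := rfl

theorem tensor_c {H ι K κ : Type*} [Ring H] [Bialgebra k H] [Fintype ι]
    [Ring K] [Bialgebra k K] [Fintype κ] (F : CoPoissonFrame k H ι) (G : CoPoissonFrame k K κ) :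
    (F.tensor G).c = tensorConst F G := rfl

theorem br_apply_x_tmul {f h : B.O₃} (hf : f ∈ B.frame₃.I 2) (hh : h ∈ B.frame₃.I 2)
    (a b c : B.Idx) : (B.frame₃.br f h).ofConv ((B.frame.x a ⊗ₜ B.frame.x b) ⊗ₜ B.frame.x c) =
      ∑ j, ∑ l, B.frame.c a j l *
        (f.ofConv ((B.frame.x j ⊗ₜ B.frame.x b) ⊗ₜ 1) * h.ofConv ((B.frame.x l ⊗ₜ 1) ⊗ₜ B.frame.x c)
        + f.ofConv ((B.frame.x j ⊗ₜ 1) ⊗ₜ B.frame.x c) *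
          h.ofConv ((B.frame.x l ⊗ₜ B.frame.x b) ⊗ₜ 1)) +
      ∑ j, ∑ l, B.frame.c b j l *
        (f.ofConv ((1 ⊗ₜ B.frame.x j) ⊗ₜ B.frame.x c) * h.ofConv ((B.frame.x a ⊗ₜ B.frame.x l) ⊗ₜ 1)
        + f.ofConv ((B.frame.x a ⊗ₜ B.frame.x j) ⊗ₜ 1) *
          h.ofConv ((1 ⊗ₜ B.frame.x l) ⊗ₜ B.frame.x c)) +
      ∑ j, ∑ l, B.frame.c c j l *
        (f.ofConv ((B.frame.x a ⊗ₜ 1) ⊗ₜ B.frame.x j) * h.ofConv ((1 ⊗ₜ B.frame.x b) ⊗ₜ B.frame.x l)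
        + f.ofConv ((1 ⊗ₜ B.frame.x b) ⊗ₜ B.frame.x j) *
          h.ofConv ((B.frame.x a ⊗ₜ 1) ⊗ₜ B.frame.x l)) := by
  have e := B.frame₃.br_apply_three hf hh (Sum.inl (Sum.inl a)) (Sum.inl (Sum.inr b)) (Sum.inr c)
  simpa only [Fintype.sum_sum_type, tensor_x_inl, tensor_x_inr, tensor_c, tensorConst,
    Algebra.TensorProduct.tmul_mul_tmul, mul_one, one_mul, Algebra.TensorProduct.one_def,
    zero_mul, Finset.sum_const_zero, add_zero, zero_add] using e

/-- The pairing of the structure constants of `g` with two families of scalars. -/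
def constPair (B : LieBialgebra k g) (i : B.Idx) (u v : B.Idx → k) : k :=
  ∑ j, ∑ l, B.frame.c i j l * (u j * v l)

theorem constPair_antisymm (i : B.Idx) (u v : B.Idx → k) :
    B.constPair i u v = -B.constPair i v u := by
  rw [constPair, Finset.sum_comm, constPair, ← Finset.sum_neg_distrib]
  refine Finset.sum_congr rfl fun l _ => ?_
  rw [← Finset.sum_neg_distrib]
  refine Finset.sum_congr rfl fun j _ => ?_
  rw [B.frame.c_antisymm i l j]
  ring

/-- The values of a function on the square of the formal group on `g* ⊗ g*`. -/
def linCoeff (F : B.O₂) (i j : B.Idx) : k := F.ofConv (B.frame.x i ⊗ₜ B.frame.x j)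

theorem linCoeff_eq (F : B.O₂) (i j : B.Idx) :
    F.ofConv (B.frame.x i ⊗ₜ B.frame.x j) = linCoeff F i j := rfl

theorem obstruction_apply_x {F : B.O₂} (hF : B.IsInMaxIdealSq F) (a b c : B.Idx) :
    (B.obstruction 3 hF.lieFun).ofConv ((B.frame.x a ⊗ₜ B.frame.x b) ⊗ₜ B.frame.x c) =
      F.ofConv ((B.frame.x a * B.frame.x b) ⊗ₜ B.frame.x c) -
      F.ofConv (B.frame.x a ⊗ₜ (B.frame.x b * B.frame.x c)) +
      (2 : k)⁻¹ * (B.constPair a (fun d => linCoeff F d b) (fun e => linCoeff F e c) +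
        B.constPair b (linCoeff F a) (fun e => linCoeff F e c) -
        B.constPair b (fun d => linCoeff F d c) (linCoeff F a) -
        B.constPair c (linCoeff F b) (linCoeff F a)) := by
  have hx : ∀ i, Coalgebra.counit (R := k) (B.frame.x i) = 0 := B.frame.counit_x
  have hl : ∀ u : B.U, F.ofConv (1 ⊗ₜ u) = 0 := fun u => (hF u).2
  have hr : ∀ u : B.U, F.ofConv (u ⊗ₜ 1) = 0 := fun u => (hF u).1
  have hm : ∀ φ : Hom B.frame₃ B.frame₂, φ.pull F ∈ B.frame₃.I 2 := fun φ => φ.pull_mem_I hF.mem_I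
  rw [obstruction, bchSum_three, bchSum_three, hF.val_lieFun]
  simp only [ofConv_sub_apply, ofConv_add_apply, ofConv_smul_apply, br_apply_x_tmul (hm _) (hm _),
    Hom.pull_apply, face₀_map, face₁_map, face₂_map, face₃_map, hx, hl, hr, zero_smul, map_zero,
    Bialgebra.counit_one, one_smul, mul_one, one_mul, mul_zero, zero_mul, add_zero, zero_add,
    Finset.sum_const_zero, linCoeff_eq, constPair]
  ring

/-- The total antisymmetrization of the obstruction in degree three is the left hand side of the
twist equation for the antisymmetrization of the leading term of `F`. -/
theorem alt_obstruction {F : B.O₂} (hF : B.IsInMaxIdealSq F)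
    (hanti : ∀ i j, linCoeff F i j = -linCoeff F j i)
    (h : ∀ i j l, F.ofConv ((B.frame.x i * B.frame.x j - B.frame.x j * B.frame.x i) ⊗ₜ B.frame.x l)
        + F.ofConv ((B.frame.x j * B.frame.x l - B.frame.x l * B.frame.x j) ⊗ₜ B.frame.x i)
        + F.ofConv ((B.frame.x l * B.frame.x i - B.frame.x i * B.frame.x l) ⊗ₜ B.frame.x j)
        - F.ofConv (B.frame.x l ⊗ₜ (B.frame.x i * B.frame.x j - B.frame.x j * B.frame.x i))
        - F.ofConv (B.frame.x i ⊗ₜ (B.frame.x j * B.frame.x l - B.frame.x l * B.frame.x j))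
        - F.ofConv (B.frame.x j ⊗ₜ (B.frame.x l * B.frame.x i - B.frame.x i * B.frame.x l))
        + 4 * (B.constPair i (linCoeff F j) (linCoeff F l) +
          B.constPair j (linCoeff F l) (linCoeff F i) +
          B.constPair l (linCoeff F i) (linCoeff F j)) = 0) (i j l : B.Idx) :
    obstructionCoeff 3 hF.lieFun {i} {j} {l} +
      obstructionCoeff 3 hF.lieFun {j} {l} {i} + obstructionCoeff 3 hF.lieFun {l} {i} {j} =
      obstructionCoeff 3 hF.lieFun {j} {i} {l} + obstructionCoeff 3 hF.lieFun {i} {l} {j} +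
      obstructionCoeff 3 hF.lieFun {l} {j} {i} := by
  have hc : ∀ a b c : B.Idx, obstructionCoeff 3 hF.lieFun {a} {b} {c} =
      F.ofConv ((B.frame.x a * B.frame.x b) ⊗ₜ B.frame.x c) -
      F.ofConv (B.frame.x a ⊗ₜ (B.frame.x b * B.frame.x c)) +
      (2 : k)⁻¹ * (B.constPair a (linCoeff F b) (linCoeff F c) +
        2 * B.constPair b (linCoeff F c) (linCoeff F a) +
        B.constPair c (linCoeff F a) (linCoeff F b)) := by
    intro a b c
    have hn : ∀ a, (fun d => linCoeff F d a) = -linCoeff F a := fun a => funext fun d => hanti d a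
    have n1 : ∀ i (u v : B.Idx → k), B.constPair i (-u) v = -B.constPair i u v := by
      intro i u v
      simp [constPair]
    have n2 : ∀ i (u v : B.Idx → k), B.constPair i u (-v) = -B.constPair i u v := by
      intro i u v
      simp [constPair]
    rw [obstructionCoeff, if_pos (by simp), pbw_singleton, pbw_singleton, pbw_singleton,
      obstruction_apply_x hF, hn, hn, n1, n1, n2, n2, constPair_antisymm b (linCoeff F a),
      constPair_antisymm c (linCoeff F b)]
    ring
  have h0 := h i j l
  simp only [TensorProduct.sub_tmul, TensorProduct.tmul_sub, map_sub] at h0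
  rw [hc, hc, hc, hc, hc, hc, constPair_antisymm j (linCoeff F i), constPair_antisymm i (linCoeff F l),
    constPair_antisymm l (linCoeff F j)]
  linear_combination h0

end LieBialgebra

open FormalFun

namespace LieBialgebra

variable {k g : Type*} [Field k] [CharZero k] [LieRing g] [LieAlgebra k g] [Module.Finite k g]
variable {B : LieBialgebra k g}

open CoPoissonFrame

/-! ### Existence of twists -/

/-- A function that takes the same values as `c t` on pairs of basis vectors of `g*`. -/
theorem apply_ι_tmul_ι {F : B.O₂} {c : k} {t : g ⊗[k] g}
    (h : ∀ i j, linCoeff F i j = c * B.pair (B.dualBasis i) (B.dualBasis j) t) (ξ η : B.DualLie) :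
    F.ofConv (UniversalEnvelopingAlgebra.ι k ξ ⊗ₜ[k] UniversalEnvelopingAlgebra.ι k η) =
      c * B.pair ξ η t := by
  have e : F.ofConv ∘ₗ B.ι₂ = c • (LinearMap.applyₗ t ∘ₗ TensorProduct.dualDistrib k g g ∘ₗ
      TensorProduct.map B.toDual.toLinearMap B.toDual.toLinearMap) := by
    refine (B.dualBasis.tensorProduct B.dualBasis).ext ?_
    rintro ⟨i, j⟩
    rw [Module.Basis.tensorProduct_apply]
    exact h i j
  exact LinearMap.congr_fun e (ξ ⊗ₜ η)

theorem pair₃_bracket1323 (a b c : B.Idx) (s t : g ⊗[k] g) :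
    B.pair₃ (B.dualBasis a) (B.dualBasis b) (B.dualBasis c) (bracket1323 k g s t) =
      B.constPair c (fun d => B.pair (B.dualBasis a) (B.dualBasis d) s)
        (fun e => B.pair (B.dualBasis b) (B.dualBasis e) t) := by
  induction s with
  | zero => simp [bracket1323, constPair]
  | add s s' hs hs' =>
    have e : bracket1323 k g (s + s') t = bracket1323 k g s t + bracket1323 k g s' t := by
      simp [bracket1323, TensorProduct.add_tmul]
    rw [e, map_add, hs, hs']
    simp only [constPair, map_add, add_mul, mul_add, Finset.sum_add_distrib]
  | tmul x y =>
    induction t with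
    | zero => simp [bracket1323, constPair]
    | add s s' hs hs' =>
      have e : bracket1323 k g (x ⊗ₜ y) (s + s') =
          bracket1323 k g (x ⊗ₜ y) s + bracket1323 k g (x ⊗ₜ y) s' := by
        simp [bracket1323, TensorProduct.tmul_add]
      rw [e, map_add, hs, hs']
      simp only [constPair, map_add, mul_add, Finset.sum_add_distrib]
    | tmul x' y' =>
      have e : bracket1323 k g (x ⊗ₜ y) (x' ⊗ₜ y') = (x ⊗ₜ x') ⊗ₜ ⁅y, y'⁆ := by
        simp [bracket1323]
      rw [e]
      simp only [constPair, pair_tmul, pair₃, TensorProduct.dualDistrib_apply, toDual_dualBasis]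
      have hy : (Module.finBasis k g).coord c ⁅y, y'⁆ = ∑ d, ∑ e, B.frame.c c d e *
          ((Module.finBasis k g).coord d y * (Module.finBasis k g).coord e y') := by
        conv_lhs => rw [← (Module.finBasis k g).sum_repr y, ← (Module.finBasis k g).sum_repr y']
        simp only [sum_lie, lie_sum, smul_lie, lie_smul, map_sum, map_smul,
          smul_eq_mul, Finset.mul_sum]
        rw [Finset.sum_comm]
        refine Finset.sum_congr rfl fun j _ => Finset.sum_congr rfl fun l _ => ?_
        simp only [Module.Basis.coord_apply, frame]
        ring
      rw [hy, Finset.mul_sum]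
      refine Finset.sum_congr rfl fun j _ => ?_
      rw [Finset.mul_sum]
      refine Finset.sum_congr rfl fun l _ => ?_
      ring

/-- The function with leading term `t / 2`; the factor is forced since `t` is antisymmetric, so that
`t / 2 - (t / 2)^{2,1} = t`. -/
def leadingTwist (B : LieBialgebra k g) (t : g ⊗[k] g) : B.O₂ := by
  classical exact B.ofCoeffs fun P Q => ∑ i, ∑ j, if P = {i} ∧ Q = {j} then
    (2 : k)⁻¹ * B.pair (B.dualBasis i) (B.dualBasis j) t else 0

theorem isInMaxIdealSq_leadingTwist (t : g ⊗[k] g) : B.IsInMaxIdealSq (B.leadingTwist t) :=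
  B.isInMaxIdealSq_ofCoeffs fun P => by
    constructor
    · refine Finset.sum_eq_zero fun i _ => Finset.sum_eq_zero fun j _ => if_neg ?_
      rintro ⟨-, h⟩
      simpa using congrArg Multiset.card h
    · refine Finset.sum_eq_zero fun i _ => Finset.sum_eq_zero fun j _ => if_neg ?_
      rintro ⟨h, -⟩
      simpa using congrArg Multiset.card h

theorem linCoeff_leadingTwist (t : g ⊗[k] g) (i j : B.Idx) : linCoeff (B.leadingTwist t) i j =
    (2 : k)⁻¹ * B.pair (B.dualBasis i) (B.dualBasis j) t := by
  classical
  rw [linCoeff, ← pbw_singleton, ← pbw_singleton, leadingTwist, ofCoeffs_apply,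
    Finset.sum_eq_single i, Finset.sum_eq_single j, if_pos ⟨rfl, rfl⟩]
  · intro j' _ hj
    exact if_neg fun h => hj (Multiset.singleton_inj.1 h.2).symm
  · simp
  · intro i' _ hi
    exact Finset.sum_eq_zero fun j' _ => if_neg fun h => hi (Multiset.singleton_inj.1 h.1).symm
  · simp

/-- The twist equation holds in degree `< 3`, because a monomial of `U(g*)^{⊗ 3}` of degree at most
`2` has a factor equal to `1`. -/
theorem isTwistMod_three {F : B.O₂} (hF : B.IsInMaxIdealSq F) : B.IsTwistMod 3 hF.lieFun := by
  rw [isTwistMod_iff B (N := 2) le_rfl, hF.val_lieFun]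
  have h2 : ∀ f f' : B.O₃, B.bchSum 2 f f' = f + f' := fun f f' => by
    rw [bchSum, Finset.sum_range_succ, Finset.sum_range_one, bchTerm_zero, bchTerm_one, zero_add]
  rw [h2, h2]
  refine B.spansFilt_pbw₃.mem_I_iff.2 ?_
  rintro ⟨⟨P, Q⟩, R⟩ hc
  dsimp only at hc ⊢
  rw [ofConv_sub_apply, ofConv_add_apply, ofConv_add_apply, Hom.pull_apply, Hom.pull_apply,
    Hom.pull_apply, Hom.pull_apply, face₀_map, face₁_map, face₂_map, face₃_map, map_smul, map_smul]
  have h0 : P = 0 ∨ Q = 0 ∨ R = 0 := by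
    rw [← Multiset.card_eq_zero, ← Multiset.card_eq_zero, ← Multiset.card_eq_zero]; omega
  rcases h0 with rfl | rfl | rfl <;> simp [pbw_zero, (hF _).1, (hF _).2]

theorem alt_obstruction_leadingTwist {t : g ⊗[k] g} (ht : TensorProduct.comm k g g t = -t)
    (h : cyclicSum k (TensorProduct.map B.cobracket LinearMap.id t + bracket1323 k g t t) = 0)
    (i j l : B.Idx) :
    obstructionCoeff 3 (isInMaxIdealSq_leadingTwist (B := B) t).lieFun {i} {j} {l} +
      obstructionCoeff 3 (isInMaxIdealSq_leadingTwist t).lieFun {j} {l} {i} +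
      obstructionCoeff 3 (isInMaxIdealSq_leadingTwist t).lieFun {l} {i} {j} =
      obstructionCoeff 3 (isInMaxIdealSq_leadingTwist t).lieFun {j} {i} {l} +
      obstructionCoeff 3 (isInMaxIdealSq_leadingTwist t).lieFun {i} {l} {j} +
      obstructionCoeff 3 (isInMaxIdealSq_leadingTwist t).lieFun {l} {j} {i} := by
  have hs : ∀ ξ η : B.DualLie, B.pair ξ η t = -B.pair η ξ t := fun ξ η => by
    rw [← pair_comm, ht, map_neg]
  refine alt_obstruction _ (fun i j => ?_) (fun i j l => ?_) i j l
  · rw [linCoeff_leadingTwist, linCoeff_leadingTwist, hs]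
    ring
  · have hv := apply_ι_tmul_ι (linCoeff_leadingTwist (B := B) t)
    have h3 := congrArg (B.pair₃ (B.dualBasis i) (B.dualBasis j) (B.dualBasis l)) h
    simp only [cyclicSum, map_add, pair₃_cyclicPerm, pair₃_cobracket, map_zero,
      pair₃_bracket1323] at h3
    have hq : ∀ a b c, B.constPair a (linCoeff (B.leadingTwist t) b)
        (linCoeff (B.leadingTwist t) c) = (4 : k)⁻¹ * B.constPair a
        (fun d => B.pair (B.dualBasis b) (B.dualBasis d) t)
        (fun e => B.pair (B.dualBasis c) (B.dualBasis e) t) := by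
      intro a b c
      simp only [constPair, linCoeff_leadingTwist, Finset.mul_sum]
      refine Finset.sum_congr rfl fun j _ => Finset.sum_congr rfl fun l _ => ?_
      ring
    simp only [x_eq_ι, ← UniversalEnvelopingAlgebra.ι_lie, hv, hq]
    rw [hs (B.dualBasis l), hs (B.dualBasis i), hs (B.dualBasis j)]
    linear_combination h3

theorem IsTwistMod.of_sub_mem {p q : ℕ} (hpq : p ≤ q) {F G : B.frame₂.LieFun}
    (h : B.IsTwistMod q F) (hFG : LieFun.val G - LieFun.val F ∈ B.frame₂.I p) :
    B.IsTwistMod p G := by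
  have h' : B.IsTwistMod p F := by
    rw [isTwistMod_iff B (N := q) (by omega)] at h ⊢
    exact B.frame₃.I_anti hpq h
  have e : ∀ φ : Hom B.frame₃ B.frame₂, B.frame₃.gp p (φ.lie G) = B.frame₃.gp p (φ.lie F) := by
    intro φ
    rw [gp_eq_iff, Hom.val_lie, Hom.val_lie, ← map_sub]
    exact φ.pull_mem_I hFG
  rw [IsTwistMod, e, e, e, e]
  exact h'

/-- A solution `t` of the twist equation of `g` lifts to a twist. -/
theorem exists_isTwist {t : g ⊗[k] g} (ht : TensorProduct.comm k g g t = -t)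
    (h : cyclicSum k (TensorProduct.map B.cobracket LinearMap.id t + bracket1323 k g t t) = 0) :
    ∃ F : B.O₂, B.IsTwist F ∧ B.HasAltClass F t := by
  let P : ℕ → B.O₂ → Prop := fun n F => (n = 0 → F = B.leadingTwist t) ∧
    ∃ hF : B.IsInMaxIdealSq F, B.IsTwistMod (n + 3) hF.lieFun
  have step : ∀ n F, P n F → ∃ G, P (n + 1) G ∧ G - F ∈ B.frame₂.I (n + 3) := by
    rintro n F ⟨h0, hF, hT⟩
    obtain ⟨G, hG, hGF, hGT⟩ := exists_twist_lift hF hT (fun i j l => by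
      rcases n with _ | n
      · obtain rfl := h0 rfl
        exact alt_obstruction_leadingTwist ht h i j l
      · simp [obstructionCoeff])
    exact ⟨G, ⟨fun h => absurd h (Nat.succ_ne_zero n), hG, by rwa [add_right_comm]⟩, hGF⟩
  -- The twist is the limit of the successive approximations `f n`, that is the sum of the series `s`
  -- of their differences.
  choose! next hnext using step
  let f : ℕ → B.O₂ := fun n => Nat.rec (B.leadingTwist t) next n
  have hP : ∀ n, P n (f n) := by
    intro n
    induction n with
    | zero => exact ⟨fun _ => rfl, isInMaxIdealSq_leadingTwist t, isTwistMod_three _⟩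
    | succ n ih => exact (hnext n _ ih).1
  have hsub : ∀ n, f (n + 1) - f n ∈ B.frame₂.I (n + 3) := fun n => (hnext n _ (hP n)).2
  let s : ℕ → B.O₂ := fun n => Nat.casesOn n (f 0) fun n => f (n + 1) - f n
  have hs : ∀ n, ∑ i ∈ Finset.range (n + 1), s i = f n := by
    intro n
    induction n with
    | zero => simp [s]
    | succ n ih => rw [Finset.sum_range_succ, ih]; simp [s]
  have hsI : ∀ n, s n ∈ B.frame₂.I n := by
    rintro (_ | n)
    · exact B.frame₂.mem_I_zero _
    · exact B.frame₂.I_anti (by omega) (hsub n)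
  obtain ⟨F, hF⟩ := B.frame₂.exists_hasFormalSum hsI
  have hfF : ∀ n, F - f n ∈ B.frame₂.I (n + 1) := fun n => by
    rw [← hs, ← neg_sub]
    exact neg_mem ((B.frame₂.hasFormalSum_iff hsI).1 hF (n + 1))
  have hn : B.IsInMaxIdealSq F := by
    have hval : ∀ v, (∀ n, (f n).ofConv v = 0) → F.ofConv v = 0 := by
      intro v hv
      obtain ⟨N, hN⟩ := hF v
      rw [← hN (N + 1) (Nat.le_succ N), hs, hv]
    exact fun u => ⟨hval _ fun n => ((hP n).2.choose u).1, hval _ fun n => ((hP n).2.choose u).2⟩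
  refine ⟨F, (B.isTwist_iff hn).2 fun p => ?_, fun ξ η => ?_⟩
  · obtain ⟨-, hf, hT⟩ := hP p
    exact IsTwistMod.of_sub_mem (show p ≤ p + 3 by omega) hT
      (B.frame₂.I_anti (Nat.le_succ p) (hfF p))
  · have h0 : F - B.leadingTwist t ∈ B.frame₂.I 3 := by
      have h1 := add_mem (add_mem (hfF 2) (B.frame₂.I_anti (by omega) (hsub 1))) (hsub 0)
      change F - f 2 + (f 2 - f 1) + (f 1 - f 0) ∈ _ at h1
      rwa [sub_add_sub_cancel, sub_add_sub_cancel] at h1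
    have h1 : ∀ ξ η : B.DualLie, F.ofConv (UniversalEnvelopingAlgebra.ι k ξ ⊗ₜ[k]
        UniversalEnvelopingAlgebra.ι k η) = (2 : k)⁻¹ * B.pair ξ η t := by
      intro ξ η
      rw [← apply_ι_tmul_ι (linCoeff_leadingTwist t), ← sub_eq_zero, ← ofConv_sub_apply]
      exact B.frame₂.I_apply_filt h0 (tmul_mem_filt _ _ (B.ι_mem_filt ξ) (B.ι_mem_filt η) le_rfl)
        (by omega)
    rw [h1, h1, ← B.pair_comm ξ η, ht, map_neg]
    ring

end LieBialgebra

open FormalFun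

/-! ### Exponentials of locally nilpotent maps -/

section LocallyNilpotent

variable {k : Type*} [Field k] {V W : Type*} [AddCommGroup V] [Module k V] [AddCommGroup W]
  [Module k W]

/-- A locally nilpotent endomorphism. -/
def IsLocNil (L : V →ₗ[k] V) : Prop := ∀ v, ∃ N, (L ^ N) v = 0

theorem pow_apply_eq_zero {L : V →ₗ[k] V} {v : V} {N n : ℕ} (h : (L ^ N) v = 0) (hn : N ≤ n) :
    (L ^ n) v = 0 := by
  obtain ⟨m, rfl⟩ := Nat.exists_eq_add_of_le' hn
  rw [pow_add, Module.End.mul_apply, h, map_zero]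

/-- The exponential of a locally nilpotent endomorphism. The sum at `v` is cut at some exponent `N`
with `L ^ N v = 0`. -/
def locExp {L : V →ₗ[k] V} (hL : IsLocNil L) : V →ₗ[k] V where
  toFun v := ∑ n ∈ Finset.range (hL v).choose, ((n.factorial : k)⁻¹) • (L ^ n) v
  map_add' := by
    have key : ∀ v, ∀ M ≥ (hL v).choose,
        ∑ n ∈ Finset.range (hL v).choose, ((n.factorial : k)⁻¹) • (L ^ n) v =
        ∑ n ∈ Finset.range M, ((n.factorial : k)⁻¹) • (L ^ n) v := by
      intro v M hM
      refine Finset.sum_subset (Finset.range_mono hM) fun n _ hn => ?_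
      rw [pow_apply_eq_zero (hL v).choose_spec (by simpa using hn), smul_zero]
    intro v w
    have h1 := le_max_left (hL (v + w)).choose (max (hL v).choose (hL w).choose)
    have h2 := le_max_right (hL (v + w)).choose (max (hL v).choose (hL w).choose)
    rw [key _ _ h1, key v _ ((le_max_left _ _).trans h2), key w _ ((le_max_right _ _).trans h2),
      ← Finset.sum_add_distrib]
    simp only [map_add, smul_add]
  map_smul' := by
    have key : ∀ v, ∀ M ≥ (hL v).choose,
        ∑ n ∈ Finset.range (hL v).choose, ((n.factorial : k)⁻¹) • (L ^ n) v =
        ∑ n ∈ Finset.range M, ((n.factorial : k)⁻¹) • (L ^ n) v := by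
      intro v M hM
      refine Finset.sum_subset (Finset.range_mono hM) fun n _ hn => ?_
      rw [pow_apply_eq_zero (hL v).choose_spec (by simpa using hn), smul_zero]
    intro c v
    rw [key _ _ (le_max_left (hL (c • v)).choose (hL v).choose),
      key v _ (le_max_right (hL (c • v)).choose (hL v).choose), RingHom.id_apply, Finset.smul_sum]
    exact Finset.sum_congr rfl fun n _ => by rw [map_smul, smul_comm]

theorem locExp_apply {L : V →ₗ[k] V} (hL : IsLocNil L) {v : V} {M : ℕ} (h : (L ^ M) v = 0) :
    locExp hL v = ∑ n ∈ Finset.range M, ((n.factorial : k)⁻¹) • (L ^ n) v := by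
  change ∑ n ∈ Finset.range (hL v).choose, _ = _
  rcases le_total (hL v).choose M with h' | h'
  · refine Finset.sum_subset (Finset.range_mono h') fun n _ hn => ?_
    rw [pow_apply_eq_zero (hL v).choose_spec (by simpa using hn), smul_zero]
  · refine (Finset.sum_subset (Finset.range_mono h') fun n _ hn => ?_).symm
    rw [pow_apply_eq_zero h (by simpa using hn), smul_zero]

theorem locExp_of_apply_eq_zero {L : V →ₗ[k] V} (hL : IsLocNil L) {v : V} (h : L v = 0) :
    locExp hL v = v := by
  rw [locExp_apply hL (M := 1) (by simpa using h)]
  simp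

theorem map_locExp {L : V →ₗ[k] V} {L' : W →ₗ[k] W} (hL : IsLocNil L) (hL' : IsLocNil L')
    (φ : V →ₗ[k] W) (h : ∀ v, φ (L v) = L' (φ v)) (v : V) :
    φ (locExp hL v) = locExp hL' (φ v) := by
  have hp : ∀ n v, φ ((L ^ n) v) = (L' ^ n) (φ v) := by
    intro n
    induction n with
    | zero => simp
    | succ n ih => intro v; rw [pow_succ, pow_succ, Module.End.mul_apply, Module.End.mul_apply, ih, h]
  obtain ⟨M, hM⟩ := hL v
  rw [locExp_apply hL hM, locExp_apply hL' (M := M) (by rw [← hp, hM, map_zero]), map_sum]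
  exact Finset.sum_congr rfl fun n _ => by rw [map_smul, hp]

/-- The endomorphism `L ⊗ 1 + 1 ⊗ L'`. -/
def tensorSum (L : V →ₗ[k] V) (L' : W →ₗ[k] W) : V ⊗[k] W →ₗ[k] V ⊗[k] W :=
  TensorProduct.map L LinearMap.id + TensorProduct.map LinearMap.id L'

theorem tensorSum_pow_tmul (L : V →ₗ[k] V) (L' : W →ₗ[k] W) (n : ℕ) (v : V) (w : W) :
    (tensorSum L L' ^ n) (v ⊗ₜ w) =
      ∑ p ∈ Finset.HasAntidiagonal.antidiagonal n, (n.choose p.1 : k) • (L ^ p.1) v ⊗ₜ[k] (L' ^ p.2) w := by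
  have hc : Commute (TensorProduct.map L (LinearMap.id : W →ₗ[k] W) : Module.End k (V ⊗[k] W))
      (TensorProduct.map LinearMap.id L') := by
    refine TensorProduct.ext' fun v w => ?_
    simp
  have h1 : ∀ i, (TensorProduct.map L (LinearMap.id : W →ₗ[k] W) : Module.End k (V ⊗[k] W)) ^ i =
      TensorProduct.map (L ^ i) LinearMap.id := fun i => by
    induction i with
    | zero => exact TensorProduct.map_id.symm
    | succ i ih =>
      rw [pow_succ, ih, pow_succ, Module.End.mul_eq_comp, Module.End.mul_eq_comp,
        ← TensorProduct.map_comp, LinearMap.id_comp]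
  have h2 : ∀ i, (TensorProduct.map (LinearMap.id : V →ₗ[k] V) L' : Module.End k (V ⊗[k] W)) ^ i =
      TensorProduct.map LinearMap.id (L' ^ i) := fun i => by
    induction i with
    | zero => exact TensorProduct.map_id.symm
    | succ i ih =>
      rw [pow_succ, ih, pow_succ, Module.End.mul_eq_comp, Module.End.mul_eq_comp,
        ← TensorProduct.map_comp, LinearMap.id_comp]
  rw [tensorSum, hc.add_pow', LinearMap.sum_apply]
  refine Finset.sum_congr rfl fun p _ => ?_
  rw [h1, h2, LinearMap.smul_apply, ← Nat.cast_smul_eq_nsmul k]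
  simp

theorem IsLocNil.tensorSum {L : V →ₗ[k] V} {L' : W →ₗ[k] W} (hL : IsLocNil L) (hL' : IsLocNil L') :
    IsLocNil (tensorSum L L') := by
  intro t
  induction t with
  | zero => exact ⟨0, map_zero _⟩
  | add s t hs ht =>
    obtain ⟨M, hM⟩ := hs
    obtain ⟨N, hN⟩ := ht
    exact ⟨max M N, by rw [map_add, pow_apply_eq_zero hM (le_max_left _ _),
      pow_apply_eq_zero hN (le_max_right _ _), add_zero]⟩
  | tmul v w =>
    obtain ⟨M, hM⟩ := hL v
    obtain ⟨N, hN⟩ := hL' w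
    refine ⟨M + N, ?_⟩
    rw [tensorSum_pow_tmul]
    refine Finset.sum_eq_zero fun p hp => ?_
    rw [Finset.HasAntidiagonal.mem_antidiagonal] at hp
    rcases le_total M p.1 with h | h
    · rw [pow_apply_eq_zero hM h, TensorProduct.zero_tmul, smul_zero]
    · rw [pow_apply_eq_zero hN (by omega), TensorProduct.tmul_zero, smul_zero]

theorem locExp_tensorSum [CharZero k] {L : V →ₗ[k] V} {L' : W →ₗ[k] W} (hL : IsLocNil L)
    (hL' : IsLocNil L') (t : V ⊗[k] W) :
    locExp (hL.tensorSum hL') t = TensorProduct.map (locExp hL) (locExp hL') t := by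
  have key : locExp (hL.tensorSum hL') = TensorProduct.map (locExp hL) (locExp hL') := by
    refine TensorProduct.ext' fun v w => ?_
    obtain ⟨M, hM⟩ := hL v
    obtain ⟨N, hN⟩ := hL' w
    have hz : (_root_.tensorSum L L' ^ (M + N)) (v ⊗ₜ w) = 0 := by
      rw [tensorSum_pow_tmul]
      refine Finset.sum_eq_zero fun p hp => ?_
      rw [Finset.HasAntidiagonal.mem_antidiagonal] at hp
      rcases le_total M p.1 with h | h
      · rw [pow_apply_eq_zero hM h, TensorProduct.zero_tmul, smul_zero]
      · rw [pow_apply_eq_zero hN (by omega), TensorProduct.tmul_zero, smul_zero]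
    set f : ℕ × ℕ → V ⊗[k] W := fun p => (((p.1.factorial : k)⁻¹) • (L ^ p.1) v) ⊗ₜ
      (((p.2.factorial : k)⁻¹) • (L' ^ p.2) w) with hf
    have hn : ∀ n, ((n.factorial : k)⁻¹) • (_root_.tensorSum L L' ^ n) (v ⊗ₜ w) =
        ∑ p ∈ Finset.HasAntidiagonal.antidiagonal n, f p := by
      intro n
      rw [tensorSum_pow_tmul, Finset.smul_sum]
      refine Finset.sum_congr rfl fun p hp => ?_
      rw [Finset.HasAntidiagonal.mem_antidiagonal] at hp
      have h1 : ((n.factorial : k)⁻¹) * (n.choose p.1 : k) =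
          ((p.1.factorial : k)⁻¹) * ((p.2.factorial : k)⁻¹) := by
        have := Nat.choose_mul_factorial_mul_factorial (show p.1 ≤ n by omega)
        rw [show n - p.1 = p.2 by omega] at this
        have h' : (n.choose p.1 : k) * p.1.factorial * p.2.factorial = n.factorial := by
          exact_mod_cast this
        have := Nat.cast_ne_zero (R := k).2 p.1.factorial_ne_zero
        have := Nat.cast_ne_zero (R := k).2 p.2.factorial_ne_zero
        have := Nat.cast_ne_zero (R := k).2 n.factorial_ne_zero
        field_simp
        rw [← h']
      rw [hf, smul_smul, h1]
      dsimp only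
      rw [TensorProduct.smul_tmul_smul]
    rw [locExp_apply _ hz, TensorProduct.map_tmul, locExp_apply hL hM, locExp_apply hL' hN,
      TensorProduct.sum_tmul]
    simp only [TensorProduct.tmul_sum, hn]
    rw [← Finset.sum_product', ← Finset.sum_fiberwise_of_maps_to (t := Finset.range (M + N))
      (g := fun p : ℕ × ℕ => p.1 + p.2)]
    · refine Finset.sum_congr rfl fun n _ => (Finset.sum_subset ?_ ?_).symm
      · intro p hp
        exact Finset.HasAntidiagonal.mem_antidiagonal.2 (Finset.mem_filter.1 hp).2
      · intro p hp hp'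
        rw [Finset.HasAntidiagonal.mem_antidiagonal] at hp
        simp only [Finset.mem_filter, Finset.mem_product, Finset.mem_range, hp, and_true,
          not_and_or, not_lt] at hp'
        rw [hf]
        dsimp only
        rcases hp' with h | h
        · rw [pow_apply_eq_zero hM h, smul_zero, TensorProduct.zero_tmul]
        · rw [pow_apply_eq_zero hN h, smul_zero, TensorProduct.tmul_zero]
    · intro p hp
      simp only [Finset.mem_product, Finset.mem_range] at hp ⊢
      omega
  rw [key]

end LocallyNilpotent

open FormalFun

/-! ### Hamiltonian flows -/

namespace FormalFun

variable {k C : Type*} [Field k] [AddCommGroup C] [Module k C]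

/-- Functions separate points. -/
theorem eq_of_ofConv {c d : C} (h : ∀ f : FormalFun k C, f.ofConv c = f.ofConv d) : c = d := by
  rw [← sub_eq_zero, ← Module.forall_dual_apply_eq_zero_iff k]
  intro φ
  rw [map_sub, sub_eq_zero]
  exact h (WithConv.toConv φ)

/-- A vector on which all the functions vanishing on a subspace vanish belongs to the subspace. -/
theorem mem_of_forall_ofConv {S : Submodule k C} {c : C}
    (h : ∀ f : FormalFun k C, (∀ s ∈ S, f.ofConv s = 0) → f.ofConv c = 0) : c ∈ S := by
  by_contra hc
  obtain ⟨φ, h1, h2⟩ := S.exists_le_ker_of_notMem hc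
  exact h1 (h (WithConv.toConv φ) fun s hs => h2 hs)

end FormalFun

namespace CoPoissonFrame

variable {k : Type*} [Field k] {H ι K κ M μ : Type*} [Ring H] [Bialgebra k H] [Fintype ι]
  [Ring K] [Bialgebra k K] [Fintype κ] [Ring M] [Bialgebra k M] [Fintype μ]

section Ham

variable (F : CoPoissonFrame k H ι)

/-- The endomorphism of `H` whose transpose is the Hamiltonian derivation `{f, -}`. -/
def ham (f : FormalFun k H) : H →ₗ[k] H :=
  (TensorProduct.lid k H).toLinearMap ∘ₗ TensorProduct.map f.ofConv LinearMap.id ∘ₗ F.δ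

theorem ofConv_ham (f g : FormalFun k H) (u : H) :
    g.ofConv (F.ham f u) = (F.br f g).ofConv u := by
  have h : ∀ t : H ⊗[k] H, g.ofConv (TensorProduct.lid k H
      (TensorProduct.map f.ofConv LinearMap.id t)) = (tmul f g).ofConv t := by
    intro t
    induction t with
    | zero => simp
    | add s t hs ht => simp only [map_add, hs, ht]
    | tmul a b => simp [tmul_tmul]
  exact h (F.δ u)

theorem pullback_ham (f g : FormalFun k H) : pullback (F.ham f) g = F.br f g :=
  ext_ofConv fun u => F.ofConv_ham f g u

theorem ham_add (f g : FormalFun k H) : F.ham (f + g) = F.ham f + F.ham g := by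
  refine LinearMap.ext fun u => eq_of_ofConv (k := k) fun h => ?_
  rw [LinearMap.add_apply, map_add, ofConv_ham, ofConv_ham, ofConv_ham, map_add]
  rfl

theorem ham_smul (c : k) (f : FormalFun k H) : F.ham (c • f) = c • F.ham f := by
  refine LinearMap.ext fun u => eq_of_ofConv (k := k) fun h => ?_
  rw [LinearMap.smul_apply, map_smul, ofConv_ham, ofConv_ham, map_smul]
  rfl

variable [Coalgebra.IsCocomm k H]

theorem ham_mem_filt {p m n : ℕ} {f : FormalFun k H} (hf : f ∈ F.I p) {u : H} (hu : u ∈ F.filt m)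
    (h : m + 2 ≤ p + (n + 1)) : F.ham f u ∈ F.filt n := by
  refine mem_of_forall_ofConv (k := k) fun g hg => ?_
  rw [ofConv_ham]
  have hg' : g ∈ F.I (n + 1) := fun l hl => hg _ (F.word_mem_filt (by omega))
  exact F.I_apply_filt (F.br_mem_I (r := m + 1) hf hg' (by omega)) hu (by omega)

theorem ham_eq_zero {p m : ℕ} {f : FormalFun k H} (hf : f ∈ F.I p) {u : H} (hu : u ∈ F.filt m)
    (h : m + 2 ≤ p) : F.ham f u = 0 := by
  refine eq_of_ofConv (k := k) fun g => ?_
  rw [ofConv_ham, map_zero]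
  exact F.I_apply_filt (F.br_mem_I (r := m + 1) hf (F.mem_I_zero g) (by omega)) hu (by omega)

theorem ham_pow_mem_filt {f : FormalFun k H} (hf : f ∈ F.I 2) {m : ℕ} {u : H} (hu : u ∈ F.filt m)
    (n : ℕ) : (F.ham f ^ n) u ∈ F.filt (m - n) := by
  induction n with
  | zero => exact hu
  | succ n ih =>
    rw [pow_succ', Module.End.mul_apply]
    rcases Nat.eq_zero_or_pos (m - n) with h | h
    · rw [F.ham_eq_zero hf ih (by omega)]
      exact zero_mem _
    · exact F.ham_mem_filt hf ih (by omega)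

theorem ham_pow_eq_zero {f : FormalFun k H} (hf : f ∈ F.I 2) {m n : ℕ} {u : H}
    (hu : u ∈ F.filt m) (h : m < n) : (F.ham f ^ n) u = 0 := by
  obtain ⟨n, rfl⟩ : ∃ n', n = n' + 1 := ⟨n - 1, by omega⟩
  rw [pow_succ', Module.End.mul_apply]
  exact F.ham_eq_zero hf (F.ham_pow_mem_filt hf hu n) (by omega)

theorem isLocNil_ham {f : FormalFun k H} (hf : f ∈ F.I 2) : IsLocNil (F.ham f) := fun u => by
  obtain ⟨m, hm⟩ := F.exists_mem_filt u
  exact ⟨m + 1, F.ham_pow_eq_zero hf hm (Nat.lt_succ_self m)⟩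

theorem tmul_tensorSum (f g h : FormalFun k H) (t : H ⊗[k] H) :
    (tmul g h).ofConv (tensorSum (F.ham f) (F.ham f) t) =
      (tmul (F.br f g) h).ofConv t + (tmul g (F.br f h)).ofConv t := by
  rw [tensorSum, LinearMap.add_apply, map_add, ← pullback_apply, ← pullback_apply, ← tmul_pullback,
    ← tmul_pullback, pullback_ham, pullback_ham]
  rfl

/-- A Hamiltonian derivation is a derivation of the product. -/
theorem comul_ham (f : FormalFun k H) (u : H) : Coalgebra.comul (R := k) (F.ham f u) =
    tensorSum (F.ham f) (F.ham f) (Coalgebra.comul (R := k) u) := by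
  refine eq_of_tmul_eq fun g h => ?_
  rw [tmul_tensorSum, ← pullback_apply, ← mul_eq_pullback, ofConv_ham, br_mul]
  rfl

/-- A Hamiltonian derivation is a derivation of the Poisson bracket. -/
theorem δ_ham (f : FormalFun k H) (u : H) : F.δ (F.ham f u) =
    tensorSum (F.ham f) (F.ham f) (F.δ u) := by
  refine eq_of_tmul_eq fun g h => ?_
  rw [tmul_tensorSum]
  change (F.br g h).ofConv (F.ham f u) = (F.br (F.br f g) h).ofConv u + (F.br g (F.br f h)).ofConv u
  rw [ofConv_ham, ← ofConv_add_apply]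
  congr 2
  have := F.br_jacobi f g h
  rw [F.br_skew (F.br g h) f, F.br_skew (F.br h f) g, F.br_skew h f, map_neg, neg_neg] at this
  rw [← sub_eq_zero, ← neg_eq_zero, ← this]
  abel

theorem counit_ham (f : FormalFun k H) (u : H) : Coalgebra.counit (R := k) (F.ham f u) = 0 := by
  rw [← one_apply, ofConv_ham, counit_counit_δ]
  rfl

end Ham

section Flow

variable [CharZero k] (F : CoPoissonFrame k H ι) [Coalgebra.IsCocomm k H]

theorem locExp_ham_sub_mem {f : FormalFun k H} (hf : f ∈ F.I 2) {n : ℕ} {u : H}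
    (hu : u ∈ F.filt n) : locExp (F.isLocNil_ham hf) u - u ∈ F.filt (n - 1) := by
  rw [locExp_apply _ (F.ham_pow_eq_zero hf hu (Nat.lt_succ_self n)), Finset.sum_range_succ']
  simp only [Nat.factorial_zero, Nat.cast_one, inv_one, one_smul, pow_zero, Module.End.one_apply,
    add_sub_cancel_right]
  exact sum_mem fun i _ => Submodule.smul_mem _ _
    (F.filt_mono (by omega) (F.ham_pow_mem_filt hf hu (i + 1)))

/-- The time one flow of the Hamiltonian derivation `{f, -}`, for `f` vanishing to order `2` at
the origin. -/
def flow (f : F.LieFun) : Hom F F where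
  map := locExp (F.isLocNil_ham (LieFun.val_mem f))
  counit_map u := by
    have h : IsLocNil (0 : k →ₗ[k] k) := fun v => ⟨1, by simp⟩
    rw [map_locExp _ h Coalgebra.counit fun v => by rw [counit_ham]; rfl,
      locExp_of_apply_eq_zero h rfl]
  comul_map u := by
    rw [map_locExp _ ((F.isLocNil_ham (LieFun.val_mem f)).tensorSum
      (F.isLocNil_ham (LieFun.val_mem f))) Coalgebra.comul (F.comul_ham _), locExp_tensorSum]
  δ_map u := by
    rw [map_locExp _ ((F.isLocNil_ham (LieFun.val_mem f)).tensorSum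
      (F.isLocNil_ham (LieFun.val_mem f))) F.δ (F.δ_ham _), locExp_tensorSum]
  map_word l := by
    have h := F.word_mem_filt (le_refl l.length)
    have := add_mem (F.filt_mono (Nat.sub_le _ 1) (F.locExp_ham_sub_mem (LieFun.val_mem f) h)) h
    rwa [sub_add_cancel] at this

theorem flow_map (f : F.LieFun) : (F.flow f).map = locExp (F.isLocNil_ham (LieFun.val_mem f)) := rfl

theorem flow_sub_mem (f : F.LieFun) {n : ℕ} {u : H} (hu : u ∈ F.filt n) :
    (F.flow f).map u - u ∈ F.filt (n - 1) :=
  F.locExp_ham_sub_mem (LieFun.val_mem f) hu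

theorem flow_apply_of_ham_ham (f : F.LieFun) {u : H}
    (h : F.ham (LieFun.val f) (F.ham (LieFun.val f) u) = 0) :
    (F.flow f).map u = u + F.ham (LieFun.val f) u := by
  rw [flow_map, locExp_apply (M := 2) _ (by rw [pow_two, Module.End.mul_apply, h]),
    Finset.sum_range_succ, Finset.sum_range_one]
  simp

theorem flow_zero : (F.flow 0).map = LinearMap.id := by
  refine LinearMap.ext fun u => locExp_of_apply_eq_zero _ ?_
  have : F.ham (LieFun.val (0 : F.LieFun)) = 0 := by
    rw [map_zero, ← zero_smul k (0 : FormalFun k H), ham_smul, zero_smul]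
  rw [this, LinearMap.zero_apply]

variable {F} [Coalgebra.IsCocomm k K] {G : CoPoissonFrame k K κ}

theorem Hom.map_ham (φ : Hom F G) (f : FormalFun k K) (u : H) :
    φ.map (F.ham (φ.pull f) u) = G.ham f (φ.map u) := by
  refine eq_of_ofConv (k := k) fun g => ?_
  rw [ofConv_ham, ← φ.pull_apply, ← φ.pull_apply, ofConv_ham, φ.pull_br]

/-- Morphisms intertwine Hamiltonian flows. -/
theorem Hom.map_flow (φ : Hom F G) (f : G.LieFun) (u : H) :
    φ.map ((F.flow (φ.lie f)).map u) = (G.flow f).map (φ.map u) :=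
  map_locExp _ _ φ.map (φ.map_ham (LieFun.val f)) u

theorem ham_counitRight (f : FormalFun k H) : (F.tensor G).ham ((Hom.counitRight F G).pull f) =
    tensorSum (F.ham f) 0 := by
  have e : (Hom.counitRight F G).pull f = tmul f 1 := by
    refine ext_ofConv fun t => ?_
    induction t with
    | zero => simp
    | add s t hs ht => rw [map_add, map_add, hs, ht]
    | tmul a b => rw [tmul_tmul, Hom.pull_apply]; simp [Hom.counitRight, one_apply, mul_comm]
  refine TensorProduct.ext' fun u v => eq_of_tmul_eq fun g h => ?_
  rw [ofConv_ham, e, bracket_tmul, one_mul, G.br_skew 1 h, counit_counit_δ, neg_zero, tensorSum,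
    TensorProduct.map_zero_right, add_zero, TensorProduct.map_tmul, tmul_tmul, ofConv_add_apply,
    tmul_tmul, tmul_tmul, ofConv_ham, ofConv_zero_apply, mul_zero, add_zero]
  rfl

theorem ham_counitLeft (f : FormalFun k K) : (F.tensor G).ham ((Hom.counitLeft F G).pull f) =
    tensorSum 0 (G.ham f) := by
  have e : (Hom.counitLeft F G).pull f = tmul 1 f := by
    refine ext_ofConv fun t => ?_
    induction t with
    | zero => simp
    | add s t hs ht => rw [map_add, map_add, hs, ht]
    | tmul a b => rw [tmul_tmul, Hom.pull_apply]; simp [Hom.counitLeft, one_apply]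
  refine TensorProduct.ext' fun u v => eq_of_tmul_eq fun g h => ?_
  rw [ofConv_ham, e, bracket_tmul, one_mul, F.br_skew 1 g, counit_counit_δ, neg_zero, tensorSum,
    TensorProduct.map_zero_left, zero_add, TensorProduct.map_tmul, tmul_tmul, ofConv_add_apply,
    tmul_tmul, tmul_tmul, ofConv_ham, ofConv_zero_apply, zero_mul, zero_add]
  rfl

theorem isLocNil_zero {V : Type*} [AddCommGroup V] [Module k V] : IsLocNil (0 : V →ₗ[k] V) :=
  fun v => ⟨1, by simp⟩

theorem flow_counitRight (f : F.LieFun) : ((F.tensor G).flow ((Hom.counitRight F G).lie f)).map =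
    TensorProduct.map (F.flow f).map LinearMap.id := by
  have h0 : locExp (isLocNil_zero (k := k) (V := K)) = LinearMap.id :=
    LinearMap.ext fun v => locExp_of_apply_eq_zero _ rfl
  refine LinearMap.ext fun u => ?_
  rw [← h0, flow_map, flow_map, ← locExp_tensorSum]
  exact map_locExp _ _ LinearMap.id (fun v => by
    rw [Hom.val_lie, ham_counitRight]; rfl) u

theorem flow_counitLeft (f : G.LieFun) : ((F.tensor G).flow ((Hom.counitLeft F G).lie f)).map =
    TensorProduct.map LinearMap.id (G.flow f).map := by
  have h0 : locExp (isLocNil_zero (k := k) (V := H)) = LinearMap.id :=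
    LinearMap.ext fun v => locExp_of_apply_eq_zero _ rfl
  refine LinearMap.ext fun u => ?_
  rw [← h0, flow_map, flow_map, ← locExp_tensorSum]
  exact map_locExp _ _ LinearMap.id (fun v => by
    rw [Hom.val_lie, ham_counitLeft]; rfl) u

/-! ### Composition of flows -/

variable (F)

/-- The action of functions on the space of distributions of order at most `n`, with the order of
composition reversed. -/
def hamOp (n : ℕ) : F.LieFun →ₗ[k] (Module.End k (F.filt n))ᵐᵒᵖ where
  toFun f := MulOpposite.op ((F.ham (LieFun.val f)).restrict fun _ hu =>
    F.ham_mem_filt (LieFun.val_mem f) hu (by omega))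
  map_add' f g := by
    refine MulOpposite.unop_injective (LinearMap.ext fun u => Subtype.ext ?_)
    change F.ham (LieFun.val (f + g)) u = F.ham (LieFun.val f) u + F.ham (LieFun.val g) u
    rw [map_add, ham_add, LinearMap.add_apply]
  map_smul' c f := by
    refine MulOpposite.unop_injective (LinearMap.ext fun u => Subtype.ext ?_)
    change F.ham (LieFun.val (c • f)) u = c • F.ham (LieFun.val f) u
    rw [map_smul, ham_smul, LinearMap.smul_apply]

theorem hamOp_apply (n : ℕ) (f : F.LieFun) (u : F.filt n) :
    ((F.hamOp n f).unop u : H) = F.ham (LieFun.val f) u := rfl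

theorem hamOp_lie (n : ℕ) (f g : F.LieFun) :
    F.hamOp n ⁅f, g⁆ = F.hamOp n f * F.hamOp n g - F.hamOp n g * F.hamOp n f := by
  refine MulOpposite.unop_injective (LinearMap.ext fun u => Subtype.ext
    (eq_of_ofConv (k := k) fun h => ?_))
  change h.ofConv (F.ham (F.br (LieFun.val f) (LieFun.val g)) u) =
    h.ofConv (F.ham (LieFun.val g) (F.ham (LieFun.val f) u) -
      F.ham (LieFun.val f) (F.ham (LieFun.val g) u))
  rw [map_sub, ofConv_ham, ofConv_ham, ofConv_ham, ofConv_ham, ofConv_ham, ← ofConv_sub_apply]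
  congr 2
  have := F.br_jacobi (LieFun.val f) (LieFun.val g) h
  rw [F.br_skew (F.br (LieFun.val g) h) (LieFun.val f), F.br_skew (F.br h (LieFun.val f)) (LieFun.val g),
    F.br_skew h (LieFun.val f), map_neg, neg_neg] at this
  rw [← sub_eq_zero, ← this]
  abel

theorem hamOp_pow_apply (n : ℕ) (f : F.LieFun) (m : ℕ) (u : F.filt n) :
    (((F.hamOp n f) ^ m).unop u : H) = (F.ham (LieFun.val f) ^ m) u := by
  induction m with
  | zero => rfl
  | succ m ih =>
    rw [pow_succ, pow_succ', Module.End.mul_apply, ← ih]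
    rfl

theorem hamOp_words (n : ℕ) (f g : F.LieFun) :
    NilWords (n + 1) (F.hamOp n f) (F.hamOp n g) := by
  have key : ∀ l : List (Module.End k (F.filt n))ᵐᵒᵖ, (∀ a ∈ l, a = F.hamOp n f ∨ a = F.hamOp n g) →
      ∀ (u : F.filt n) (m : ℕ), (u : H) ∈ F.filt m → (l.prod.unop u : H) ∈ F.filt (m - l.length) ∧
        (m < l.length → (l.prod.unop u : H) = 0) := by
    intro l
    induction l with
    | nil => intro _ u m hm; exact ⟨hm, fun h => absurd h (by simp)⟩
    | cons a l ih =>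
      intro hl u m hm
      obtain ⟨h', ha⟩ : ∃ h' : F.LieFun, a = F.hamOp n h' := by
        rcases hl a (by simp) with h | h <;> exact ⟨_, h⟩
      have hx := ih fun b hb => hl b (List.mem_cons_of_mem _ hb)
      have e : ((a :: l).prod.unop u) = l.prod.unop (a.unop u) := rfl
      rw [e]
      have ea : (a.unop u : H) = F.ham (LieFun.val h') u := by rw [ha]; rfl
      rcases Nat.eq_zero_or_pos m with h0 | h0
      · have z : a.unop u = 0 := Subtype.ext (by
          rw [ea, F.ham_eq_zero (LieFun.val_mem h') hm (by omega)]; rfl)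
        rw [z, map_zero]
        exact ⟨zero_mem _, fun _ => rfl⟩
      · obtain ⟨h1, h2⟩ := hx (a.unop u) (m - 1) (by
          rw [ea]; exact F.ham_mem_filt (LieFun.val_mem h') hm (by omega))
        rw [List.length_cons]
        exact ⟨F.filt_mono (by omega) h1, fun h => h2 (by omega)⟩
  intro l hl hlen
  refine MulOpposite.unop_injective (LinearMap.ext fun u => Subtype.ext ?_)
  exact (key l hl u n u.2).2 (by omega)

theorem nilExp_hamOp (n : ℕ) (f : F.LieFun) (u : F.filt n) :
    ((nilExp k (F.hamOp n f)).unop u : H) = (F.flow f).map u := by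
  have h0 := (F.hamOp_words n f f).pow_left
  rw [nilExp_eq_sum h0, flow_map,
    locExp_apply _ (F.ham_pow_eq_zero (LieFun.val_mem f) u.2 (Nat.lt_succ_self n)),
    Finset.unop_sum, LinearMap.sum_apply, AddSubmonoidClass.coe_finsetSum]
  refine Finset.sum_congr rfl fun m _ => ?_
  rw [← hamOp_pow_apply]
  rfl

theorem flow_congr {n p : ℕ} {f g : F.LieFun} (h : F.gp p f = F.gp p g) (hp : n + 2 ≤ p) {u : H}
    (hu : u ∈ F.filt n) : (F.flow f).map u = (F.flow g).map u := by
  have e : F.hamOp n f = F.hamOp n g := by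
    refine MulOpposite.unop_injective (LinearMap.ext fun u => Subtype.ext ?_)
    have h' := F.ham_eq_zero (F.gp_eq_iff.1 h) u.2 hp
    rw [hamOp_apply, hamOp_apply, ← sub_add_cancel (LieFun.val f) (LieFun.val g), ham_add,
      LinearMap.add_apply, h', zero_add]
  rw [← F.nilExp_hamOp n f ⟨u, hu⟩, e, nilExp_hamOp]

theorem flow_bch (n : ℕ) (f g : F.LieFun) {u : H} (hu : u ∈ F.filt n) {N : ℕ} (hN : n + 1 ≤ N) :
    (F.flow g).map ((F.flow f).map u) = (F.flow (∑ n ∈ Finset.Ico 1 N,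
      bchTerm k (fun f g : F.LieFun => ⁅f, g⁆) f g n)).map u := by
  have hf : (F.flow f).map u ∈ F.filt n := (F.flow f).map_mem_filt hu
  have h := exp_mul_exp (k := k) ((F.hamOp_words n f g).mono hN)
  have e : ∑ n' ∈ Finset.Ico 1 N, bchTerm k (fun a b => a * b - b * a) (F.hamOp n f) (F.hamOp n g) n' =
      F.hamOp n (∑ n ∈ Finset.Ico 1 N, bchTerm k (fun f g : F.LieFun => ⁅f, g⁆) f g n) := by
    rw [map_sum]
    exact Finset.sum_congr rfl fun m _ => (map_bchTerm _ _ _ (F.hamOp_lie n) f g m).symm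
  rw [e] at h
  have h2 := congrArg (fun a => ((MulOpposite.unop a) ⟨u, hu⟩ : H)) h
  rw [nilExp_hamOp] at h2
  rw [← h2, MulOpposite.unop_mul, Module.End.mul_apply, nilExp_hamOp, nilExp_hamOp]

/-- The flow of a Baker-Campbell-Hausdorff product is the composition of the flows. -/
theorem flow_mul {n p : ℕ} {f g h : F.LieFun} (e : F.gp p f * F.gp p g = F.gp p h)
    (hp : n + 2 ≤ p) {u : H} (hu : u ∈ F.filt n) :
    (F.flow g).map ((F.flow f).map u) = (F.flow h).map u := by
  rw [F.flow_bch n f g hu (N := p) (by omega)]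
  refine F.flow_congr (p := p) ?_ hp hu
  rw [← e]
  refine ((F.gp_mul_eq_iff (N := p) (by omega)).2 ?_).symm
  have : LieFun.val (∑ n ∈ Finset.Ico 1 p, bchTerm k (fun f g : F.LieFun => ⁅f, g⁆) f g n) =
      ∑ n ∈ Finset.range p, bchTerm k (fun f g => F.br f g) (LieFun.val f) (LieFun.val g) n := by
    have hv : ∀ n, LieFun.val (bchTerm k (fun f g : F.LieFun => ⁅f, g⁆) f g n) =
        bchTerm k (fun f g => F.br f g) (LieFun.val f) (LieFun.val g) n :=
      map_bchTerm LieFun.val _ _ (fun a b => LieFun.val_lie a b) f g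
    rw [map_sum, Finset.range_eq_Ico]
    simp only [hv]
    refine Finset.sum_subset (Finset.Ico_subset_Ico (by omega) le_rfl) fun n hn hn' => ?_
    have : n = 0 := by simp at hn hn'; omega
    rw [this, bchTerm_zero]
  rw [this, sub_self]
  exact zero_mem _

end Flow

end CoPoissonFrame

open FormalFun

/-! ### The twisted product -/

namespace LieBialgebra

variable {k g : Type*} [Field k] [CharZero k] [LieRing g] [LieAlgebra k g] [Module.Finite k g]
variable {B : LieBialgebra k g}

open CoPoissonFrame

/-- The product of `U(g*)` precomposed with the Hamiltonian flow of `F`; it is dual to the twisted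
coproduct `a ↦ F ⋆ Δ(a) ⋆ (-F)`. -/
def twistMul (F : B.frame₂.LieFun) : Hom B.frame₂ B.frame := B.mulHom.comp (B.frame₂.flow F)

theorem twistMul_map (F : B.frame₂.LieFun) (t : B.U ⊗[k] B.U) :
    (twistMul F).map t = B.mulHom.map ((B.frame₂.flow F).map t) := rfl

theorem mulHom_map_tmul (u v : B.U) : B.mulHom.map (u ⊗ₜ v) = u * v := rfl

theorem mulHom_face (s : (B.U ⊗[k] B.U) ⊗[k] B.U) :
    B.mulHom.map (B.face₁.map s) = B.mulHom.map (B.face₂.map s) := by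
  have : B.mulHom.map ∘ₗ B.face₁.map = B.mulHom.map ∘ₗ B.face₂.map :=
    B.ext_tmul₃ fun a b c => by
      rw [LinearMap.comp_apply, LinearMap.comp_apply, face₁_map, face₂_map, mulHom_map_tmul,
        mulHom_map_tmul, mul_assoc]
  exact LinearMap.congr_fun this s

theorem face₁_map_flow (F : B.frame₂.LieFun) (t : B.U ⊗[k] B.U) (w : B.U) :
    (twistMul F).map t ⊗ₜ w =
      B.face₁.map ((B.frame₃.flow (B.face₃.lie F)).map (t ⊗ₜ w)) := by
  have h : (B.frame₃.flow (B.face₃.lie F)).map =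
      TensorProduct.map (B.frame₂.flow F).map LinearMap.id := flow_counitRight F
  rw [h]
  rfl

theorem face₂_map_flow (F : B.frame₂.LieFun) (u v w : B.U) :
    u ⊗ₜ (twistMul F).map (v ⊗ₜ w) =
      B.face₂.map ((B.frame₃.flow (B.face₀.lie F)).map ((u ⊗ₜ v) ⊗ₜ w)) := by
  have h1 : ((B.frame.tensor B.frame₂).flow ((Hom.counitLeft B.frame B.frame₂).lie F)).map =
      TensorProduct.map LinearMap.id (B.frame₂.flow F).map := flow_counitLeft F
  have h2 := (Hom.assoc B.frame B.frame B.frame).map_flow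
    ((Hom.counitLeft B.frame B.frame₂).lie F) ((u ⊗ₜ v) ⊗ₜ w)
  rw [h1] at h2
  exact (congrArg ((Hom.id B.frame).tensor B.mulHom).map h2).symm

/-- The twist equation makes the twisted product associative. -/
theorem twistMul_assoc {F : B.frame₂.LieFun} (hF : ∀ p, B.IsTwistMod p F) (u v w : B.U) :
    (twistMul F).map ((twistMul F).map (u ⊗ₜ v) ⊗ₜ w) =
      (twistMul F).map (u ⊗ₜ (twistMul F).map (v ⊗ₜ w)) := by
  obtain ⟨n, hn⟩ := B.frame₃.exists_mem_filt ((u ⊗ₜ v) ⊗ₜ w)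
  obtain ⟨h, hh⟩ := B.frame₃.gp_surjective
    (B.frame₃.gp (n + 2) (B.face₃.lie F) * B.frame₃.gp (n + 2) (B.face₁.lie F))
  have e1 := B.frame₃.flow_mul hh.symm le_rfl hn
  have e2 := B.frame₃.flow_mul ((hF (n + 2)).symm.trans hh.symm) le_rfl hn
  rw [face₁_map_flow, face₂_map_flow, twistMul_map, twistMul_map, ← B.face₁.map_flow,
    ← B.face₂.map_flow, e1, e2, mulHom_face]

theorem twistMul_one {F : B.frame₂.LieFun} (hF : B.IsInMaxIdealSq (LieFun.val F)) (u : B.U) :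
    (twistMul F).map (u ⊗ₜ 1) = u := by
  have h0 : (Hom.unitRight B.frame B.frame).lie F = 0 :=
    LieFun.val_injective (ext_ofConv fun v => (hF v).1)
  have h := (Hom.unitRight B.frame B.frame).map_flow F u
  rw [h0, flow_zero] at h
  exact (congrArg B.mulHom.map h).symm.trans (mul_one u)

theorem one_twistMul {F : B.frame₂.LieFun} (hF : B.IsInMaxIdealSq (LieFun.val F)) (u : B.U) :
    (twistMul F).map (1 ⊗ₜ u) = u := by
  have h0 : (Hom.unitLeft B.frame B.frame).lie F = 0 :=
    LieFun.val_injective (ext_ofConv fun v => (hF v).2)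
  have h := (Hom.unitLeft B.frame B.frame).map_flow F u
  rw [h0, flow_zero] at h
  exact (congrArg B.mulHom.map h).symm.trans (one_mul u)

theorem twistMul_sub_mem (F : B.frame₂.LieFun) {m n : ℕ} {u v : B.U} (hu : u ∈ B.frame.filt m)
    (hv : v ∈ B.frame.filt n) :
    (twistMul F).map (u ⊗ₜ v) - u * v ∈ B.frame.filt (m + n - 1) := by
  have := B.mulHom.map_mem_filt
    (B.frame₂.flow_sub_mem F (tmul_mem_filt B.frame B.frame hu hv le_rfl))
  rwa [map_sub] at this

/-- The values of a function on pairs of elements of `g*`. -/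
def quadPart (F : B.O₂) : B.DualLie →ₗ[k] B.DualLie →ₗ[k] k :=
  TensorProduct.curry (F.ofConv ∘ₗ B.ι₂)

theorem quadPart_apply (F : B.O₂) (ξ η : B.DualLie) : quadPart F ξ η =
    F.ofConv (UniversalEnvelopingAlgebra.ι k ξ ⊗ₜ UniversalEnvelopingAlgebra.ι k η) := rfl

/-- The contraction of the first factor of the cobracket of `g*` with a linear form. -/
def contract (φ : B.DualLie →ₗ[k] k) (ξ : B.DualLie) : B.DualLie :=
  TensorProduct.lid k B.DualLie (TensorProduct.map φ LinearMap.id (B.dualCobracket ξ))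

theorem contract_sub (φ ψ : B.DualLie →ₗ[k] k) (ξ : B.DualLie) :
    contract (φ - ψ) ξ = contract φ ξ - contract ψ ξ := by
  rw [contract, contract, contract, eq_sub_iff_add_eq, ← map_add, ← LinearMap.add_apply,
    ← TensorProduct.map_add_left, sub_add_cancel]

theorem toDual_contract (φ : B.DualLie →ₗ[k] k) (z : g) (hφ : ∀ η, φ η = B.toDual η z)
    (ξ : B.DualLie) (x : g) : B.toDual (contract φ ξ) x = B.toDual ξ ⁅z, x⁆ := by
  rw [← coPair_dualCobracket, contract]
  generalize B.dualCobracket ξ = t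
  induction t with
  | zero => simp
  | add s t hs ht => simp only [map_add, LinearMap.add_apply, hs, ht]
  | tmul a b => simp [coPair_tmul, hφ]

theorem ham_ι_tmul_ι {F : B.O₂} (hF : B.IsInMaxIdealSq F) (ξ η : B.DualLie) :
    B.frame₂.ham F (UniversalEnvelopingAlgebra.ι k ξ ⊗ₜ UniversalEnvelopingAlgebra.ι k η) =
      UniversalEnvelopingAlgebra.ι k (contract ((quadPart F).flip η) ξ) ⊗ₜ 1 +
        1 ⊗ₜ UniversalEnvelopingAlgebra.ι k (contract (quadPart F ξ) η) := by
  have h1 : ∀ t : B.DualLie ⊗[k] B.DualLie,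
      TensorProduct.lid k (B.U ⊗[k] B.U) (TensorProduct.map F.ofConv LinearMap.id
        (tensorComm₄ k B.U B.U B.U B.U (B.ι₂ t ⊗ₜ
          Coalgebra.comul (R := k) (UniversalEnvelopingAlgebra.ι k η)))) =
      UniversalEnvelopingAlgebra.ι k (TensorProduct.lid k B.DualLie
        (TensorProduct.map ((quadPart F).flip η) LinearMap.id t)) ⊗ₜ 1 := by
    intro t
    induction t with
    | zero => simp [-UniversalEnvelopingAlgebra.ι_apply]
    | add s t hs ht => simp only [map_add, TensorProduct.add_tmul, hs, ht]
    | tmul a b =>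
      rw [UniversalEnvelopingAlgebra.comul_ι, ι₂, TensorProduct.map_tmul, TensorProduct.tmul_add,
        map_add, tensorComm₄_tmul, tensorComm₄_tmul, map_add, TensorProduct.map_tmul,
        TensorProduct.map_tmul, map_add, TensorProduct.lid_tmul, TensorProduct.lid_tmul,
        TensorProduct.map_tmul, TensorProduct.lid_tmul, LinearMap.flip_apply, quadPart_apply]
      have : F.ofConv ((UniversalEnvelopingAlgebra.ι k a : B.U) ⊗ₜ 1) = 0 := (hF _).1
      rw [map_smul, ← TensorProduct.smul_tmul']
      simp only [LieHom.coe_toLinearMap, LinearMap.id_apply]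
      rw [this, zero_smul, add_zero]
  have h2 : ∀ t : B.DualLie ⊗[k] B.DualLie,
      TensorProduct.lid k (B.U ⊗[k] B.U) (TensorProduct.map F.ofConv LinearMap.id
        (tensorComm₄ k B.U B.U B.U B.U (
          Coalgebra.comul (R := k) (UniversalEnvelopingAlgebra.ι k ξ) ⊗ₜ B.ι₂ t))) =
      1 ⊗ₜ UniversalEnvelopingAlgebra.ι k (TensorProduct.lid k B.DualLie
        (TensorProduct.map (quadPart F ξ) LinearMap.id t)) := by
    intro t
    induction t with
    | zero => simp [-UniversalEnvelopingAlgebra.ι_apply]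
    | add s t hs ht => simp only [map_add, TensorProduct.tmul_add, hs, ht]
    | tmul a b =>
      rw [UniversalEnvelopingAlgebra.comul_ι, ι₂, TensorProduct.map_tmul, TensorProduct.add_tmul,
        map_add, tensorComm₄_tmul, tensorComm₄_tmul, map_add, TensorProduct.map_tmul,
        TensorProduct.map_tmul, map_add, TensorProduct.lid_tmul, TensorProduct.lid_tmul,
        TensorProduct.map_tmul, TensorProduct.lid_tmul, quadPart_apply]
      have : F.ofConv (1 ⊗ₜ (UniversalEnvelopingAlgebra.ι k a : B.U)) = 0 := (hF _).2
      rw [map_smul, TensorProduct.tmul_smul]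
      simp only [LieHom.coe_toLinearMap, LinearMap.id_apply]
      rw [this, zero_smul, add_zero]
  change TensorProduct.lid k (B.U ⊗[k] B.U) (TensorProduct.map F.ofConv LinearMap.id
    (coPoissonTensor B.coPoisson B.coPoisson _)) = _
  rw [coPoissonTensor_tmul, coPoisson_ι, coPoisson_ι, map_add, map_add, map_add, h1, h2]
  rfl

/-- The twisted product of two elements of `g*`. -/
theorem twistMul_ι_tmul_ι {F : B.frame₂.LieFun} (hF : B.IsInMaxIdealSq (LieFun.val F))
    (ξ η : B.DualLie) : (twistMul F).map
      (UniversalEnvelopingAlgebra.ι k ξ ⊗ₜ UniversalEnvelopingAlgebra.ι k η) =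
    UniversalEnvelopingAlgebra.ι k ξ * UniversalEnvelopingAlgebra.ι k η +
      UniversalEnvelopingAlgebra.ι k (contract ((quadPart (LieFun.val F)).flip η) ξ +
        contract (quadPart (LieFun.val F) ξ) η) := by
  have hR : ∀ u : B.U, B.frame₂.ham (LieFun.val F) (u ⊗ₜ 1) = 0 := by
    intro u
    have h0 : (Hom.unitRight B.frame B.frame).pull (LieFun.val F) = 0 :=
      ext_ofConv fun v => (hF v).1
    have h := (Hom.unitRight B.frame B.frame).map_ham (LieFun.val F) u
    rw [h0, show B.frame.ham 0 = 0 by rw [← zero_smul k (0 : B.O), ham_smul, zero_smul]] at h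
    exact h.symm.trans (map_zero _)
  have hL : ∀ u : B.U, B.frame₂.ham (LieFun.val F) (1 ⊗ₜ u) = 0 := by
    intro u
    have h0 : (Hom.unitLeft B.frame B.frame).pull (LieFun.val F) = 0 :=
      ext_ofConv fun v => (hF v).2
    have h := (Hom.unitLeft B.frame B.frame).map_ham (LieFun.val F) u
    rw [h0, show B.frame.ham 0 = 0 by rw [← zero_smul k (0 : B.O), ham_smul, zero_smul]] at h
    exact h.symm.trans (map_zero _)
  rw [twistMul_map, flow_apply_of_ham_ham, ham_ι_tmul_ι hF, map_add, map_add, mulHom_map_tmul,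
    mulHom_map_tmul, mulHom_map_tmul, mul_one, one_mul, map_add]
  rw [ham_ι_tmul_ι hF, map_add, hR, hL, add_zero]

/-- The commutator for the twisted product is the Lie bracket dual to the twisted cobracket
`x ↦ δ(x) - ⁅x, t⁆`. -/
theorem toDual_twist_commutator {F : B.O₂} {t : g ⊗[k] g} (hF : B.HasAltClass F t)
    (ξ η : B.DualLie) (x : g) : B.toDual (⁅ξ, η⁆ +
      (contract ((quadPart F).flip η) ξ + contract (quadPart F ξ) η) -
      (contract ((quadPart F).flip ξ) η + contract (quadPart F η) ξ)) x =
    B.pair ξ η (B.cobracket x - ⁅x, t⁆) := by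
  have e : ⁅ξ, η⁆ + (contract ((quadPart F).flip η) ξ + contract (quadPart F ξ) η) -
      (contract ((quadPart F).flip ξ) η + contract (quadPart F η) ξ) =
      ⁅ξ, η⁆ + (contract ((quadPart F).flip η - quadPart F η) ξ +
        contract (quadPart F ξ - (quadPart F).flip ξ) η) := by
    rw [contract_sub, contract_sub]
    abel
  have hp : ∀ (s s' : B.DualLie) (t : g ⊗[k] g), B.pair s s' t =
      B.toDual s (TensorProduct.rid k g (TensorProduct.map LinearMap.id (B.toDual s') t)) ∧
      B.pair s s' t =
      B.toDual s' (TensorProduct.lid k g (TensorProduct.map (B.toDual s) LinearMap.id t)) := by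
    intro s s' t
    induction t with
    | zero => simp
    | add a b ha hb => exact ⟨by simp only [map_add, ← ha.1, ← hb.1],
        by simp only [map_add, ← ha.2, ← hb.2]⟩
    | tmul a b => simp [pair_tmul, mul_comm]
  rw [e, map_add, map_add, LinearMap.add_apply, LinearMap.add_apply, toDual_lie,
    toDual_contract _ (TensorProduct.rid k g (TensorProduct.map LinearMap.id (B.toDual η) t))
      (fun s => by rw [← (hp _ _ _).1, ← hF]; rfl),
    toDual_contract _ (TensorProduct.lid k g (TensorProduct.map (B.toDual ξ) LinearMap.id t))
      (fun s => by rw [← (hp _ _ _).2, ← hF]; rfl), map_sub, sub_eq_add_neg, add_right_inj]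
  clear e hF
  induction t with
  | zero => simp
  | add a b ha hb =>
    simp only [map_add, lie_add, add_lie, neg_add, ← ha, ← hb]
    ring
  | tmul a b =>
    simp only [TensorProduct.map_tmul, TensorProduct.rid_tmul, TensorProduct.lid_tmul,
      LinearMap.id_apply, smul_lie, map_smul, TensorProduct.LieModule.lie_tmul_right, map_add,
      pair_tmul]
    rw [← lie_skew, ← lie_skew b x]
    simp only [map_neg, smul_eq_mul]
    ring

end LieBialgebra

open FormalFun

/-! ### The enveloping algebra of the twisted Lie bialgebra -/

theorem CoPoissonFrame.SpansFilt.filt_le {k H ι A : Type*} [Field k] [Ring H] [Bialgebra k H]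
    [Fintype ι] {F : CoPoissonFrame k H ι} {m : A → H} {d : A → ℕ} (h : F.SpansFilt m d) (n : ℕ) :
    F.filt n ≤ Submodule.span k (m '' {a | d a ≤ n}) := by
  refine Submodule.span_le.2 ?_
  rintro _ ⟨l, hl, rfl⟩
  refine Submodule.span_mono (Set.image_mono ?_) (h.2 l)
  intro P (hP : d P ≤ l.length)
  exact hP.trans hl

section TwistedEnveloping

attribute [local instance 100] LieRing.ofAssociativeRing

namespace LieBialgebra

variable {k g : Type*} [Field k] [CharZero k] [LieRing g] [LieAlgebra k g] [Module.Finite k g]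
variable {B B' : LieBialgebra k g}

open CoPoissonFrame UniversalEnvelopingAlgebra

/-- The identity of `g*`, as a map between the dual Lie algebras of two cobrackets. -/
def dualCast (B B' : LieBialgebra k g) : B'.DualLie ≃ₗ[k] B.DualLie := B'.toDual.trans B.toDual.symm

theorem toDual_dualCast (ξ : B'.DualLie) : B.toDual (dualCast B B' ξ) = B'.toDual ξ := rfl

theorem dualCobracket_dualCast (ξ : B'.DualLie) : B.dualCobracket (dualCast B B' ξ) =
    TensorProduct.map (dualCast B B').toLinearMap (dualCast B B').toLinearMap
      (B'.dualCobracket ξ) := by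
  apply B.coPair_ext
  intro x y
  have h : ∀ t : B'.DualLie ⊗[k] B'.DualLie, B.coPair x y (TensorProduct.map
      (dualCast B B').toLinearMap (dualCast B B').toLinearMap t) = B'.coPair x y t := by
    intro t
    induction t with
    | zero => simp
    | add a b ha hb => simp only [map_add, ha, hb]
    | tmul a b => simp [coPair_tmul, toDual_dualCast]
  rw [coPair_dualCobracket, h, coPair_dualCobracket, toDual_dualCast]

/-- There is a linear map that matches the Poincaré-Birkhoff-Witt bases. -/
theorem exists_pbw_map (B B' : LieBialgebra k g) : ∃ ψ : B.U →ₗ[k] B'.U,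
    ψ 1 = 1 ∧ ∀ P, ψ (B.pbw P) = B'.pbw P := by
  have e : ∀ P, (B.pbwBasis.constr k B'.pbw) (B.pbw P) = B'.pbw P := fun P => by
    rw [← pbwBasis_apply, Module.Basis.constr_basis]
  exact ⟨B.pbwBasis.constr k B'.pbw, by rw [← pbw_zero, e, pbw_zero], e⟩

/-- `F` is a twist for `B`, and `B'` is the Lie bialgebra obtained from `B` by the twist `F`. -/
structure IsTwisting (B B' : LieBialgebra k g) (F : B.frame₂.LieFun) : Prop where
  isInMaxIdealSq : B.IsInMaxIdealSq (LieFun.val F)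
  isTwistMod : ∀ p, B.IsTwistMod p F
  cobracket : ∃ t, B.HasAltClass (LieFun.val F) t ∧ ∀ x, B'.cobracket x = B.cobracket x - ⁅x, t⁆

namespace IsTwisting

variable {F : B.frame₂.LieFun} (h : IsTwisting B B' F)

theorem twistMul_commutator (h : IsTwisting B B' F) (ξ η : B'.DualLie) :
    (twistMul F).map (ι k (dualCast B B' ξ) ⊗ₜ ι k (dualCast B B' η)) -
      (twistMul F).map (ι k (dualCast B B' η) ⊗ₜ ι k (dualCast B B' ξ)) =
    (ι k (dualCast B B' ⁅ξ, η⁆) : B.U) := by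
  obtain ⟨t, ht, hB⟩ := h.cobracket
  rw [twistMul_ι_tmul_ι h.isInMaxIdealSq, twistMul_ι_tmul_ι h.isInMaxIdealSq]
  have e : dualCast B B' ⁅ξ, η⁆ = ⁅dualCast B B' ξ, dualCast B B' η⁆ +
      (contract ((quadPart (LieFun.val F)).flip (dualCast B B' η)) (dualCast B B' ξ) +
        contract (quadPart (LieFun.val F) (dualCast B B' ξ)) (dualCast B B' η)) -
      (contract ((quadPart (LieFun.val F)).flip (dualCast B B' ξ)) (dualCast B B' η) +
        contract (quadPart (LieFun.val F) (dualCast B B' η)) (dualCast B B' ξ)) := by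
    refine B.toDual.injective (LinearMap.ext fun x => ?_)
    rw [toDual_twist_commutator ht, toDual_dualCast, toDual_lie, hB]
    rfl
  rw [e]
  simp only [map_sub, map_add, ι_lie]
  abel

/-- The representation of `U(g'*)` on `U(g*)` by twisted left multiplication. -/
def rep : B'.U →ₐ[k] Module.End k B.U :=
  lift k
    { toFun := fun ξ => (twistMul F).map ∘ₗ TensorProduct.mk k B.U B.U (ι k (dualCast B B' ξ))
      map_add' := fun ξ η => by
        rw [map_add, map_add, map_add, LinearMap.comp_add]
      map_smul' := fun c ξ => by
        rw [map_smul, map_smul, map_smul, LinearMap.comp_smul, RingHom.id_apply]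
      map_lie' := fun {ξ η} => by
        refine LinearMap.ext fun u => ?_
        change (twistMul F).map (ι k (dualCast B B' ⁅ξ, η⁆) ⊗ₜ u) =
          (twistMul F).map (ι k (dualCast B B' ξ) ⊗ₜ
            (twistMul F).map (ι k (dualCast B B' η) ⊗ₜ u)) -
          (twistMul F).map (ι k (dualCast B B' η) ⊗ₜ
            (twistMul F).map (ι k (dualCast B B' ξ) ⊗ₜ u))
        rw [← twistMul_assoc h.isTwistMod, ← twistMul_assoc h.isTwistMod,
          ← h.twistMul_commutator, TensorProduct.sub_tmul, map_sub] }

theorem rep_ι (ξ : B'.DualLie) (u : B.U) :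
    h.rep (ι k ξ) u = (twistMul F).map (ι k (dualCast B B' ξ) ⊗ₜ u) := by
  rw [rep, lift_ι_apply]
  rfl

/-- The isomorphism from `U(g'*)`, with its product, to `U(g*)`, with the twisted product. -/
def toU : B'.U →ₗ[k] B.U := LinearMap.applyₗ (1 : B.U) ∘ₗ h.rep.toLinearMap

theorem toU_apply (u : B'.U) : h.toU u = h.rep u 1 := rfl

theorem toU_one : h.toU 1 = 1 := LinearMap.congr_fun (map_one h.rep) 1

theorem toU_ι (ξ : B'.DualLie) : h.toU (ι k ξ) = ι k (dualCast B B' ξ) := by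
  rw [toU_apply, rep_ι, twistMul_one h.isInMaxIdealSq]

theorem rep_apply (u : B'.U) : ∀ v : B.U, h.rep u v = (twistMul F).map (h.toU u ⊗ₜ v) := by
  have hu : u ∈ Algebra.adjoin k (Set.range (ι k : B'.DualLie → B'.U)) := by
    rw [adjoin_range_ι]; trivial
  induction hu using Algebra.adjoin_induction with
  | mem u hu => obtain ⟨ξ, rfl⟩ := hu; intro v; rw [rep_ι, toU_ι]
  | algebraMap c =>
    intro v
    rw [Algebra.algebraMap_eq_smul_one, map_smul, map_smul, map_one, toU_one,
      ← TensorProduct.smul_tmul', map_smul, one_twistMul h.isInMaxIdealSq]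
    rfl
  | add u v _ _ hu hv =>
    intro w
    rw [map_add, map_add, TensorProduct.add_tmul, map_add, LinearMap.add_apply, hu, hv]
  | mul u v _ _ hu hv =>
    intro w
    have e : h.toU (u * v) = (twistMul F).map (h.toU u ⊗ₜ h.toU v) := by
      rw [← hu (h.toU v), toU_apply, map_mul, Module.End.mul_apply, toU_apply]
    rw [map_mul, Module.End.mul_apply, hv, hu, e, twistMul_assoc h.isTwistMod]

theorem toU_mul (u v : B'.U) : h.toU (u * v) = (twistMul F).map (h.toU u ⊗ₜ h.toU v) := by
  rw [toU_apply, map_mul, Module.End.mul_apply, ← toU_apply, rep_apply]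

theorem map_toU_mul (s t : B'.U ⊗[k] B'.U) : TensorProduct.map h.toU h.toU (s * t) =
    TensorProduct.map (twistMul F).map (twistMul F).map (tensorComm₄ k B.U B.U B.U B.U
      (TensorProduct.map h.toU h.toU s ⊗ₜ TensorProduct.map h.toU h.toU t)) := by
  induction s with
  | zero => simp
  | add s s' hs hs' => simp only [TensorProduct.add_tmul, map_add, hs, hs', add_mul]
  | tmul a a' =>
    induction t with
    | zero => simp
    | add t t' ht ht' => simp only [TensorProduct.tmul_add, map_add, ht, ht', mul_add]
    | tmul b b' =>
      rw [Algebra.TensorProduct.tmul_mul_tmul, TensorProduct.map_tmul, TensorProduct.map_tmul,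
        TensorProduct.map_tmul, tensorComm₄_tmul, TensorProduct.map_tmul, toU_mul, toU_mul]

theorem counit_toU (u : B'.U) :
    Coalgebra.counit (R := k) (h.toU u) = Coalgebra.counit (R := k) u := by
  have hu : u ∈ Algebra.adjoin k (Set.range (ι k : B'.DualLie → B'.U)) := by
    rw [adjoin_range_ι]; trivial
  induction hu using Algebra.adjoin_induction with
  | mem u hu =>
    obtain ⟨ξ, rfl⟩ := hu
    rw [toU_ι]
    exact (counitHom_ι k _ _).trans (counitHom_ι k _ _).symm
  | algebraMap c =>
    rw [Algebra.algebraMap_eq_smul_one, map_smul, map_smul, map_smul, toU_one,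
      Bialgebra.counit_one, Bialgebra.counit_one]
  | add u v _ _ hu hv => rw [map_add, map_add, map_add, hu, hv]
  | mul u v _ _ hu hv =>
    rw [toU_mul, (twistMul F).counit_map, Bialgebra.counit_mul, ← hu, ← hv]
    simp [mul_comm]

theorem comul_toU (u : B'.U) : Coalgebra.comul (R := k) (h.toU u) =
    TensorProduct.map h.toU h.toU (Coalgebra.comul (R := k) u) := by
  have hu : u ∈ Algebra.adjoin k (Set.range (ι k : B'.DualLie → B'.U)) := by
    rw [adjoin_range_ι]; trivial
  induction hu using Algebra.adjoin_induction with
  | mem u hu =>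
    obtain ⟨ξ, rfl⟩ := hu
    rw [toU_ι, comul_ι, comul_ι, map_add, TensorProduct.map_tmul, TensorProduct.map_tmul, toU_one,
      toU_ι]
  | algebraMap c =>
    rw [Algebra.algebraMap_eq_smul_one, map_smul, map_smul, map_smul, map_smul, toU_one,
      Bialgebra.comul_one, Bialgebra.comul_one]
    change c • ((1 : B.U) ⊗ₜ[k] (1 : B.U)) =
      c • TensorProduct.map h.toU h.toU ((1 : B'.U) ⊗ₜ[k] (1 : B'.U))
    rw [TensorProduct.map_tmul, toU_one]
  | add u v _ _ hu hv => rw [map_add, map_add, map_add, map_add, hu, hv]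
  | mul u v _ _ hu hv =>
    rw [toU_mul, (twistMul F).comul_map, Bialgebra.comul_mul, map_toU_mul, ← hu, ← hv,
      comul_tmul_eq]

theorem map_toU_ι₂ (t : B'.DualLie ⊗[k] B'.DualLie) : TensorProduct.map h.toU h.toU (B'.ι₂ t) =
    B.ι₂ (TensorProduct.map (dualCast B B').toLinearMap (dualCast B B').toLinearMap t) := by
  induction t with
  | zero => simp
  | add a b ha hb => simp only [map_add, ha, hb]
  | tmul a b =>
    rw [ι₂, ι₂, TensorProduct.map_tmul, TensorProduct.map_tmul, TensorProduct.map_tmul,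
      TensorProduct.map_tmul]
    exact congrArg₂ _ (h.toU_ι a) (h.toU_ι b)

theorem coPoisson_toU (u : B'.U) : B.coPoisson (h.toU u) =
    TensorProduct.map h.toU h.toU (B'.coPoisson u) := by
  have hu : u ∈ Algebra.adjoin k (Set.range (ι k : B'.DualLie → B'.U)) := by
    rw [adjoin_range_ι]; trivial
  induction hu using Algebra.adjoin_induction with
  | mem u hu =>
    obtain ⟨ξ, rfl⟩ := hu
    rw [toU_ι, coPoisson_ι, coPoisson_ι, map_toU_ι₂, dualCobracket_dualCast]
  | algebraMap c =>
    rw [Algebra.algebraMap_eq_smul_one, map_smul, map_smul, map_smul, toU_one, coPoisson_one,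
      coPoisson_one, smul_zero, smul_zero, map_zero]
  | add u v _ _ hu hv => rw [map_add, map_add, map_add, map_add, hu, hv]
  | mul u v _ _ hu hv =>
    rw [toU_mul, coPoisson_mul, map_add, map_toU_mul, map_toU_mul, ← hu, ← hv, ← comul_toU,
      ← comul_toU, ← map_add, ← map_add]
    exact (twistMul F).δ_map (h.toU u ⊗ₜ h.toU v)

theorem toU_word_cons (i : B.Idx) (l : List B.Idx) : h.toU (B'.frame.word (i :: l)) =
    (twistMul F).map (B.frame.x i ⊗ₜ h.toU (B'.frame.word l)) := by
  rw [word_cons, toU_mul, x_eq_ι, toU_ι]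
  rfl

theorem toU_word_mem (l : List B.Idx) : h.toU (B'.frame.word l) ∈ B.frame.filt l.length := by
  induction l with
  | nil => rw [word_nil, toU_one]; exact B.frame.one_mem_filt _
  | cons i l ih =>
    rw [toU_word_cons]
    exact (twistMul F).map_mem_filt (tmul_mem_filt B.frame B.frame (B.ι_mem_filt _) ih
      (by rw [List.length_cons]; omega))

/-- The map `toU`, as a morphism of co-Poisson bialgebras. -/
def hom : Hom B'.frame B.frame where
  map := h.toU
  counit_map := h.counit_toU
  comul_map := h.comul_toU
  δ_map := h.coPoisson_toU
  map_word := h.toU_word_mem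

theorem toU_word_sub_mem (l : List B.Idx) {n : ℕ} (hl : l.length = n + 1) :
    h.toU (B'.frame.word l) - B.frame.word l ∈ B.frame.filt n := by
  induction l generalizing n with
  | nil => simp at hl
  | cons i l ih =>
    have hl' : l.length = n := by simpa using hl
    have h1 := twistMul_sub_mem F (B.ι_mem_filt (B.dualBasis i)) (h.toU_word_mem l)
    rw [hl', show 1 + n - 1 = n by omega, ← x_eq_ι, ← toU_word_cons] at h1
    have h2 : B.frame.x i * h.toU (B'.frame.word l) - B.frame.word (i :: l) ∈ B.frame.filt n := by
      rw [word_cons, ← mul_sub]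
      rcases n with _ | n
      · rw [List.length_eq_zero_iff.1 hl', word_nil, word_nil, toU_one, sub_self, mul_zero]
        exact zero_mem _
      · exact B.frame.mul_mem_filt (B.ι_mem_filt (B.dualBasis i)) (ih hl') (by omega)
    have := add_mem h1 h2
    rwa [sub_add_sub_cancel] at this

theorem toU_surjective : Function.Surjective h.toU := by
  have key : ∀ n, B.frame.filt n ≤ LinearMap.range h.toU := by
    intro n
    induction n with
    | zero =>
      refine Submodule.span_le.2 ?_
      rintro _ ⟨l, hl, rfl⟩
      rw [List.length_eq_zero_iff.1 (Nat.le_zero.1 hl), word_nil]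
      exact ⟨1, h.toU_one⟩
    | succ n ih =>
      refine Submodule.span_le.2 ?_
      rintro _ ⟨l, hl, rfl⟩
      rcases Nat.lt_or_ge l.length (n + 1) with hl' | hl'
      · exact ih (B.frame.word_mem_filt (Nat.lt_succ_iff.1 hl'))
      · have h1 := ih (h.toU_word_sub_mem l (le_antisymm hl hl'))
        have h2 : h.toU (B'.frame.word l) ∈ LinearMap.range h.toU := ⟨_, rfl⟩
        have := sub_mem h2 h1
        rwa [sub_sub_cancel] at this
  intro u
  obtain ⟨n, hn⟩ := B.frame.exists_mem_filt u
  exact key n hn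

/-- With `ψ` the linear map that matches the Poincaré-Birkhoff-Witt bases, `ψ ∘ toU` differs from the
identity by a map that lowers the filtration degree. -/
theorem toU_injective : Function.Injective h.toU := by
  obtain ⟨ψ, h1, hψ⟩ := exists_pbw_map B B'
  have hf : ∀ n, ∀ u ∈ B.frame.filt n, ψ u ∈ B'.frame.filt n := by
    intro n u hu
    replace hu := B.spansFilt_pbw.filt_le n hu
    induction hu using Submodule.span_induction with
    | zero => simp
    | add u v _ _ hu hv => rw [map_add]; exact add_mem hu hv
    | smul c u _ hu => rw [map_smul]; exact Submodule.smul_mem _ _ hu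
    | mem u hu =>
      obtain ⟨P, hP, rfl⟩ := hu
      rw [hψ]
      exact B'.frame.filt_mono hP (B'.pbw_mem_filt P)
  have hu : ∀ n, ∀ u ∈ B'.frame.filt (n + 1), ψ (h.toU u) - u ∈ B'.frame.filt n := by
    intro n u hu
    replace hu := B'.spansFilt_pbw.filt_le (n + 1) hu
    induction hu using Submodule.span_induction with
    | zero => simp
    | add u v _ _ hu hv =>
      have := add_mem hu hv
      rw [map_add, map_add]
      convert this using 1
      abel
    | smul c u _ hu => rw [map_smul, map_smul, ← smul_sub]; exact Submodule.smul_mem _ _ hu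
    | mem u hu =>
      obtain ⟨P, hP, rfl⟩ := hu
      rcases Nat.lt_or_ge (Multiset.card P) (n + 1) with hP' | hP'
      · have hm := B'.frame.filt_mono (Nat.lt_succ_iff.1 hP') (B'.pbw_mem_filt P)
        exact sub_mem (hf n _ (h.hom.map_mem_filt hm)) hm
      · have hm := hf n _ (h.toU_word_sub_mem (P.sort (· ≤ ·)) (n := n)
          (by rw [Multiset.length_sort]; exact le_antisymm hP hP'))
        rw [map_sub, ← pbw_eq_word, ← pbw_eq_word, hψ] at hm
        exact hm
  rw [← LinearMap.ker_eq_bot, LinearMap.ker_eq_bot']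
  intro u hu0
  obtain ⟨n, hn⟩ := B'.frame.exists_mem_filt u
  induction n with
  | zero =>
    have hn := B'.spansFilt_pbw.filt_le 0 hn
    have h0 : B'.pbw '' {P | Multiset.card P ≤ 0} = {1} := by
      ext v
      simp only [Nat.le_zero, Multiset.card_eq_zero, Set.mem_image, Set.mem_ofPred_eq,
        exists_eq_left, pbw_zero, Set.mem_singleton_iff]
      exact eq_comm
    rw [h0] at hn
    obtain ⟨c, rfl⟩ := Submodule.mem_span_singleton.1 hn
    have := congrArg (Coalgebra.counit (R := k)) hu0
    rw [map_smul, toU_one, map_smul, Bialgebra.counit_one, map_zero, smul_eq_mul, mul_one] at this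
    rw [this, zero_smul]
  | succ n ih =>
    have := hu n u hn
    rw [hu0, map_zero, zero_sub] at this
    exact ih (neg_mem_iff.1 this)

end IsTwisting

end LieBialgebra

end TwistedEnveloping

open FormalFun

/-! ### The isomorphism of Poisson algebras -/

namespace CoPoissonFrame

variable {k : Type*} [Field k] [CharZero k] {H ι : Type*} [Ring H] [Bialgebra k H] [Fintype ι]
  [Coalgebra.IsCocomm k H] (F : CoPoissonFrame k H ι)

theorem ofConv_iterate_br (f g : FormalFun k H) (n : ℕ) (u : H) :
    ((F.br f)^[n] g).ofConv u = g.ofConv ((F.ham f ^ n) u) := by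
  induction n generalizing u with
  | zero => rfl
  | succ n ih =>
    rw [Function.iterate_succ_apply', ← ofConv_ham, ih, pow_succ, Module.End.mul_apply]

/-- The pullback of functions by a Hamiltonian flow is the exponential of the derivation. -/
theorem hasFormalSum_flow (f : F.LieFun) (g : FormalFun k H) :
    HasFormalSum (fun n => ((n.factorial : k)⁻¹) • (F.br (LieFun.val f))^[n] g)
      ((F.flow f).pull g) := by
  intro u
  obtain ⟨m, hm⟩ := F.exists_mem_filt u
  refine ⟨m + 1, fun n hn => ?_⟩
  rw [Hom.pull_apply, flow_map, locExp_apply _ (F.ham_pow_eq_zero (LieFun.val_mem f) hm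
    (show m < n by omega)), ofConv_sum_apply, map_sum]
  refine Finset.sum_congr rfl fun i _ => ?_
  rw [ofConv_smul_apply, ofConv_iterate_br, map_smul, smul_eq_mul]

end CoPoissonFrame

namespace LieBialgebra

variable {k g : Type*} [Field k] [CharZero k] [LieRing g] [LieAlgebra k g] [Module.Finite k g]
variable {B B' : LieBialgebra k g}

open CoPoissonFrame UniversalEnvelopingAlgebra

namespace IsTwisting

variable {F : B.frame₂.LieFun} (h : IsTwisting B B' F)

/-- The isomorphism of coalgebras `toU`, as a linear equivalence. -/
def toUEquiv : B'.U ≃ₗ[k] B.U := LinearEquiv.ofBijective h.toU ⟨h.toU_injective, h.toU_surjective⟩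

theorem pull_hom_one : h.hom.pull 1 = 1 := ext_ofConv h.counit_toU

/-- The isomorphism of algebras of formal functions transpose to `toU`. -/
def funEquiv : B.O ≃ₐ[k] B'.O :=
  AlgEquiv.ofLinearEquiv
    { h.hom.pull with
      invFun := pullback h.toUEquiv.symm.toLinearMap
      left_inv := fun a => ext_ofConv fun u =>
        congrArg a.ofConv (h.toUEquiv.apply_symm_apply u)
      right_inv := fun a => ext_ofConv fun u =>
        congrArg a.ofConv (h.toUEquiv.symm_apply_apply u) }
    h.pull_hom_one h.hom.pull_mul

theorem ofConv_funEquiv (a : B.O) (u : B'.U) :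
    (h.funEquiv a).ofConv u = a.ofConv (h.toU u) := rfl

theorem funEquiv_poisson (a b : B.O) :
    h.funEquiv (B.poisson a b) = B'.poisson (h.funEquiv a) (h.funEquiv b) :=
  h.hom.pull_br a b

theorem hasCotangentClass_funEquiv {a : B.O} {x : g} (ha : B.HasCotangentClass a x) :
    B'.HasCotangentClass (h.funEquiv a) x := by
  refine ⟨?_, fun ξ => ?_⟩
  · rw [ofConv_funEquiv, toU_one, ha.1]
  · rw [ofConv_funEquiv, toU_ι, ha.2, toDual_dualCast]

theorem isCompletedTensorSquare : IsCompletedTensorSquare h.funEquiv.toLinearMap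
    (pullback (TensorProduct.map h.toU h.toU)) :=
  ⟨fun d => ⟨TensorProduct.map h.toU h.toU d, fun _ => rfl⟩,
    fun a b => (tmul_pullback h.toU h.toU a b).symm⟩

theorem comul_funEquiv (a : B.O) : B'.comul (h.funEquiv a) =
    pullback (TensorProduct.map h.toU h.toU) ((twistMul F).pull a) := by
  refine ext_ofConv fun t => ?_
  induction t with
  | zero => simp
  | add s t hs ht => rw [map_add, map_add, hs, ht]
  | tmul u v =>
    change a.ofConv (h.toU (u * v)) = a.ofConv ((twistMul F).map (h.toU u ⊗ₜ h.toU v))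
    rw [toU_mul]

end IsTwisting

theorem isTwistedComul_twistMul (F : B.frame₂.LieFun) (a : B.O) :
    B.IsTwistedComul (LieFun.val F) a ((twistMul F).pull a) :=
  B.frame₂.hasFormalSum_flow F (B.comul a)

end LieBialgebra

/-! ### Twists attached to a `Γ` Lie bialgebra -/

section CyclicSum

variable {k g : Type*} [Field k] [LieRing g] [LieAlgebra k g]

theorem bracket1323_map (e : g ≃ₗ⁅k⁆ g) (s t : g ⊗[k] g) :
    bracket1323 k g (TensorProduct.map (e : g →ₗ[k] g) (e : g →ₗ[k] g) s)
      (TensorProduct.map (e : g →ₗ[k] g) (e : g →ₗ[k] g) t) =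
    TensorProduct.map (TensorProduct.map (e : g →ₗ[k] g) (e : g →ₗ[k] g)) (e : g →ₗ[k] g)
      (bracket1323 k g s t) := by
  induction s with
  | zero => simp [bracket1323]
  | add s s' hs hs' =>
    simp only [bracket1323, map_add, TensorProduct.add_tmul] at hs hs' ⊢
    rw [hs, hs']
  | tmul a b =>
    induction t with
    | zero => simp [bracket1323]
    | add t t' ht ht' =>
      simp only [bracket1323, map_add, TensorProduct.tmul_add] at ht ht' ⊢
      rw [ht, ht']
    | tmul c d => simp [bracket1323, LieEquiv.map_lie]

theorem LieBialgebra.map_transport_cobracket (B : LieBialgebra k g) (e : g ≃ₗ⁅k⁆ g)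
    (t : g ⊗[k] g) :
    TensorProduct.map (B.transport e).cobracket LinearMap.id
      (TensorProduct.map (e : g →ₗ[k] g) (e : g →ₗ[k] g) t) =
    TensorProduct.map (TensorProduct.map (e : g →ₗ[k] g) (e : g →ₗ[k] g)) (e : g →ₗ[k] g)
      (TensorProduct.map B.cobracket LinearMap.id t) := by
  induction t with
  | zero => simp
  | add a b ha hb => simp only [map_add, ha, hb]
  | tmul a b => simp [LieBialgebra.transport]

theorem cyclicSum_map (e : g →ₗ[k] g) (t : (g ⊗[k] g) ⊗[k] g) :
    cyclicSum k (TensorProduct.map (TensorProduct.map e e) e t) =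
      TensorProduct.map (TensorProduct.map e e) e (cyclicSum k t) := by
  simp only [cyclicSum, cyclicPerm_map, map_add]

end CyclicSum

namespace GammaLieBialgebra

variable {k g Γ : Type*} [Field k] [LieRing g] [LieAlgebra k g] [Group Γ]
  (B : GammaLieBialgebra k g Γ) (γ γ' : Γ)

theorem lieBialgebra_cobracket (x : g) :
    (B.lieBialgebra γ).cobracket x = B.cobracket x - ⁅x, B.f γ⁆ := B.twist_cobracket γ x

theorem lieBialgebra_mul_cobracket (x : g) : (B.lieBialgebra (γ * γ')).cobracket x =
    (B.lieBialgebra γ).cobracket x -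
      ⁅x, TensorProduct.map (B.θ γ : g →ₗ[k] g) (B.θ γ : g →ₗ[k] g) (B.f γ')⁆ := by
  rw [lieBialgebra_cobracket, lieBialgebra_cobracket, f_mul, lie_add, sub_sub]

theorem exists_isTwistLift [CharZero k] [Module.Finite k g] :
    ∃ F : (B.lieBialgebra γ).O₂, B.IsTwistLift γ γ' F := by
  refine LieBialgebra.exists_isTwist ?_ ?_
  · rw [← TensorProduct.map_comm, B.f_antisymm, map_neg]
  · rw [bracket1323_map, lieBialgebra, LieBialgebra.map_transport_cobracket, ← map_add,
      cyclicSum_map, B.f_twist, map_zero]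

theorem IsTwistLift.isTwisting [CharZero k] [Module.Finite k g] {B : GammaLieBialgebra k g Γ}
    {γ γ' : Γ} {F : (B.lieBialgebra γ).O₂} (h : B.IsTwistLift γ γ' F) :
    (B.lieBialgebra γ).IsTwisting (B.lieBialgebra (γ * γ'))
      (CoPoissonFrame.LieFun.mk F h.1.1.mem_I) where
  isInMaxIdealSq := h.1.1
  isTwistMod := (LieBialgebra.isTwist_iff _ h.1.1).1 h.1
  cobracket := ⟨_, h.2, B.lieBialgebra_mul_cobracket γ γ'⟩

end GammaLieBialgebra

end

theorem proposition3p4 {k g Γ : Type*} [Field k] [CharZero k] [LieRing g] [LieAlgebra k g]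
    [Module.Finite k g] [Group Γ] (B : GammaLieBialgebra k g Γ) (γ γ' : Γ) :
    (∃ F : (B.lieBialgebra γ).O₂, B.IsTwistLift γ γ' F) ∧
    ∀ F : (B.lieBialgebra γ).O₂, B.IsTwistLift γ γ' F →
      ∃ j : (B.lieBialgebra γ).O ≃ₐ[k] (B.lieBialgebra (γ * γ')).O,
        (∀ a b, j ((B.lieBialgebra γ).poisson a b) =
          (B.lieBialgebra (γ * γ')).poisson (j a) (j b)) ∧
        (∀ a x, (B.lieBialgebra γ).HasCotangentClass a x →
          (B.lieBialgebra (γ * γ')).HasCotangentClass (j a) x) ∧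
        ∃ j₂ : (B.lieBialgebra γ).O₂ →ₗ[k] (B.lieBialgebra (γ * γ')).O₂,
          FormalFun.IsCompletedTensorSquare j.toLinearMap j₂ ∧
          ∀ a, ∃ b, (B.lieBialgebra γ).IsTwistedComul F a b ∧
            (B.lieBialgebra (γ * γ')).comul (j a) = j₂ b := by
  refine ⟨B.exists_isTwistLift γ γ', fun F hF => ?_⟩
  have h := hF.isTwisting
  exact ⟨h.funEquiv, h.funEquiv_poisson, fun a x => h.hasCotangentClass_funEquiv, _,
    h.isCompletedTensorSquare, fun a =>
      ⟨_, LieBialgebra.isTwistedComul_twistMul (CoPoissonFrame.LieFun.mk F hF.1.1.mem_I) a,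
        h.comul_funEquiv a⟩⟩
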